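/- **Conventions.** Let $k$ be a field of characteristic zero; $\otimes=\otimes_k$. Differentials have degree $-1$, the Koszul sign rule is used throughout, and $M[n]=M\otimes k[n]$, so that $M[n]_p=M_{p+n}$, the differential and the left action on $M[n]$ are those of $M$, and the right action of $v$ is multiplied by $(-1)^{n|v|}$. *Algebras.* Let $A=k\oplus A_1\oplus A_2\oplus\cdots$ be a connected graded $k$-algebra. $A$ is *AS-regular of dimension $n$* if its (left) global dimension is $n$, $\mathrm{Ext}^i_A(k,A)=0$ for $i\ne n$ and $\mathrm{Ext}^n_A(k,A)\cong k$. Its *Koszul dual coalgebra* is $A^{¡}=\bigoplus_i A^{¡}_i\subseteq T(A_1)$ with the deconcatenation coproduct $\Delta$, where $A^{¡}_0=k$, $A^{¡}_1=A_1$, $A^{¡}_i=\bigcap_{a+2+b=i}A_1^{\otimes a}\otimes W\otimes A_1^{\otimes b}$ and $W=\ker(A_1\otimes A_1\to A_2)$; an element of $A^{¡}_i$ has degree $i$. Let $\kappa:A^{¡}\to A^{¡}_1=A_1\subseteq A$ be the projection. $A$ is *Koszul* if the complex $A\otimes A^{¡}$ with $d(a\otimes c)=\sum a\,\kappa(c_1)\otimes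 c_2$ is a resolution of $k$. *Cobar construction.* $R=\Omega(A^{¡})$ is the free algebra on $\Sigma^{-1}\bar A^{¡}$, $\bar A^{¡}=\bigoplus_{i>0}A^{¡}_i$, with $\partial\bar c=\sum(-1)^{|c_1|}\bar c_1\bar c_2$, where $\bar c$ (of degree $|c|-1$) is the generator given by $c$ and $\bar 1=0$. A graded coalgebra automorphism $\sigma$ of $A^{¡}$ induces a DG automorphism $\sigma$ of $R$, $\bar c\mapsto\overline{\sigma(c)}$. *Nakayama automorphism.* For $\eta\in A^{¡}_n$ with $\Delta(\eta)=\sum\eta'\otimes\eta''$, let $\langle u,v\rangle=\sum\eta'(v)\,\eta''(u)$ for $u,v$ in the linear dual of $A^{¡}$. An automorphism $\sigma$ of the graded coalgebra $A^{¡}$ is *adjoint to the Nakayama automorphism* for $\eta$ if $\langle u,v\rangle=(-1)^{|u||v|}\langle v,u\circ\sigma\rangle$ for all homogeneous $u,v$. *Twisted forms.* For a DG automorphism $\sigma$ of $R$ let $\Omega^1_\sigma R=\ker(R\otimes R\to R,\ x\otimes y\mapsto x\sigma(y))$ and let $\widehat\Omega^1_\sigma R[-1]$ be the cone of the inclusion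 $\Omega^1_\sigma R\subseteq R\otimes R$, graded so that $R\otimes R$ keeps its degree: its elements are $\Sigma\alpha+\beta$ with $\alpha\in\Omega^1_\sigma R$, $\beta\in R\otimes R$, $|\Sigma\alpha|=|\alpha|+1$ and $\partial(\Sigma\alpha+\beta)=-\Sigma\partial\alpha+\alpha+\partial\beta$. It is a DG bimodule by $u\circ x\circ v=\sigma(u)\,x\,v$ for the outer bimodule structure of $R\otimes R$. Omit $\sigma$ if $\sigma=\mathrm{id}$; put $d\mathbf 1=1\otimes 1\in R\otimes R$ and $dr=\Sigma(r\otimes1-1\otimes r)$ for $r\in R$. Let $\widehat\Omega^\bullet R=T_R(\widehat\Omega^1R[-1])$, with the internal differential $\partial$, the de Rham differential $d$ (the odd derivation with $r\mapsto dr$, $dr\mapsto0$, $d\mathbf 1\mapsto 0$) and the action of $\sigma$. The twisted Karoubi–de Rham complex is $$\widehat{\mathrm{DR}}_\sigma R=\widehat\Omega^\bullet R\big/\operatorname{span}\{xy-(-1)^{|x||y|}y\,\sigma(x)\},$$ with the induced $\partial$ and $d$. A form is *closed* if it is annihilated by $\partial$ and by $d$ in $\widehat{\mathrm{DR}}_\sigma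 R$. *Contraction.* Let $\widehat{\mathrm{Der}}R[1]=\mathrm{Hom}_{R^e}(\widehat\Omega^1R[-1],R\otimes R)$ (homogeneous bimodule maps of all degrees for the outer structure of $R\otimes R$), with $\delta\Theta=\partial\Theta-(-1)^{|\Theta|}\Theta\partial$ and the $R$-bimodule structure $(u,\Theta,v)\mapsto u*\Theta*v$ induced by the inner structure $x\otimes y\mapsto\pm xv\otimes uy$ of $R\otimes R$. Extend $\Theta$ to a double derivation $\widehat\Omega^\bullet R\to\widehat\Omega^\bullet R\otimes\widehat\Omega^\bullet R$ that vanishes on $R$, and, writing $\Theta(\omega)=\sum\Theta(\omega)'\otimes\Theta(\omega)''$, put $\iota_\Theta\omega=\sum\pm\Theta(\omega)''\sigma(\Theta(\omega)')$; thus $\iota_\Theta(\alpha_1\alpha_2)=\sum\pm\Theta(\alpha_1)''\alpha_2\,\sigma(\Theta(\alpha_1)')\pm\Theta(\alpha_2)''\sigma(\alpha_1)\sigma(\Theta(\alpha_2)')$ for one-forms $\alpha_1,\alpha_2$, with Koszul signs. Let $\Psi:\widehat\Omega^1R[-1]\to\widehat\Omega^1_\sigma R[-1]$ be induced by $x\otimes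 y\mapsto\sigma(x)\otimes y$. **Theorem.** Let $A$ be a Koszul AS-regular algebra of dimension $n$ and let $R=\Omega(A^{¡})$. Then $A^{¡}$ is finite dimensional and $\dim A^{¡}_n=1$. Let $0\ne\eta\in A^{¡}_n$ be a volume element, with $\Delta(\eta)=\sum\eta'\otimes\eta''$. Then the pairing defined by $\eta$ is non-degenerate, and there is exactly one automorphism $\sigma$ of the graded coalgebra $A^{¡}$ that is adjoint to the Nakayama automorphism for $\eta$. For the induced automorphism $\sigma$ of $R$, the two-form $$\omega=\tfrac12\sum d\eta'\otimes d\eta''\in\widehat\Omega^2R$$ (where $dc$ means $d\bar c$ for $c\in\bar A^{¡}$, and $d1=d\mathbf 1$) has total degree $n$, satisfies $\sigma(\omega)=\omega$, and its class in $\widehat{\mathrm{DR}}^2_\sigma R$ is both $\partial$-closed and $d$-closed. Moreover $$\Phi=\Psi\circ\iota_{(-)}\omega:\ \widehat{\mathrm{Der}}R[1]\longrightarrow\widehat\Omega^1_\sigma R[-1][n]$$ (equivalently $\widehat{\mathrm{Der}}R\to\widehat\Omega^1_\sigma R[n-2]$) is an isomorphism of DG $R$-bimodules, where $v\in R$ acts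 on the target from the right through $\sigma(v)$: $\Phi$ is bijective in every degree, $\Phi(\delta\Theta)=\partial\Phi(\Theta)$, and $\Phi(u*\Theta*v)=(-1)^{n|v|}\,u\circ\Phi(\Theta)\circ\sigma(v)$. -/

import Mathlib

open scoped TensorProduct

namespace NCG

noncomputable section

/-! ## Triangular matrices, used to extend skew derivations from generators -/

section Tri

variable (k : Type*) {B : Type*} [CommRing k] [Ring B] [Algebra k B]

/-- The matrix `(a, b; 0, c)` acting on `B × B`. -/
def tri (a b c : B) : Module.End k (B × B) :=
  LinearMap.prod
    (LinearMap.mulLeft k a ∘ₗ LinearMap.fst k B B + LinearMap.mulLeft k b ∘ₗ LinearMap.snd k B B)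
    (LinearMap.mulLeft k c ∘ₗ LinearMap.snd k B B)

@[simp] theorem tri_apply (a b c : B) (x : B × B) :
    tri k a b c x = (a * x.1 + b * x.2, c * x.2) := rfl

theorem tri_one : tri k (1 : B) 0 1 = 1 := by
  refine LinearMap.ext fun x => Prod.ext ?_ ?_ <;> simp

theorem tri_mul (a b c a' b' c' : B) :
    tri k a b c * tri k a' b' c' = tri k (a * a') (a * b' + b * c') (c * c') := by
  refine LinearMap.ext fun x => Prod.ext ?_ ?_ <;> simp [mul_add, add_mul, mul_assoc, add_assoc]

theorem tri_add (a b c a' b' c' : B) :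
    tri k (a + a') (b + b') (c + c') = tri k a b c + tri k a' b' c' := by
  refine LinearMap.ext fun x => Prod.ext ?_ ?_ <;> simp [add_mul]
  abel

theorem tri_smul (r : k) (a b c : B) : tri k (r • a) (r • b) (r • c) = r • tri k a b c := by
  refine LinearMap.ext fun x => Prod.ext ?_ ?_ <;> simp

end Tri

/-! ## Differential graded algebras -/

section DGAlgebra

/-- A DG algebra over `k` with differential of degree `-1`. `parity` is the sign automorphism
`x ↦ (-1)^{|x|} x`. -/
structure DGAlgebra (k R : Type*) [Field k] [Ring R] [Algebra k R] where
  deg : ℤ → Submodule k R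
  isInternal : DirectSum.IsInternal deg
  one_mem : (1 : R) ∈ deg 0
  mul_mem : ∀ {p q : ℤ} {x y : R}, x ∈ deg p → y ∈ deg q → x * y ∈ deg (p + q)
  parity : R →ₐ[k] R
  parity_apply : ∀ {p : ℤ} {x : R}, x ∈ deg p → parity x = p.negOnePow • x
  diff : R →ₗ[k] R
  diff_mem : ∀ {p : ℤ} {x : R}, x ∈ deg p → diff x ∈ deg (p - 1)
  diff_mul : ∀ x y : R, diff (x * y) = diff x * y + parity x * diff y
  diff_diff : ∀ x : R, diff (diff x) = 0

variable {k R : Type*} [Field k] [Ring R] [Algebra k R]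

/-- An automorphism of a DG algebra. -/
structure DGAlgebra.Aut (D : DGAlgebra k R) where
  toAlgEquiv : R ≃ₐ[k] R
  map_mem : ∀ {p : ℤ} {x : R}, x ∈ D.deg p → toAlgEquiv x ∈ D.deg p
  map_diff : ∀ x : R, toAlgEquiv (D.diff x) = D.diff (toAlgEquiv x)

namespace DGAlgebra

variable (D : DGAlgebra k R)

theorem induction_deg {P : R → Prop} (h : ∀ p, ∀ x ∈ D.deg p, P x) (h0 : P 0)
    (ha : ∀ x y, P x → P y → P (x + y)) (x : R) : P x := by
  have hx : x ∈ ⨆ p, D.deg p := by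
    rw [D.isInternal.submodule_iSup_eq_top]; trivial
  exact Submodule.iSup_induction (motive := P) D.deg hx (fun p x hx => h p x hx) h0 ha

theorem parity_parity (x : R) : D.parity (D.parity x) = x := by
  refine D.induction_deg (P := fun x => D.parity (D.parity x) = x) ?_ (by simp) ?_ x
  · intro p x hx
    have h := LinearMap.CompatibleSMul.map_smul D.parity.toLinearMap p.negOnePow x
    simp only [AlgHom.toLinearMap_apply] at h
    rw [D.parity_apply hx, h, D.parity_apply hx, smul_smul]
    simp
  · intro x y hx hy; simp [hx, hy]

theorem diff_parity (x : R) : D.diff (D.parity x) = - D.parity (D.diff x) := by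
  refine D.induction_deg (P := fun x => D.diff (D.parity x) = - D.parity (D.diff x)) ?_ (by simp)
    ?_ x
  · intro p x hx
    rw [D.parity_apply hx, LinearMap.CompatibleSMul.map_smul D.diff p.negOnePow x,
      D.parity_apply (D.diff_mem hx), Int.negOnePow_sub]
    simp
  · intro x y hx hy; simp [hx, hy, add_comm]

theorem diff_one : D.diff 1 = 0 := by
  have h := D.diff_mul 1 1
  simpa using h

/-- The identity automorphism. -/
def Aut.refl : D.Aut where
  toAlgEquiv := AlgEquiv.refl
  map_mem := fun h => h
  map_diff := fun _ => rfl

variable {D}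

/-- The underlying algebra map of an automorphism. -/
def Aut.hom (σ : D.Aut) : R →ₐ[k] R := σ.toAlgEquiv

theorem Aut.hom_diff (σ : D.Aut) (x : R) : σ.hom (D.diff x) = D.diff (σ.hom x) := σ.map_diff x

theorem Aut.hom_mem (σ : D.Aut) {p : ℤ} {x : R} (h : x ∈ D.deg p) : σ.hom x ∈ D.deg p :=
  σ.map_mem h

theorem Aut.hom_refl (x : R) : (Aut.refl D).hom x = x := rfl

theorem Aut.hom_parity (σ : D.Aut) (x : R) : σ.hom (D.parity x) = D.parity (σ.hom x) := by
  refine D.induction_deg (P := fun x => σ.hom (D.parity x) = D.parity (σ.hom x)) ?_ (by simp) ?_ x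
  · intro p x hx
    rw [D.parity_apply hx, D.parity_apply (σ.hom_mem hx)]
    exact LinearMap.CompatibleSMul.map_smul σ.hom.toLinearMap p.negOnePow x
  · intro x y hx hy; simp [hx, hy]

variable (D)

/-- The sign `(-1)^{p|x|} x`. -/
def parityPow (p : ℤ) : R →ₐ[k] R := if Even p then AlgHom.id k R else D.parity

/-! ### The tensor square

`R ⊗ R` is used as a ring; the outer bimodule structure is `u t v = (u ⊗ 1) * t * (1 ⊗ v)`. -/

/-- `x ⊗ y ↦ (-1)^{|x| + |y|} x ⊗ y`. -/
def parityT : R ⊗[k] R →ₐ[k] R ⊗[k] R := Algebra.TensorProduct.map D.parity D.parity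

/-- `x ⊗ y ↦ ∂x ⊗ y + (-1)^{|x|} x ⊗ ∂y`. -/
def diffT : R ⊗[k] R →ₗ[k] R ⊗[k] R :=
  TensorProduct.map D.diff LinearMap.id + TensorProduct.map D.parity.toLinearMap D.diff

/-- The degree `q` part of `R ⊗ R`. -/
def degT (q : ℤ) : Submodule k (R ⊗[k] R) :=
  ⨆ a : ℤ, Submodule.map₂ (TensorProduct.mk k R R) (D.deg a) (D.deg (q - a))

variable {D}

/-- `x ⊗ y ↦ σ(x) ⊗ σ(y)`. -/
def Aut.homT (σ : D.Aut) : R ⊗[k] R →ₐ[k] R ⊗[k] R := Algebra.TensorProduct.map σ.hom σ.hom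

/-- `x ⊗ y ↦ σ(x) ⊗ y`. -/
def Aut.homL (σ : D.Aut) : R ⊗[k] R →ₐ[k] R ⊗[k] R :=
  Algebra.TensorProduct.map σ.hom (AlgHom.id k R)

variable (D)

@[simp] theorem parityT_tmul (x y : R) : D.parityT (x ⊗ₜ y) = D.parity x ⊗ₜ D.parity y := rfl

@[simp] theorem diffT_tmul (x y : R) :
    D.diffT (x ⊗ₜ y) = D.diff x ⊗ₜ y + D.parity x ⊗ₜ D.diff y := rfl

@[simp] theorem Aut.homT_tmul (σ : D.Aut) (x y : R) :
    σ.homT (x ⊗ₜ y) = σ.hom x ⊗ₜ σ.hom y := rfl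

@[simp] theorem Aut.homL_tmul (σ : D.Aut) (x y : R) : σ.homL (x ⊗ₜ y) = σ.hom x ⊗ₜ y := rfl

theorem diffT_left (u : R) (t : R ⊗[k] R) :
    D.diffT ((u ⊗ₜ[k] 1) * t) = (D.diff u ⊗ₜ[k] 1) * t + (D.parity u ⊗ₜ[k] 1) * D.diffT t := by
  induction t with
  | zero => simp
  | tmul x y => simp [D.diff_mul, TensorProduct.add_tmul, mul_add, add_assoc]
  | add x y hx hy => simp only [mul_add, map_add, hx, hy]; abel

theorem diffT_right (v : R) (t : R ⊗[k] R) :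
    D.diffT (t * (1 ⊗ₜ[k] v)) = D.diffT t * (1 ⊗ₜ[k] v) + D.parityT t * (1 ⊗ₜ[k] D.diff v) := by
  induction t with
  | zero => simp
  | tmul x y => simp [D.diff_mul, TensorProduct.tmul_add, add_mul, add_assoc]
  | add x y hx hy => simp only [add_mul, map_add, hx, hy]; abel

theorem parityT_parityT (t : R ⊗[k] R) : D.parityT (D.parityT t) = t := by
  induction t with
  | zero => simp
  | tmul x y => simp [D.parity_parity]
  | add x y hx hy => simp [hx, hy]

theorem diffT_parityT (t : R ⊗[k] R) : D.diffT (D.parityT t) = - D.parityT (D.diffT t) := by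
  induction t with
  | zero => simp
  | tmul x y => simp [D.diff_parity, TensorProduct.neg_tmul, TensorProduct.tmul_neg, add_comm]
  | add x y hx hy => simp only [map_add, hx, hy]; abel

theorem homT_diffT (σ : D.Aut) (t : R ⊗[k] R) : σ.homT (D.diffT t) = D.diffT (σ.homT t) := by
  induction t with
  | zero => simp
  | tmul x y => simp [σ.hom_diff, σ.hom_parity]
  | add x y hx hy => simp [hx, hy]

theorem homT_parityT (σ : D.Aut) (t : R ⊗[k] R) :
    σ.homT (D.parityT t) = D.parityT (σ.homT t) := by
  induction t with
  | zero => simp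
  | tmul x y => simp [σ.hom_parity]
  | add x y hx hy => simp [hx, hy]

theorem diffT_mem {q : ℤ} {t : R ⊗[k] R} (h : t ∈ D.degT q) : D.diffT t ∈ D.degT (q - 1) := by
  suffices h' : D.degT q ≤ (D.degT (q - 1)).comap D.diffT from h' h
  refine iSup_le fun a => Submodule.map₂_le.2 fun x hx y hy => ?_
  rw [Submodule.mem_comap, TensorProduct.mk_apply, diffT_tmul]
  refine Submodule.add_mem _ ?_ ?_
  · refine Submodule.mem_iSup_of_mem (a - 1) (Submodule.apply_mem_map₂ _ (D.diff_mem hx) ?_)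
    simpa using hy
  · refine Submodule.mem_iSup_of_mem a (Submodule.apply_mem_map₂ _ ?_ ?_)
    · rw [D.parity_apply hx, Units.smul_def]; exact zsmul_mem hx _
    · have := D.diff_mem hy
      rwa [show q - a - 1 = q - 1 - a by ring] at this

theorem degT_mul_mem {a b c d : ℤ} {t : R ⊗[k] R} {x y : R} (hx : x ∈ D.deg a)
    (hy : y ∈ D.deg b) (ht : t ∈ D.degT c) (hd : a + c + b = d) :
    (x ⊗ₜ[k] 1) * t * (1 ⊗ₜ[k] y) ∈ D.degT d := by
  suffices h' : D.degT c ≤ (D.degT d).comap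
      ((LinearMap.mulRight k ((1 : R) ⊗ₜ[k] y)) ∘ₗ LinearMap.mulLeft k (x ⊗ₜ[k] (1 : R))) from h' ht
  refine iSup_le fun e => Submodule.map₂_le.2 fun r hr s hs => ?_
  refine Submodule.mem_iSup_of_mem (a + e) ?_
  have := Submodule.apply_mem_map₂ (TensorProduct.mk k R R) (D.mul_mem hx hr) (D.mul_mem hs hy)
  rw [show c - e + b = d - (a + e) by rw [← hd]; ring] at this
  simpa using this

end DGAlgebra

end DGAlgebra

/-! ## One-forms -/

section OneForms

variable {k R : Type*} [Field k] [Ring R] [Algebra k R]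

namespace DGAlgebra

variable {D : DGAlgebra k R}

/-- The twisted product `x ⊗ y ↦ x σ(y)`. -/
def twMul (σ : D.Aut) : R ⊗[k] R →ₗ[k] R :=
  LinearMap.mul' k R ∘ₗ LinearMap.lTensor R σ.hom.toLinearMap

/-- `Ω¹_σ R`, the kernel of the twisted product; `σ = id` gives `Ω¹ R`. -/
def omega (σ : D.Aut) : Submodule k (R ⊗[k] R) := LinearMap.ker (twMul σ)

/-- The space `Ω̂¹_σ R [-1] = cone (Ω¹_σ R → R ⊗ R)[-1]`; the pair `(α, β)` stands for
`Σα + β`. For `σ = id` this is `Ω̂¹ R [-1]`. -/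
abbrev OneForm (σ : D.Aut) : Type _ := omega σ × (R ⊗[k] R)

@[simp] theorem twMul_tmul (σ : D.Aut) (x y : R) : twMul σ (x ⊗ₜ y) = x * σ.hom y := rfl

theorem mem_omega {σ : D.Aut} {t : R ⊗[k] R} : t ∈ omega σ ↔ twMul σ t = 0 := Iff.rfl

theorem twMul_left (σ : D.Aut) (u : R) (t : R ⊗[k] R) :
    twMul σ ((u ⊗ₜ[k] 1) * t) = u * twMul σ t := by
  induction t with
  | zero => simp
  | tmul x y => simp [mul_assoc]
  | add x y hx hy => simp only [mul_add, map_add, hx, hy]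

theorem twMul_right (σ : D.Aut) (v : R) (t : R ⊗[k] R) :
    twMul σ (t * (1 ⊗ₜ[k] v)) = twMul σ t * σ.hom v := by
  induction t with
  | zero => simp
  | tmul x y => simp [mul_assoc]
  | add x y hx hy => simp only [add_mul, map_add, hx, hy]

theorem twMul_diffT (σ : D.Aut) (t : R ⊗[k] R) :
    twMul σ (D.diffT t) = D.diff (twMul σ t) := by
  induction t with
  | zero => simp
  | tmul x y => simp [D.diff_mul, σ.hom_diff]
  | add x y hx hy => simp [hx, hy]

theorem twMul_parityT (σ : D.Aut) (t : R ⊗[k] R) :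
    twMul σ (D.parityT t) = D.parity (twMul σ t) := by
  induction t with
  | zero => simp
  | tmul x y => simp [σ.hom_parity]
  | add x y hx hy => simp [hx, hy]

theorem twMul_homT (σ τ : D.Aut) (h : ∀ x, σ.hom (τ.hom x) = τ.hom (σ.hom x)) (t : R ⊗[k] R) :
    twMul σ (τ.homT t) = τ.hom (twMul σ t) := by
  induction t with
  | zero => simp
  | tmul x y => simp [h]
  | add x y hx hy => simp [hx, hy]

theorem twMul_homL (σ : D.Aut) (t : R ⊗[k] R) :
    twMul σ (σ.homL t) = σ.hom (twMul (Aut.refl D) t) := by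
  induction t with
  | zero => simp
  | tmul x y => simp [Aut.hom_refl]
  | add x y hx hy => simp [hx, hy]

namespace OneForm

variable (σ : D.Aut)

/-- `(-1)^{|m|} m`; the suspension `Σ` has degree `1`. -/
def parity : OneForm σ →ₗ[k] OneForm σ :=
  LinearMap.prodMap
    (-(D.parityT.toLinearMap.restrict (p := omega σ) (q := omega σ)
      fun t ht => by
        have := twMul_parityT σ t
        rw [mem_omega.1 ht, map_zero] at this
        exact this))
    D.parityT.toLinearMap

/-- The differential of the cone: `Σα + β ↦ -Σ∂α + α + ∂β`. -/
def diff : OneForm σ →ₗ[k] OneForm σ :=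
  LinearMap.prod
    (-((D.diffT.restrict (p := omega σ) (q := omega σ)
      fun t ht => by
        have := twMul_diffT σ t
        rw [mem_omega.1 ht, map_zero] at this
        exact this) ∘ₗ LinearMap.fst k _ _))
    ((omega σ).subtype ∘ₗ LinearMap.fst k _ _ + D.diffT ∘ₗ LinearMap.snd k _ _)

/-- The left action `u ∘ (Σα + β) = (-1)^{|u|} Σ(σ(u) α) + σ(u) β`. -/
def left (u : R) : OneForm σ →ₗ[k] OneForm σ :=
  LinearMap.prodMap
    ((LinearMap.mulLeft k (D.parity (σ.hom u) ⊗ₜ[k] (1 : R))).restrict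
      (p := omega σ) (q := omega σ)
      fun t ht => by
        have := twMul_left σ (D.parity (σ.hom u)) t
        rw [mem_omega.1 ht, mul_zero] at this
        exact this)
    (LinearMap.mulLeft k (σ.hom u ⊗ₜ[k] (1 : R)))

/-- The right action `(Σα + β) ∘ v = Σ(α v) + β v`. -/
def right (v : R) : OneForm σ →ₗ[k] OneForm σ :=
  LinearMap.prodMap
    ((LinearMap.mulRight k ((1 : R) ⊗ₜ[k] v)).restrict (p := omega σ) (q := omega σ)
      fun t ht => by
        have := twMul_right σ v t
        rw [mem_omega.1 ht, zero_mul] at this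
        exact this)
    (LinearMap.mulRight k ((1 : R) ⊗ₜ[k] v))

/-- The degree `q` part of `Ω̂¹_σ R [-1]`. -/
def deg (q : ℤ) : Submodule k (OneForm σ) :=
  ((D.degT (q - 1)).comap (omega σ).subtype).prod (D.degT q)

variable {σ}

@[simp] theorem parity_fst (m : OneForm σ) :
    ((parity σ m).1 : R ⊗[k] R) = - D.parityT m.1 := rfl

@[simp] theorem parity_snd (m : OneForm σ) : (parity σ m).2 = D.parityT m.2 := rfl

@[simp] theorem diff_fst (m : OneForm σ) : ((diff σ m).1 : R ⊗[k] R) = - D.diffT m.1 := rfl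

@[simp] theorem diff_snd (m : OneForm σ) : (diff σ m).2 = m.1 + D.diffT m.2 := rfl

@[simp] theorem left_fst (u : R) (m : OneForm σ) :
    ((left σ u m).1 : R ⊗[k] R) = (D.parity (σ.hom u) ⊗ₜ[k] (1 : R)) * (m.1 : R ⊗[k] R) := rfl

@[simp] theorem left_snd (u : R) (m : OneForm σ) :
    (left σ u m).2 = (σ.hom u ⊗ₜ[k] 1) * m.2 := rfl

@[simp] theorem right_fst (v : R) (m : OneForm σ) :
    ((right σ v m).1 : R ⊗[k] R) = (m.1 : R ⊗[k] R) * ((1 : R) ⊗ₜ[k] v) := rfl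

@[simp] theorem right_snd (v : R) (m : OneForm σ) : (right σ v m).2 = m.2 * (1 ⊗ₜ[k] v) := rfl

theorem ext' {m m' : OneForm σ} (h1 : (m.1 : R ⊗[k] R) = m'.1) (h2 : m.2 = m'.2) : m = m' :=
  Prod.ext (Subtype.ext h1) h2

theorem left_mul (u v : R) (m : OneForm σ) : left σ (u * v) m = left σ u (left σ v m) := by
  apply ext' <;> simp [← mul_assoc]

theorem left_one (m : OneForm σ) : left σ 1 m = m := by
  apply ext' <;> simp [← Algebra.TensorProduct.one_def]

theorem right_mul (u v : R) (m : OneForm σ) : right σ (u * v) m = right σ v (right σ u m) := by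
  apply ext' <;> simp [mul_assoc]

theorem right_one (m : OneForm σ) : right σ 1 m = m := by
  apply ext' <;> simp [← Algebra.TensorProduct.one_def]

theorem left_right (u v : R) (m : OneForm σ) :
    left σ u (right σ v m) = right σ v (left σ u m) := by
  apply ext' <;> simp [mul_assoc]

theorem left_add (u v : R) (m : OneForm σ) : left σ (u + v) m = left σ u m + left σ v m := by
  apply ext' <;> simp [TensorProduct.add_tmul, add_mul]

theorem left_smul (c : k) (u : R) (m : OneForm σ) : left σ (c • u) m = c • left σ u m := by
  apply ext' <;> simp [← TensorProduct.smul_tmul']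

theorem right_add (u v : R) (m : OneForm σ) : right σ (u + v) m = right σ u m + right σ v m := by
  apply ext' <;> simp [TensorProduct.tmul_add, mul_add]

theorem right_smul (c : k) (u : R) (m : OneForm σ) : right σ (c • u) m = c • right σ u m := by
  apply ext' <;> simp

theorem diff_left (u : R) (m : OneForm σ) :
    diff σ (left σ u m) = left σ (D.diff u) m + left σ (D.parity u) (diff σ m) := by
  apply ext'
  · simp only [diff_fst, left_fst, Prod.fst_add, Submodule.coe_add, D.diffT_left]
    simp [σ.hom_parity, σ.hom_diff, D.parity_parity, D.diff_parity, TensorProduct.neg_tmul,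
      add_comm]
  · simp only [diff_snd, left_snd, left_fst, Prod.snd_add, D.diffT_left]
    simp only [σ.hom_parity, σ.hom_diff, mul_add]
    abel

theorem diff_right (v : R) (m : OneForm σ) :
    diff σ (right σ v m) = right σ v (diff σ m) + right σ (D.diff v) (parity σ m) := by
  apply ext'
  · simp [D.diffT_right]
    abel
  · simp [D.diffT_right, add_mul]
    abel

theorem parity_left (u : R) (m : OneForm σ) :
    parity σ (left σ u m) = left σ (D.parity u) (parity σ m) := by
  apply ext' <;> simp [σ.hom_parity]

theorem parity_right (v : R) (m : OneForm σ) :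
    parity σ (right σ v m) = right σ (D.parity v) (parity σ m) := by
  apply ext' <;> simp

theorem parity_parity (m : OneForm σ) : parity σ (parity σ m) = m := by
  apply ext' <;> simp [D.parityT_parityT]

theorem diff_parity (m : OneForm σ) : diff σ (parity σ m) = - parity σ (diff σ m) := by
  apply ext' <;> simp [D.diffT_parityT, add_comm]

/-- The automorphism of `Ω̂¹ R [-1]` induced by `σ`. -/
def map (σ : D.Aut) : OneForm (Aut.refl D) →ₗ[k] OneForm (Aut.refl D) :=
  LinearMap.prodMap
    (σ.homT.toLinearMap.restrict (p := omega (Aut.refl D)) (q := omega (Aut.refl D))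
      fun t ht => by
        have := twMul_homT (Aut.refl D) σ (fun _ => rfl) t
        rw [mem_omega.1 ht, map_zero] at this
        exact this)
    σ.homT.toLinearMap

/-- The map `Ψ : Ω̂¹ R [-1] → Ω̂¹_σ R [-1]`, `x ⊗ y ↦ σ(x) ⊗ y`. -/
def psi (σ : D.Aut) : OneForm (Aut.refl D) →ₗ[k] OneForm σ :=
  LinearMap.prodMap
    (σ.homL.toLinearMap.restrict (p := omega (Aut.refl D)) (q := omega σ)
      fun t ht => by
        have := twMul_homL σ t
        rw [mem_omega.1 ht, map_zero] at this
        exact this)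
    σ.homL.toLinearMap

@[simp] theorem map_fst (m : OneForm (Aut.refl D)) :
    ((map σ m).1 : R ⊗[k] R) = σ.homT m.1 := rfl

@[simp] theorem map_snd (m : OneForm (Aut.refl D)) : (map σ m).2 = σ.homT m.2 := rfl

@[simp] theorem psi_fst (m : OneForm (Aut.refl D)) :
    ((psi σ m).1 : R ⊗[k] R) = σ.homL m.1 := rfl

@[simp] theorem psi_snd (m : OneForm (Aut.refl D)) : (psi σ m).2 = σ.homL m.2 := rfl

theorem map_left (u : R) (m : OneForm (Aut.refl D)) :
    map σ (left _ u m) = left _ (σ.hom u) (map σ m) := by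
  apply ext' <;> simp [Aut.hom_refl, σ.hom_parity]

theorem map_right (v : R) (m : OneForm (Aut.refl D)) :
    map σ (right _ v m) = right _ (σ.hom v) (map σ m) := by
  apply ext' <;> simp

theorem map_diff (m : OneForm (Aut.refl D)) : map σ (diff _ m) = diff _ (map σ m) := by
  apply ext' <;> simp [D.homT_diffT]

theorem map_parity (m : OneForm (Aut.refl D)) : map σ (parity _ m) = parity _ (map σ m) := by
  apply ext' <;> simp [D.homT_parityT]

end OneForm

/-- The element `d𝟏 = 1 ⊗ 1` of the summand `R ⊗ R` of `Ω̂¹ R [-1]`. -/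
def dOne (D : DGAlgebra k R) : OneForm (Aut.refl D) := (0, 1)

/-- The de Rham differential `r ↦ Σ(r ⊗ 1 - 1 ⊗ r)` on functions. -/
def dFun (D : DGAlgebra k R) : R →ₗ[k] OneForm (Aut.refl D) :=
  LinearMap.inl k _ _ ∘ₗ LinearMap.codRestrict (omega (Aut.refl D))
    ((TensorProduct.mk k R R).flip 1 - TensorProduct.mk k R R 1)
    fun r => by simp [mem_omega, Aut.hom_refl]

@[simp] theorem dFun_fst (r : R) :
    ((dFun D r).1 : R ⊗[k] R) = r ⊗ₜ 1 - 1 ⊗ₜ r := rfl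

@[simp] theorem dFun_snd (r : R) : (dFun D r).2 = 0 := rfl

theorem dFun_mul (r s : R) :
    dFun D (r * s) = OneForm.right _ s (dFun D r) + OneForm.left _ (D.parity r) (dFun D s) := by
  apply OneForm.ext'
  · simp [Aut.hom_refl, D.parity_parity, sub_mul, mul_sub]
  · simp

theorem dFun_parity (r : R) : dFun D (D.parity r) = - OneForm.parity _ (dFun D r) := by
  apply OneForm.ext' <;> simp

theorem dFun_hom (σ : D.Aut) (r : R) : dFun D (σ.hom r) = OneForm.map σ (dFun D r) := by
  apply OneForm.ext' <;> simp

end DGAlgebra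

end OneForms

/-! ## Noncommutative differential forms -/

section Forms

variable {k R : Type*} [Field k] [Ring R] [Algebra k R]

namespace DGAlgebra

/-- The relations of the tensor algebra of the bimodule `Ω̂¹ R [-1]` over `R`, on the free algebra
on `R ⊕ Ω̂¹ R [-1]`. -/
inductive FormsRel (D : DGAlgebra k R) :
    TensorAlgebra k (R × OneForm (Aut.refl D)) → TensorAlgebra k (R × OneForm (Aut.refl D)) → Prop
  | one : FormsRel D (TensorAlgebra.ι k (1, 0)) 1
  | mul (r s : R) : FormsRel D (TensorAlgebra.ι k (r * s, 0))
      (TensorAlgebra.ι k (r, 0) * TensorAlgebra.ι k (s, 0))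
  | left (r : R) (m : OneForm (Aut.refl D)) :
      FormsRel D (TensorAlgebra.ι k (0, OneForm.left _ r m))
        (TensorAlgebra.ι k (r, 0) * TensorAlgebra.ι k (0, m))
  | right (m : OneForm (Aut.refl D)) (r : R) :
      FormsRel D (TensorAlgebra.ι k (0, OneForm.right _ r m))
        (TensorAlgebra.ι k (0, m) * TensorAlgebra.ι k (r, 0))

/-- The algebra of noncommutative differential forms `Ω̂^• R = T_R(Ω̂¹ R [-1])`. -/
def Forms (D : DGAlgebra k R) : Type _ := RingQuot (FormsRel D)

instance (D : DGAlgebra k R) : Ring (Forms D) := inferInstanceAs (Ring (RingQuot (FormsRel D)))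

instance (D : DGAlgebra k R) : Algebra k (Forms D) :=
  inferInstanceAs (Algebra k (RingQuot (FormsRel D)))

namespace Forms

variable (D : DGAlgebra k R)

/-- The quotient map. -/
def mk : TensorAlgebra k (R × OneForm (Aut.refl D)) →ₐ[k] Forms D :=
  RingQuot.mkAlgHom k (FormsRel D)

theorem mk_rel {x y : TensorAlgebra k (R × OneForm (Aut.refl D))} (h : FormsRel D x y) :
    mk D x = mk D y := RingQuot.mkAlgHom_rel k h

/-- The inclusion `R → Ω̂^• R`. -/
def base : R →ₐ[k] Forms D :=
  AlgHom.ofLinearMap ((mk D).toLinearMap ∘ₗ TensorAlgebra.ι k ∘ₗ LinearMap.inl k _ _)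
    (by simpa using mk_rel D .one)
    (fun r s => by simpa using mk_rel D (.mul r s))

/-- The inclusion `Ω̂¹ R [-1] → Ω̂^• R`. -/
def form : OneForm (Aut.refl D) →ₗ[k] Forms D :=
  (mk D).toLinearMap ∘ₗ TensorAlgebra.ι k ∘ₗ LinearMap.inr k _ _

theorem form_left (r : R) (m : OneForm (Aut.refl D)) :
    form D (OneForm.left _ r m) = base D r * form D m := by
  simpa [form, base] using mk_rel D (.left r m)

theorem form_right (m : OneForm (Aut.refl D)) (r : R) :
    form D (OneForm.right _ r m) = form D m * base D r := by
  simpa [form, base] using mk_rel D (.right m r)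

variable {D}

section Lift

variable {B : Type*} [Ring B] [Algebra k B]

/-- The conditions under which `f` and `g` extend to an algebra map on forms. -/
structure IsLift (f : R →ₐ[k] B) (g : OneForm (Aut.refl D) →ₗ[k] B) : Prop where
  left : ∀ r m, g (OneForm.left _ r m) = f r * g m
  right : ∀ m r, g (OneForm.right _ r m) = g m * f r

/-- The universal property of `T_R(Ω̂¹ R [-1])`. -/
def lift (f : R →ₐ[k] B) (g : OneForm (Aut.refl D) →ₗ[k] B) (h : IsLift f g) :
    Forms D →ₐ[k] B :=
  RingQuot.liftAlgHom k ⟨TensorAlgebra.lift k (f.toLinearMap.coprod g), by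
    intro x y hxy
    cases hxy with
    | one => simp
    | mul r s => simp
    | left r m => simp [h.left]
    | right m r => simp [h.right]⟩

variable {f : R →ₐ[k] B} {g : OneForm (Aut.refl D) →ₗ[k] B} {h : IsLift f g}

@[simp] theorem lift_base (r : R) : lift f g h (base D r) = f r :=
  (RingQuot.liftAlgHom_mkAlgHom_apply k _ _ _).trans (by simp)

@[simp] theorem lift_form (m : OneForm (Aut.refl D)) : lift f g h (form D m) = g m :=
  (RingQuot.liftAlgHom_mkAlgHom_apply k _ _ _).trans (by simp)

end Lift

/-- Induction: every form is a sum of products of functions and one-forms. -/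
theorem induction {P : Forms D → Prop} (h1 : P 1) (ha : ∀ x y, P x → P y → P (x + y))
    (hb : ∀ r x, P x → P (base D r * x)) (hf : ∀ m x, P x → P (form D m * x)) (x : Forms D) :
    P x := by
  obtain ⟨t, rfl⟩ := RingQuot.mkAlgHom_surjective k (FormsRel D) x
  change P (mk D t)
  suffices H : ∀ y, P y → P (mk D t * y) by simpa using H 1 h1
  induction t using TensorAlgebra.induction with
  | algebraMap c =>
    intro y hy
    have h := hb (algebraMap k R c) y hy
    rwa [AlgHom.commutes] at h ⊢
  | ι m =>
    intro y hy
    have e : mk D (TensorAlgebra.ι k m) = base D m.1 + form D m.2 := by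
      simp [base, form, ← map_add]
    rw [e, add_mul]
    exact ha _ _ (hb _ _ hy) (hf _ _ hy)
  | mul a b ha' hb' => intro y hy; rw [map_mul, mul_assoc]; exact ha' _ (hb' _ hy)
  | add a b ha' hb' => intro y hy; rw [map_add, add_mul]; exact ha _ _ (ha' _ hy) (hb' _ hy)

section Derivation

variable {B : Type*} [Ring B] [Algebra k B] (f g : Forms D →ₐ[k] B) (d0 : R →ₗ[k] B)
  (d1 : OneForm (Aut.refl D) →ₗ[k] B)

/-- The conditions under which `d0`, `d1` extend to a map `d` on forms with
`d (x y) = d x * g y + f x * d y`. -/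
structure IsDer : Prop where
  mul : ∀ r s, d0 (r * s) = d0 r * g (base D s) + f (base D r) * d0 s
  left : ∀ r m, d1 (OneForm.left _ r m) = d0 r * g (form D m) + f (base D r) * d1 m
  right : ∀ m r, d1 (OneForm.right _ r m) = d1 m * g (base D r) + f (form D m) * d0 r

variable {f g d0 d1}

variable (f g d0) in
/-- The triangular representation on functions. -/
def derBase (h : ∀ r s, d0 (r * s) = d0 r * g (base D s) + f (base D r) * d0 s) :
    R →ₐ[k] Module.End k (B × B) :=
  AlgHom.ofLinearMap
    { toFun := fun r => tri k (f (base D r)) (d0 r) (g (base D r))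
      map_add' := fun r s => by simp only [map_add, tri_add]
      map_smul' := fun c r => by simp only [map_smul, tri_smul, RingHom.id_apply] }
    (by
      have h0 : d0 1 = 0 := by simpa using h 1 1
      simp only [LinearMap.coe_mk, AddHom.coe_mk, map_one, h0, tri_one])
    (fun r s => by
      simp only [LinearMap.coe_mk, AddHom.coe_mk, map_mul, tri_mul, h, add_comm])

variable (f g d1) in
/-- The triangular representation on one-forms. -/
def derForm : OneForm (Aut.refl D) →ₗ[k] Module.End k (B × B) where
  toFun := fun m => tri k (f (form D m)) (d1 m) (g (form D m))
  map_add' := fun r s => by simp only [map_add, tri_add]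
  map_smul' := fun c r => by simp only [map_smul, tri_smul, RingHom.id_apply]

theorem derBase_apply (h : ∀ r s, d0 (r * s) = d0 r * g (base D s) + f (base D r) * d0 s) (r : R) :
    derBase f g d0 h r = tri k (f (base D r)) (d0 r) (g (base D r)) := rfl

theorem derForm_apply (m : OneForm (Aut.refl D)) :
    derForm f g d1 m = tri k (f (form D m)) (d1 m) (g (form D m)) := rfl

theorem isLift_der (h : IsDer f g d0 d1) : IsLift (derBase f g d0 h.mul) (derForm f g d1) where
  left r m := by
    rw [derForm_apply, derForm_apply, derBase_apply, tri_mul, h.left, form_left, map_mul, map_mul,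
      add_comm]
  right m r := by
    rw [derForm_apply, derForm_apply, derBase_apply, tri_mul, h.right, form_right, map_mul, map_mul,
      add_comm]

/-- The triangular representation `x ↦ (f x, d x; 0, g x)` of a skew derivation. -/
def derHom (h : IsDer f g d0 d1) : Forms D →ₐ[k] Module.End k (B × B) :=
  lift (derBase f g d0 h.mul) (derForm f g d1) (isLift_der h)

/-- The skew derivation extending `d0` and `d1`. -/
def der (h : IsDer f g d0 d1) : Forms D →ₗ[k] B where
  toFun x := (derHom h x (0, 1)).1
  map_add' x y := by rw [map_add, LinearMap.add_apply, Prod.fst_add]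
  map_smul' c x := by rw [map_smul, LinearMap.smul_apply, Prod.smul_fst, RingHom.id_apply]

theorem derHom_base (h : IsDer f g d0 d1) (r : R) :
    derHom h (base D r) = tri k (f (base D r)) (d0 r) (g (base D r)) := by
  rw [derHom, lift_base]; rfl

theorem derHom_form (h : IsDer f g d0 d1) (m : OneForm (Aut.refl D)) :
    derHom h (form D m) = tri k (f (form D m)) (d1 m) (g (form D m)) := by
  rw [derHom, lift_form]; rfl

@[simp] theorem der_base (h : IsDer f g d0 d1) (r : R) : der h (base D r) = d0 r := by
  simp [der, derHom_base]

@[simp] theorem der_form (h : IsDer f g d0 d1) (m : OneForm (Aut.refl D)) :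
    der h (form D m) = d1 m := by
  simp [der, derHom_form]

theorem derHom_eq (h : IsDer f g d0 d1) (x : Forms D) :
    derHom h x = tri k (f x) (der h x) (g x) := by
  induction x using induction with
  | h1 => simp [der, tri_one]
  | ha x y hx hy => simp only [map_add, hx, hy, tri_add]
  | hb r x hx =>
    have e : der h (base D r * x) = f (base D r) * der h x + d0 r * g x := by
      change (derHom h (base D r * x) (0, 1)).1 = _
      rw [map_mul, hx, derHom_base, tri_mul]; simp
    rw [map_mul, hx, derHom_base, tri_mul, e, map_mul, map_mul]
  | hf m x hx =>
    have e : der h (form D m * x) = f (form D m) * der h x + d1 m * g x := by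
      change (derHom h (form D m * x) (0, 1)).1 = _
      rw [map_mul, hx, derHom_form, tri_mul]; simp
    rw [map_mul, hx, derHom_form, tri_mul, e, map_mul, map_mul]

theorem der_mul (h : IsDer f g d0 d1) (x y : Forms D) :
    der h (x * y) = der h x * g y + f x * der h y := by
  change (derHom h (x * y) (0, 1)).1 = _
  rw [map_mul, derHom_eq, derHom_eq, tri_mul]
  simp [add_comm]

theorem der_one (h : IsDer f g d0 d1) : der h 1 = 0 := by
  simpa using der_mul h 1 1

end Derivation

variable (D)

theorem isLift_parity : IsLift ((base D).comp D.parity) (form D ∘ₗ OneForm.parity _) where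
  left r m := by simp [OneForm.parity_left, form_left]
  right m r := by simp [OneForm.parity_right, form_right]

/-- The sign automorphism `x ↦ (-1)^{|x|} x` of `Ω̂^• R` for the total degree. -/
def parity : Forms D →ₐ[k] Forms D := lift _ _ (isLift_parity D)

@[simp] theorem parity_base (r : R) : parity D (base D r) = base D (D.parity r) := by
  simp [parity]

@[simp] theorem parity_form (m : OneForm (Aut.refl D)) :
    parity D (form D m) = form D (OneForm.parity _ m) := by
  simp [parity]

theorem isDer_diff : IsDer (parity D) (AlgHom.id k (Forms D)) ((base D).toLinearMap ∘ₗ D.diff)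
    (form D ∘ₗ OneForm.diff _) where
  mul r s := by simp [D.diff_mul]
  left r m := by simp [OneForm.diff_left, form_left]
  right m r := by simp [OneForm.diff_right, form_right]

/-- The differential `∂` of `Ω̂^• R`. -/
def diff : Forms D →ₗ[k] Forms D := der (isDer_diff D)

/-- The linear map `x ⊗ y ↦ f x * g y`. -/
def mulMap (f g : R →ₗ[k] Forms D) : R ⊗[k] R →ₗ[k] Forms D :=
  LinearMap.mul' k (Forms D) ∘ₗ TensorProduct.map f g

variable {D} in
@[simp] theorem mulMap_tmul (f g : R →ₗ[k] Forms D) (x y : R) :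
    mulMap D f g (x ⊗ₜ y) = f x * g y := rfl

/-- `r ↦ dr` as a map to forms. -/
def dBase : R →ₗ[k] Forms D := form D ∘ₗ dFun D

theorem dBase_apply (r : R) : dBase D r = form D (dFun D r) := rfl

theorem dBase_mul (r s : R) :
    dBase D (r * s) = dBase D r * base D s + base D (D.parity r) * dBase D s := by
  simp [dBase_apply, dFun_mul, form_left, form_right]

theorem parity_dBase (r : R) : parity D (dBase D r) = - dBase D (D.parity r) := by
  simp [dBase_apply, dFun_parity]

/-- The de Rham differential on one-forms. It is determined by the Leibniz rule, `d(dr) = 0` and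
`d(d𝟏) = 0`: the element `Σ(∑ x ⊗ y)`, with `∑ x y = 0`, equals `-∑ (-1)^{|x|} x · dy` and is
sent to `-∑ (-1)^{|x|} dx · dy`, and `x · d𝟏 · y` is sent to
`dx · d𝟏 · y + (-1)^{|x|} x · d𝟏 · dy`. -/
def dForm : OneForm (Aut.refl D) →ₗ[k] Forms D :=
  LinearMap.coprod
    (-(mulMap D (dBase D ∘ₗ D.parity.toLinearMap) (dBase D) ∘ₗ (omega (Aut.refl D)).subtype))
    (mulMap D (LinearMap.mulRight k (form D (dOne D)) ∘ₗ dBase D) (base D).toLinearMap +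
      mulMap D (LinearMap.mulRight k (form D (dOne D)) ∘ₗ (base D).toLinearMap ∘ₗ
        D.parity.toLinearMap) (dBase D))

theorem dForm_apply (m : OneForm (Aut.refl D)) :
    dForm D m = - mulMap D (dBase D ∘ₗ D.parity.toLinearMap) (dBase D) m.1 +
      (mulMap D (LinearMap.mulRight k (form D (dOne D)) ∘ₗ dBase D) (base D).toLinearMap m.2 +
      mulMap D (LinearMap.mulRight k (form D (dOne D)) ∘ₗ (base D).toLinearMap ∘ₗ
        D.parity.toLinearMap) (dBase D) m.2) := rfl

variable {D} in
theorem mul'_omega (m : OneForm (Aut.refl D)) : LinearMap.mul' k R (m.1 : R ⊗[k] R) = 0 := by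
  have h : twMul (Aut.refl D) (m.1 : R ⊗[k] R) = 0 := m.1.2
  have e : twMul (Aut.refl D) = LinearMap.mul' k R := by
    ext x y; simp [Aut.hom_refl]
  rwa [e] at h

/-- A one-form in terms of the generators `dr` and `d𝟏`. -/
theorem form_eq (m : OneForm (Aut.refl D)) :
    form D m =
      - mulMap D ((base D).toLinearMap ∘ₗ D.parity.toLinearMap) (dBase D) m.1 +
      mulMap D (LinearMap.mulRight k (form D (dOne D)) ∘ₗ (base D).toLinearMap)
          (base D).toLinearMap m.2 := by
  have key1 : ∀ t : R ⊗[k] R, ∃ m' : OneForm (Aut.refl D),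
      form D m' = mulMap D ((base D).toLinearMap ∘ₗ D.parity.toLinearMap) (dBase D) t ∧
      (m'.1 : R ⊗[k] R) = LinearMap.mul' k R t ⊗ₜ 1 - t ∧ m'.2 = 0 := by
    intro t
    induction t with
    | zero => exact ⟨0, by simp, by simp, rfl⟩
    | tmul x y =>
      refine ⟨OneForm.left _ (D.parity x) (dFun D y), by simp [form_left, dBase_apply], ?_, by simp⟩
      simp [Aut.hom_refl, D.parity_parity, mul_sub]
    | add x y hx hy =>
      obtain ⟨a, ha, ha1, ha2⟩ := hx
      obtain ⟨b, hb, hb1, hb2⟩ := hy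
      refine ⟨a + b, by rw [map_add, map_add, ha, hb], ?_, by simp [ha2, hb2]⟩
      simp only [Prod.fst_add, Submodule.coe_add, ha1, hb1, map_add, TensorProduct.add_tmul]
      abel
  have key2 : ∀ t : R ⊗[k] R, (form D ∘ₗ LinearMap.inr k _ _) t =
      mulMap D (LinearMap.mulRight k (form D (dOne D)) ∘ₗ (base D).toLinearMap)
          (base D).toLinearMap t := by
    intro t
    induction t with
    | zero => rw [map_zero, map_zero]
    | tmul x y =>
      have e : ((0, x ⊗ₜ y) : OneForm (Aut.refl D)) =
          OneForm.right _ y (OneForm.left _ x (dOne D)) := by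
        apply OneForm.ext' <;> simp [dOne, Aut.hom_refl]
      rw [LinearMap.comp_apply, LinearMap.inr_apply, e, form_right, form_left]
      simp
    | add x y hx hy => rw [map_add, map_add, hx, hy]
  obtain ⟨m', h1, h2, h3⟩ := key1 m.1
  rw [← h1, ← key2, LinearMap.comp_apply, ← map_neg, ← map_add]
  congr 1
  apply OneForm.ext'
  · simp [h2, mul'_omega]
  · simp [h3]

theorem dForm_left (r : R) (m : OneForm (Aut.refl D)) :
    dForm D (OneForm.left _ r m) = dBase D r * form D m + base D (D.parity r) * dForm D m := by
  have e1 : ∀ t : R ⊗[k] R, mulMap D (dBase D ∘ₗ D.parity.toLinearMap) (dBase D)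
        ((D.parity r ⊗ₜ[k] (1 : R)) * t) =
      dBase D r * mulMap D ((base D).toLinearMap ∘ₗ D.parity.toLinearMap) (dBase D) t +
      base D (D.parity r) * mulMap D (dBase D ∘ₗ D.parity.toLinearMap) (dBase D) t := by
    intro t
    induction t with
    | zero => simp
    | tmul x y => simp [D.parity_parity, dBase_mul, add_mul, mul_assoc]
    | add x y hx hy => simp only [mul_add, map_add, hx, hy]; abel
  have e2 : ∀ t : R ⊗[k] R,
      mulMap D (LinearMap.mulRight k (form D (dOne D)) ∘ₗ dBase D) (base D).toLinearMap
        ((r ⊗ₜ[k] (1 : R)) * t) +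
      mulMap D (LinearMap.mulRight k (form D (dOne D)) ∘ₗ (base D).toLinearMap ∘ₗ
        D.parity.toLinearMap) (dBase D) ((r ⊗ₜ[k] (1 : R)) * t) =
      dBase D r * mulMap D (LinearMap.mulRight k (form D (dOne D)) ∘ₗ (base D).toLinearMap)
          (base D).toLinearMap t +
      base D (D.parity r) *
        (mulMap D (LinearMap.mulRight k (form D (dOne D)) ∘ₗ dBase D) (base D).toLinearMap t +
        mulMap D (LinearMap.mulRight k (form D (dOne D)) ∘ₗ (base D).toLinearMap ∘ₗ
          D.parity.toLinearMap) (dBase D) t) := by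
    intro t
    induction t with
    | zero => simp
    | tmul x y => simp [dBase_mul, add_mul, mul_add, mul_assoc, add_assoc]
    | add x y hx hy =>
      simp only [mul_add, map_add] at hx hy ⊢
      rw [add_add_add_comm, hx, hy]; abel
  rw [dForm_apply, dForm_apply, form_eq D m, OneForm.left_fst, OneForm.left_snd, Aut.hom_refl,
    e1, e2]
  simp only [mul_add, mul_neg]
  abel

theorem dForm_right (m : OneForm (Aut.refl D)) (r : R) :
    dForm D (OneForm.right _ r m) = dForm D m * base D r + parity D (form D m) * dBase D r := by
  have e1 : ∀ t : R ⊗[k] R, mulMap D (dBase D ∘ₗ D.parity.toLinearMap) (dBase D)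
        (t * ((1 : R) ⊗ₜ[k] r)) =
      mulMap D (dBase D ∘ₗ D.parity.toLinearMap) (dBase D) t * base D r +
      dBase D (D.parity (LinearMap.mul' k R t)) * dBase D r +
      parity D (mulMap D ((base D).toLinearMap ∘ₗ D.parity.toLinearMap) (dBase D) t) *
        dBase D r := by
    intro t
    induction t with
    | zero => simp
    | tmul x y =>
      simp [D.parity_parity, dBase_mul, mul_add, add_mul, mul_assoc, parity_dBase]
      abel
    | add x y hx hy => simp only [add_mul, map_add, hx, hy]; abel
  have e2 : ∀ t : R ⊗[k] R,
      mulMap D (LinearMap.mulRight k (form D (dOne D)) ∘ₗ dBase D) (base D).toLinearMap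
        (t * ((1 : R) ⊗ₜ[k] r)) +
      mulMap D (LinearMap.mulRight k (form D (dOne D)) ∘ₗ (base D).toLinearMap ∘ₗ
        D.parity.toLinearMap) (dBase D) (t * ((1 : R) ⊗ₜ[k] r)) =
      (mulMap D (LinearMap.mulRight k (form D (dOne D)) ∘ₗ dBase D) (base D).toLinearMap t +
        mulMap D (LinearMap.mulRight k (form D (dOne D)) ∘ₗ (base D).toLinearMap ∘ₗ
          D.parity.toLinearMap) (dBase D) t) * base D r +
      parity D (mulMap D (LinearMap.mulRight k (form D (dOne D)) ∘ₗ (base D).toLinearMap)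
          (base D).toLinearMap t) * dBase D r := by
    have hp : OneForm.parity _ (dOne D) = dOne D := by
      apply OneForm.ext' <;> simp [dOne]
    intro t
    induction t with
    | zero => simp
    | tmul x y => simp [dBase_mul, add_mul, mul_add, mul_assoc, hp]; abel
    | add x y hx hy =>
      simp only [add_mul, map_add] at hx hy ⊢
      rw [add_add_add_comm, hx, hy]; abel
  rw [dForm_apply, dForm_apply, form_eq D m, OneForm.right_fst, OneForm.right_snd, e1, e2,
    mul'_omega]
  simp only [add_mul, neg_mul, map_add, map_neg, map_zero, zero_mul]
  abel

theorem isDer_d : IsDer (parity D) (AlgHom.id k (Forms D)) (dBase D) (dForm D) where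
  mul r s := by simp [dBase_mul]
  left r m := by simp [dForm_left]
  right m r := by simp [dForm_right]

/-- The de Rham differential `d` of `Ω̂^• R`. -/
def d : Forms D →ₗ[k] Forms D := der (isDer_d D)

variable {D} in
theorem isLift_map (σ : D.Aut) : IsLift ((base D).comp σ.hom) (form D ∘ₗ OneForm.map σ) where
  left r m := by simp [OneForm.map_left, form_left]
  right m r := by simp [OneForm.map_right, form_right]

variable {D} in
/-- The automorphism of `Ω̂^• R` extending `σ`. -/
def map (σ : D.Aut) : Forms D →ₐ[k] Forms D := lift _ _ (isLift_map σ)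

@[simp] theorem diff_base (r : R) : diff D (base D r) = base D (D.diff r) := by simp [diff]

@[simp] theorem diff_form (m : OneForm (Aut.refl D)) :
    diff D (form D m) = form D (OneForm.diff _ m) := by simp [diff]

theorem diff_mul (x y : Forms D) : diff D (x * y) = diff D x * y + parity D x * diff D y := by
  simp [diff, der_mul]

@[simp] theorem d_base (r : R) : d D (base D r) = form D (dFun D r) := by simp [d, dBase_apply]

@[simp] theorem d_form (m : OneForm (Aut.refl D)) : d D (form D m) = dForm D m := by simp [d]

theorem d_mul (x y : Forms D) : d D (x * y) = d D x * y + parity D x * d D y := by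
  simp [d, der_mul]

@[simp] theorem map_base (σ : D.Aut) (r : R) : map σ (base D r) = base D (σ.hom r) := by
  simp [map]

@[simp] theorem map_form (σ : D.Aut) (m : OneForm (Aut.refl D)) :
    map σ (form D m) = form D (OneForm.map σ m) := by
  simp [map]

/-- Products of homogeneous functions and one-forms, with their weight (form degree) and total
degree. -/
inductive IsMonomial : ℕ → ℤ → Forms D → Prop
  | one : IsMonomial 0 0 1
  | base_mul {w : ℕ} {p q : ℤ} {r : R} {x : Forms D} (hr : r ∈ D.deg p) (hx : IsMonomial w q x) :
      IsMonomial w (p + q) (base D r * x)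
  | form_mul {w : ℕ} {p q : ℤ} {m : OneForm (Aut.refl D)} {x : Forms D}
      (hm : m ∈ OneForm.deg (Aut.refl D) p) (hx : IsMonomial w q x) :
      IsMonomial (w + 1) (p + q) (form D m * x)

/-- The forms of weight `w` and total degree `q`. -/
def bideg (w : ℕ) (q : ℤ) : Submodule k (Forms D) := Submodule.span k {x | IsMonomial D w q x}

end Forms

end DGAlgebra

end Forms

/-! ## The twisted Karoubi-de Rham complex -/

section Karoubi

variable {k R : Type*} [Field k] [Ring R] [Algebra k R]

namespace DGAlgebra

namespace Forms

variable (D : DGAlgebra k R)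

/-- The action of a function on `R ⊕ Ω̂¹ R [-1]`, the quotient of `Ω̂^• R` by weights `≥ 2`. -/
def repBase : R →ₐ[k] Module.End k (R × OneForm (Aut.refl D)) :=
  AlgHom.ofLinearMap
    { toFun := fun r => LinearMap.prodMap (LinearMap.mulLeft k r) (OneForm.left _ r)
      map_add' := fun r s => by
        refine LinearMap.ext fun x => Prod.ext ?_ ?_ <;> simp [add_mul, OneForm.left_add]
      map_smul' := fun c r => by
        refine LinearMap.ext fun x => Prod.ext ?_ ?_ <;> simp [OneForm.left_smul] }
    (by refine LinearMap.ext fun x => Prod.ext ?_ ?_ <;> simp [OneForm.left_one])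
    (fun r s => by
      refine LinearMap.ext fun x => Prod.ext ?_ ?_ <;> simp [OneForm.left_mul])

/-- The action of a one-form on `R ⊕ Ω̂¹ R [-1]`. -/
def repForm : OneForm (Aut.refl D) →ₗ[k] Module.End k (R × OneForm (Aut.refl D)) where
  toFun m :=
    { toFun := fun x => (0, OneForm.right _ x.1 m)
      map_add' := fun x y => by simp [OneForm.right_add]
      map_smul' := fun c x => by simp [OneForm.right_smul] }
  map_add' m m' := by refine LinearMap.ext fun x => Prod.ext ?_ ?_ <;> simp
  map_smul' c m := by refine LinearMap.ext fun x => Prod.ext ?_ ?_ <;> simp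

theorem isLift_rep : IsLift (B := Module.End k (R × OneForm (Aut.refl D))) (repBase D)
    (repForm D) where
  left r m := by
    refine LinearMap.ext fun x => Prod.ext ?_ ?_ <;>
      simp [repBase, repForm, OneForm.left_right]
  right m r := by
    refine LinearMap.ext fun x => Prod.ext ?_ ?_ <;>
      simp [repBase, repForm, OneForm.right_mul]

/-- The projection of `Ω̂^• R` onto its weight one part `Ω̂¹ R [-1]`. -/
def weightOne : Forms D →ₗ[k] OneForm (Aut.refl D) :=
  LinearMap.snd k _ _ ∘ₗ LinearMap.applyₗ (1, 0) ∘ₗ (lift _ _ (isLift_rep D)).toLinearMap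

theorem weightOne_base_form_base (r s : R) (m : OneForm (Aut.refl D)) :
    weightOne D (base D r * form D m * base D s) = OneForm.left _ r (OneForm.right _ s m) := by
  simp [weightOne, repBase, repForm]

variable {D}

/-- A `k`-linear map which is an odd derivation. -/
structure IsOddDer (δ : Forms D →ₗ[k] Forms D) : Prop where
  mul : ∀ x y, δ (x * y) = δ x * y + parity D x * δ y

theorem IsOddDer.map_one {δ : Forms D →ₗ[k] Forms D} (h : IsOddDer δ) : δ 1 = 0 := by
  simpa using h.mul 1 1

theorem parity_parity (x : Forms D) : parity D (parity D x) = x := by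
  induction x using induction with
  | h1 => simp
  | ha x y hx hy => simp [hx, hy]
  | hb r x hx => simp [hx, D.parity_parity]
  | hf m x hx => simp [hx, OneForm.parity_parity]

theorem map_parity (σ : D.Aut) (x : Forms D) : map σ (parity D x) = parity D (map σ x) := by
  induction x using induction with
  | h1 => simp
  | ha x y hx hy => simp [hx, hy]
  | hb r x hx => simp [hx, σ.hom_parity]
  | hf m x hx => simp [hx, OneForm.map_parity]

theorem IsOddDer.comm_parity {δ : Forms D →ₗ[k] Forms D} (h : IsOddDer δ)
    (hb : ∀ r, δ (base D (D.parity r)) = - parity D (δ (base D r)))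
    (hf : ∀ m, δ (form D (OneForm.parity _ m)) = - parity D (δ (form D m))) (x : Forms D) :
    δ (parity D x) = - parity D (δ x) := by
  induction x using induction with
  | h1 => simp [h.map_one]
  | ha x y hx hy => simp [hx, hy, add_comm]
  | hb r x hx => simp [h.mul, hx, hb, add_comm]
  | hf m x hx => simp [h.mul, hx, hf, add_comm]

theorem IsOddDer.comm_map {δ : Forms D →ₗ[k] Forms D} (h : IsOddDer δ) (σ : D.Aut)
    (hb : ∀ r, δ (base D (σ.hom r)) = map σ (δ (base D r)))
    (hf : ∀ m, δ (form D (OneForm.map σ m)) = map σ (δ (form D m))) (x : Forms D) :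
    δ (map σ x) = map σ (δ x) := by
  induction x using induction with
  | h1 => simp [h.map_one]
  | ha x y hx hy => simp [hx, hy]
  | hb r x hx => simp [h.mul, hx, hb, σ.hom_parity]
  | hf m x hx => simp [h.mul, hx, hf, OneForm.map_parity]

theorem isOddDer_diff : IsOddDer (diff D) := ⟨diff_mul D⟩

theorem isOddDer_d : IsOddDer (d D) := ⟨d_mul D⟩

theorem diff_parity (x : Forms D) : diff D (parity D x) = - parity D (diff D x) :=
  isOddDer_diff.comm_parity (fun r => by simp [D.diff_parity])
    (fun m => by simp [OneForm.diff_parity]) x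

theorem diff_map (σ : D.Aut) (x : Forms D) : diff D (map σ x) = map σ (diff D x) :=
  isOddDer_diff.comm_map σ (fun r => by simp [σ.hom_diff])
    (fun m => by simp [OneForm.map_diff]) x

theorem parity_dOne : OneForm.parity _ (dOne D) = dOne D := by
  apply OneForm.ext' <;> simp [dOne]

theorem map_dOne (σ : D.Aut) : OneForm.map σ (dOne D) = dOne D := by
  apply OneForm.ext' <;> simp [dOne]

theorem parity_mulMap (f g f' g' : R →ₗ[k] Forms D) (c : k)
    (h : ∀ x y, parity D (f x) * parity D (g y) = c • (f' (D.parity x) * g' (D.parity y)))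
    (t : R ⊗[k] R) : parity D (mulMap D f g t) = c • mulMap D f' g' (D.parityT t) := by
  induction t with
  | zero => simp
  | tmul x y => simp [h]
  | add x y hx hy => simp [hx, hy]

theorem map_mulMap (σ : D.Aut) (f g : R →ₗ[k] Forms D)
    (h : ∀ x y, map σ (f x) * map σ (g y) = f (σ.hom x) * g (σ.hom y))
    (t : R ⊗[k] R) : map σ (mulMap D f g t) = mulMap D f g (σ.homT t) := by
  induction t with
  | zero => simp
  | tmul x y => simp [h]
  | add x y hx hy => simp [hx, hy]

theorem map_dBase (σ : D.Aut) (r : R) : map σ (dBase D r) = dBase D (σ.hom r) := by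
  simp [dBase_apply, dFun_hom]

theorem d_parity (x : Forms D) : d D (parity D x) = - parity D (d D x) := by
  refine isOddDer_d.comm_parity (fun r => by simp [dFun_parity]) (fun m => ?_) x
  rw [d_form, d_form, dForm_apply, dForm_apply, map_add, map_neg, map_add,
    parity_mulMap (dBase D ∘ₗ D.parity.toLinearMap) (dBase D)
      (dBase D ∘ₗ D.parity.toLinearMap) (dBase D) 1 (by simp [parity_dBase]),
    parity_mulMap _ _ (LinearMap.mulRight k (form D (dOne D)) ∘ₗ dBase D) (base D).toLinearMap (-1)
      (by simp [parity_dBase, parity_dOne]),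
    parity_mulMap _ _ (LinearMap.mulRight k (form D (dOne D)) ∘ₗ (base D).toLinearMap ∘ₗ
        D.parity.toLinearMap) (dBase D) (-1) (by simp [parity_dBase, parity_dOne])]
  simp
  abel

theorem d_map (σ : D.Aut) (x : Forms D) : d D (map σ x) = map σ (d D x) := by
  refine isOddDer_d.comm_map σ (fun r => by simp [dFun_hom]) (fun m => ?_) x
  rw [d_form, d_form, dForm_apply, dForm_apply, map_add, map_neg, map_add,
    map_mulMap σ _ _ (by simp [map_dBase, ← σ.hom_parity]),
    map_mulMap σ _ _ (by simp [map_dBase, map_dOne]),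
    map_mulMap σ _ _ (by simp [map_dBase, map_dOne, ← σ.hom_parity])]
  simp

variable (D)

/-- The projection to forms of even total degree. -/
def even : Forms D →ₗ[k] Forms D := (2⁻¹ : k) • (LinearMap.id + (parity D).toLinearMap)

/-- The projection to forms of odd total degree. -/
def odd : Forms D →ₗ[k] Forms D := (2⁻¹ : k) • (LinearMap.id - (parity D).toLinearMap)

variable {D}

/-- The twisted cyclic product `x ⊗ y ↦ (-1)^{|x||y|} y σ(x)`. -/
def cyc (σ : D.Aut) : Forms D ⊗[k] Forms D →ₗ[k] Forms D :=
  LinearMap.mul' k (Forms D) ∘ₗ (TensorProduct.comm k (Forms D) (Forms D)).toLinearMap ∘ₗ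
    (TensorProduct.map ((map σ).toLinearMap ∘ₗ even D) LinearMap.id +
      TensorProduct.map ((map σ).toLinearMap ∘ₗ odd D) (parity D).toLinearMap)

theorem cyc_tmul (σ : D.Aut) (x y : Forms D) :
    cyc σ (x ⊗ₜ y) = y * map σ (even D x) + parity D y * map σ (odd D x) := by
  simp [cyc]

/-- The span of the twisted commutators `x y - (-1)^{|x||y|} y σ(x)`. -/
def twComm (σ : D.Aut) : Submodule k (Forms D) :=
  LinearMap.range (LinearMap.mul' k (Forms D) - cyc σ)

/-- The twisted Karoubi-de Rham complex of `R`. -/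
abbrev DR (σ : D.Aut) : Type _ := Forms D ⧸ twComm σ

theorem twComm_le_comap (σ : D.Aut) {δ : Forms D →ₗ[k] Forms D} (h : IsOddDer δ)
    (hp : ∀ x, δ (parity D x) = - parity D (δ x)) (hm : ∀ x, δ (map σ x) = map σ (δ x)) :
    twComm σ ≤ (twComm σ).comap δ := by
  rintro _ ⟨t, rfl⟩
  refine ⟨(TensorProduct.map δ LinearMap.id + TensorProduct.map (parity D).toLinearMap δ :
    Forms D ⊗[k] Forms D →ₗ[k] Forms D ⊗[k] Forms D) t, ?_⟩
  induction t with
  | zero => simp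
  | tmul x y =>
    simp only [LinearMap.add_apply, TensorProduct.map_tmul, LinearMap.id_apply, map_add,
      LinearMap.sub_apply, LinearMap.mul'_apply, cyc_tmul, map_sub, h.mul,
      AlgHom.toLinearMap_apply, even, odd, LinearMap.smul_apply, map_smul, map_parity,
      hm, hp, parity_parity, mul_sub, mul_add, mul_smul_comm, smul_add, smul_sub,
      mul_neg, neg_mul, smul_neg]
    abel
  | add x y hx hy => simp only [map_add] at hx hy ⊢; rw [hx, hy]

/-- The differential `∂` of the twisted Karoubi-de Rham complex. -/
def DR.diff (σ : D.Aut) : DR σ →ₗ[k] DR σ :=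
  (twComm σ).mapQ (twComm σ) (Forms.diff D)
    (twComm_le_comap σ isOddDer_diff diff_parity (diff_map σ))

/-- The de Rham differential `d` of the twisted Karoubi-de Rham complex. -/
def DR.d (σ : D.Aut) : DR σ →ₗ[k] DR σ :=
  (twComm σ).mapQ (twComm σ) (Forms.d D) (twComm_le_comap σ isOddDer_d d_parity (d_map σ))

end Forms

end DGAlgebra

end Karoubi

/-! ## Double derivations and contraction -/

section DoubleDerivations

variable {k R : Type*} [Field k] [Ring R] [Algebra k R]

namespace DGAlgebra

variable (D : DGAlgebra k R)

theorem parityPow_apply {a p : ℤ} {x : R} (hx : x ∈ D.deg a) :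
    D.parityPow p x = (p * a).negOnePow • x := by
  unfold parityPow
  split_ifs with h
  · simp [Int.negOnePow_even _ (h.mul_right a)]
  · rw [D.parity_apply hx]
    congr 1
    rw [Int.not_even_iff_odd] at h
    rcases Int.even_or_odd a with ha | ha
    · rw [Int.negOnePow_even _ ha, Int.negOnePow_even _ (ha.mul_left p)]
    · rw [Int.negOnePow_odd _ ha, Int.negOnePow_odd _ (h.mul ha)]

theorem parityPow_mem {a p : ℤ} {x : R} (hx : x ∈ D.deg a) : D.parityPow p x ∈ D.deg a := by
  rw [D.parityPow_apply hx, Units.smul_def]; exact zsmul_mem hx _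

theorem parityPow_parityPow (p q : ℤ) (x : R) :
    D.parityPow p (D.parityPow q x) = D.parityPow (p + q) x := by
  unfold parityPow
  by_cases hp : Even p <;> by_cases hq : Even q <;> simp [hp, hq, Int.even_add, D.parity_parity]

theorem parityPow_self (p : ℤ) (x : R) : D.parityPow p (D.parityPow p x) = x := by
  rw [parityPow_parityPow]; simp [parityPow]

theorem parityPow_sub_one (p : ℤ) (x : R) :
    D.parityPow (p - 1) x = D.parity (D.parityPow p x) := by
  unfold parityPow
  have h : Even (p - 1) ↔ ¬ Even p := by simp
  by_cases hp : Even p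
  · rw [if_neg (by rw [h]; simpa using hp), if_pos hp]; rfl
  · rw [if_pos (h.2 hp), if_neg hp, D.parity_parity]; rfl

theorem diff_parityPow (p : ℤ) (x : R) :
    D.diff (D.parityPow p x) = p.negOnePow • D.parityPow p (D.diff x) := by
  unfold parityPow
  by_cases hp : Even p
  · simp [hp, Int.negOnePow_even _ hp]
  · rw [Int.not_even_iff_odd] at hp
    simp [Int.not_even_iff_odd.2 hp, Int.negOnePow_odd _ hp, D.diff_parity]

namespace OneForm

variable {D}

/-- The sign `(-1)^{p|m|} m`. -/
def parityPow (σ : D.Aut) (p : ℤ) : OneForm σ →ₗ[k] OneForm σ :=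
  if Even p then LinearMap.id else parity σ

theorem parityPow_left (σ : D.Aut) (p : ℤ) (u : R) (m : OneForm σ) :
    parityPow σ p (left σ u m) = left σ (D.parityPow p u) (parityPow σ p m) := by
  unfold parityPow DGAlgebra.parityPow
  split_ifs <;> simp [parity_left]

theorem parityPow_right (σ : D.Aut) (p : ℤ) (v : R) (m : OneForm σ) :
    parityPow σ p (right σ v m) = right σ (D.parityPow p v) (parityPow σ p m) := by
  unfold parityPow DGAlgebra.parityPow
  split_ifs <;> simp [parity_right]

end OneForm

theorem parityT_apply {q : ℤ} {t : R ⊗[k] R} (h : t ∈ D.degT q) :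
    D.parityT t = q.negOnePow • t := by
  suffices h' : D.degT q ≤ LinearMap.ker
      (D.parityT.toLinearMap - (q.negOnePow : ℤ) • LinearMap.id) by
    have := h' h
    rw [LinearMap.mem_ker, LinearMap.sub_apply, sub_eq_zero] at this
    exact this
  refine iSup_le fun a => Submodule.map₂_le.2 fun x hx y hy => ?_
  rw [LinearMap.mem_ker, LinearMap.sub_apply, sub_eq_zero]
  simp only [AlgHom.toLinearMap_apply, TensorProduct.mk_apply, parityT_tmul, LinearMap.smul_apply,
    LinearMap.id_apply, D.parity_apply hx, D.parity_apply hy]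
  rw [Units.smul_def, Units.smul_def, TensorProduct.tmul_smul, ← TensorProduct.smul_tmul',
    smul_smul, ← Units.val_mul, ← Int.negOnePow_add]
  congr 3
  ring

theorem iSup_degT : ⨆ q, D.degT q = ⊤ := by
  rw [eq_top_iff]
  rintro t -
  induction t with
  | zero => exact zero_mem _
  | add x y hx hy => exact add_mem hx hy
  | tmul x y =>
    refine D.induction_deg (P := fun x => x ⊗ₜ[k] y ∈ ⨆ q, D.degT q) (fun a x hx => ?_) (by simp)
      (fun x x' h h' => by rw [TensorProduct.add_tmul]; exact add_mem h h') x
    refine D.induction_deg (P := fun y => x ⊗ₜ[k] y ∈ ⨆ q, D.degT q) (fun b y hy => ?_) (by simp)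
      (fun x x' h h' => by rw [TensorProduct.tmul_add]; exact add_mem h h') y
    refine Submodule.mem_iSup_of_mem (a + b) (Submodule.mem_iSup_of_mem a ?_)
    refine Submodule.apply_mem_map₂ _ hx ?_
    simpa using hy

theorem tmul_mem_degT {a b q : ℤ} {x y : R} (hx : x ∈ D.deg a) (hy : y ∈ D.deg b)
    (h : a + b = q) : x ⊗ₜ[k] y ∈ D.degT q := by
  refine Submodule.mem_iSup_of_mem a (Submodule.apply_mem_map₂ _ hx ?_)
  rwa [show q - a = b by omega]

theorem OneForm.iSup_deg : ⨆ q, OneForm.deg (Aut.refl D) q = ⊤ := by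
  have hd : ∀ t : R ⊗[k] R, ∃ m' : OneForm (Aut.refl D),
      m' ∈ ⨆ q, OneForm.deg (Aut.refl D) q ∧
      (m'.1 : R ⊗[k] R) = LinearMap.mul' k R t ⊗ₜ 1 - t ∧ m'.2 = 0 := by
    intro t
    have ht : t ∈ ⨆ q, D.degT q := by rw [iSup_degT]; trivial
    refine Submodule.iSup_induction (motive := fun t => ∃ m' : OneForm (Aut.refl D),
      m' ∈ ⨆ q, OneForm.deg (Aut.refl D) q ∧
      (m'.1 : R ⊗[k] R) = LinearMap.mul' k R t ⊗ₜ 1 - t ∧ m'.2 = 0) _ ht (fun q t ht => ?_)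
      ⟨0, zero_mem _, by simp, rfl⟩ ?_
    · have hm : (LinearMap.mul' k R t ⊗ₜ[k] 1 - t) ∈ omega (Aut.refl D) := by
        have e : twMul (Aut.refl D) = LinearMap.mul' k R := by
          ext x y; simp [Aut.hom_refl]
        rw [mem_omega, map_sub, twMul_tmul, e]; simp
      refine ⟨(⟨_, hm⟩, 0), Submodule.mem_iSup_of_mem (q + 1) ⟨?_, zero_mem _⟩, rfl, rfl⟩
      change LinearMap.mul' k R t ⊗ₜ[k] 1 - t ∈ D.degT (q + 1 - 1)
      rw [add_sub_cancel_right]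
      refine sub_mem ?_ ht
      have hq : D.degT q ≤ (D.deg q).comap (LinearMap.mul' k R) := by
        refine iSup_le fun a => Submodule.map₂_le.2 fun x hx y hy => ?_
        have := D.mul_mem hx hy
        rw [add_sub_cancel] at this
        exact this
      exact D.tmul_mem_degT (hq ht) D.one_mem (add_zero q)
    · rintro x y ⟨a, ha, ha1, ha2⟩ ⟨b, hb, hb1, hb2⟩
      refine ⟨a + b, add_mem ha hb, ?_, by simp [ha2, hb2]⟩
      simp only [Prod.fst_add, Submodule.coe_add, ha1, hb1, map_add, TensorProduct.add_tmul]
      abel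
  rw [eq_top_iff]
  rintro m -
  obtain ⟨m', h1, h2, h3⟩ := hd m.1
  have hs : ((0, m.2) : OneForm (Aut.refl D)) ∈ ⨆ q, OneForm.deg (Aut.refl D) q := by
    have ht : m.2 ∈ ⨆ q, D.degT q := by rw [iSup_degT]; trivial
    refine Submodule.iSup_induction
      (motive := fun t => ((0, t) : OneForm (Aut.refl D)) ∈ ⨆ q, OneForm.deg (Aut.refl D) q)
      _ ht (fun q t ht => ?_) (zero_mem _) (fun x y hx hy => by simpa using add_mem hx hy)
    exact Submodule.mem_iSup_of_mem q ⟨zero_mem _, ht⟩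
  have e : m = -m' + (0, m.2) := by
    apply OneForm.ext'
    · simp [h2, Forms.mul'_omega]
    · simp [h3]
  rw [e]
  exact add_mem (neg_mem h1) hs

theorem OneForm.parity_apply {q : ℤ} {m : OneForm (Aut.refl D)}
    (h : m ∈ OneForm.deg (Aut.refl D) q) : OneForm.parity _ m = q.negOnePow • m := by
  have h1 := D.parityT_apply h.1
  have h2 := D.parityT_apply h.2
  have e : (q - 1).negOnePow = - q.negOnePow := by simp [Int.negOnePow_sub]
  apply OneForm.ext'
  · rw [OneForm.parity_fst]
    simp only [Submodule.subtype_apply] at h1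
    rw [h1, e, Units.smul_def, Units.smul_def]
    simp
  · rw [OneForm.parity_snd, h2]; rfl

/-- The degree `p` part of `Der̂ R [1] = Hom_{R^e} (Ω̂¹ R [-1], R ⊗ R)`: maps of degree `p`,
bilinear (with the Koszul sign) for the outer bimodule structure of `R ⊗ R`. -/
def DDer (p : ℤ) : Submodule k (OneForm (Aut.refl D) →ₗ[k] R ⊗[k] R) where
  carrier := {Θ | (∀ q, ∀ m ∈ OneForm.deg (Aut.refl D) q, Θ m ∈ D.degT (q + p)) ∧
    (∀ u m, Θ (OneForm.left _ u m) = (D.parityPow p u ⊗ₜ[k] 1) * Θ m) ∧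
    (∀ v m, Θ (OneForm.right _ v m) = Θ m * (1 ⊗ₜ[k] v))}
  add_mem' := by
    rintro Θ Θ' ⟨h1, h2, h3⟩ ⟨h1', h2', h3'⟩
    refine ⟨fun q m hm => add_mem (h1 q m hm) (h1' q m hm), fun u m => ?_, fun v m => ?_⟩
    · simp [h2, h2', mul_add]
    · simp [h3, h3', add_mul]
  zero_mem' := ⟨fun q m _ => zero_mem _, fun u m => by simp, fun v m => by simp⟩
  smul_mem' := by
    rintro c Θ ⟨h1, h2, h3⟩
    refine ⟨fun q m hm => Submodule.smul_mem _ c (h1 q m hm), fun u m => ?_, fun v m => ?_⟩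
    · simp [h2]
    · simp [h3]

variable {D}

namespace DDer

theorem parityT_apply {p : ℤ} (Θ : D.DDer p) (m : OneForm (Aut.refl D)) :
    D.parityT (Θ.1 m) = p.negOnePow • Θ.1 (OneForm.parity _ m) := by
  have hm : m ∈ ⨆ q, OneForm.deg (Aut.refl D) q := by rw [OneForm.iSup_deg]; trivial
  refine Submodule.iSup_induction (motive := fun m => D.parityT (Θ.1 m) =
    p.negOnePow • Θ.1 (OneForm.parity _ m)) _ hm (fun q m hm => ?_) (by simp) ?_
  · rw [D.parityT_apply (Θ.2.1 q m hm), OneForm.parity_apply D hm,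
      LinearMap.CompatibleSMul.map_smul Θ.1 q.negOnePow m, smul_smul, Int.negOnePow_add, mul_comm]
  · intro x y hx hy; simp only [map_add, hx, hy, smul_add]

/-- The differential `δ Θ = ∂ ∘ Θ - (-1)^{|Θ|} Θ ∘ ∂`. -/
def delta {p : ℤ} (Θ : D.DDer p) : D.DDer (p - 1) :=
  ⟨D.diffT ∘ₗ Θ.1 - p.negOnePow • (Θ.1 ∘ₗ OneForm.diff _), by
    have hmem : ∀ q, ∀ m ∈ OneForm.deg (Aut.refl D) q,
        OneForm.diff _ m ∈ OneForm.deg (Aut.refl D) (q - 1) := by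
      rintro q m ⟨h1, h2⟩
      exact ⟨neg_mem (D.diffT_mem h1), add_mem h1 (D.diffT_mem h2)⟩
    refine ⟨fun q m hm => sub_mem ?_ ?_, fun u m => ?_, fun v m => ?_⟩
    · have := D.diffT_mem (Θ.2.1 q m hm)
      rwa [add_sub_assoc] at this
    · have := Θ.2.1 _ _ (hmem q m hm)
      rw [show q - 1 + p = q + (p - 1) by ring] at this
      rw [Units.smul_def]
      exact zsmul_mem this _
    · simp only [LinearMap.sub_apply, LinearMap.comp_apply, LinearMap.smul_apply, Θ.2.2.1,
        OneForm.diff_left, map_add, D.diffT_left, D.diff_parityPow, D.parityPow_sub_one,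
        smul_add, mul_sub]
      have e : D.parityPow p (D.parity u) = D.parity (D.parityPow p u) := by
        unfold DGAlgebra.parityPow; split_ifs <;> simp
      rw [e, Units.smul_def, Units.smul_def, Units.smul_def, Units.smul_def,
        ← TensorProduct.smul_tmul', mul_smul_comm, smul_mul_assoc]
      abel
    · simp only [LinearMap.sub_apply, LinearMap.comp_apply, LinearMap.smul_apply, Θ.2.2.2,
        OneForm.diff_right, map_add, D.diffT_right, parityT_apply, smul_add, sub_mul]
      rw [Units.smul_def, Units.smul_def, Units.smul_def, smul_mul_assoc, smul_mul_assoc]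
      abel⟩

variable (D) in
/-- The inner bimodule structure
`u * (x ⊗ y) * v = (-1)^{|u||x| + |v||y| + |u||v|} x v ⊗ u y`, for `|u| = a` and `|v| = b`. -/
def inner (a b : ℤ) (u v : R) : R ⊗[k] R →ₗ[k] R ⊗[k] R :=
  (a * b).negOnePow • (LinearMap.mulRight k (v ⊗ₜ[k] (1 : R)) ∘ₗ
    LinearMap.mulLeft k ((1 : R) ⊗ₜ[k] u) ∘ₗ
    (Algebra.TensorProduct.map (D.parityPow a) (D.parityPow b)).toLinearMap)

theorem inner_tmul (a b : ℤ) (u v x y : R) : inner D a b u v (x ⊗ₜ y) =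
    (a * b).negOnePow • ((D.parityPow a x * v) ⊗ₜ[k] (u * D.parityPow b y)) := by
  simp [inner]

theorem inner_left (a b : ℤ) (u v w : R) (t : R ⊗[k] R) :
    inner D a b u v ((w ⊗ₜ[k] 1) * t) = (D.parityPow a w ⊗ₜ[k] 1) * inner D a b u v t := by
  induction t with
  | zero => simp
  | tmul x y =>
    simp only [Algebra.TensorProduct.tmul_mul_tmul, inner_tmul, map_mul, one_mul]
    rw [Units.smul_def, Units.smul_def, mul_smul_comm]
    simp [mul_assoc]
  | add x y hx hy => simp only [mul_add, map_add, hx, hy]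

theorem inner_right (a b : ℤ) (u v w : R) (t : R ⊗[k] R) :
    inner D a b u v (t * (1 ⊗ₜ[k] w)) = inner D a b u v t * (1 ⊗ₜ[k] D.parityPow b w) := by
  induction t with
  | zero => simp
  | tmul x y =>
    simp only [Algebra.TensorProduct.tmul_mul_tmul, inner_tmul, map_mul, mul_one]
    rw [Units.smul_def, Units.smul_def, smul_mul_assoc]
    simp [mul_assoc]
  | add x y hx hy => simp only [add_mul, map_add, hx, hy]

theorem inner_mem {a b q : ℤ} {u v : R} (hu : u ∈ D.deg a) (hv : v ∈ D.deg b) {t : R ⊗[k] R}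
    (ht : t ∈ D.degT q) : inner D a b u v t ∈ D.degT (a + q + b) := by
  suffices h' : D.degT q ≤ (D.degT (a + q + b)).comap (inner D a b u v) from h' ht
  refine iSup_le fun c => Submodule.map₂_le.2 fun x hx y hy => ?_
  rw [Submodule.mem_comap, TensorProduct.mk_apply, inner_tmul, Units.smul_def]
  refine zsmul_mem ?_ _
  exact D.tmul_mem_degT (D.mul_mem (D.parityPow_mem hx) hv) (D.mul_mem hu (D.parityPow_mem hy))
    (by ring)

/-- The bimodule structure of `Der̂ R [1]` induced by the inner structure of `R ⊗ R`:
`(u Θ v)(m) = (-1)^{|v||m|} u * Θ(m) * v`. -/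
def act {a b p : ℤ} (u : D.deg a) (v : D.deg b) (Θ : D.DDer p) : D.DDer (a + p + b) :=
  ⟨inner D a b u v ∘ₗ Θ.1 ∘ₗ OneForm.parityPow _ b, by
    refine ⟨fun q m hm => ?_, fun w m => ?_, fun w m => ?_⟩
    · have hm' : OneForm.parityPow _ b m ∈ OneForm.deg (Aut.refl D) q := by
        unfold OneForm.parityPow
        split_ifs
        · exact hm
        · rw [OneForm.parity_apply D hm, Units.smul_def]; exact zsmul_mem hm _
      have := inner_mem u.2 v.2 (Θ.2.1 q _ hm')
      rw [show a + (q + p) + b = q + (a + p + b) by ring] at this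
      exact this
    · simp only [LinearMap.comp_apply, OneForm.parityPow_left, Θ.2.2.1, inner_left,
        D.parityPow_parityPow]
      rw [add_assoc]
    · simp only [LinearMap.comp_apply, OneForm.parityPow_right, Θ.2.2.2, inner_right,
        D.parityPow_self]⟩

variable (D) in
/-- The sign `(-1)^{p|x|} x` on forms. -/
def signForms (p : ℤ) : Forms D →ₐ[k] Forms D :=
  if Even p then AlgHom.id k _ else Forms.parity D

variable (D) in
/-- `R ⊗ R → Ω̂^• R ⊗ Ω̂^• R`. -/
def baseT : R ⊗[k] R →ₐ[k] Forms D ⊗[k] Forms D :=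
  Algebra.TensorProduct.map (Forms.base D) (Forms.base D)

theorem signForms_base (p : ℤ) (r : R) :
    signForms D p (Forms.base D r) = Forms.base D (D.parityPow p r) := by
  unfold signForms DGAlgebra.parityPow
  split_ifs <;> simp

theorem isDer_ext {p : ℤ} (Θ : D.DDer p) :
    Forms.IsDer (Algebra.TensorProduct.includeLeft.comp (signForms D p))
      (Algebra.TensorProduct.includeRight : Forms D →ₐ[k] Forms D ⊗[k] Forms D) 0
      ((baseT D).toLinearMap ∘ₗ Θ.1) where
  mul r s := by simp
  left r m := by
    simp only [LinearMap.comp_apply, Θ.2.2.1, AlgHom.toLinearMap_apply, map_mul, AlgHom.comp_apply,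
      signForms_base, LinearMap.zero_apply, zero_mul, zero_add]
    rw [baseT, Algebra.TensorProduct.map_tmul, map_one]; rfl
  right m r := by
    simp only [LinearMap.comp_apply, Θ.2.2.2, AlgHom.toLinearMap_apply, map_mul,
      LinearMap.zero_apply, mul_zero, add_zero]
    rw [baseT, Algebra.TensorProduct.map_tmul, map_one]; rfl

/-- The extension of `Θ` to a double derivation `Ω̂^• R → Ω̂^• R ⊗ Ω̂^• R` vanishing on `R`:
`Θ(x y) = Θ(x) y + (-1)^{|Θ||x|} x Θ(y)`. -/
def ext {p : ℤ} (Θ : D.DDer p) : Forms D →ₗ[k] Forms D ⊗[k] Forms D := Forms.der (isDer_ext Θ)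

theorem ext_form {p : ℤ} (Θ : D.DDer p) (m : OneForm (Aut.refl D)) :
    ext Θ (Forms.form D m) = baseT D (Θ.1 m) := by
  simp [ext]

theorem ext_base {p : ℤ} (Θ : D.DDer p) (r : R) : ext Θ (Forms.base D r) = 0 := by
  simp [ext]

theorem ext_mul {p : ℤ} (Θ : D.DDer p) (x y : Forms D) :
    ext Θ (x * y) = ext Θ x * (1 ⊗ₜ y) + (signForms D p x ⊗ₜ 1) * ext Θ y := by
  simp [ext, Forms.der_mul]

/-- The twisted contraction `ι_Θ ω = ∑ ± Θ(ω)'' σ(Θ(ω)')`. On a product of one-forms this is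
`ι_Θ (α₁ ⋯ αₙ) = ∑ᵢ ± Θ(αᵢ)'' αᵢ₊₁ ⋯ αₙ σ(α₁) ⋯ σ(αᵢ₋₁) σ(Θ(αᵢ)')` with Koszul signs. -/
def contract (σ : D.Aut) {p : ℤ} (Θ : D.DDer p) (w : Forms D) : Forms D :=
  Forms.cyc σ (ext Θ w)

/-- The map `Θ ↦ Ψ(ι_Θ ω)` for a two-form `ω`. -/
def psiContract (σ : D.Aut) (w : Forms D) {p : ℤ} (Θ : D.DDer p) : OneForm σ :=
  OneForm.psi σ (Forms.weightOne D (contract σ Θ w))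

end DDer

/-- `Φ` is an isomorphism of DG `R`-bimodules `Der̂ R [1] → Ω̂¹_σ R [-1][n]`. Here the shift is
`M[n] = M ⊗ k[n]`, so that its degree `p` part is `M_{p+n}`, its differential and left action are
those of `M`, and its right action is that of `M` times `(-1)^{n|v|}`; and, as `Φ` is linear over
`σ` on the right, `v` acts on `M = Ω̂¹_σ R [-1]` from the right through `σ(v)`. -/
structure IsDGBimoduleIso (σ : D.Aut) (n : ℤ) (Φ : ∀ {p : ℤ}, D.DDer p → OneForm σ) : Prop where
  /-- `Φ` is a `k`-linear bijection in every degree. -/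
  bijective : ∀ p : ℤ, ∃ e : D.DDer p ≃ₗ[k] OneForm.deg σ (p + n), ∀ Θ, (e Θ : OneForm σ) = Φ Θ
  /-- `Φ` commutes with the differentials. -/
  map_delta : ∀ {p : ℤ} (Θ : D.DDer p), Φ (DDer.delta Θ) = OneForm.diff σ (Φ Θ)
  /-- `Φ` commutes with the bimodule structures. -/
  map_act : ∀ {a b p : ℤ} (u : D.deg a) (v : D.deg b) (Θ : D.DDer p),
    Φ (DDer.act u v Θ) =
      (n * b).negOnePow • OneForm.left σ u (OneForm.right σ (σ.hom v) (Φ Θ))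

end DGAlgebra

end DoubleDerivations

/-! ## Connected graded coalgebras and the cobar construction -/

section Cobar

theorem isInternal_of_coaction {k ι M : Type*} [CommRing k] [AddCommGroup M] [Module k M]
    [DecidableEq ι] (S : ι → Submodule k M) (κ : ι → M →ₗ[k] M)
    (h : ∀ i, ∀ x ∈ S i, ∀ j, κ j x = if i = j then x else 0) (hS : ⨆ i, S i = ⊤) :
    DirectSum.IsInternal S := by
  have key : ∀ (f : DirectSum ι fun i => S i) (j : ι),
      κ j (DirectSum.coeAddMonoidHom S f) = f j := by
    intro f j
    induction f using DirectSum.induction_on with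
    | zero => simp
    | of i x =>
      rw [DirectSum.coeAddMonoidHom_of, h i x x.2]
      split_ifs with hij
      · subst hij; rw [DirectSum.of_eq_same]
      · rw [DirectSum.of_eq_of_ne _ _ _ (Ne.symm hij)]; rfl
    | add x y hx hy => simp [hx, hy]
  refine ⟨fun f g hfg => ?_, fun x => ?_⟩
  · refine DFinsupp.ext fun j => Subtype.ext ?_
    rw [← key f j, ← key g j, hfg]
  · have hx : x ∈ ⨆ i, S i := by rw [hS]; trivial
    refine Submodule.iSup_induction (motive := fun x => ∃ f, DirectSum.coeAddMonoidHom S f = x)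
      S hx (fun i x hx => ⟨DirectSum.of (fun i => S i) i ⟨x, hx⟩, by simp⟩) ⟨0, by simp⟩ ?_
    rintro x y ⟨f, rfl⟩ ⟨g, rfl⟩
    exact ⟨f + g, by simp⟩

/-- A coaugmented coalgebra `C = k 1 ⊕ C₁ ⊕ C₂ ⊕ ⋯` which is connected and graded. `parity` is
the sign `c ↦ (-1)^{|c|} c`. -/
structure ConnCoalgebra (k C : Type*) [Field k] [AddCommGroup C] [Module k C] [Coalgebra k C] where
  gr : ℕ → Submodule k C
  isInternal : DirectSum.IsInternal gr
  one : C
  gr_zero : gr 0 = Submodule.span k {one}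
  counit_one : Coalgebra.counit (R := k) one = 1
  counit_pos : ∀ {i : ℕ} {c : C}, c ∈ gr (i + 1) → Coalgebra.counit (R := k) c = 0
  comul_one : Coalgebra.comul (R := k) one = one ⊗ₜ[k] one
  comul_mem : ∀ {i : ℕ} {c : C}, c ∈ gr i → Coalgebra.comul (R := k) c ∈
    ⨆ pq ∈ Finset.HasAntidiagonal.antidiagonal i,
      Submodule.map₂ (TensorProduct.mk k C C) (gr pq.1) (gr pq.2)
  parity : C →ₗ[k] C
  parity_apply : ∀ {i : ℕ} {c : C}, c ∈ gr i → parity c = (-1 : k) ^ i • c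

namespace ConnCoalgebra

open Coalgebra

variable {k C : Type*} [Field k] [AddCommGroup C] [Module k C] [Coalgebra k C]
variable (G : ConnCoalgebra k C)

/-- `C̄`, the kernel of the counit. -/
abbrev Red (_G : ConnCoalgebra k C) : Submodule k C := LinearMap.ker (counit (R := k) (A := C))

/-- The projection `C → C̄`, `c ↦ c - ε(c) 1`. -/
def red : C →ₗ[k] G.Red :=
  LinearMap.codRestrict _ (LinearMap.id - (LinearMap.toSpanSingleton k C G.one) ∘ₗ counit)
    fun c => by simp [G.counit_one]

theorem coe_red (c : C) : (G.red c : C) = c - counit (R := k) c • G.one := rfl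

theorem red_coe (c : G.Red) : G.red (c : C) = c := by
  apply Subtype.ext
  have : counit (R := k) (c : C) = 0 := c.2
  rw [coe_red, this]; simp

theorem red_one : G.red G.one = 0 := by
  apply Subtype.ext
  rw [coe_red, G.counit_one]; simp

/-- The underlying algebra of the cobar construction `Ω(C)`: the free algebra on `Σ⁻¹ C̄`. -/
abbrev Cobar : Type _ := TensorAlgebra k G.Red

/-- The map `c ↦ Σ⁻¹ c̄` from `C` to the generators of `Ω(C)`; it vanishes on `1`. -/
def bar : C →ₗ[k] G.Cobar := TensorAlgebra.ι k ∘ₗ G.red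

theorem bar_one : G.bar G.one = 0 := by simp [bar, red_one]

theorem bar_coe (c : G.Red) : G.bar (c : C) = TensorAlgebra.ι k c := by simp [bar, red_coe]

theorem induction_gr {P : C → Prop} (h : ∀ i, ∀ c ∈ G.gr i, P c) (h0 : P 0)
    (ha : ∀ x y, P x → P y → P (x + y)) (c : C) : P c := by
  have hx : c ∈ ⨆ p, G.gr p := by
    rw [G.isInternal.submodule_iSup_eq_top]; trivial
  exact Submodule.iSup_induction (motive := P) G.gr hx (fun p x hx => h p x hx) h0 ha

/-- Every element of the cobar construction is a combination of products of generators. -/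
theorem cobar_induction {P : G.Cobar → Prop} (h1 : P 1) (ha : ∀ x y, P x → P y → P (x + y))
    (hs : ∀ (c : k) x, P x → P (c • x)) (hb : ∀ c x, P x → P (G.bar c * x)) (x : G.Cobar) :
    P x := by
  suffices H : ∀ y, P y → P (x * y) by simpa using H 1 h1
  induction x using TensorAlgebra.induction with
  | algebraMap c => intro y hy; rw [← Algebra.smul_def]; exact hs c y hy
  | ι m => intro y hy; rw [← G.bar_coe]; exact hb _ y hy
  | mul a b ha' hb' => intro y hy; rw [mul_assoc]; exact ha' _ (hb' _ hy)
  | add a b ha' hb' => intro y hy; rw [add_mul]; exact ha _ _ (ha' _ hy) (hb' _ hy)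

/-- The sign automorphism of the cobar construction; `Σ⁻¹ c̄` has degree `|c| - 1`. -/
def cobarParity : G.Cobar →ₐ[k] G.Cobar :=
  TensorAlgebra.lift k (-(G.bar ∘ₗ G.parity ∘ₗ G.Red.subtype))

theorem parity_one : G.parity G.one = G.one := by
  have h : G.one ∈ G.gr 0 := by rw [G.gr_zero]; exact Submodule.mem_span_singleton_self _
  simpa using G.parity_apply h

theorem cobarParity_bar (c : C) : G.cobarParity (G.bar c) = - G.bar (G.parity c) := by
  have : G.cobarParity (G.bar c) = -(G.bar (G.parity (G.red c : C))) := by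
    rw [bar, LinearMap.comp_apply, cobarParity, TensorAlgebra.lift_ι_apply]; rfl
  rw [this, coe_red]
  simp [parity_one, bar_one]

/-- The quadratic expression `∑ (-1)^{|c₁|} Σ⁻¹c̄₁ Σ⁻¹c̄₂`. -/
def cobarQuad : C →ₗ[k] G.Cobar :=
  LinearMap.mul' k G.Cobar ∘ₗ TensorProduct.map (G.bar ∘ₗ G.parity) G.bar ∘ₗ comul

theorem cobarQuad_one : G.cobarQuad G.one = 0 := by
  simp [cobarQuad, G.comul_one, bar_one]

/-- The triangular representation of the differential. -/
def cobarTri : G.Cobar →ₐ[k] Module.End k (G.Cobar × G.Cobar) :=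
  TensorAlgebra.lift k
    { toFun := fun c => tri k (G.cobarParity (G.bar c)) (G.cobarQuad c) (G.bar c)
      map_add' := fun r s => by simp only [Submodule.coe_add, map_add, tri_add]
      map_smul' := fun c r => by
        simp only [Submodule.coe_smul, map_smul, tri_smul, RingHom.id_apply] }

/-- The differential of the cobar construction: the derivation with
`∂(Σ⁻¹c̄) = ∑ (-1)^{|c₁|} Σ⁻¹c̄₁ Σ⁻¹c̄₂`. -/
def cobarDiff : G.Cobar →ₗ[k] G.Cobar :=
  LinearMap.fst k _ _ ∘ₗ LinearMap.applyₗ ((0, 1) : G.Cobar × G.Cobar) ∘ₗ G.cobarTri.toLinearMap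

theorem cobarTri_bar (c : C) : G.cobarTri (G.bar c) =
    tri k (G.cobarParity (G.bar c)) (G.cobarQuad c) (G.bar c) := by
  have h : G.cobarTri (G.bar c) = tri k (G.cobarParity (G.bar (G.red c : C)))
      (G.cobarQuad (G.red c : C)) (G.bar (G.red c : C)) := by
    rw [bar, LinearMap.comp_apply, cobarTri, TensorAlgebra.lift_ι_apply]; rfl
  rw [h, coe_red]
  simp [bar_one, cobarQuad_one]

theorem cobarDiff_bar (c : C) : G.cobarDiff (G.bar c) = G.cobarQuad c := by
  change (G.cobarTri (G.bar c) (0, 1)).1 = _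
  rw [cobarTri_bar]; simp

theorem cobarTri_eq (x : G.Cobar) :
    G.cobarTri x = tri k (G.cobarParity x) (G.cobarDiff x) x := by
  induction x using G.cobar_induction with
  | h1 => 
    have : G.cobarDiff 1 = 0 := by simp [cobarDiff]
    simp [tri_one, this]
  | ha x y hx hy => simp only [map_add, hx, hy, tri_add]
  | hs c x hx => simp only [map_smul, hx, tri_smul]
  | hb c x hx =>
    have e : G.cobarDiff (G.bar c * x) =
        G.cobarParity (G.bar c) * G.cobarDiff x + G.cobarQuad c * x := by
      change (G.cobarTri (G.bar c * x) (0, 1)).1 = _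
      rw [map_mul, hx, cobarTri_bar, tri_mul]; simp
    rw [map_mul, hx, cobarTri_bar, tri_mul, e, map_mul]

theorem cobarDiff_mul (x y : G.Cobar) :
    G.cobarDiff (x * y) = G.cobarDiff x * y + G.cobarParity x * G.cobarDiff y := by
  change (G.cobarTri (x * y) (0, 1)).1 = _
  rw [map_mul, cobarTri_eq, cobarTri_eq, tri_mul]
  simp [add_comm]

/-- Products of homogeneous generators `Σ⁻¹c̄` with `|c| = i + 1`, of degree `i`. -/
inductive IsMonomial : ℤ → G.Cobar → Prop
  | one : IsMonomial 0 1
  | bar_mul {i : ℕ} {q : ℤ} {c : C} {x : G.Cobar} (hc : c ∈ G.gr (i + 1)) (hx : IsMonomial q x) :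
      IsMonomial (i + q) (G.bar c * x)

/-- The degree `q` part of the cobar construction. -/
def cobarDeg (q : ℤ) : Submodule k G.Cobar := Submodule.span k {x | G.IsMonomial q x}

theorem cobarDeg_one : (1 : G.Cobar) ∈ G.cobarDeg 0 := Submodule.subset_span .one

theorem cobarDeg_bar {i : ℕ} {c : C} (hc : c ∈ G.gr (i + 1)) : G.bar c ∈ G.cobarDeg i := by
  have := Submodule.subset_span (R := k) (s := {x | G.IsMonomial _ x})
    (IsMonomial.bar_mul hc IsMonomial.one)
  rw [mul_one, add_zero] at this
  exact this

theorem cobarDeg_mul {p q : ℤ} {x y : G.Cobar} (hx : x ∈ G.cobarDeg p) (hy : y ∈ G.cobarDeg q) :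
    x * y ∈ G.cobarDeg (p + q) := by
  have h1 : ∀ x, G.IsMonomial p x → ∀ y ∈ G.cobarDeg q, x * y ∈ G.cobarDeg (p + q) := by
    clear hx x hy y
    intro x hx
    induction hx with
    | one => intro y hy; simpa using hy
    | @bar_mul i r c x hc hx ih =>
      intro y hy
      have := ih y hy
      rw [mul_assoc, add_assoc]
      have h2 : G.cobarDeg (r + q) ≤
          (G.cobarDeg (i + (r + q))).comap (LinearMap.mulLeft k (G.bar c)) :=
        Submodule.span_le.2 fun z hz => Submodule.subset_span (.bar_mul hc hz)
      exact h2 this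
  have h2 : G.cobarDeg p ≤ (G.cobarDeg (p + q)).comap (LinearMap.mulRight k y) :=
    Submodule.span_le.2 fun z hz => h1 z hz y hy
  exact h2 hx

theorem bar_mem {i : ℕ} {c : C} (hc : c ∈ G.gr i) : G.bar c ∈ G.cobarDeg ((i : ℤ) - 1) := by
  cases i with
  | zero =>
    rw [G.gr_zero, Submodule.mem_span_singleton] at hc
    obtain ⟨a, rfl⟩ := hc
    rw [map_smul, bar_one, smul_zero]; exact zero_mem _
  | succ i => simpa using G.cobarDeg_bar hc

theorem cobarParity_apply {p : ℤ} {x : G.Cobar} (hx : x ∈ G.cobarDeg p) :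
    G.cobarParity x = p.negOnePow • x := by
  suffices h' : G.cobarDeg p ≤ LinearMap.ker
      (G.cobarParity.toLinearMap - (p.negOnePow : ℤ) • LinearMap.id) by
    have := h' hx
    rw [LinearMap.mem_ker, LinearMap.sub_apply, sub_eq_zero] at this
    exact this
  clear hx x
  refine Submodule.span_le.2 fun z hz => ?_
  rw [SetLike.mem_coe, LinearMap.mem_ker, LinearMap.sub_apply, sub_eq_zero]
  change G.cobarParity z = p.negOnePow • z
  induction hz with
  | one => simp
  | @bar_mul i q c x hc hx ih =>
    rw [map_mul, ih, cobarParity_bar, G.parity_apply hc, Int.negOnePow_add, mul_smul,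
      Units.smul_def, Units.smul_def, mul_smul_comm, map_smul, smul_comm]
    congr 1
    rcases Nat.even_or_odd i with hi | hi
    · rw [Int.negOnePow_even _ (by exact_mod_cast hi), pow_succ, hi.neg_one_pow]; simp
    · rw [Int.negOnePow_odd _ (by exact_mod_cast hi), pow_succ, hi.neg_one_pow]; simp

theorem comul_parity (c : C) : comul (R := k) (G.parity c) =
    TensorProduct.map G.parity G.parity (comul c) := by
  refine G.induction_gr (P := fun c => comul (R := k) (G.parity c) =
    TensorProduct.map G.parity G.parity (comul c)) (fun i c hc => ?_) (by simp)
    (fun x y hx hy => by simp [hx, hy]) c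
  rw [G.parity_apply hc, map_smul]
  have h : (⨆ pq ∈ Finset.HasAntidiagonal.antidiagonal i,
      Submodule.map₂ (TensorProduct.mk k C C) (G.gr pq.1) (G.gr pq.2)) ≤
      LinearMap.ker ((-1 : k) ^ i • LinearMap.id - TensorProduct.map G.parity G.parity) := by
    refine iSup₂_le fun pq hpq => Submodule.map₂_le.2 fun x hx y hy => ?_
    rw [LinearMap.mem_ker, LinearMap.sub_apply, sub_eq_zero]
    simp only [LinearMap.smul_apply, LinearMap.id_apply, TensorProduct.mk_apply,
      TensorProduct.map_tmul, G.parity_apply hx, G.parity_apply hy]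
    rw [TensorProduct.tmul_smul, ← TensorProduct.smul_tmul', smul_smul, ← pow_add,
      ← Finset.HasAntidiagonal.mem_antidiagonal.1 hpq, add_comm]
  have := h (G.comul_mem hc)
  rw [LinearMap.mem_ker, LinearMap.sub_apply, sub_eq_zero] at this
  exact this

theorem cobarQuad_mem {i : ℕ} {c : C} (hc : c ∈ G.gr i) :
    G.cobarQuad c ∈ G.cobarDeg ((i : ℤ) - 2) := by
  have h : (⨆ pq ∈ Finset.HasAntidiagonal.antidiagonal i,
      Submodule.map₂ (TensorProduct.mk k C C) (G.gr pq.1) (G.gr pq.2)) ≤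
      (G.cobarDeg ((i : ℤ) - 2)).comap
        (LinearMap.mul' k G.Cobar ∘ₗ TensorProduct.map (G.bar ∘ₗ G.parity) G.bar) := by
    refine iSup₂_le fun pq hpq => Submodule.map₂_le.2 fun x hx y hy => ?_
    have e : (i : ℤ) - 2 = ((pq.1 : ℤ) - 1) + ((pq.2 : ℤ) - 1) := by
      rw [← Finset.HasAntidiagonal.mem_antidiagonal.1 hpq]; push_cast; ring
    rw [e]
    refine G.cobarDeg_mul ?_ (G.bar_mem hy)
    rw [LinearMap.comp_apply, G.parity_apply hx, map_smul]
    exact Submodule.smul_mem _ _ (G.bar_mem hx)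
  exact h (G.comul_mem hc)

theorem cobarDiff_mem {p : ℤ} {x : G.Cobar} (hx : x ∈ G.cobarDeg p) :
    G.cobarDiff x ∈ G.cobarDeg (p - 1) := by
  suffices h' : G.cobarDeg p ≤ (G.cobarDeg (p - 1)).comap G.cobarDiff from h' hx
  clear hx x
  refine Submodule.span_le.2 fun z hz => ?_
  rw [SetLike.mem_coe, Submodule.mem_comap]
  induction hz with
  | one =>
    have : G.cobarDiff 1 = 0 := by simp [cobarDiff]
    rw [this]; exact zero_mem _
  | @bar_mul i q c x hc hx ih =>
    rw [cobarDiff_mul, cobarDiff_bar]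
    refine add_mem ?_ ?_
    · have := G.cobarDeg_mul (G.cobarQuad_mem hc) (Submodule.subset_span hx)
      rwa [show ((i + 1 : ℕ) : ℤ) - 2 + q = i + q - 1 by push_cast; ring] at this
    · rw [cobarParity_bar, G.parity_apply hc]
      have := G.cobarDeg_mul (neg_mem (Submodule.smul_mem _ ((-1 : k) ^ (i + 1))
        (G.cobarDeg_bar hc))) ih
      rwa [map_smul, add_sub_assoc]

theorem cobarDiff_quad (c : C) : G.cobarDiff (G.cobarQuad c) = 0 := by
  have hpp : ∀ c, G.parity (G.parity c) = c := by
    intro c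
    refine G.induction_gr (P := fun c => G.parity (G.parity c) = c) (fun i c hc => ?_) (by simp)
      (fun x y hx hy => by simp [hx, hy]) c
    rw [G.parity_apply hc, map_smul, G.parity_apply hc, smul_smul, ← mul_pow]; simp
  let F : C ⊗[k] (C ⊗[k] C) →ₗ[k] G.Cobar :=
    LinearMap.mul' k G.Cobar ∘ₗ TensorProduct.map G.bar
      (LinearMap.mul' k G.Cobar ∘ₗ TensorProduct.map (G.bar ∘ₗ G.parity) G.bar)
  have h1 : ∀ t : C ⊗[k] C, G.cobarDiff (LinearMap.mul' k G.Cobar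
      (TensorProduct.map (G.bar ∘ₗ G.parity) G.bar t)) =
      F (TensorProduct.assoc k C C C (LinearMap.rTensor C comul t)) -
      F (LinearMap.lTensor C comul t) := by
    intro t
    induction t with
    | zero => simp
    | tmul x y =>
      have h2 : ∀ s : C ⊗[k] C, LinearMap.mul' k G.Cobar (TensorProduct.map (G.bar ∘ₗ G.parity)
          G.bar (TensorProduct.map G.parity G.parity s)) * G.bar y =
          F (TensorProduct.assoc k C C C (s ⊗ₜ y)) := by
        intro s
        induction s with
        | zero => simp
        | tmul a b => simp [F, hpp, mul_assoc]
        | add a b ha hb => simp only [map_add, add_mul, ha, hb, TensorProduct.add_tmul]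
      simp only [TensorProduct.map_tmul, LinearMap.mul'_apply, LinearMap.comp_apply,
        cobarDiff_mul, cobarDiff_bar, cobarParity_bar, hpp, LinearMap.rTensor_tmul,
        LinearMap.lTensor_tmul]
      rw [← h2, ← comul_parity]
      simp [F, cobarQuad]
      abel
    | add x y hx hy => simp only [map_add, hx, hy]; abel
  have h := h1 (comul c)
  have hc := Coalgebra.coassoc_apply (R := k) c
  rw [hc, sub_self] at h
  exact h

theorem cobarDiff_parity (x : G.Cobar) :
    G.cobarDiff (G.cobarParity x) = - G.cobarParity (G.cobarDiff x) := by
  induction x using G.cobar_induction with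
  | h1 => simp [cobarDiff]
  | ha x y hx hy => simp [hx, hy, add_comm]
  | hs c x hx => simp [hx]
  | hb c x hx =>
    have h1 : G.cobarParity (G.cobarQuad c) = G.cobarQuad (G.parity c) := by
      have : ∀ t : C ⊗[k] C, G.cobarParity (LinearMap.mul' k G.Cobar
          (TensorProduct.map (G.bar ∘ₗ G.parity) G.bar t)) =
          LinearMap.mul' k G.Cobar (TensorProduct.map (G.bar ∘ₗ G.parity) G.bar
            (TensorProduct.map G.parity G.parity t)) := by
        intro t
        induction t with
        | zero => simp
        | tmul x y => simp [cobarParity_bar]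
        | add x y hx hy => simp [hx, hy]
      rw [cobarQuad, LinearMap.comp_apply, LinearMap.comp_apply, this, ← comul_parity]; rfl
    simp only [map_mul, cobarDiff_mul, hx, cobarParity_bar, cobarDiff_bar, h1, map_add, map_neg]
    simp [add_comm]

theorem cobarDiff_diff (x : G.Cobar) : G.cobarDiff (G.cobarDiff x) = 0 := by
  induction x using G.cobar_induction with
  | h1 => simp [cobarDiff]
  | ha x y hx hy => simp [hx, hy]
  | hs c x hx => simp [hx]
  | hb c x hx =>
    rw [cobarDiff_mul, map_add, cobarDiff_mul, cobarDiff_mul, hx, cobarDiff_parity, cobarDiff_bar,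
      cobarDiff_quad]
    rw [show G.cobarParity (G.cobarQuad c) = - G.cobarDiff (G.cobarParity (G.bar c)) by
      rw [cobarDiff_parity, cobarDiff_bar, neg_neg], cobarDiff_parity, cobarDiff_bar]
    simp

theorem iSup_cobarDeg : ⨆ p, G.cobarDeg p = ⊤ := by
  rw [eq_top_iff]
  intro x _
  induction x using G.cobar_induction with
  | h1 => exact Submodule.mem_iSup_of_mem 0 G.cobarDeg_one
  | ha x y hx hy => exact add_mem (hx trivial) (hy trivial)
  | hs c x hx => exact Submodule.smul_mem _ _ (hx trivial)
  | hb c x hx =>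
    have hx := hx trivial
    refine G.induction_gr (P := fun c => G.bar c * x ∈ ⨆ p, G.cobarDeg p) (fun i c hc => ?_)
      (by simp) (fun a b ha hb => by rw [map_add, add_mul]; exact add_mem ha hb) c
    have h : (⨆ p, G.cobarDeg p) ≤
        (⨆ p, G.cobarDeg p).comap (LinearMap.mulLeft k (G.bar c)) :=
      iSup_le fun q y hy => Submodule.mem_iSup_of_mem _ (G.cobarDeg_mul (G.bar_mem hc) hy)
    exact h hx

theorem cobarDeg_isInternal : DirectSum.IsInternal G.cobarDeg := by
  let L : C →ₗ[k] AddMonoidAlgebra G.Cobar ℤ :=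
    (DirectSum.toModule k ℕ _ fun i => (AddMonoidAlgebra.lsingle ((i : ℤ) - 1)) ∘ₗ G.bar ∘ₗ
      (G.gr i).subtype) ∘ₗ
      (LinearEquiv.ofBijective (DirectSum.coeLinearMap G.gr) G.isInternal).symm.toLinearMap
  have hL : ∀ (i : ℕ) (c : C), c ∈ G.gr i →
      L c = AddMonoidAlgebra.single ((i : ℤ) - 1) (G.bar c) := by
    intro i c hc
    have e : (LinearEquiv.ofBijective (DirectSum.coeLinearMap G.gr) G.isInternal).symm c =
        DirectSum.lof k ℕ (fun i => G.gr i) i ⟨c, hc⟩ := by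
      refine (LinearEquiv.symm_apply_eq _).2 ?_
      exact (DirectSum.coeLinearMap_lof G.gr i (⟨c, hc⟩ : G.gr i)).symm
    simp only [L, LinearMap.comp_apply, LinearEquiv.coe_coe, e, DirectSum.toModule_lof]
    rfl
  let K : G.Cobar →ₐ[k] AddMonoidAlgebra G.Cobar ℤ :=
    TensorAlgebra.lift k (L ∘ₗ G.Red.subtype)
  have hK : ∀ c, K (G.bar c) = L c := by
    intro c
    have h1 : L G.one = 0 := by
      rw [hL 0 G.one (by rw [G.gr_zero]; exact Submodule.mem_span_singleton_self _), bar_one]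
      simp
    have : K (G.bar c) = L (G.red c : C) := by
      rw [bar, LinearMap.comp_apply]; exact TensorAlgebra.lift_ι_apply _ _
    rw [this, coe_red, map_sub, map_smul, h1]; simp
  have hKm : ∀ p x, G.IsMonomial p x → K x = AddMonoidAlgebra.single p x := by
    intro p x hx
    induction hx with
    | one => rw [map_one]; rfl
    | @bar_mul i q c x hc hx ih =>
      rw [map_mul, hK, hL _ _ hc, ih, AddMonoidAlgebra.single_mul_single]
      simp
  refine isInternal_of_coaction _
    (fun j => Finsupp.lapply j ∘ₗ (AddMonoidAlgebra.coeffLinearEquiv k).toLinearMap ∘ₗ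
      K.toLinearMap) (fun p x hx j => ?_) G.iSup_cobarDeg
  have h : G.cobarDeg p ≤ LinearMap.ker (((AddMonoidAlgebra.coeffLinearEquiv k).toLinearMap ∘ₗ
      K.toLinearMap) - Finsupp.lsingle p) := by
    refine Submodule.span_le.2 fun z hz => ?_
    rw [SetLike.mem_coe, LinearMap.mem_ker, LinearMap.sub_apply, sub_eq_zero, LinearMap.comp_apply,
      AlgHom.toLinearMap_apply, hKm p z hz]
    rfl
  have := h hx
  rw [LinearMap.mem_ker, LinearMap.sub_apply, sub_eq_zero] at this
  change (((AddMonoidAlgebra.coeffLinearEquiv k).toLinearMap ∘ₗ K.toLinearMap) x) j = _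
  rw [this, Finsupp.lsingle_apply, Finsupp.single_apply]

/-- The cobar construction `Ω(C)` as a DG algebra. -/
def cobarDG : DGAlgebra k G.Cobar where
  deg := G.cobarDeg
  isInternal := G.cobarDeg_isInternal
  one_mem := G.cobarDeg_one
  mul_mem := G.cobarDeg_mul
  parity := G.cobarParity
  parity_apply := G.cobarParity_apply
  diff := G.cobarDiff
  diff_mem := G.cobarDiff_mem
  diff_mul := G.cobarDiff_mul
  diff_diff := G.cobarDiff_diff

/-- An automorphism of a graded coalgebra. -/
structure Aut where
  toCoalgEquiv : C ≃ₗc[k] C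
  map_mem : ∀ {i : ℕ} {c : C}, c ∈ G.gr i → toCoalgEquiv c ∈ G.gr i

/-- The map of cobar constructions induced by a coalgebra automorphism. -/
def cobarMap (f : C ≃ₗc[k] C) : G.Cobar →ₐ[k] G.Cobar :=
  TensorAlgebra.lift k (G.bar ∘ₗ (f.toLinearEquiv : C →ₗ[k] C) ∘ₗ G.Red.subtype)

theorem cobarMap_bar (f : C ≃ₗc[k] C) (h : f G.one = G.one) (c : C) :
    G.cobarMap f (G.bar c) = G.bar (f c) := by
  have : G.cobarMap f (G.bar c) = G.bar (f (G.red c : C)) := by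
    rw [bar, LinearMap.comp_apply, cobarMap, TensorAlgebra.lift_ι_apply]; rfl
  rw [this, coe_red, map_sub, map_smul, h, map_sub, map_smul, bar_one, smul_zero, sub_zero]

variable {G}

theorem Aut.map_one (σ : G.Aut) : σ.toCoalgEquiv G.one = G.one := by
  have h0 : G.one ∈ G.gr 0 := by rw [G.gr_zero]; exact Submodule.mem_span_singleton_self _
  have h1 := σ.map_mem h0
  rw [G.gr_zero, Submodule.mem_span_singleton] at h1
  obtain ⟨a, ha⟩ := h1
  have h2 := congrArg (counit (R := k)) ha
  rw [map_smul, G.counit_one, CoalgHomClass.counit_comp_apply, G.counit_one] at h2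
  simp only [smul_eq_mul, mul_one] at h2
  rw [← ha, h2, one_smul]

/-- The automorphism `Σ⁻¹c̄ ↦ Σ⁻¹ \overline{σ(c)}` of the cobar construction. -/
def Aut.cobar (σ : G.Aut) : G.cobarDG.Aut where
  toAlgEquiv := AlgEquiv.ofAlgHom (G.cobarMap σ.toCoalgEquiv) (G.cobarMap σ.toCoalgEquiv.symm)
    (by
      have hs : σ.toCoalgEquiv.symm G.one = G.one := by
        conv_lhs => rw [← σ.map_one]
        exact CoalgEquiv.symm_apply_apply _ _
      refine AlgHom.ext fun x => ?_
      induction x using G.cobar_induction with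
      | h1 => simp
      | ha x y hx hy => rw [map_add, hx, hy, map_add]
      | hs c x hx => rw [map_smul, hx, map_smul]
      | hb c x hx =>
        rw [map_mul, hx, map_mul, AlgHom.comp_apply, cobarMap_bar _ _ hs, cobarMap_bar _ _ σ.map_one]
        simp)
    (by
      have hs : σ.toCoalgEquiv.symm G.one = G.one := by
        conv_lhs => rw [← σ.map_one]
        exact CoalgEquiv.symm_apply_apply _ _
      refine AlgHom.ext fun x => ?_
      induction x using G.cobar_induction with
      | h1 => simp
      | ha x y hx hy => rw [map_add, hx, hy, map_add]
      | hs c x hx => rw [map_smul, hx, map_smul]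
      | hb c x hx =>
        rw [map_mul, hx, map_mul, AlgHom.comp_apply, cobarMap_bar _ _ σ.map_one, cobarMap_bar _ _ hs]
        simp)
  map_mem := fun {p x} hx => by
    change x ∈ G.cobarDeg p at hx
    change G.cobarMap σ.toCoalgEquiv x ∈ G.cobarDeg p
    suffices h' : G.cobarDeg p ≤ (G.cobarDeg p).comap
      (G.cobarMap σ.toCoalgEquiv).toLinearMap from h' hx
    clear hx x
    refine Submodule.span_le.2 fun z hz => ?_
    rw [SetLike.mem_coe, Submodule.mem_comap, AlgHom.toLinearMap_apply]
    induction hz with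
    | one => rw [_root_.map_one]; exact G.cobarDeg_one
    | bar_mul hc hx ih =>
      rw [map_mul, cobarMap_bar _ _ σ.map_one]
      exact G.cobarDeg_mul (G.cobarDeg_bar (σ.map_mem hc)) ih
  map_diff := fun x => by
    change G.cobarMap σ.toCoalgEquiv (G.cobarDiff x) = G.cobarDiff (G.cobarMap σ.toCoalgEquiv x)
    have hp : ∀ c, σ.toCoalgEquiv (G.parity c) = G.parity (σ.toCoalgEquiv c) := by
      intro c
      refine G.induction_gr (P := fun c => σ.toCoalgEquiv (G.parity c) =
        G.parity (σ.toCoalgEquiv c)) (fun i c hc => ?_) (by simp)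
        (fun x y hx hy => by simp only [map_add, hx, hy]) c
      rw [G.parity_apply hc, map_smul, G.parity_apply (σ.map_mem hc)]
    have hq : ∀ c, G.cobarMap σ.toCoalgEquiv (G.cobarQuad c) =
        G.cobarQuad (σ.toCoalgEquiv c) := by
      intro c
      have h1 : ∀ t : C ⊗[k] C, G.cobarMap σ.toCoalgEquiv (LinearMap.mul' k G.Cobar
          (TensorProduct.map (G.bar ∘ₗ G.parity) G.bar t)) =
          LinearMap.mul' k G.Cobar (TensorProduct.map (G.bar ∘ₗ G.parity) G.bar
            (TensorProduct.map (σ.toCoalgEquiv.toLinearEquiv : C →ₗ[k] C)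
              (σ.toCoalgEquiv.toLinearEquiv : C →ₗ[k] C) t)) := by
        intro t
        induction t with
        | zero => simp
        | tmul x y =>
          simp only [TensorProduct.map_tmul, LinearMap.comp_apply, LinearMap.mul'_apply, map_mul,
            cobarMap_bar _ _ σ.map_one]
          exact congrArg₂ _ (congrArg _ (hp x)) rfl
        | add x y hx hy => simp only [map_add, hx, hy]
      rw [cobarQuad, LinearMap.comp_apply, LinearMap.comp_apply, h1]
      exact congrArg (fun t => LinearMap.mul' k G.Cobar (TensorProduct.map (G.bar ∘ₗ G.parity)
        G.bar t)) (CoalgHomClass.map_comp_comul_apply σ.toCoalgEquiv c)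
    induction x using G.cobar_induction with
    | h1 => simp [cobarDiff]
    | ha x y hx hy => simp only [map_add, hx, hy]
    | hs c x hx => simp only [map_smul, hx]
    | hb c x hx =>
      simp only [map_mul, cobarDiff_mul, map_add, hx, cobarParity_bar, cobarDiff_bar, hq, map_neg,
        cobarMap_bar _ σ.toCoalgEquiv σ.map_one, hp c]

end ConnCoalgebra

end Cobar

/-! ## Quadratic coalgebras -/

section Deconcatenation

variable (k V : Type*) [Field k] [AddCommGroup V] [Module k V]

/-- The tensors of degree `i` in the tensor algebra. -/
abbrev tpow (i : ℕ) : Submodule k (TensorAlgebra k V) :=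
  LinearMap.range (TensorAlgebra.ι k : V →ₗ[k] TensorAlgebra k V) ^ i

instance tpowGraded : GradedAlgebra (tpow k V) := TensorAlgebra.gradedAlgebra

/-- The projection on the tensors of degree `i`. -/
def tproj (i : ℕ) : TensorAlgebra k V →ₗ[k] TensorAlgebra k V := GradedAlgebra.proj (tpow k V) i

variable {k V}

theorem tproj_same {i : ℕ} {x : TensorAlgebra k V} (hx : x ∈ tpow k V i) :
    tproj k V i x = x := DirectSum.decompose_of_mem_same (tpow k V) hx

theorem tproj_ne {i j : ℕ} {x : TensorAlgebra k V} (hx : x ∈ tpow k V i) (h : i ≠ j) :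
    tproj k V j x = 0 := DirectSum.decompose_of_mem_ne (tpow k V) hx h

theorem tproj_mem (i : ℕ) (x : TensorAlgebra k V) : tproj k V i x ∈ tpow k V i :=
  (DirectSum.decompose (tpow k V) x i).2

theorem tproj_mul_left {i : ℕ} (j : ℕ) {x : TensorAlgebra k V} (hx : x ∈ tpow k V i)
    (y : TensorAlgebra k V) : tproj k V (i + j) (x * y) = x * tproj k V j y :=
  DirectSum.coe_decompose_mul_add_of_left_mem (tpow k V) hx

theorem tproj_mul_right {i : ℕ} (j : ℕ) {x : TensorAlgebra k V} (hx : x ∈ tpow k V i)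
    (y : TensorAlgebra k V) : tproj k V (j + i) (y * x) = tproj k V j y * x :=
  DirectSum.coe_decompose_mul_add_of_right_mem (tpow k V) hx

theorem ι_mem_tpow (v : V) : TensorAlgebra.ι k v ∈ tpow k V 1 := by
  rw [tpow, pow_one]; exact LinearMap.mem_range_self _ v

theorem tens_induction {P : TensorAlgebra k V → Prop} (h1 : P 1)
    (ha : ∀ x y, P x → P y → P (x + y)) (hs : ∀ (c : k) x, P x → P (c • x))
    (hb : ∀ v x, P x → P (TensorAlgebra.ι k v * x)) (x : TensorAlgebra k V) : P x := by
  suffices H : ∀ y, P y → P (x * y) by simpa using H 1 h1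
  induction x using TensorAlgebra.induction with
  | algebraMap c => intro y hy; rw [← Algebra.smul_def]; exact hs c y hy
  | ι m => intro y hy; exact hb _ y hy
  | mul a b ha' hb' => intro y hy; rw [mul_assoc]; exact ha' _ (hb' _ hy)
  | add a b ha' hb' => intro y hy; rw [add_mul]; exact ha _ _ (ha' _ hy) (hb' _ hy)

variable (k V)

/-- The triangular representation of the derivation `T → T ⊗ T` with `v ↦ 1 ⊗ v`. -/
def decTri : TensorAlgebra k V →ₐ[k]
    Module.End k ((TensorAlgebra k V ⊗[k] TensorAlgebra k V) ×
      (TensorAlgebra k V ⊗[k] TensorAlgebra k V)) :=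
  TensorAlgebra.lift k
    { toFun := fun v => tri k (TensorAlgebra.ι k v ⊗ₜ[k] (1 : TensorAlgebra k V))
        ((1 : TensorAlgebra k V) ⊗ₜ[k] TensorAlgebra.ι k v)
        ((1 : TensorAlgebra k V) ⊗ₜ[k] TensorAlgebra.ι k v)
      map_add' := fun r s => by
        simp only [map_add, TensorProduct.add_tmul, TensorProduct.tmul_add, tri_add]
      map_smul' := fun c r => by
        simp only [map_smul, ← TensorProduct.smul_tmul', TensorProduct.tmul_smul, tri_smul,
          RingHom.id_apply] }

/-- Deconcatenation `v₁⋯vₘ ↦ ∑ v₁⋯vᵢ ⊗ vᵢ₊₁⋯vₘ`. -/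
def deconc : TensorAlgebra k V →ₗ[k] TensorAlgebra k V ⊗[k] TensorAlgebra k V :=
  (TensorProduct.mk k (TensorAlgebra k V) (TensorAlgebra k V)).flip 1 +
  LinearMap.fst k _ _ ∘ₗ LinearMap.applyₗ
    ((0, 1) : (TensorAlgebra k V ⊗[k] TensorAlgebra k V) ×
      (TensorAlgebra k V ⊗[k] TensorAlgebra k V)) ∘ₗ (decTri k V).toLinearMap

variable {k V}

theorem deconc_one : deconc k V 1 = 1 ⊗ₜ[k] 1 := by simp [deconc]

theorem decTri_eq (x : TensorAlgebra k V) :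
    decTri k V x = tri k (x ⊗ₜ[k] (1 : TensorAlgebra k V)) (deconc k V x - x ⊗ₜ[k] 1)
      ((1 : TensorAlgebra k V) ⊗ₜ[k] x) := by
  induction x using tens_induction with
  | h1 =>
    rw [deconc_one, sub_self, map_one]
    exact (tri_one k).symm
  | ha x y hx hy =>
    rw [map_add, hx, hy, ← tri_add]
    simp only [map_add, TensorProduct.add_tmul, TensorProduct.tmul_add]
    congr 1; abel
  | hs c x hx =>
    rw [map_smul, hx, ← tri_smul]
    simp only [map_smul, ← TensorProduct.smul_tmul', TensorProduct.tmul_smul, smul_sub]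
  | hb v x hx =>
    have e : decTri k V (TensorAlgebra.ι k v) = tri k (TensorAlgebra.ι k v ⊗ₜ[k] 1)
        ((1 : TensorAlgebra k V) ⊗ₜ[k] TensorAlgebra.ι k v)
        ((1 : TensorAlgebra k V) ⊗ₜ[k] TensorAlgebra.ι k v) := by
      rw [decTri, TensorAlgebra.lift_ι_apply]; rfl
    have e2 : deconc k V (TensorAlgebra.ι k v * x) - (TensorAlgebra.ι k v * x) ⊗ₜ[k] 1 =
        (decTri k V (TensorAlgebra.ι k v * x) (0, 1)).1 := by
      simp [deconc]
    rw [e2, map_mul, hx, e, tri_mul]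
    simp

theorem deconc_mul (x y : TensorAlgebra k V) : deconc k V (x * y) =
    (x ⊗ₜ[k] 1) * deconc k V y + (deconc k V x - x ⊗ₜ[k] 1) * (1 ⊗ₜ[k] y) := by
  have h := congrArg (fun f => (f (0, 1)).1) (decTri_eq (x * y))
  simp only [map_mul, decTri_eq, tri_mul, tri_apply, mul_zero, mul_one, zero_add] at h
  rw [eq_comm, sub_eq_iff_eq_add] at h
  rw [h, mul_sub]
  simp
  abel

theorem deconc_ι (v : V) : deconc k V (TensorAlgebra.ι k v) =
    1 ⊗ₜ[k] TensorAlgebra.ι k v + TensorAlgebra.ι k v ⊗ₜ[k] 1 := by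
  have e : decTri k V (TensorAlgebra.ι k v) = tri k (TensorAlgebra.ι k v ⊗ₜ[k] 1)
      ((1 : TensorAlgebra k V) ⊗ₜ[k] TensorAlgebra.ι k v)
      ((1 : TensorAlgebra k V) ⊗ₜ[k] TensorAlgebra.ι k v) := by
    rw [decTri, TensorAlgebra.lift_ι_apply]; rfl
  simp [deconc, e, add_comm]

theorem deconc_ι_mul (v : V) (x : TensorAlgebra k V) : deconc k V (TensorAlgebra.ι k v * x) =
    1 ⊗ₜ[k] (TensorAlgebra.ι k v * x) + (TensorAlgebra.ι k v ⊗ₜ[k] 1) * deconc k V x := by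
  rw [deconc_mul, deconc_ι, add_sub_cancel_right, Algebra.TensorProduct.tmul_mul_tmul, one_mul,
    add_comm]

theorem deconc_mul_ι (v : V) (x : TensorAlgebra k V) : deconc k V (x * TensorAlgebra.ι k v) =
    (x * TensorAlgebra.ι k v) ⊗ₜ[k] 1 + deconc k V x * (1 ⊗ₜ[k] TensorAlgebra.ι k v) := by
  rw [deconc_mul, deconc_ι, mul_add, sub_mul]
  simp
  abel

theorem deconc_coassoc (x : TensorAlgebra k V) :
    TensorProduct.assoc k _ _ _ (LinearMap.rTensor _ (deconc k V) (deconc k V x)) =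
      LinearMap.lTensor _ (deconc k V) (deconc k V x) := by
  induction x using tens_induction with
  | h1 => simp [deconc_one]
  | ha x y hx hy => simp only [map_add, hx, hy]
  | hs c x hx => simp only [map_smul, hx]
  | hb v x hx =>
    have h1 : ∀ t : TensorAlgebra k V ⊗[k] TensorAlgebra k V,
        TensorProduct.assoc k _ _ _ (LinearMap.rTensor _ (deconc k V)
          ((TensorAlgebra.ι k v ⊗ₜ[k] 1) * t)) =
        1 ⊗ₜ[k] ((TensorAlgebra.ι k v ⊗ₜ[k] 1) * t) +
        (TensorAlgebra.ι k v ⊗ₜ[k] 1) *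
          TensorProduct.assoc k _ _ _ (LinearMap.rTensor _ (deconc k V) t) := by
      intro t
      induction t with
      | zero => simp
      | tmul a b =>
        rw [Algebra.TensorProduct.tmul_mul_tmul, one_mul, LinearMap.rTensor_tmul, deconc_ι_mul,
          TensorProduct.add_tmul, map_add, TensorProduct.assoc_tmul, LinearMap.rTensor_tmul]
        congr 1
        generalize deconc k V a = s
        induction s with
        | zero => simp
        | tmul c d => simp
        | add c d hc hd => simp only [mul_add, map_add, TensorProduct.add_tmul, hc, hd]
      | add a b ha hb =>
        simp only [mul_add, map_add, TensorProduct.tmul_add, ha, hb]; abel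
    have h2 : ∀ t : TensorAlgebra k V ⊗[k] TensorAlgebra k V,
        LinearMap.lTensor _ (deconc k V) ((TensorAlgebra.ι k v ⊗ₜ[k] 1) * t) =
        (TensorAlgebra.ι k v ⊗ₜ[k] 1) * LinearMap.lTensor _ (deconc k V) t := by
      intro t
      induction t with
      | zero => simp
      | tmul a b =>
        rw [Algebra.TensorProduct.tmul_mul_tmul, one_mul, LinearMap.lTensor_tmul,
          LinearMap.lTensor_tmul, Algebra.TensorProduct.tmul_mul_tmul, one_mul]
      | add a b ha hb => simp only [mul_add, map_add, ha, hb]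
    rw [deconc_ι_mul, map_add, map_add, map_add, h1, h2, hx, LinearMap.rTensor_tmul, deconc_one,
      TensorProduct.assoc_tmul, LinearMap.lTensor_tmul, deconc_ι_mul, TensorProduct.tmul_add,
      add_assoc]

theorem deconc_counit_left (x : TensorAlgebra k V) :
    LinearMap.rTensor _ (TensorAlgebra.algebraMapInv (R := k) (M := V)).toLinearMap
      (deconc k V x) = 1 ⊗ₜ[k] x := by
  induction x using tens_induction with
  | h1 => simp [deconc_one]
  | ha x y hx hy => simp only [map_add, hx, hy, TensorProduct.tmul_add]
  | hs c x hx => simp only [map_smul, hx, TensorProduct.tmul_smul]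
  | hb v x hx =>
    have h2 : ∀ t : TensorAlgebra k V ⊗[k] TensorAlgebra k V,
        LinearMap.rTensor _ (TensorAlgebra.algebraMapInv (R := k) (M := V)).toLinearMap
          ((TensorAlgebra.ι k v ⊗ₜ[k] 1) * t) = 0 := by
      intro t
      induction t with
      | zero => simp
      | tmul a b => simp [TensorAlgebra.algebraMapInv]
      | add a b ha hb => simp only [mul_add, map_add, ha, hb, add_zero]
    rw [deconc_ι_mul, map_add, h2]
    simp

theorem deconc_counit_right (x : TensorAlgebra k V) :
    LinearMap.lTensor _ (TensorAlgebra.algebraMapInv (R := k) (M := V)).toLinearMap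
      (deconc k V x) = x ⊗ₜ[k] 1 := by
  induction x using tens_induction with
  | h1 => simp [deconc_one]
  | ha x y hx hy => simp only [map_add, hx, hy, TensorProduct.add_tmul]
  | hs c x hx => simp only [map_smul, hx, TensorProduct.smul_tmul']
  | hb v x hx =>
    have h2 : ∀ t : TensorAlgebra k V ⊗[k] TensorAlgebra k V,
        LinearMap.lTensor _ (TensorAlgebra.algebraMapInv (R := k) (M := V)).toLinearMap
          ((TensorAlgebra.ι k v ⊗ₜ[k] 1) * t) = (TensorAlgebra.ι k v ⊗ₜ[k] 1) *
        LinearMap.lTensor _ (TensorAlgebra.algebraMapInv (R := k) (M := V)).toLinearMap t := by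
      intro t
      induction t with
      | zero => simp
      | tmul a b => simp
      | add a b ha hb => simp only [mul_add, map_add, ha, hb]
    rw [deconc_ι_mul, map_add, h2, hx]
    simp [TensorAlgebra.algebraMapInv]

/-- Deconcatenation is graded. -/
theorem deconc_mem {i : ℕ} {x : TensorAlgebra k V} (hx : x ∈ tpow k V i) :
    deconc k V x ∈ ⨆ pq ∈ Finset.HasAntidiagonal.antidiagonal i,
      Submodule.map₂ (TensorProduct.mk k _ _) (tpow k V pq.1) (tpow k V pq.2) := by
  induction hx using Submodule.pow_induction_on_left' with
  | algebraMap r =>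
    have h0 : ((0, 0) : ℕ × ℕ) ∈ Finset.HasAntidiagonal.antidiagonal 0 := by simp
    refine Submodule.mem_iSup_of_mem (0, 0) (Submodule.mem_iSup_of_mem h0 ?_)
    rw [Algebra.algebraMap_eq_smul_one, map_smul, deconc_one]
    exact Submodule.smul_mem _ _ (Submodule.apply_mem_map₂ _ SetLike.GradedOne.one_mem
      SetLike.GradedOne.one_mem)
  | add x y i hx hy h1 h2 => rw [map_add]; exact add_mem h1 h2
  | mem_mul m hm i x hx ih =>
    obtain ⟨v, rfl⟩ := hm
    rw [deconc_ι_mul]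
    refine add_mem ?_ ?_
    · have h0 : ((0, i + 1) : ℕ × ℕ) ∈ Finset.HasAntidiagonal.antidiagonal (i + 1) := by simp
      refine Submodule.mem_iSup_of_mem (0, i + 1) (Submodule.mem_iSup_of_mem h0 ?_)
      refine Submodule.apply_mem_map₂ _ ?_ ?_
      · exact SetLike.GradedOne.one_mem
      · rw [add_comm]
        exact SetLike.GradedMul.mul_mem (A := tpow k V) (ι_mem_tpow v) hx
    · have h : (⨆ pq ∈ Finset.HasAntidiagonal.antidiagonal i,
          Submodule.map₂ (TensorProduct.mk k _ _) (tpow k V pq.1) (tpow k V pq.2)) ≤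
          (⨆ pq ∈ Finset.HasAntidiagonal.antidiagonal (i + 1),
          Submodule.map₂ (TensorProduct.mk k _ _) (tpow k V pq.1) (tpow k V pq.2)).comap
            (LinearMap.mulLeft k (TensorAlgebra.ι k v ⊗ₜ[k] (1 : TensorAlgebra k V))) := by
        refine iSup₂_le fun pq hpq => Submodule.map₂_le.2 fun a ha b hb => ?_
        have h0 : ((1 + pq.1, pq.2) : ℕ × ℕ) ∈ Finset.HasAntidiagonal.antidiagonal (i + 1) := by
          rw [Finset.HasAntidiagonal.mem_antidiagonal] at hpq ⊢
          simp only
          omega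
        refine Submodule.mem_iSup_of_mem _ (Submodule.mem_iSup_of_mem h0 ?_)
        rw [LinearMap.mulLeft_apply, TensorProduct.mk_apply, Algebra.TensorProduct.tmul_mul_tmul,
          one_mul]
        exact Submodule.apply_mem_map₂ (TensorProduct.mk k _ _)
          (SetLike.GradedMul.mul_mem (A := tpow k V) (ι_mem_tpow v) ha) hb
      exact h ih

theorem rTensor_tproj_deconc_mul {i : ℕ} (j : ℕ) {x : TensorAlgebra k V} (hx : x ∈ tpow k V i)
    (y : TensorAlgebra k V) :
    LinearMap.rTensor _ (tproj k V (i + j)) (deconc k V (x * y)) =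
      (x ⊗ₜ[k] 1) * LinearMap.rTensor _ (tproj k V j) (deconc k V y) := by
  induction hx using Submodule.pow_induction_on_left' generalizing y with
  | algebraMap r =>
    rw [Algebra.algebraMap_eq_smul_one]
    simp [zero_add, ← TensorProduct.smul_tmul', ← Algebra.TensorProduct.one_def]
  | add x z i hx hz h1 h2 =>
    simp only [add_mul, map_add, h1, h2, TensorProduct.add_tmul]
  | mem_mul m hm i x hx ih =>
    obtain ⟨v, rfl⟩ := hm
    have h1 : tproj k V (i + 1 + j) (1 : TensorAlgebra k V) = 0 :=
      tproj_ne (i := 0) SetLike.GradedOne.one_mem (by omega)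
    have h2 : ∀ t : TensorAlgebra k V ⊗[k] TensorAlgebra k V,
        LinearMap.rTensor _ (tproj k V (i + 1 + j)) ((TensorAlgebra.ι k v ⊗ₜ[k] 1) * t) =
        (TensorAlgebra.ι k v ⊗ₜ[k] 1) * LinearMap.rTensor _ (tproj k V (i + j)) t := by
      intro t
      induction t with
      | zero => simp
      | tmul a b =>
        rw [show i + 1 + j = 1 + (i + j) by omega, Algebra.TensorProduct.tmul_mul_tmul,
          LinearMap.rTensor_tmul, LinearMap.rTensor_tmul, tproj_mul_left _ (ι_mem_tpow v),
          Algebra.TensorProduct.tmul_mul_tmul]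
      | add a b ha hb => simp only [mul_add, map_add, ha, hb]
    rw [mul_assoc, deconc_ι_mul, map_add, LinearMap.rTensor_tmul, Nat.succ_eq_add_one, h1,
      TensorProduct.zero_tmul, zero_add, h2, ih, ← mul_assoc, Algebra.TensorProduct.tmul_mul_tmul,
      one_mul]

theorem lTensor_tproj_deconc_mul {i : ℕ} (j : ℕ) {x : TensorAlgebra k V} (hx : x ∈ tpow k V i)
    (y : TensorAlgebra k V) :
    LinearMap.lTensor _ (tproj k V (j + i)) (deconc k V (y * x)) =
      LinearMap.lTensor _ (tproj k V j) (deconc k V y) * (1 ⊗ₜ[k] x) := by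
  induction hx using Submodule.pow_induction_on_right' generalizing y with
  | algebraMap r =>
    rw [Algebra.algebraMap_eq_smul_one]
    simp [TensorProduct.tmul_smul, ← Algebra.TensorProduct.one_def]
  | add x z i hx hz h1 h2 =>
    simp only [mul_add, map_add, h1, h2, TensorProduct.tmul_add]
  | mul_mem i x hx ih m hm =>
    obtain ⟨v, rfl⟩ := hm
    have h1 : tproj k V (j + (i + 1)) (1 : TensorAlgebra k V) = 0 :=
      tproj_ne (i := 0) SetLike.GradedOne.one_mem (by omega)
    have h2 : ∀ t : TensorAlgebra k V ⊗[k] TensorAlgebra k V,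
        LinearMap.lTensor _ (tproj k V (j + (i + 1))) (t * (1 ⊗ₜ[k] TensorAlgebra.ι k v)) =
        LinearMap.lTensor _ (tproj k V (j + i)) t * (1 ⊗ₜ[k] TensorAlgebra.ι k v) := by
      intro t
      induction t with
      | zero => simp
      | tmul a b =>
        rw [← add_assoc, Algebra.TensorProduct.tmul_mul_tmul,
          LinearMap.lTensor_tmul, LinearMap.lTensor_tmul, tproj_mul_right _ (ι_mem_tpow v),
          Algebra.TensorProduct.tmul_mul_tmul]
      | add a b ha hb => simp only [add_mul, map_add, ha, hb]
    rw [← mul_assoc, deconc_mul_ι, map_add, LinearMap.lTensor_tmul, Nat.succ_eq_add_one, h1,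
      TensorProduct.tmul_zero, zero_add, h2, ih, mul_assoc, Algebra.TensorProduct.tmul_mul_tmul,
      one_mul]

end Deconcatenation

section QuadraticCoalgebra

theorem tensor_sep_right {k M N : Type*} [Field k] [AddCommGroup M] [Module k M] [AddCommGroup N]
    [Module k N] (t : M ⊗[k] N)
    (h : ∀ φ : N →ₗ[k] k, TensorProduct.rid k M (φ.lTensor M t) = 0) : t = 0 := by
  let b := Module.Free.chooseBasis k N
  apply (TensorProduct.equivFinsuppOfBasisRight (M := M) b).injective
  ext i
  rw [TensorProduct.equivFinsuppOfBasisRight_apply, h]; simp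

theorem tensor_sep_left {k M N : Type*} [Field k] [AddCommGroup M] [Module k M] [AddCommGroup N]
    [Module k N] (t : M ⊗[k] N)
    (h : ∀ φ : M →ₗ[k] k, TensorProduct.lid k N (φ.rTensor N t) = 0) : t = 0 := by
  have h1 : TensorProduct.comm k M N t = 0 := by
    refine tensor_sep_right _ fun φ => ?_
    rw [← h φ]
    clear h
    induction t with
    | zero => simp
    | tmul x y => simp
    | add x y hx hy => simp only [map_add, hx, hy]
  simpa using h1

theorem exists_retraction {k M : Type*} [Field k] [AddCommGroup M] [Module k M]
    (S : Submodule k M) : ∃ p : M →ₗ[k] S, ∀ x : S, p x = x := by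
  obtain ⟨p, hp⟩ := S.subtype.exists_leftInverse_of_injective (by simp)
  exact ⟨p, fun x => LinearMap.congr_fun hp x⟩

theorem mem_map₂_of_slices {k M : Type*} [Field k] [AddCommGroup M] [Module k M]
    (S S' : Submodule k M) (t : M ⊗[k] M)
    (h : ∀ φ : M →ₗ[k] k, TensorProduct.rid k M (φ.lTensor M t) ∈ S)
    (h' : ∀ φ : M →ₗ[k] k, TensorProduct.lid k M (φ.rTensor M t) ∈ S') :
    t ∈ Submodule.map₂ (TensorProduct.mk k M M) S S' := by
  obtain ⟨p, hp⟩ := exists_retraction S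
  obtain ⟨q, hq⟩ := exists_retraction S'
  have h1 : (S.subtype ∘ₗ p).rTensor M t = t := by
    rw [← sub_eq_zero]
    refine tensor_sep_right _ fun φ => ?_
    have : ∀ t : M ⊗[k] M, TensorProduct.rid k M (φ.lTensor M ((S.subtype ∘ₗ p).rTensor M t)) =
        p (TensorProduct.rid k M (φ.lTensor M t)) := by
      intro t
      induction t with
      | zero => simp
      | tmul x y => simp
      | add x y hx hy => simp only [map_add, hx, hy, Submodule.coe_add]
    rw [map_sub, map_sub, this, sub_eq_zero]
    exact congrArg Subtype.val (hp ⟨_, h φ⟩)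
  have h2 : (S'.subtype ∘ₗ q).lTensor M t = t := by
    rw [← sub_eq_zero]
    refine tensor_sep_left _ fun φ => ?_
    have : ∀ t : M ⊗[k] M, TensorProduct.lid k M (φ.rTensor M ((S'.subtype ∘ₗ q).lTensor M t)) =
        q (TensorProduct.lid k M (φ.rTensor M t)) := by
      intro t
      induction t with
      | zero => simp
      | tmul x y => simp
      | add x y hx hy => simp only [map_add, hx, hy, Submodule.coe_add]
    rw [map_sub, map_sub, this, sub_eq_zero]
    exact congrArg Subtype.val (hq ⟨_, h' φ⟩)
  have h3 : ∀ t : M ⊗[k] M, (S'.subtype ∘ₗ q).lTensor M ((S.subtype ∘ₗ p).rTensor M t) ∈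
      Submodule.map₂ (TensorProduct.mk k M M) S S' := by
    intro t
    induction t with
    | zero => simp
    | tmul x y => exact Submodule.apply_mem_map₂ _ (p x).2 (q y).2
    | add x y hx hy => rw [map_add, map_add]; exact add_mem hx hy
  have := h3 t
  rwa [h1, h2] at this

variable {k V : Type*} [Field k] [AddCommGroup V] [Module k V]
variable (W : Submodule k (TensorAlgebra k V))

/-- The degree `i` part `⋂ V^{⊗a} ⊗ W ⊗ V^{⊗b}`, `a + 2 + b = i`, of the quadratic coalgebra
cogenerated by `V` with corelations `W ⊆ V ⊗ V`. It is `k` for `i = 0` and `V` for `i = 1`. -/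
def quadPart (i : ℕ) : Submodule k (TensorAlgebra k V) :=
  tpow k V i ⊓ ⨅ (a : ℕ) (b : ℕ) (_ : a + 2 + b = i), tpow k V a * W * tpow k V b

variable {W} in
theorem mem_quadPart {i : ℕ} {x : TensorAlgebra k V} : x ∈ quadPart W i ↔
    x ∈ tpow k V i ∧ ∀ a b, a + 2 + b = i → x ∈ tpow k V a * W * tpow k V b := by
  simp [quadPart, Submodule.mem_iInf]

theorem deconc_slice_left (hW : W ≤ tpow k V 2) {i : ℕ} {c : TensorAlgebra k V}
    (hc : c ∈ quadPart W i) (p : ℕ) (hp : p ≤ i) (φ : TensorAlgebra k V →ₗ[k] k) :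
    TensorProduct.rid k _ (φ.lTensor _ ((tproj k V p).rTensor _ (deconc k V c))) ∈
      quadPart W p := by
  have hm : ∀ (p : ℕ) (t : TensorAlgebra k V ⊗[k] TensorAlgebra k V),
      TensorProduct.rid k _ (φ.lTensor _ ((tproj k V p).rTensor _ t)) ∈ tpow k V p := by
    intro p t
    induction t with
    | zero => rw [map_zero, map_zero, map_zero]; exact zero_mem _
    | tmul x y => simpa using Submodule.smul_mem _ _ (tproj_mem p x)
    | add x y hx hy => simp only [map_add]; exact add_mem hx hy
  have hl : ∀ (u : TensorAlgebra k V) (t : TensorAlgebra k V ⊗[k] TensorAlgebra k V),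
      TensorProduct.rid k _ (φ.lTensor _ ((u ⊗ₜ[k] 1) * t)) =
        u * TensorProduct.rid k _ (φ.lTensor _ t) := by
    intro u t
    induction t with
    | zero => simp
    | tmul x y => simp
    | add x y hx hy => simp only [mul_add, map_add, hx, hy]
  refine mem_quadPart.2 ⟨hm _ _, fun a b hab => ?_⟩
  have hc' := (mem_quadPart.1 hc).2 a (b + (i - p)) (by omega)
  subst hab
  refine Submodule.mul_induction_on' (C := fun c _ => TensorProduct.rid k _ (φ.lTensor _
    ((tproj k V (a + 2 + b)).rTensor _ (deconc k V c))) ∈ _) (fun x hx y hy => ?_)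
    (fun x hx y hy h1 h2 => by simp only [map_add]; exact add_mem h1 h2) hc'
  have hx2 : x ∈ tpow k V (a + 2) := by
    have h := mul_le_mul' (le_refl (tpow k V a)) hW hx
    rw [tpow, tpow, ← pow_add] at h
    exact h
  rw [rTensor_tproj_deconc_mul b hx2, hl]
  exact Submodule.mul_mem_mul hx (hm _ _)

theorem deconc_slice_right (hW : W ≤ tpow k V 2) {i : ℕ} {c : TensorAlgebra k V}
    (hc : c ∈ quadPart W i) (p : ℕ) (hp : p ≤ i) (φ : TensorAlgebra k V →ₗ[k] k) :
    TensorProduct.lid k _ (φ.rTensor _ ((tproj k V p).lTensor _ (deconc k V c))) ∈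
      quadPart W p := by
  have hm : ∀ (p : ℕ) (t : TensorAlgebra k V ⊗[k] TensorAlgebra k V),
      TensorProduct.lid k _ (φ.rTensor _ ((tproj k V p).lTensor _ t)) ∈ tpow k V p := by
    intro p t
    induction t with
    | zero => rw [map_zero, map_zero, map_zero]; exact zero_mem _
    | tmul x y => simpa using Submodule.smul_mem _ _ (tproj_mem p y)
    | add x y hx hy => simp only [map_add]; exact add_mem hx hy
  have hl : ∀ (u : TensorAlgebra k V) (t : TensorAlgebra k V ⊗[k] TensorAlgebra k V),
      TensorProduct.lid k _ (φ.rTensor _ (t * (1 ⊗ₜ[k] u))) =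
        TensorProduct.lid k _ (φ.rTensor _ t) * u := by
    intro u t
    induction t with
    | zero => simp
    | tmul x y => simp
    | add x y hx hy => simp only [add_mul, map_add, hx, hy]
  refine mem_quadPart.2 ⟨hm _ _, fun a b hab => ?_⟩
  have hc' := (mem_quadPart.1 hc).2 (i - p + a) b (by omega)
  rw [mul_assoc] at hc' ⊢
  subst hab
  refine Submodule.mul_induction_on' (C := fun c _ => TensorProduct.lid k _ (φ.rTensor _
    ((tproj k V (a + 2 + b)).lTensor _ (deconc k V c))) ∈ _) (fun y hy x hx => ?_)
    (fun x hx y hy h1 h2 => by simp only [map_add]; exact add_mem h1 h2) hc'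
  have hx2 : x ∈ tpow k V (2 + b) := by
    have h := mul_le_mul' hW (le_refl (tpow k V b)) hx
    rw [tpow, tpow, ← pow_add] at h
    exact h
  rw [show a + 2 + b = a + (2 + b) by omega, lTensor_tproj_deconc_mul a hx2, hl]
  exact Submodule.mul_mem_mul (hm _ _) hx

/-- Deconcatenation restricts to the quadratic coalgebra. -/
theorem deconc_mem_quad (hW : W ≤ tpow k V 2) {i : ℕ} {c : TensorAlgebra k V}
    (hc : c ∈ quadPart W i) : deconc k V c ∈ ⨆ pq ∈ Finset.HasAntidiagonal.antidiagonal i,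
      Submodule.map₂ (TensorProduct.mk k _ _) (quadPart W pq.1) (quadPart W pq.2) := by
  classical
  let E : TensorAlgebra k V ⊗[k] TensorAlgebra k V →ₗ[k] TensorAlgebra k V ⊗[k] TensorAlgebra k V :=
    ∑ pq ∈ Finset.HasAntidiagonal.antidiagonal i,
      TensorProduct.map (tproj k V pq.1) (tproj k V pq.2)
  have hE : (⨆ pq ∈ Finset.HasAntidiagonal.antidiagonal i,
      Submodule.map₂ (TensorProduct.mk k _ _) (tpow k V pq.1) (tpow k V pq.2)) ≤
      LinearMap.ker (E - LinearMap.id) := by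
    refine iSup₂_le fun pq hpq => Submodule.map₂_le.2 fun a ha b hb => ?_
    rw [LinearMap.mem_ker, LinearMap.sub_apply, sub_eq_zero, LinearMap.sum_apply,
      Finset.sum_eq_single_of_mem pq hpq]
    · simp [tproj_same ha, tproj_same hb]
    · intro rs hrs hne
      by_cases h1 : pq.1 = rs.1
      · have h2 : pq.2 ≠ rs.2 := fun h2 => hne (Prod.ext h1.symm h2.symm)
        simp [tproj_ne hb h2]
      · simp [tproj_ne ha h1]
  have h := hE (deconc_mem (mem_quadPart.1 hc).1)
  rw [LinearMap.mem_ker, LinearMap.sub_apply, sub_eq_zero] at h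
  change E _ = deconc k V c at h
  rw [← h, LinearMap.sum_apply]
  refine sum_mem fun pq hpq => Submodule.mem_iSup_of_mem pq (Submodule.mem_iSup_of_mem hpq ?_)
  rw [Finset.HasAntidiagonal.mem_antidiagonal] at hpq
  refine mem_map₂_of_slices _ _ _ (fun φ => ?_) (fun φ => ?_)
  · have h1 := deconc_slice_left W hW hc pq.1 (by omega) (φ ∘ₗ tproj k V pq.2)
    have h2 : ∀ t, φ.lTensor _ (TensorProduct.map (tproj k V pq.1) (tproj k V pq.2) t) =
        (φ ∘ₗ tproj k V pq.2).lTensor _ ((tproj k V pq.1).rTensor _ t) := by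
      intro t
      induction t with
      | zero => simp
      | tmul x y => simp
      | add x y hx hy => simp only [map_add, hx, hy]
    rwa [h2]
  · have h1 := deconc_slice_right W hW hc pq.2 (by omega) (φ ∘ₗ tproj k V pq.1)
    have h2 : ∀ t, φ.rTensor _ (TensorProduct.map (tproj k V pq.1) (tproj k V pq.2) t) =
        (φ ∘ₗ tproj k V pq.1).rTensor _ ((tproj k V pq.2).lTensor _ t) := by
      intro t
      induction t with
      | zero => simp
      | tmul x y => simp
      | add x y hx hy => simp only [map_add, hx, hy]
    rwa [h2]

/-- The quadratic coalgebra cogenerated by `V` with corelations `W`. -/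
def quadCoalg : Submodule k (TensorAlgebra k V) := ⨆ i, quadPart W i

theorem quadPart_le (i : ℕ) : quadPart W i ≤ quadCoalg W := le_iSup (quadPart W) i

theorem deconc_mem_quadCoalg (hW : W ≤ tpow k V 2) {c : TensorAlgebra k V}
    (hc : c ∈ quadCoalg W) :
    deconc k V c ∈ Submodule.map₂ (TensorProduct.mk k _ _) (quadCoalg W) (quadCoalg W) := by
  have h : quadCoalg W ≤ (Submodule.map₂ (TensorProduct.mk k _ _) (quadCoalg W)
      (quadCoalg W)).comap (deconc k V) := by
    refine iSup_le fun i x hx => ?_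
    have h2 : (⨆ pq ∈ Finset.HasAntidiagonal.antidiagonal i,
      Submodule.map₂ (TensorProduct.mk k _ _) (quadPart W pq.1) (quadPart W pq.2)) ≤
      Submodule.map₂ (TensorProduct.mk k _ _) (quadCoalg W) (quadCoalg W) :=
      iSup₂_le fun pq hpq => Submodule.map₂_le_map₂ (quadPart_le W _) (quadPart_le W _)
    exact h2 (deconc_mem_quad W hW hx)
  exact h hc

/-- A chosen linear retraction on the quadratic coalgebra. -/
def quadRetr : TensorAlgebra k V →ₗ[k] quadCoalg W := (exists_retraction (quadCoalg W)).choose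

theorem quadRetr_coe (x : quadCoalg W) : quadRetr W x = x :=
  (exists_retraction (quadCoalg W)).choose_spec x

/-- The comultiplication of the quadratic coalgebra, see `coe_quadComul`. -/
def quadComul : quadCoalg W →ₗ[k] quadCoalg W ⊗[k] quadCoalg W :=
  TensorProduct.map (quadRetr W) (quadRetr W) ∘ₗ deconc k V ∘ₗ (quadCoalg W).subtype

/-- The comultiplication of the quadratic coalgebra is deconcatenation. -/
theorem coe_quadComul (hW : W ≤ tpow k V 2) (c : quadCoalg W) :
    TensorProduct.map (quadCoalg W).subtype (quadCoalg W).subtype (quadComul W c) =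
      deconc k V c := by
  have h : Submodule.map₂ (TensorProduct.mk k _ _) (quadCoalg W) (quadCoalg W) ≤
      LinearMap.ker (TensorProduct.map (quadCoalg W).subtype (quadCoalg W).subtype ∘ₗ
        TensorProduct.map (quadRetr W) (quadRetr W) - LinearMap.id) := by
    refine Submodule.map₂_le.2 fun a ha b hb => ?_
    rw [LinearMap.mem_ker, LinearMap.sub_apply, sub_eq_zero]
    have h1 := quadRetr_coe W ⟨a, ha⟩
    have h2 := quadRetr_coe W ⟨b, hb⟩
    simp only at h1 h2
    simp [h1, h2]
  have := h (deconc_mem_quadCoalg W hW c.2)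
  rw [LinearMap.mem_ker, LinearMap.sub_apply, sub_eq_zero] at this
  exact this

/-- The quadratic coalgebra, with the deconcatenation coproduct. -/
abbrev quadCoalgebra (hW : W ≤ tpow k V 2) : Coalgebra k (quadCoalg W) where
  comul := quadComul W
  counit := (TensorAlgebra.algebraMapInv (R := k) (M := V)).toLinearMap ∘ₗ (quadCoalg W).subtype
  coassoc := by
    let j := (quadCoalg W).subtype
    have hj : Function.Injective j := Subtype.val_injective
    have hinj : Function.Injective (TensorProduct.map j (TensorProduct.map j j)) :=
      TensorProduct.map_injective_of_flat_flat _ _ hj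
        (TensorProduct.map_injective_of_flat_flat _ _ hj hj)
    refine LinearMap.ext fun c => hinj ?_
    have h1 : ∀ t : quadCoalg W ⊗[k] quadCoalg W,
        TensorProduct.map j (TensorProduct.map j j) (TensorProduct.assoc k _ _ _
          (LinearMap.rTensor _ (quadComul W) t)) =
        TensorProduct.assoc k _ _ _ (LinearMap.rTensor _ (deconc k V) (TensorProduct.map j j t)) := by
      intro t
      induction t with
      | zero => simp
      | tmul x y =>
        rw [LinearMap.rTensor_tmul, TensorProduct.map_tmul, LinearMap.rTensor_tmul,
          show j x = (x : TensorAlgebra k V) from rfl, ← coe_quadComul W hW]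
        generalize quadComul W x = s
        induction s with
        | zero => simp
        | tmul a b => simp [j]
        | add a b ha hb => simp only [map_add, TensorProduct.add_tmul, ha, hb]
      | add x y hx hy => simp only [map_add, hx, hy]
    have h2 : ∀ t : quadCoalg W ⊗[k] quadCoalg W,
        TensorProduct.map j (TensorProduct.map j j) (LinearMap.lTensor _ (quadComul W) t) =
        LinearMap.lTensor _ (deconc k V) (TensorProduct.map j j t) := by
      intro t
      induction t with
      | zero => simp
      | tmul x y =>
        rw [LinearMap.lTensor_tmul, TensorProduct.map_tmul, TensorProduct.map_tmul,
          LinearMap.lTensor_tmul, show j y = (y : TensorAlgebra k V) from rfl,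
          ← coe_quadComul W hW]
      | add x y hx hy => simp only [map_add, hx, hy]
    have h3 := coe_quadComul W hW c
    change TensorProduct.map j j _ = _ at h3
    rw [LinearMap.comp_apply, LinearMap.comp_apply, LinearMap.comp_apply, LinearEquiv.coe_coe, h1,
      h2, h3, deconc_coassoc]
  rTensor_counit_comp_comul := by
    let j := (quadCoalg W).subtype
    have hinj : Function.Injective (LinearMap.lTensor k j) :=
      Module.Flat.lTensor_preserves_injective_linearMap _ Subtype.val_injective
    refine LinearMap.ext fun c => hinj ?_
    have h1 : ∀ t : quadCoalg W ⊗[k] quadCoalg W,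
        LinearMap.lTensor k j (LinearMap.rTensor _
          ((TensorAlgebra.algebraMapInv (R := k) (M := V)).toLinearMap ∘ₗ j) t) =
        LinearMap.rTensor _ (TensorAlgebra.algebraMapInv (R := k) (M := V)).toLinearMap
          (TensorProduct.map j j t) := by
      intro t
      induction t with
      | zero => simp
      | tmul x y => simp
      | add x y hx hy => simp only [map_add, hx, hy]
    have h3 := coe_quadComul W hW c
    change TensorProduct.map j j _ = _ at h3
    rw [LinearMap.comp_apply, h1, h3, deconc_counit_left]
    rfl
  lTensor_counit_comp_comul := by
    let j := (quadCoalg W).subtype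
    have hinj : Function.Injective (LinearMap.rTensor k j) :=
      Module.Flat.rTensor_preserves_injective_linearMap _ Subtype.val_injective
    refine LinearMap.ext fun c => hinj ?_
    have h1 : ∀ t : quadCoalg W ⊗[k] quadCoalg W,
        LinearMap.rTensor k j (LinearMap.lTensor _
          ((TensorAlgebra.algebraMapInv (R := k) (M := V)).toLinearMap ∘ₗ j) t) =
        LinearMap.lTensor _ (TensorAlgebra.algebraMapInv (R := k) (M := V)).toLinearMap
          (TensorProduct.map j j t) := by
      intro t
      induction t with
      | zero => simp
      | tmul x y => simp
      | add x y hx hy => simp only [map_add, hx, hy]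
    have h3 := coe_quadComul W hW c
    change TensorProduct.map j j _ = _ at h3
    rw [LinearMap.comp_apply, h1, h3, deconc_counit_right]
    rfl

end QuadraticCoalgebra

/-! ## The Koszul dual coalgebra of a graded algebra -/

section KoszulDual

variable {k A : Type*} [Field k] [Ring A] [Algebra k A] (𝒜 : ℕ → Submodule k A)

/-- The quadratic relations of `A`: the kernel of the multiplication `A₁ ⊗ A₁ → A₂`. -/
def relations : Submodule k (TensorAlgebra k (𝒜 1)) :=
  tpow k (𝒜 1) 2 ⊓ LinearMap.ker (TensorAlgebra.lift k (𝒜 1).subtype).toLinearMap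

theorem relations_le : relations 𝒜 ≤ tpow k (𝒜 1) 2 := inf_le_left

/-- The Koszul dual coalgebra `A^¡`, the quadratic coalgebra cogenerated by `A₁` with
corelations the quadratic relations of `A`. -/
abbrev KoszulDual : Type _ := quadCoalg (relations 𝒜)

instance KoszulDual.coalgebra : Coalgebra k (KoszulDual 𝒜) :=
  quadCoalgebra (relations 𝒜) (relations_le 𝒜)

/-- The Koszul dual coalgebra as a connected graded coalgebra. -/
def koszulDual : ConnCoalgebra k (KoszulDual 𝒜) where
  gr i := (quadPart (relations 𝒜) i).comap (quadCoalg (relations 𝒜)).subtype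
  isInternal := by
    refine isInternal_of_coaction _ (fun j => quadRetr (relations 𝒜) ∘ₗ tproj k (𝒜 1) j ∘ₗ
      (quadCoalg (relations 𝒜)).subtype) (fun i x hx j => ?_) ?_
    · have hx' := (mem_quadPart.1 (Submodule.mem_comap.1 hx)).1
      simp only [LinearMap.comp_apply]
      split_ifs with h
      · subst h
        rw [tproj_same hx']
        exact quadRetr_coe _ x
      · rw [tproj_ne hx' h, map_zero]
    · have h : quadCoalg (relations 𝒜) ≤ (⨆ i, (quadPart (relations 𝒜) i).comap
          (quadCoalg (relations 𝒜)).subtype).map (quadCoalg (relations 𝒜)).subtype :=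
        iSup_le fun i x hx => ⟨⟨x, quadPart_le _ i hx⟩, Submodule.mem_iSup_of_mem i hx, rfl⟩
      rw [eq_top_iff]
      intro x _
      obtain ⟨y, hy, hyx⟩ := h x.2
      rwa [← Subtype.ext hyx]
  one := ⟨1, quadPart_le _ 0 (mem_quadPart.2 ⟨SetLike.GradedOne.one_mem, fun a b h => by omega⟩)⟩
  gr_zero := by
    refine le_antisymm (fun x hx => ?_) ?_
    · have hx' := (mem_quadPart.1 (Submodule.mem_comap.1 hx)).1
      rw [tpow, pow_zero, Submodule.mem_one] at hx'
      obtain ⟨r, hr⟩ := hx'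
      refine Submodule.mem_span_singleton.2 ⟨r, Subtype.ext ?_⟩
      rw [Submodule.coe_smul, ← Algebra.algebraMap_eq_smul_one]
      exact hr
    · rw [Submodule.span_singleton_le_iff_mem]
      exact mem_quadPart.2 ⟨SetLike.GradedOne.one_mem, fun a b h => by omega⟩
  counit_one := map_one (TensorAlgebra.algebraMapInv (R := k) (M := 𝒜 1))
  counit_pos := fun {i c} hc => by
    have hx' := (mem_quadPart.1 (Submodule.mem_comap.1 hc)).1
    rw [tpow, pow_succ] at hx'
    change TensorAlgebra.algebraMapInv (R := k) (M := 𝒜 1) (c : TensorAlgebra k (𝒜 1)) = 0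
    refine Submodule.mul_induction_on' (C := fun c _ =>
      TensorAlgebra.algebraMapInv (R := k) (M := 𝒜 1) c = 0) (fun x hx y hy => ?_)
      (fun x hx y hy h1 h2 => by rw [map_add, h1, h2, add_zero]) hx'
    obtain ⟨v, rfl⟩ := hy
    rw [map_mul]
    simp [TensorAlgebra.algebraMapInv]
  comul_one := by
    let j := (quadCoalg (relations 𝒜)).subtype
    have hj : Function.Injective j := Subtype.val_injective
    refine TensorProduct.map_injective_of_flat_flat _ _ hj hj ?_
    refine (coe_quadComul _ (relations_le 𝒜) _).trans ?_
    exact deconc_one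
  comul_mem := fun {i c} hc => by
    have h : (⨆ pq ∈ Finset.HasAntidiagonal.antidiagonal i, Submodule.map₂ (TensorProduct.mk k _ _)
        (quadPart (relations 𝒜) pq.1) (quadPart (relations 𝒜) pq.2)) ≤
        (⨆ pq ∈ Finset.HasAntidiagonal.antidiagonal i, Submodule.map₂ (TensorProduct.mk k _ _)
          ((quadPart (relations 𝒜) pq.1).comap (quadCoalg (relations 𝒜)).subtype)
          ((quadPart (relations 𝒜) pq.2).comap (quadCoalg (relations 𝒜)).subtype)).comap
        (TensorProduct.map (quadRetr (relations 𝒜)) (quadRetr (relations 𝒜))) := by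
      refine iSup₂_le fun pq hpq => Submodule.map₂_le.2 fun a ha b hb => ?_
      have h1 := quadRetr_coe (relations 𝒜) ⟨a, quadPart_le _ _ ha⟩
      have h2 := quadRetr_coe (relations 𝒜) ⟨b, quadPart_le _ _ hb⟩
      refine Submodule.mem_iSup_of_mem pq (Submodule.mem_iSup_of_mem hpq ?_)
      simp only at h1 h2
      rw [TensorProduct.mk_apply, TensorProduct.map_tmul, h1, h2]
      exact Submodule.apply_mem_map₂ _ ha hb
    exact h (deconc_mem_quad _ (relations_le 𝒜) (Submodule.mem_comap.1 hc))
  parity := quadRetr (relations 𝒜) ∘ₗ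
    (TensorAlgebra.lift k (-(TensorAlgebra.ι k : 𝒜 1 →ₗ[k] _))).toLinearMap ∘ₗ
      (quadCoalg (relations 𝒜)).subtype
  parity_apply := fun {i c} hc => by
    have hx' := (mem_quadPart.1 (Submodule.mem_comap.1 hc)).1
    have h : ∀ {i : ℕ} {x : TensorAlgebra k (𝒜 1)}, x ∈ tpow k (𝒜 1) i →
        TensorAlgebra.lift k (-(TensorAlgebra.ι k : 𝒜 1 →ₗ[k] _)) x = (-1 : k) ^ i • x := by
      intro i x hx
      induction hx using Submodule.pow_induction_on_left' with
      | algebraMap r => simp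
      | add x y i hx hy h1 h2 => rw [map_add, h1, h2, smul_add]
      | mem_mul m hm i x hx ih =>
        obtain ⟨v, rfl⟩ := hm
        rw [map_mul, ih, TensorAlgebra.lift_ι_apply, pow_succ]
        simp
    have h2 := h hx'
    simp only [LinearMap.comp_apply, AlgHom.toLinearMap_apply]
    rw [h2, map_smul]
    exact congrArg _ (quadRetr_coe _ c)

end KoszulDual

/-! ## Koszul AS-regular algebras -/

section Regular

universe u v

open CategoryTheory

variable {k : Type u} {A : Type v} [Field k] [Ring A] [Algebra k A]
variable (𝒜 : ℕ → Submodule k A)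

/-- The twisting morphism `A^¡ → A`: the projection to the degree one part `A₁` of `A^¡`,
followed by the inclusion of `A₁` in `A`. -/
def koszulTwist : KoszulDual 𝒜 →ₗ[k] A :=
  (TensorAlgebra.lift k (𝒜 1).subtype).toLinearMap ∘ₗ tproj k (𝒜 1) 1 ∘ₗ
    (quadCoalg (relations 𝒜)).subtype

/-- The differential `a ⊗ c ↦ ∑ a κ(c₁) ⊗ c₂` of the Koszul complex `A ⊗ A^¡`. -/
def koszulDiff : A ⊗[k] KoszulDual 𝒜 →ₗ[k] A ⊗[k] KoszulDual 𝒜 :=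
  TensorProduct.map (LinearMap.mul' k A ∘ₗ LinearMap.lTensor A (koszulTwist 𝒜)) LinearMap.id ∘ₗ
    (TensorProduct.assoc k A (KoszulDual 𝒜) (KoszulDual 𝒜)).symm.toLinearMap ∘ₗ
    LinearMap.lTensor A Coalgebra.comul

/-- The augmentation `A ⊗ A^¡ → A₀`, `a ⊗ c ↦ ε(c) a₀`, of the Koszul complex. -/
def koszulAug [GradedAlgebra 𝒜] : A ⊗[k] KoszulDual 𝒜 →ₗ[k] A :=
  GradedAlgebra.proj 𝒜 0 ∘ₗ (TensorProduct.rid k A).toLinearMap ∘ₗ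
    LinearMap.lTensor A Coalgebra.counit

/-- A connected graded algebra: `A = k ⊕ A₁ ⊕ A₂ ⊕ ⋯`. -/
def IsConnected : Prop := Module.finrank k (𝒜 0) = 1

/-- `A` is Koszul: the augmented Koszul complex
`⋯ → A ⊗ A^¡₂ → A ⊗ A^¡₁ → A ⊗ A^¡₀ → k` is a resolution of `k`. -/
structure IsKoszul [GradedAlgebra 𝒜] : Prop where
  connected : IsConnected 𝒜
  exact : LinearMap.range (koszulDiff 𝒜) =
    LinearMap.ker (koszulDiff 𝒜) ⊓ LinearMap.ker (koszulAug 𝒜)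

/-- The trivial left module `k = A / A_{>0}`. -/
abbrev trivialModule [GradedAlgebra 𝒜] : ModuleCat.{v} A :=
  ModuleCat.of A (A ⧸ (HomogeneousIdeal.irrelevant 𝒜).toIdeal)

/-- Artin-Schelter regular algebras of dimension `n`: connected graded algebras of global
dimension `n` such that `Extⁱ(k, A) = 0` for `i ≠ n` and `Extⁿ(k, A) ≅ k`. -/
structure IsASRegular [GradedAlgebra 𝒜] (n : ℕ) : Prop where
  connected : IsConnected 𝒜
  globalDimension : ⨆ M : ModuleCat.{v} A, projectiveDimension M = ((n : ℕ∞) : WithBot ℕ∞)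
  ext_ne : ∀ i : ℕ, i ≠ n →
    Subsingleton (Abelian.Ext (trivialModule 𝒜) (ModuleCat.of A A) i)
  ext_eq : Nonempty (Abelian.Ext (trivialModule 𝒜) (ModuleCat.of A A) n ≃ₗ[k] k)

end Regular

/-! ## The Nakayama automorphism and the two-form of a volume element -/

section VolumeForm

namespace ConnCoalgebra

open Coalgebra DGAlgebra

variable {k C : Type*} [Field k] [AddCommGroup C] [Module k C] [Coalgebra k C]
variable (G : ConnCoalgebra k C)

/-- The linear forms on `C` which are homogeneous of degree `p`, that is, vanish on the components
of degree `≠ p`. -/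
def dualDeg (p : ℕ) : Submodule k (Module.Dual k C) where
  carrier := {u | ∀ i, i ≠ p → ∀ c ∈ G.gr i, u c = 0}
  add_mem' := fun {u v} hu hv i hi c hc => by simp [hu i hi c hc, hv i hi c hc]
  zero_mem' := fun i hi c hc => rfl
  smul_mem' := fun a u hu i hi c hc => by simp [hu i hi c hc]

/-- The pairing `⟨u, v⟩ = ∑ η'(v) η''(u)` on the dual of `C` defined by `η ∈ C`, where
`Δ(η) = ∑ η' ⊗ η''`. -/
def pairing (_G : ConnCoalgebra k C) (η : C) (u v : Module.Dual k C) : k :=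
  LinearMap.mul' k k (TensorProduct.map v u (comul η))

/-- The pairing defined by `η` is non-degenerate. -/
def IsNondegenerate (η : C) : Prop :=
  (∀ u, (∀ v, G.pairing η u v = 0) → u = 0) ∧ (∀ v, (∀ u, G.pairing η u v = 0) → v = 0)

variable {G} in
/-- `σ` is adjoint to the Nakayama automorphism of the dual algebra:
`⟨u, v⟩ = (-1)^{|u||v|} ⟨v, σ^*(u)⟩`. -/
def Aut.IsNakayama (σ : G.Aut) (η : C) : Prop :=
  ∀ (p q : ℕ), ∀ u ∈ G.dualDeg p, ∀ v ∈ G.dualDeg q,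
    G.pairing η u v = (-1 : k) ^ (p * q) *
      G.pairing η v (u ∘ₗ (σ.toCoalgEquiv.toLinearEquiv : C →ₗ[k] C))

/-- The generators `dc` of the bimodule `Ω̂¹ R [-1]` for the cobar construction `R = Ω(C)`: the
element `d𝟏` for `c = 1`, and `d(Σ⁻¹c̄)` for `c ∈ C̄`. -/
def dGen : C →ₗ[k] OneForm (DGAlgebra.Aut.refl G.cobarDG) :=
  LinearMap.toSpanSingleton k _ (dOne G.cobarDG) ∘ₗ counit + dFun G.cobarDG ∘ₗ G.bar

/-- The two-form `ω = ½ ∑ dη' ⊗ dη''` on the cobar construction. -/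
def twoForm (η : C) : Forms G.cobarDG :=
  (2⁻¹ : k) • LinearMap.mul' k (Forms G.cobarDG)
    (TensorProduct.map (Forms.form G.cobarDG ∘ₗ G.dGen) (Forms.form G.cobarDG ∘ₗ G.dGen) (comul η))

end ConnCoalgebra

end VolumeForm

end

end NCG

/-! There are two independent halves: regularity makes `A^¡` a Frobenius coalgebra, and for any
finite-dimensional Frobenius coalgebra `C` contraction with the two-form of a volume element is an
isomorphism.

Regularity. The Koszul complex resolves `k`, so a cocycle for `Ext(k, M)` is a linear map from `A^¡`
to `M`, with coboundary `c ↦ ∑ κ(c₁) φ(c₂)`. Its values lie in `A₁ M`, so scalar cochains are never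
coboundaries unless zero. With `M = k` the bound on the global dimension kills `A^¡` above degree
`n` (`IsASRegular.gr_eq_bot`); with `M = A` the two conditions on `Ext(k, A)` give `dim A^¡_n = 1`,
finiteness of `A₁`, and, by descending induction on the degree, injectivity of `f ↦ ∑ η' f(η'')`
(`IsASRegular.isNondegenerate`).

Symmetry. Non-degeneracy makes both slicing maps `C^* → C` bijective. Their quotient is the unique
`ρ` with `∑ η'' ⊗ ρ(η') = ∑ η' ⊗ η''`, and coassociativity forces it to be a coalgebra automorphism
(`exists_swap`). The Koszul sign in the definition of the Nakayama automorphism depends on one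
degree only once the total degree is `n`, so it is absorbed into `ρ` (`isNakayama_iff`). By
coassociativity the iterated coproduct of `η` is invariant under rotation too (`comul₃_cyc`).

Two-form. With `d1 = d𝟏` the differential of `dc` is `∑ c̄₁ dc₂ - ∑ (-1)^{|c₁|} dc₁ c̄₂`. In the
differential of `∑ dη' dη''`, or of a contraction of it, the terms with a generator in the middle
cancel by coassociativity and the outer ones are matched by rotation (`diff_twoForm_mem`,
`contract_delta`).

Bijectivity. The bimodule of one-forms is free on `db` for `b` in a basis of `C`, so a double
derivation is an arbitrary homogeneous choice of the values `Θ(db)`. Writing `Δ(η) = ∑ bᵢ ⊗ gᵢ` with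
two bases, the contraction is `∑ ± Θ(dbᵢ)'' dgᵢ σ(Θ(dbᵢ)')`: up to a signed, twisted flip, the value
at `dbᵢ` becomes the coefficient of `dgᵢ` (`isDGBimoduleIso_psiContract`). -/

open scoped TensorProduct

namespace NCG

noncomputable section

namespace ConnCoalgebra

open Coalgebra

variable {k C : Type*} [Field k] [AddCommGroup C] [Module k C] [Coalgebra k C]
variable (G : ConnCoalgebra k C)

/-! ## Homogeneous components of a connected graded coalgebra -/

/-- The projection of `C` onto its degree `i` component. -/
def proj (i : ℕ) : C →ₗ[k] C :=
  (G.gr i).subtype ∘ₗ DirectSum.component k ℕ (fun i => G.gr i) i ∘ₗ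
    (LinearEquiv.ofBijective (DirectSum.coeLinearMap G.gr) G.isInternal).symm.toLinearMap

theorem proj_mem (i : ℕ) (c : C) : G.proj i c ∈ G.gr i := Submodule.coe_mem _

theorem proj_eq {i : ℕ} {c : C} (hc : c ∈ G.gr i) (j : ℕ) :
    G.proj j c = if i = j then c else 0 := by
  have e : (LinearEquiv.ofBijective (DirectSum.coeLinearMap G.gr) G.isInternal).symm c =
      DirectSum.lof k ℕ (fun i => G.gr i) i ⟨c, hc⟩ := by
    refine (LinearEquiv.symm_apply_eq _).2 ?_
    exact (DirectSum.coeLinearMap_lof G.gr i (⟨c, hc⟩ : G.gr i)).symm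
  simp only [proj, LinearMap.comp_apply, LinearEquiv.coe_coe, e]
  split_ifs with h
  · subst h; rw [DirectSum.component.lof_self]; rfl
  · rw [DirectSum.component.of, dif_neg h, map_zero]

theorem proj_same {i : ℕ} {c : C} (hc : c ∈ G.gr i) : G.proj i c = c := by
  rw [G.proj_eq hc, if_pos rfl]

theorem proj_ne {i j : ℕ} {c : C} (hc : c ∈ G.gr i) (h : i ≠ j) : G.proj j c = 0 := by
  rw [G.proj_eq hc, if_neg h]

theorem hom_ext_gr {M : Type*} [AddCommGroup M] [Module k M] {f g : C →ₗ[k] M}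
    (h : ∀ i, ∀ c ∈ G.gr i, f c = g c) : f = g :=
  LinearMap.ext fun c => G.induction_gr (P := fun c => f c = g c) h (by simp)
    (fun x y hx hy => by rw [map_add, map_add, hx, hy]) c

theorem eq_zero_of_proj {c : C} (h : ∀ i, G.proj i c = 0) : c = 0 := by
  have h2 : (LinearEquiv.ofBijective (DirectSum.coeLinearMap G.gr) G.isInternal).symm c = 0 := by
    refine DFinsupp.ext fun i => Subtype.ext ?_
    exact h i
  simpa using h2

theorem one_mem_gr : G.one ∈ G.gr 0 := by
  rw [G.gr_zero]; exact Submodule.mem_span_singleton_self _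

theorem counit_eq_zero {i : ℕ} (hi : i ≠ 0) {c : C} (hc : c ∈ G.gr i) :
    counit (R := k) c = 0 := by
  obtain ⟨j, rfl⟩ := Nat.exists_eq_succ_of_ne_zero hi
  exact G.counit_pos hc

/-- Linear maps that agree on homogeneous tensors of degree `i` agree on coproducts of elements
of degree `i`. -/
theorem comul_hom_ext {M : Type*} [AddCommGroup M] [Module k M] {F F' : C ⊗[k] C →ₗ[k] M} {i : ℕ}
    (h : ∀ p q, p + q = i → ∀ a ∈ G.gr p, ∀ b ∈ G.gr q, F (a ⊗ₜ b) = F' (a ⊗ₜ b))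
    {c : C} (hc : c ∈ G.gr i) : F (comul c) = F' (comul c) := by
  have h1 : (⨆ pq ∈ Finset.HasAntidiagonal.antidiagonal i,
      Submodule.map₂ (TensorProduct.mk k C C) (G.gr pq.1) (G.gr pq.2)) ≤
      LinearMap.ker (F - F') := by
    refine iSup₂_le fun pq hpq => Submodule.map₂_le.2 fun x hx y hy => ?_
    rw [LinearMap.mem_ker, LinearMap.sub_apply, sub_eq_zero]
    exact h _ _ (Finset.HasAntidiagonal.mem_antidiagonal.1 hpq) x hx y hy
  have := h1 (G.comul_mem hc)
  rwa [LinearMap.mem_ker, LinearMap.sub_apply, sub_eq_zero] at this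

/-- The iterated coproduct `C → C ⊗ (C ⊗ C)`. -/
def comul₃ : C →ₗ[k] C ⊗[k] (C ⊗[k] C) := LinearMap.lTensor C comul ∘ₗ comul

theorem comul₃_eq (c : C) : comul₃ (k := k) c =
    TensorProduct.assoc k C C C (LinearMap.rTensor C comul (comul c)) :=
  (Coalgebra.coassoc_apply c).symm

/-- The grading of the coproduct is used twice, the second time inside the right tensor factor. -/
theorem comul₃_hom_ext {M : Type*} [AddCommGroup M] [Module k M]
    {F F' : C ⊗[k] (C ⊗[k] C) →ₗ[k] M} {i : ℕ}
    (h : ∀ p q r, p + q + r = i → ∀ a ∈ G.gr p, ∀ b ∈ G.gr q, ∀ d ∈ G.gr r,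
      F (a ⊗ₜ (b ⊗ₜ d)) = F' (a ⊗ₜ (b ⊗ₜ d)))
    {c : C} (hc : c ∈ G.gr i) : F (comul₃ c) = F' (comul₃ c) := by
  refine G.comul_hom_ext (F := F ∘ₗ LinearMap.lTensor C comul)
    (F' := F' ∘ₗ LinearMap.lTensor C comul) (fun p q hpq a ha b hb => ?_) hc
  refine G.comul_hom_ext (F := F ∘ₗ TensorProduct.mk k C (C ⊗[k] C) a)
    (F' := F' ∘ₗ TensorProduct.mk k C (C ⊗[k] C) a) (fun q' r hqr b hb d hd => ?_) hb
  exact h p q' r (by omega) a ha b hb d hd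

theorem parity_mem {i : ℕ} {c : C} (hc : c ∈ G.gr i) : G.parity c ∈ G.gr i := by
  rw [G.parity_apply hc]; exact Submodule.smul_mem _ _ hc

theorem parity_parity (c : C) : G.parity (G.parity c) = c := by
  have : G.parity ∘ₗ G.parity = LinearMap.id := G.hom_ext_gr fun i c hc => by
    rw [LinearMap.comp_apply, G.parity_apply hc, map_smul, G.parity_apply hc, smul_smul, ← mul_pow]
    simp
  exact LinearMap.congr_fun this c

/-- The sign automorphism `c ↦ (-1)^{|c|} c`. -/
def parityAut : G.Aut where
  toCoalgEquiv :=
    { toLinearMap := G.parity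
      invFun := G.parity
      left_inv := G.parity_parity
      right_inv := G.parity_parity
      counit_comp := G.hom_ext_gr fun i c hc => by
        rcases eq_or_ne i 0 with rfl | hi
        · simp [G.parity_apply hc]
        · simp [G.parity_apply hc, G.counit_eq_zero hi hc]
      map_comp_comul := LinearMap.ext fun c => (G.comul_parity c).symm }
  map_mem := G.parity_mem

theorem parityAut_apply (c : C) : G.parityAut.toCoalgEquiv c = G.parity c := rfl

variable {G} in
/-- The composition of automorphisms. -/
def Aut.comp (σ τ : G.Aut) : G.Aut where
  toCoalgEquiv := τ.toCoalgEquiv.trans σ.toCoalgEquiv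
  map_mem := fun h => σ.map_mem (τ.map_mem h)

/-- The automorphism `c ↦ (-1)^{p|c|} c`. -/
def signAut (p : ℕ) : G.Aut :=
  if Even p then { toCoalgEquiv := CoalgEquiv.refl k C, map_mem := fun h => h } else G.parityAut

theorem signAut_apply (p : ℕ) {i : ℕ} {c : C} (hc : c ∈ G.gr i) :
    (G.signAut p).toCoalgEquiv c = (-1 : k) ^ (p * i) • c := by
  unfold signAut
  split_ifs with h
  · rw [(h.mul_right i).neg_one_pow, one_smul]; rfl
  · rw [parityAut_apply, G.parity_apply hc, pow_mul, (Nat.not_even_iff_odd.1 h).neg_one_pow]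

theorem signAut_signAut (p : ℕ) (c : C) :
    (G.signAut p).toCoalgEquiv ((G.signAut p).toCoalgEquiv c) = c := by
  unfold signAut
  split_ifs
  · rfl
  · exact G.parity_parity c

/-! ## Frobenius coalgebras -/

section Frobenius

/-- `u ↦ ∑ η' u(η'')`. -/
def sliceRight (η : C) : Module.Dual k C →ₗ[k] C where
  toFun u := TensorProduct.rid k C (LinearMap.lTensor C u (comul η))
  map_add' u v := by simp [LinearMap.lTensor_add]
  map_smul' r u := by simp [LinearMap.lTensor_smul]

/-- `v ↦ ∑ v(η') η''`. -/
def sliceLeft (η : C) : Module.Dual k C →ₗ[k] C where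
  toFun v := TensorProduct.lid k C (LinearMap.rTensor C v (comul η))
  map_add' u v := by simp [LinearMap.rTensor_add]
  map_smul' r u := by simp [LinearMap.rTensor_smul]

theorem pairing_eq_sliceRight (η : C) (u v : Module.Dual k C) :
    G.pairing η u v = v (sliceRight η u) := by
  simp only [pairing, sliceRight, LinearMap.coe_mk, AddHom.coe_mk]
  generalize comul (R := k) η = t
  induction t with
  | zero => simp
  | tmul a b => simp [mul_comm]
  | add x y hx hy => simp only [map_add, hx, hy]

theorem pairing_eq_sliceLeft (η : C) (u v : Module.Dual k C) :
    G.pairing η u v = u (sliceLeft η v) := by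
  simp only [pairing, sliceLeft, LinearMap.coe_mk, AddHom.coe_mk]
  generalize comul (R := k) η = t
  induction t with
  | zero => simp
  | tmul a b => simp
  | add x y hx hy => simp only [map_add, hx, hy]

variable {G} {η : C} {n : ℕ}

/-- Since `Δ(η)` has total degree `n`, a form supported in degree `j` meets only the summands whose
left factor has degree `n - j`. -/
theorem sliceRight_proj (hη : η ∈ G.gr n) {i j : ℕ} (hij : i + j = n) (u : Module.Dual k C) :
    sliceRight η (u ∘ₗ G.proj j) = G.proj i (sliceRight η u) := by
  refine G.comul_hom_ext
    (F := (TensorProduct.rid k C).toLinearMap ∘ₗ LinearMap.lTensor C (u ∘ₗ G.proj j))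
    (F' := G.proj i ∘ₗ (TensorProduct.rid k C).toLinearMap ∘ₗ LinearMap.lTensor C u)
    (fun p q hpq a ha b hb => ?_) hη
  by_cases h : p = i
  · obtain rfl : q = j := by omega
    subst h
    simp [G.proj_same ha, G.proj_same hb]
  · simp [G.proj_ne ha h, G.proj_ne hb (show q ≠ j by omega)]

theorem sliceLeft_proj (hη : η ∈ G.gr n) {i j : ℕ} (hij : i + j = n) (v : Module.Dual k C) :
    sliceLeft η (v ∘ₗ G.proj j) = G.proj i (sliceLeft η v) := by
  refine G.comul_hom_ext
    (F := (TensorProduct.lid k C).toLinearMap ∘ₗ LinearMap.rTensor C (v ∘ₗ G.proj j))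
    (F' := G.proj i ∘ₗ (TensorProduct.lid k C).toLinearMap ∘ₗ LinearMap.rTensor C v)
    (fun p q hpq a ha b hb => ?_) hη
  by_cases h : q = i
  · obtain rfl : p = j := by omega
    subst h
    simp [G.proj_same ha, G.proj_same hb]
  · simp [G.proj_ne hb h, G.proj_ne ha (show p ≠ j by omega)]

theorem proj_sliceRight_of_lt (hη : η ∈ G.gr n) {i : ℕ} (hi : n < i) (u : Module.Dual k C) :
    G.proj i (sliceRight η u) = 0 := by
  refine G.comul_hom_ext
    (F := G.proj i ∘ₗ (TensorProduct.rid k C).toLinearMap ∘ₗ LinearMap.lTensor C u)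
    (F' := 0) (fun p q hpq a ha b hb => ?_) hη
  simp [G.proj_ne ha (show p ≠ i by omega)]

/-- Non-degeneracy on one side says that the kernel is zero, and `C` has the dimension of its dual.
-/
theorem sliceRight_bijective [Module.Finite k C] (h : G.IsNondegenerate η) :
    Function.Bijective (sliceRight (k := k) η) := by
  have hi : Function.Injective (sliceRight (k := k) η) := by
    refine (injective_iff_map_eq_zero _).2 fun u hu => h.1 u fun v => ?_
    rw [pairing_eq_sliceRight, hu, map_zero]
  exact ⟨hi, (LinearMap.injective_iff_surjective_of_finrank_eq_finrank
    Subspace.dual_finrank_eq).1 hi⟩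

theorem sliceLeft_bijective [Module.Finite k C] (h : G.IsNondegenerate η) :
    Function.Bijective (sliceLeft (k := k) η) := by
  have hi : Function.Injective (sliceLeft (k := k) η) := by
    refine (injective_iff_map_eq_zero _).2 fun v hv => h.2 v fun u => ?_
    rw [pairing_eq_sliceLeft, hv, map_zero]
  exact ⟨hi, (LinearMap.injective_iff_surjective_of_finrank_eq_finrank
    Subspace.dual_finrank_eq).1 hi⟩

/-- The map `η' ⊗ η'' ↦ η'' ⊗ ρ η'`. -/
def swapMap (ρ : C →ₗ[k] C) : C ⊗[k] C →ₗ[k] C ⊗[k] C :=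
  (TensorProduct.comm k C C).toLinearMap ∘ₗ LinearMap.rTensor C ρ

omit [Coalgebra k C] in
@[simp] theorem swapMap_tmul (ρ : C →ₗ[k] C) (a b : C) :
    swapMap ρ (a ⊗ₜ b) = b ⊗ₜ[k] ρ a := by simp [swapMap]

/-- The map `a ⊗ b ⊗ c ↦ b ⊗ c ⊗ ρ a`. -/
def cycMap (ρ : C →ₗ[k] C) : C ⊗[k] (C ⊗[k] C) →ₗ[k] C ⊗[k] (C ⊗[k] C) :=
  (TensorProduct.assoc k C C C).toLinearMap ∘ₗ
    (TensorProduct.comm k C (C ⊗[k] C)).toLinearMap ∘ₗ LinearMap.rTensor (C ⊗[k] C) ρ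

omit [Coalgebra k C] in
@[simp] theorem cycMap_tmul (ρ : C →ₗ[k] C) (a b c : C) :
    cycMap ρ (a ⊗ₜ (b ⊗ₜ c)) = b ⊗ₜ[k] (c ⊗ₜ[k] ρ a) := by simp [cycMap]

/-- Rotating `(1 ⊗ Δ)t` by one factor gives `(Δ ⊗ 1)` of the swap of `t`. For `t = Δ(η)` the swap
does nothing, and coassociativity identifies the two iterated coproducts. -/
theorem cycMap_comul₃ {ρ : C →ₗ[k] C} (h : swapMap ρ (comul η) = comul η) :
    cycMap ρ (comul₃ η) = comul₃ η := by
  rw [comul₃_eq (k := k) η]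
  conv_rhs => rw [← h]
  rw [← comul₃_eq, comul₃, LinearMap.comp_apply]
  generalize comul (R := k) η = t
  induction t with
  | zero => simp
  | tmul a b => 
    simp only [LinearMap.lTensor_tmul, swapMap_tmul, LinearMap.rTensor_tmul]
    generalize comul (R := k) b = s
    induction s with
    | zero => simp
    | tmul c d => simp
    | add x y hx hy => simp only [map_add, TensorProduct.tmul_add, TensorProduct.add_tmul, hx, hy]
  | add x y hx hy => simp only [map_add, hx, hy]

/-- Slicing commutes with splitting the factor that remains, so the coproduct of a slice of `η` is a
slice of the iterated coproduct. -/
theorem lTensor_comul₃ (u : Module.Dual k C) :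
    TensorProduct.rid k _ (LinearMap.lTensor _ u ((TensorProduct.assoc k C C C).symm (comul₃ η))) =
      comul (sliceRight η u) := by
  rw [comul₃_eq, LinearEquiv.symm_apply_apply]
  simp only [sliceRight, LinearMap.coe_mk, AddHom.coe_mk]
  generalize comul (R := k) η = t
  induction t with
  | zero => simp
  | tmul a b => simp
  | add x y hx hy => simp only [map_add, hx, hy]

theorem rTensor_comul₃ (v : Module.Dual k C) :
    TensorProduct.lid k _ (LinearMap.rTensor _ v (comul₃ η)) = comul (sliceLeft η v) := by
  simp only [comul₃, sliceLeft, LinearMap.coe_mk, AddHom.coe_mk, LinearMap.comp_apply]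
  generalize comul (R := k) η = t
  induction t with
  | zero => simp
  | tmul a b => simp
  | add x y hx hy => simp only [map_add, hx, hy]

/-- Linear forms on the left factor separate tensors, and slicing the swapped tensor on the left is
slicing the original one on the right, followed by `ρ`. -/
theorem swapMap_comul_iff {ρ : C →ₗ[k] C} :
    swapMap ρ (comul η) = comul η ↔
      ∀ u : Module.Dual k C, ρ (sliceRight η u) = sliceLeft η u := by
  have key : ∀ u, TensorProduct.lid k C (LinearMap.rTensor C u (swapMap ρ (comul η))) =
      ρ (sliceRight η u) := by
    intro u
    simp only [sliceRight, LinearMap.coe_mk, AddHom.coe_mk]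
    generalize comul (R := k) η = t
    induction t with
    | zero => simp
    | tmul a b => simp
    | add x y hx hy => simp only [map_add, hx, hy]
  constructor
  · intro h u
    rw [← key, h]; rfl
  · intro h
    rw [← sub_eq_zero]
    refine tensor_sep_left _ fun u => ?_
    rw [map_sub, map_sub, key, h]
    exact sub_self _

/-- The (unsigned) adjoint of the Nakayama automorphism of a Frobenius coalgebra. -/
theorem exists_swap [Module.Finite k C] (hη : η ∈ G.gr n) (h : G.IsNondegenerate η) :
    ∃ ρ : G.Aut, swapMap (ρ.toCoalgEquiv.toLinearEquiv : C →ₗ[k] C) (comul η) = comul η := by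
  let eR := LinearEquiv.ofBijective _ (sliceRight_bijective h)
  let eL := LinearEquiv.ofBijective _ (sliceLeft_bijective h)
  -- By `swapMap_comul_iff` this is the only candidate.
  let ρ : C ≃ₗ[k] C := eR.symm.trans eL
  have hρ : ∀ u : Module.Dual k C, ρ (sliceRight η u) = sliceLeft η u := by
    intro u
    change eL (eR.symm (eR u)) = eL u
    rw [eR.symm_apply_apply]
  have hs : swapMap (ρ : C →ₗ[k] C) (comul η) = comul η := swapMap_comul_iff.2 hρ
  have hsurj : ∀ c, ∃ u : Module.Dual k C, sliceRight η u = c := (sliceRight_bijective h).2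
  have hc3 := cycMap_comul₃ hs
  have hc : ∀ u : Module.Dual k C, comul (R := k) (sliceLeft η u) =
      TensorProduct.map (ρ : C →ₗ[k] C) ρ (comul (sliceRight η u)) := by
    intro u
    rw [← rTensor_comul₃, ← lTensor_comul₃]
    -- Rotating twice sends `a ⊗ b ⊗ c` to `c ⊗ ρ a ⊗ ρ b`: slicing the first factor becomes slicing
    -- the last, with `ρ ⊗ ρ` on the others. This is why `ρ` respects the coproduct.
    conv_lhs => rw [← hc3, ← hc3]
    generalize comul₃ (k := k) η = t
    induction t with
    | zero => simp
    | tmul a s =>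
      induction s with
      | zero => simp
      | tmul b c => simp
      | add x y hx hy => simp only [TensorProduct.tmul_add, map_add, hx, hy]
    | add x y hx hy => simp only [map_add, hx, hy]
  have hproj : ∀ i c, c ∈ G.gr i → ρ c ∈ G.gr i := by
    intro i c hi
    -- Every element is a slice of `η`, and slices of `η` have no component above degree `n`.
    by_cases hin : i ≤ n
    · obtain ⟨u, rfl⟩ := hsurj c
      rw [← G.proj_same hi, ← sliceRight_proj hη (show i + (n - i) = n by omega), hρ,
        sliceLeft_proj hη (show i + (n - i) = n by omega)]
      exact G.proj_mem _ _
    · obtain ⟨u, rfl⟩ := hsurj c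
      rw [← G.proj_same hi, proj_sliceRight_of_lt hη (by omega), map_zero]
      exact zero_mem _
  refine ⟨⟨{ ρ with
    counit_comp := LinearMap.ext fun c => ?_
    map_comp_comul := LinearMap.ext fun c => ?_ }, fun {i c} => hproj i c⟩, hs⟩
  · obtain ⟨u, rfl⟩ := hsurj c
    change counit (R := k) (ρ (sliceRight η u)) = _
    -- The two counit axioms give both slices of `η` by `u` the same counit `u(η)`.
    have e1 : counit (R := k) (sliceLeft η u) = u η := by
      have := congrArg (fun t => u (TensorProduct.rid k C t))
        (Coalgebra.lTensor_counit_comul (R := k) η)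
      simp only [TensorProduct.rid_tmul, one_smul] at this
      rw [← this]
      simp only [sliceLeft, LinearMap.coe_mk, AddHom.coe_mk]
      generalize comul (R := k) η = t
      induction t with
      | zero => simp
      | tmul a b => simp [mul_comm]
      | add x y hx hy => simp only [map_add, hx, hy]
    have e2 : counit (R := k) (sliceRight η u) = u η := by
      have := congrArg (fun t => u (TensorProduct.lid k C t))
        (Coalgebra.rTensor_counit_comul (R := k) η)
      simp only [TensorProduct.lid_tmul, one_smul] at this
      rw [← this]
      simp only [sliceRight, LinearMap.coe_mk, AddHom.coe_mk]
      generalize comul (R := k) η = t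
      induction t with
      | zero => simp
      | tmul a b => simp [mul_comm]
      | add x y hx hy => simp only [map_add, hx, hy]
    rw [hρ, e1, e2]
  · obtain ⟨u, rfl⟩ := hsurj c
    change TensorProduct.map (ρ : C →ₗ[k] C) ρ (comul (sliceRight η u)) =
      comul (ρ (sliceRight η u))
    rw [hρ, hc]

variable (G) in
/-- The linear map underlying an automorphism, twisted by the sign `(-1)^{(n+1)|c|}`. -/
def Aut.twist {G : ConnCoalgebra k C} (σ : G.Aut) (n : ℕ) : C →ₗ[k] C :=
  ((σ.comp (G.signAut (n + 1))).toCoalgEquiv.toLinearEquiv : C →ₗ[k] C)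

theorem Aut.twist_apply (σ : G.Aut) (n : ℕ) {i : ℕ} {c : C} (hc : c ∈ G.gr i) :
    σ.twist n c = (-1 : k) ^ ((n + 1) * i) • σ.toCoalgEquiv c := by
  change σ.toCoalgEquiv ((G.signAut (n + 1)).toCoalgEquiv c) = _
  rw [G.signAut_apply _ hc, map_smul]

/-- The exponents differ by `p(p+1)`, which is even. Thus in total degree `n` the Koszul sign is a
function of one degree alone and can be carried by an automorphism. -/
theorem neg_one_pow_mul {p q n : ℕ} (h : p + q = n) :
    (-1 : k) ^ (p * q) = (-1) ^ ((n + 1) * p) := by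
  subst h
  rw [show (p + q + 1) * p = p * q + p * (p + 1) by ring, pow_add,
    (Nat.even_mul_succ_self p).neg_one_pow, mul_one]

theorem dualDeg_apply {p i : ℕ} {u : Module.Dual k C} (hu : u ∈ G.dualDeg p) (h : i ≠ p) {c : C}
    (hc : c ∈ G.gr i) : u c = 0 := hu i h c hc

theorem comp_proj_mem_dualDeg (u : Module.Dual k C) (p : ℕ) : u ∘ₗ G.proj p ∈ G.dualDeg p :=
  fun i hi c hc => by simp [G.proj_ne hc hi]

theorem pairing_eq_zero (hη : η ∈ G.gr n) {p q : ℕ} {u v : Module.Dual k C}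
    (hu : u ∈ G.dualDeg p) (hv : v ∈ G.dualDeg q) (h : p + q ≠ n) : G.pairing η u v = 0 := by
  refine G.comul_hom_ext (F := LinearMap.mul' k k ∘ₗ TensorProduct.map v u) (F' := 0)
    (fun i j hij a ha b hb => ?_) hη
  by_cases hi : i = q
  · simp [dualDeg_apply hu (show j ≠ p by omega) hb]
  · simp [dualDeg_apply hv hi ha]

/-- By `neg_one_pow_mul` the sign in the adjointness relation is part of the twisted map. What
remains is the unsigned identity between the two slices, tested on homogeneous forms one degree at a
time. -/
theorem isNakayama_iff [Module.Finite k C] (hη : η ∈ G.gr n) (σ : G.Aut) :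
    σ.IsNakayama η ↔ swapMap (σ.twist n) (comul η) = comul η := by
  have hmem : ∀ p, ∀ u ∈ G.dualDeg p,
      u ∘ₗ (σ.toCoalgEquiv.toLinearEquiv : C →ₗ[k] C) ∈ G.dualDeg p :=
    fun p u hu i hi c hc => hu i hi _ (σ.map_mem hc)
  -- A form of degree `p` sees only the degree `p` component of the slice, where the twist
  -- multiplies by exactly the sign required.
  have htw : ∀ p q, p + q = n → ∀ u ∈ G.dualDeg p, ∀ v ∈ G.dualDeg q,
      (-1 : k) ^ (p * q) * G.pairing η v (u ∘ₗ (σ.toCoalgEquiv.toLinearEquiv : C →ₗ[k] C)) =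
        u (σ.twist n (sliceRight η v)) := by
    intro p q hpq u hu v hv
    rw [pairing_eq_sliceRight, neg_one_pow_mul hpq]
    refine G.induction_gr (P := fun c => (-1 : k) ^ ((n + 1) * p) *
      (u ∘ₗ (σ.toCoalgEquiv.toLinearEquiv : C →ₗ[k] C)) c = u (σ.twist n c)) (fun i c hc => ?_)
      (by simp) (fun x y hx hy => by rw [map_add, map_add, map_add, mul_add, hx, hy]) _
    rw [σ.twist_apply n hc, map_smul]
    by_cases hi : i = p
    · subst hi; rfl
    · rw [hmem p u hu i hi c hc, hu i hi _ (σ.map_mem hc), smul_zero, mul_zero]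
  constructor
  · intro h
    rw [swapMap_comul_iff]
    intro v
    have hq : ∀ q ≤ n, ∀ v ∈ G.dualDeg q, σ.twist n (sliceRight η v) = sliceLeft η v := by
      intro q hq v hv
      refine Module.forall_dual_apply_eq_zero_iff k _ |>.1 ?_ |> sub_eq_zero.1
      intro u
      have hproj : ∀ c, σ.twist n c ∈ G.gr (n - q) → u (σ.twist n c) =
          (u ∘ₗ G.proj (n - q)) (σ.twist n c) := by
        intro c hc
        rw [LinearMap.comp_apply, G.proj_same hc]
      have hvq : v ∘ₗ G.proj q = v := G.hom_ext_gr fun i c hc => by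
        by_cases hi : i = q
        · subst hi; simp [G.proj_same hc]
        · simp [G.proj_ne hc hi, hv i hi c hc]
      have hR : sliceRight η v ∈ G.gr (n - q) := by
        rw [← hvq, sliceRight_proj hη (show n - q + q = n by omega)]
        exact G.proj_mem _ _
      have hL : sliceLeft η v ∈ G.gr (n - q) := by
        rw [← hvq, sliceLeft_proj hη (show n - q + q = n by omega)]
        exact G.proj_mem _ _
      -- The hypothesis concerns homogeneous forms, so `u` is cut down to the degree `n - q` in
      -- which both vectors lie.
      have hu' := comp_proj_mem_dualDeg (G := G) u (n - q)
      have h1 := h (n - q) q _ hu' v hv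
      rw [htw _ _ (by omega) _ hu' v hv, pairing_eq_sliceLeft] at h1
      have hT : σ.twist n (sliceRight η v) ∈ G.gr (n - q) := by
        rw [σ.twist_apply n hR]
        exact Submodule.smul_mem _ _ (σ.map_mem hR)
      rw [LinearMap.comp_apply, LinearMap.comp_apply, G.proj_same hL, G.proj_same hT] at h1
      rw [map_sub, h1, sub_self]
    -- For general `v`, the degree `i` component of either slice comes from the component of `v` of
    -- degree `n - i`; for `i > n` both components vanish.
    refine sub_eq_zero.1 (G.eq_zero_of_proj fun i => ?_)
    have e1 : ∀ c, G.proj i (σ.twist n c) = σ.twist n (G.proj i c) := by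
      intro c
      refine G.induction_gr (P := fun c => G.proj i (σ.twist n c) = σ.twist n (G.proj i c))
        (fun j c hc => ?_) (by simp) (fun x y hx hy => by simp only [map_add, hx, hy]) c
      rw [σ.twist_apply n hc, G.proj_eq hc, map_smul, G.proj_eq (σ.map_mem hc)]
      split_ifs
      · rw [σ.twist_apply n hc]
      · simp
    by_cases hi : i ≤ n
    · rw [map_sub, e1, ← sliceRight_proj hη (show i + (n - i) = n by omega),
        ← sliceLeft_proj hη (show i + (n - i) = n by omega),
        hq (n - i) (by omega) _ (comp_proj_mem_dualDeg v _), sub_self]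
    · rw [map_sub, e1, proj_sliceRight_of_lt hη (by omega), map_zero, zero_sub, neg_eq_zero]
      refine G.comul_hom_ext
        (F := G.proj i ∘ₗ (TensorProduct.lid k C).toLinearMap ∘ₗ LinearMap.rTensor C v)
        (F' := 0) (fun p q hpq a ha b hb => ?_) hη
      simp [G.proj_ne hb (show q ≠ i by omega)]
  · intro h p q u hu v hv
    rw [swapMap_comul_iff] at h
    by_cases hpq : p + q = n
    · rw [htw p q hpq u hu v hv, h, pairing_eq_sliceLeft]
    · rw [pairing_eq_zero hη hu hv hpq, pairing_eq_zero hη hv (hmem p u hu) (by omega), mul_zero]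

/-- The adjoint of the Nakayama automorphism exists and is unique. -/
theorem exists_isNakayama [Module.Finite k C] (hη : η ∈ G.gr n) (h : G.IsNondegenerate η) :
    ∃ σ : G.Aut, σ.IsNakayama η ∧ ∀ τ : G.Aut, τ.IsNakayama η → τ = σ := by
  obtain ⟨ρ, hρ⟩ := exists_swap hη h
  refine ⟨ρ.comp (G.signAut (n + 1)), (isNakayama_iff hη _).2 ?_, fun τ hτ => ?_⟩
  -- The sign automorphism is an involution, so twisting `ρ` composed with it gives back `ρ`.
  · convert hρ using 2
    congr 1
    refine LinearMap.ext fun c => ?_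
    exact congrArg ρ.toCoalgEquiv (G.signAut_signAut _ c)
  · rw [isNakayama_iff hη, swapMap_comul_iff] at hτ
    rw [swapMap_comul_iff] at hρ
    have e : ∀ c, τ.twist n c = ρ.toCoalgEquiv c := by
      intro c
      obtain ⟨u, rfl⟩ := (sliceRight_bijective h).2 c
      exact (hτ u).trans (hρ u).symm
    have e2 : ∀ c, τ.toCoalgEquiv c = (ρ.comp (G.signAut (n + 1))).toCoalgEquiv c := by
      intro c
      have := e ((G.signAut (n + 1)).toCoalgEquiv c)
      refine Eq.trans ?_ this
      exact (congrArg τ.toCoalgEquiv (G.signAut_signAut _ c)).symm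
    have e3 := CoalgEquiv.ext e2
    cases τ
    simp only at e3
    subst e3
    rfl

/-- Graded form of the invariance of `Δ(η)` under the Nakayama automorphism. -/
theorem comul_swap {σ : G.Aut} (h : swapMap (σ.twist n) (comul η) = comul η) (hη : η ∈ G.gr n)
    {M : Type*} [AddCommGroup M] [Module k M] {F F' : C ⊗[k] C →ₗ[k] M}
    (hF : ∀ p q, p + q = n → ∀ a ∈ G.gr p, ∀ b ∈ G.gr q,
      (-1 : k) ^ (p * q) • F (b ⊗ₜ σ.toCoalgEquiv a) = F' (a ⊗ₜ b)) :
    F (comul η) = F' (comul η) := by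
  -- The coproduct of `η` is rotated on both sides and restored on the right. What remains is a
  -- comparison on `Δ(η)` itself, which may be made on homogeneous tensors of total degree `n`.
  rw [← h]
  conv_rhs => rw [h]
  refine G.comul_hom_ext (F := F ∘ₗ swapMap (σ.twist n)) (fun p q hpq a ha b hb => ?_) hη
  rw [← hF p q hpq a ha b hb, LinearMap.comp_apply, swapMap_tmul, σ.twist_apply n ha,
    TensorProduct.tmul_smul, map_smul, neg_one_pow_mul hpq]

/-- The same principle for three factors: the sign is that of moving `a` past `b ⊗ c`. It supplies
the rotations behind both the closedness of the two-form and the compatibility of contraction with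
the differentials. -/
theorem comul₃_cyc {σ : G.Aut} (h : swapMap (σ.twist n) (comul η) = comul η) (hη : η ∈ G.gr n)
    {M : Type*} [AddCommGroup M] [Module k M] {F F' : C ⊗[k] (C ⊗[k] C) →ₗ[k] M}
    (hF : ∀ p q r, p + q + r = n → ∀ a ∈ G.gr p, ∀ b ∈ G.gr q, ∀ c ∈ G.gr r,
      (-1 : k) ^ (p * (q + r)) • F (b ⊗ₜ (c ⊗ₜ σ.toCoalgEquiv a)) = F' (a ⊗ₜ (b ⊗ₜ c))) :
    F (comul₃ η) = F' (comul₃ η) := by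
  rw [← cycMap_comul₃ h]
  conv_rhs => rw [cycMap_comul₃ h]
  refine G.comul₃_hom_ext (F := F ∘ₗ cycMap (σ.twist n))
    (fun p q r hpq a ha b hb c hc => ?_) hη
  rw [← hF p q r hpq a ha b hb c hc, LinearMap.comp_apply, cycMap_tmul, σ.twist_apply n ha,
    TensorProduct.tmul_smul, TensorProduct.tmul_smul, map_smul,
    neg_one_pow_mul (show p + (q + r) = n by omega)]

/-- A volume element is invariant under the Nakayama automorphism. -/
theorem apply_eq_self {σ : G.Aut} (h : swapMap (σ.twist n) (comul η) = comul η)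
    (hη : η ∈ G.gr n) : σ.toCoalgEquiv η = η := by
  have hinj : Function.Injective (comul (R := k) (A := C)) := fun x y hxy => by
    have hx := congrArg (TensorProduct.lid k C) (Coalgebra.rTensor_counit_comul (R := k) x)
    have hy := congrArg (TensorProduct.lid k C) (Coalgebra.rTensor_counit_comul (R := k) y)
    rw [hxy] at hx
    rw [hx] at hy
    simpa using hy
  -- Swapping twice applies the twisted automorphism to both factors. It therefore fixes `Δ(η)`, and
  -- `η` since `Δ` is injective; on `η` the sign is `(-1)^{(n+1)n} = 1`.
  have e : ∀ t : C ⊗[k] C, swapMap (σ.twist n) (swapMap (σ.twist n) t) =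
      TensorProduct.map (σ.twist n) (σ.twist n) t := by
    intro t
    induction t with
    | zero => simp
    | tmul a b => simp
    | add x y hx hy => simp only [map_add, hx, hy]
  have h2 : σ.twist n η = η := by
    apply hinj
    have := CoalgHomClass.map_comp_comul_apply (σ.comp (G.signAut (n + 1))).toCoalgEquiv η
    refine this.symm.trans ((e _).symm.trans ?_)
    rw [h, h]
  rw [σ.twist_apply n hη, mul_comm, (Nat.even_mul_succ_self n).neg_one_pow, one_smul] at h2
  exact h2

end Frobenius

end ConnCoalgebra

/-! ## Skew derivations of tensor algebras -/

section SkewDerivation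

variable {k V B : Type*} [Field k] [AddCommGroup V] [Module k V] [Ring B] [Algebra k B]
variable (f g : TensorAlgebra k V →ₐ[k] B) (d₀ : V →ₗ[k] B)

/-- The triangular representation of `skewDer`. -/
def skewTri : TensorAlgebra k V →ₐ[k] Module.End k (B × B) :=
  TensorAlgebra.lift k
    { toFun := fun v => tri k (f (TensorAlgebra.ι k v)) (d₀ v) (g (TensorAlgebra.ι k v))
      map_add' := fun r s => by simp only [map_add, tri_add]
      map_smul' := fun c r => by simp only [map_smul, tri_smul, RingHom.id_apply] }

/-- The map `d` with `d (x y) = d x * g y + f x * d y` extending `d₀`. -/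
def skewDer : TensorAlgebra k V →ₗ[k] B :=
  LinearMap.fst k _ _ ∘ₗ LinearMap.applyₗ ((0, 1) : B × B) ∘ₗ (skewTri f g d₀).toLinearMap

theorem skewTri_ι (v : V) : skewTri f g d₀ (TensorAlgebra.ι k v) =
    tri k (f (TensorAlgebra.ι k v)) (d₀ v) (g (TensorAlgebra.ι k v)) := by
  rw [skewTri, TensorAlgebra.lift_ι_apply]; rfl

@[simp] theorem skewDer_ι (v : V) : skewDer f g d₀ (TensorAlgebra.ι k v) = d₀ v := by
  simp [skewDer, skewTri_ι]

/-- Diagonal entries of upper triangular matrices multiply, and the corner entry of a product obeys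
the skew Leibniz rule. An algebra map to such matrices, given freely on generators, is thus the same
as a skew derivation. -/
theorem skewTri_eq (x : TensorAlgebra k V) :
    skewTri f g d₀ x = tri k (f x) (skewDer f g d₀ x) (g x) := by
  induction x using tens_induction with
  | h1 =>
    have : skewDer f g d₀ 1 = 0 := by simp [skewDer]
    simp [tri_one, this]
  | ha x y hx hy => simp only [map_add, hx, hy, tri_add]
  | hs c x hx => simp only [map_smul, hx, tri_smul]
  | hb v x hx =>
    have e : skewDer f g d₀ (TensorAlgebra.ι k v * x) =
        f (TensorAlgebra.ι k v) * skewDer f g d₀ x + d₀ v * g x := by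
      change (skewTri f g d₀ (TensorAlgebra.ι k v * x) (0, 1)).1 = _
      rw [map_mul, hx, skewTri_ι, tri_mul]; simp
    rw [map_mul, hx, skewTri_ι, tri_mul, e, map_mul, map_mul]

theorem skewDer_mul (x y : TensorAlgebra k V) :
    skewDer f g d₀ (x * y) = skewDer f g d₀ x * g y + f x * skewDer f g d₀ y := by
  change (skewTri f g d₀ (x * y) (0, 1)).1 = _
  rw [map_mul, skewTri_eq, skewTri_eq, tri_mul]
  simp [add_comm]

theorem skewDer_one : skewDer f g d₀ 1 = 0 := by simp [skewDer]

end SkewDerivation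

/-! ## The bimodule of one-forms -/

namespace DGAlgebra

section Sandwich

variable {k R : Type*} [Field k] [Ring R] [Algebra k R] {D : DGAlgebra k R}

namespace OneForm

variable {σ : D.Aut}

/-- The map `x ⊗ y ↦ x m y` to one-forms. -/
def sandwich (m : OneForm σ) : R ⊗[k] R →ₗ[k] OneForm σ :=
  TensorProduct.lift (LinearMap.mk₂ k (fun x y => left σ x (right σ y m))
    (fun x x' y => by rw [left_add]) (fun c x y => by rw [left_smul])
    (fun x y y' => by rw [right_add, map_add]) (fun c x y => by rw [right_smul, map_smul]))

@[simp] theorem sandwich_tmul (m : OneForm σ) (x y : R) :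
    sandwich m (x ⊗ₜ y) = left σ x (right σ y m) := by simp [sandwich]

theorem sandwich_one (m : OneForm σ) : sandwich m 1 = m := by
  rw [Algebra.TensorProduct.one_def, sandwich_tmul, right_one, left_one]

theorem left_sandwich (u : R) (m : OneForm σ) (t : R ⊗[k] R) :
    left σ u (sandwich m t) = sandwich m ((u ⊗ₜ[k] 1) * t) := by
  induction t with
  | zero => simp
  | tmul x y => simp [left_mul]
  | add x y hx hy => simp only [map_add, mul_add, hx, hy]

theorem right_sandwich (v : R) (m : OneForm σ) (t : R ⊗[k] R) :
    right σ v (sandwich m t) = sandwich m (t * (1 ⊗ₜ[k] v)) := by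
  induction t with
  | zero => simp
  | tmul x y => simp [right_mul, ← left_right]
  | add x y hx hy => simp only [map_add, add_mul, hx, hy]

theorem left_mem {p q r : ℤ} {u : R} {m : OneForm σ} (hu : u ∈ D.deg p) (hm : m ∈ deg σ q)
    (h : p + q = r) : left σ u m ∈ deg σ r := by
  have hu' : D.parity (σ.hom u) ∈ D.deg p := by
    rw [D.parity_apply (σ.hom_mem hu), Units.smul_def]
    exact zsmul_mem (σ.hom_mem hu) _
  have h1 := D.degT_mul_mem hu' D.one_mem hm.1 (show p + (q - 1) + 0 = r - 1 by omega)
  have h2 := D.degT_mul_mem (σ.hom_mem hu) D.one_mem hm.2 (show p + q + 0 = r by omega)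
  rw [← Algebra.TensorProduct.one_def, mul_one] at h1 h2
  exact ⟨h1, h2⟩

theorem right_mem {p q r : ℤ} {v : R} {m : OneForm σ} (hv : v ∈ D.deg p) (hm : m ∈ deg σ q)
    (h : q + p = r) : right σ v m ∈ deg σ r := by
  have h1 := D.degT_mul_mem D.one_mem hv hm.1 (show 0 + (q - 1) + p = r - 1 by omega)
  have h2 := D.degT_mul_mem D.one_mem hv hm.2 (show 0 + q + p = r by omega)
  rw [← Algebra.TensorProduct.one_def, one_mul] at h1 h2
  exact ⟨h1, h2⟩

theorem sandwich_mem {p q r : ℤ} {t : R ⊗[k] R} {m : OneForm σ} (ht : t ∈ D.degT p)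
    (hm : m ∈ deg σ q) (h : p + q = r) : sandwich m t ∈ deg σ r := by
  suffices h' : D.degT p ≤ (deg σ r).comap (sandwich m) from h' ht
  refine iSup_le fun a => Submodule.map₂_le.2 fun x hx y hy => ?_
  rw [Submodule.mem_comap, TensorProduct.mk_apply, sandwich_tmul]
  exact left_mem hx (right_mem hy hm rfl) (by omega)

end OneForm

theorem DDer.apply_sandwich {p : ℤ} (Θ : D.DDer p) (m : OneForm (Aut.refl D)) (t : R ⊗[k] R) :
    Θ.1 (OneForm.sandwich m t) =
      TensorProduct.lift (LinearMap.mk₂ k (fun x y => (D.parityPow p x ⊗ₜ[k] 1) * Θ.1 m *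
        ((1 : R) ⊗ₜ[k] y))
        (fun x x' y => by simp [TensorProduct.add_tmul, add_mul])
        (fun c x y => by simp [← TensorProduct.smul_tmul'])
        (fun x y y' => by simp [TensorProduct.tmul_add, mul_add])
        (fun c x y => by simp)) t := by
  induction t with
  | zero => simp
  | tmul x y => simp [Θ.2.2.1, Θ.2.2.2, mul_assoc]
  | add x y hx hy => simp only [map_add, hx, hy]

/-- A double derivation with scalar value on `m` reads off the coefficient of `m` up to an
invertible sign. Applied to dual double derivations, this yields uniqueness and degrees of
coefficients. -/
theorem DDer.apply_sandwich_of_eq_smul_one {p : ℤ} (Θ : D.DDer p) {m : OneForm (Aut.refl D)}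
    {c : k} (h : Θ.1 m = c • 1) (t : R ⊗[k] R) : Θ.1 (OneForm.sandwich m t) =
      c • Algebra.TensorProduct.map (D.parityPow p) (AlgHom.id k R) t := by
  rw [apply_sandwich, h]
  induction t with
  | zero => simp
  | tmul x y => simp
  | add x y hx hy => simp only [map_add, hx, hy, smul_add]

theorem map_parityPow_map_parityPow (p : ℤ) (t : R ⊗[k] R) :
    Algebra.TensorProduct.map (D.parityPow p) (AlgHom.id k R)
      (Algebra.TensorProduct.map (D.parityPow p) (AlgHom.id k R) t) = t := by
  induction t with
  | zero => simp
  | tmul x y => simp [D.parityPow_self]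
  | add x y hx hy => simp only [map_add, hx, hy]

theorem map_parityPow_mem (p : ℤ) {q : ℤ} {t : R ⊗[k] R} (ht : t ∈ D.degT q) :
    Algebra.TensorProduct.map (D.parityPow p) (AlgHom.id k R) t ∈ D.degT q := by
  suffices h' : D.degT q ≤ (D.degT q).comap
    (Algebra.TensorProduct.map (D.parityPow p) (AlgHom.id k R)).toLinearMap from h' ht
  refine iSup_le fun a => Submodule.map₂_le.2 fun x hx y hy => ?_
  exact D.tmul_mem_degT (D.parityPow_mem hx) hy (by ring)

end Sandwich

end DGAlgebra

/-! ### Generators of the one-forms on the cobar construction -/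

namespace ConnCoalgebra

open Coalgebra DGAlgebra

variable {k C : Type*} [Field k] [AddCommGroup C] [Module k C] [Coalgebra k C]
variable {G : ConnCoalgebra k C}

theorem dGen_apply (c : C) :
    G.dGen c = counit (R := k) c • dOne G.cobarDG + dFun G.cobarDG (G.bar c) := by
  simp [dGen]

theorem dGen_one : G.dGen G.one = dOne G.cobarDG := by
  simp [dGen_apply, G.counit_one, bar_one]

theorem bar_red (c : C) : G.bar (G.red c : C) = G.bar c := by
  rw [coe_red, map_sub, map_smul, bar_one, smul_zero, sub_zero]

theorem dGen_red (c : C) : G.dGen (G.red c : C) = dFun G.cobarDG (G.bar c) := by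
  have h : counit (R := k) (G.red c : C) = 0 := (G.red c).2
  rw [dGen_apply, h, zero_smul, zero_add, bar_red]

/-- The generator of `c` has degree `|c| - 1` and `d` adds one. For `c = 1` the form `d𝟏` has degree
zero, so the rule is uniform. -/
theorem dGen_mem {i : ℕ} {c : C} (hc : c ∈ G.gr i) :
    G.dGen c ∈ OneForm.deg (Aut.refl G.cobarDG) i := by
  have h1 : ∀ {q : ℤ} {r : G.Cobar}, r ∈ G.cobarDG.deg q →
      dFun G.cobarDG r ∈ OneForm.deg (Aut.refl G.cobarDG) (q + 1) := by
    intro q r hr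
    refine ⟨?_, zero_mem _⟩
    change r ⊗ₜ[k] 1 - 1 ⊗ₜ[k] r ∈ G.cobarDG.degT (q + 1 - 1)
    exact sub_mem (G.cobarDG.tmul_mem_degT hr G.cobarDG.one_mem (by ring))
      (G.cobarDG.tmul_mem_degT G.cobarDG.one_mem hr (by ring))
  rw [dGen_apply]
  refine add_mem ?_ ?_
  · rcases eq_or_ne i 0 with rfl | hi
    · exact Submodule.smul_mem _ _
        ⟨zero_mem _, G.cobarDG.tmul_mem_degT G.cobarDG.one_mem G.cobarDG.one_mem (by simp)⟩
    · rw [G.counit_eq_zero hi hc, zero_smul]; exact zero_mem _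
  · have := h1 (show G.bar c ∈ G.cobarDG.deg _ from G.bar_mem hc)
    rwa [sub_add_cancel] at this

/-- The one-forms on the cobar construction are generated, as a bimodule, by the forms `dc`. -/
theorem oneForm_span (S : Submodule k (OneForm (Aut.refl G.cobarDG))) (h : ∀ c, G.dGen c ∈ S)
    (hl : ∀ u, ∀ m ∈ S, OneForm.left _ u m ∈ S) (hr : ∀ u, ∀ m ∈ S, OneForm.right _ u m ∈ S)
    (m : OneForm (Aut.refl G.cobarDG)) : m ∈ S := by
  have hd : ∀ r : G.Cobar, dFun G.cobarDG r ∈ S := by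
    intro r
    induction r using G.cobar_induction with
    | h1 =>
      have : dFun G.cobarDG 1 = 0 := by apply OneForm.ext' <;> simp
      rw [this]; exact zero_mem _
    | ha x y hx hy => rw [map_add]; exact add_mem hx hy
    | hs c x hx => rw [map_smul]; exact Submodule.smul_mem _ _ hx
    | hb c x hx =>
      rw [dFun_mul, ← dGen_red]
      exact add_mem (hr _ _ (h _)) (hl _ _ hx)
  have h0 : ∀ t : G.Cobar ⊗[k] G.Cobar, ((0, t) : OneForm (Aut.refl G.cobarDG)) ∈ S := by
    intro t
    induction t with
    | zero => exact zero_mem _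
    | tmul x y =>
      have e : ((0, x ⊗ₜ y) : OneForm (Aut.refl G.cobarDG)) =
          OneForm.right _ y (OneForm.left _ x (dOne G.cobarDG)) := by
        apply OneForm.ext' <;> simp [dOne, Aut.hom_refl]
      rw [e, ← dGen_one]
      exact hr _ _ (hl _ _ (h _))
    | add x y hx hy => simpa using add_mem hx hy
  -- The sum of the `± x dy` has suspended part `∑ xy ⊗ 1 - ∑ x ⊗ y`. On the kernel of the product
  -- the first term disappears, so every suspended element is minus such a sum.
  have key : ∀ t : G.Cobar ⊗[k] G.Cobar, ∃ m' ∈ S,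
      (m'.1 : G.Cobar ⊗[k] G.Cobar) = LinearMap.mul' k G.Cobar t ⊗ₜ 1 - t ∧ m'.2 = 0 := by
    intro t
    induction t with
    | zero => exact ⟨0, zero_mem _, by simp, rfl⟩
    | tmul x y =>
      refine ⟨OneForm.left _ (G.cobarDG.parity x) (dFun G.cobarDG y), hl _ _ (hd y), ?_, by simp⟩
      simp [Aut.hom_refl, DGAlgebra.parity_parity, mul_sub]
    | add x y hx hy =>
      obtain ⟨a, ha, ha1, ha2⟩ := hx
      obtain ⟨b, hb, hb1, hb2⟩ := hy
      refine ⟨a + b, add_mem ha hb, ?_, by simp [ha2, hb2]⟩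
      simp only [Prod.fst_add, Submodule.coe_add, ha1, hb1, map_add, TensorProduct.add_tmul]
      abel
  obtain ⟨m', h1, h2, h3⟩ := key m.1
  have e : m = -m' + (0, m.2) := by
    apply OneForm.ext'
    · simp [h2, Forms.mul'_omega]
    · simp [h3]
  rw [e]
  exact add_mem (neg_mem h1) (h0 _)

/-- A double derivation is determined by its values on the forms `dc`. -/
theorem dder_ext {p : ℤ} {Θ Θ' : G.cobarDG.DDer p} (h : ∀ c, Θ.1 (G.dGen c) = Θ'.1 (G.dGen c)) :
    Θ = Θ' := by
  refine Subtype.ext (LinearMap.ext fun m => ?_)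
  suffices hm : m ∈ LinearMap.ker (Θ.1 - Θ'.1) from sub_eq_zero.1 hm
  refine oneForm_span _ (fun c => ?_) (fun u m hm => ?_) (fun u m hm => ?_) m
  · simp [h]
  · rw [LinearMap.mem_ker, LinearMap.sub_apply] at hm ⊢
    rw [Θ.2.2.1, Θ'.2.2.1, ← mul_sub, hm, mul_zero]
  · rw [LinearMap.mem_ker, LinearMap.sub_apply] at hm ⊢
    rw [Θ.2.2.2, Θ'.2.2.2, ← sub_mul, hm, zero_mul]

/-! ### Double derivations with prescribed values on the generators -/

section Extension

variable (p : ℤ) (f : C →ₗ[k] G.Cobar ⊗[k] G.Cobar)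

/-- The skew derivation `R → R ⊗ R` extending `f`. -/
def dderFun : G.Cobar →ₗ[k] G.Cobar ⊗[k] G.Cobar :=
  -- This map stands for `Θ ∘ d`, of degree `p + 1`; only the parity matters, so `p - 1` gives the
  -- same sign.
  skewDer (Algebra.TensorProduct.includeLeft.comp (G.cobarDG.parityPow (p - 1)))
    Algebra.TensorProduct.includeRight (f ∘ₗ G.Red.subtype)

theorem dderFun_bar (c : C) : dderFun p f (G.bar c) = f (G.red c) := by
  rw [← bar_red, bar_coe, dderFun, skewDer_ι]; rfl

theorem dderFun_mul (x y : G.Cobar) : dderFun p f (x * y) = dderFun p f x * (1 ⊗ₜ y) +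
    (G.cobarDG.parityPow (p - 1) x ⊗ₜ 1) * dderFun p f y := skewDer_mul _ _ _ x y

theorem dderFun_one : dderFun p f 1 = 0 := skewDer_one _ _ _

/-- The map `x ⊗ y ↦ (-1)^{(p-1)|x|} x D(y)`. -/
def dderLeft : G.Cobar ⊗[k] G.Cobar →ₗ[k] G.Cobar ⊗[k] G.Cobar :=
  LinearMap.mul' k _ ∘ₗ TensorProduct.map
    (Algebra.TensorProduct.includeLeft.comp (G.cobarDG.parityPow (p - 1)) :
      G.Cobar →ₐ[k] G.Cobar ⊗[k] G.Cobar).toLinearMap (dderFun p f)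

theorem dderLeft_tmul (x y : G.Cobar) : dderLeft p f (x ⊗ₜ y) =
    (G.cobarDG.parityPow (p - 1) x ⊗ₜ 1) * dderFun p f y := rfl

/-- The map `x ⊗ y ↦ (-1)^{p|x|} x f(1) y`. -/
def dderOne : G.Cobar ⊗[k] G.Cobar →ₗ[k] G.Cobar ⊗[k] G.Cobar :=
  LinearMap.mul' k _ ∘ₗ TensorProduct.map
    (LinearMap.mulRight k (f G.one) ∘ₗ
      (Algebra.TensorProduct.includeLeft.comp (G.cobarDG.parityPow p) :
      G.Cobar →ₐ[k] G.Cobar ⊗[k] G.Cobar).toLinearMap)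
    (Algebra.TensorProduct.includeRight : G.Cobar →ₐ[k] G.Cobar ⊗[k] G.Cobar).toLinearMap

theorem dderOne_tmul (x y : G.Cobar) : dderOne p f (x ⊗ₜ y) =
    (G.cobarDG.parityPow p x ⊗ₜ 1) * f G.one * (1 ⊗ₜ y) := rfl

/-- The map on one-forms with `dc ↦ f c`. -/
def dderMap : OneForm (Aut.refl G.cobarDG) →ₗ[k] G.Cobar ⊗[k] G.Cobar :=
  -- If `∑ xy = 0`, then `Σ(∑ x ⊗ y) = -∑ (-1)^{|x|} x dy`. This accounts for the minus sign, and
  -- `(-1)^{|x|}` together with the sign `(-1)^{p|x|}` of moving `Θ` past `x` gives the exponent `p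
  -- - 1` in `dderLeft`.
  LinearMap.coprod (-(dderLeft p f ∘ₗ (omega (Aut.refl G.cobarDG)).subtype)) (dderOne p f)

theorem dderMap_apply (m : OneForm (Aut.refl G.cobarDG)) :
    dderMap p f m = - dderLeft p f m.1 + dderOne p f m.2 := rfl

theorem dderMap_dGen (c : C) : dderMap p f (G.dGen c) = f c := by
  have h1 : dderMap p f (dOne G.cobarDG) = f G.one := by
    rw [dderMap_apply]
    simp [dOne, Algebra.TensorProduct.one_def, dderOne_tmul]
    simp [← Algebra.TensorProduct.one_def]
  have h2 : dderMap p f (dFun G.cobarDG (G.bar c)) = f (G.red c) := by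
    rw [dderMap_apply, dFun_fst, dFun_snd, map_sub, dderLeft_tmul, dderLeft_tmul, dderFun_one,
      dderFun_bar, map_one, ← Algebra.TensorProduct.one_def]
    simp
  rw [dGen_apply, map_add, map_smul, h1, h2, coe_red, map_sub, map_smul]
  simp

theorem dderFun_mem (hf : ∀ i, ∀ c ∈ G.gr i, f c ∈ G.cobarDG.degT (i + p)) {q : ℤ} {x : G.Cobar}
    (hx : x ∈ G.cobarDG.deg q) : dderFun p f x ∈ G.cobarDG.degT (q + 1 + p) := by
  suffices h' : G.cobarDeg q ≤ (G.cobarDG.degT (q + 1 + p)).comap (dderFun p f) from h' hx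
  clear hx x
  refine Submodule.span_le.2 fun z hz => ?_
  rw [SetLike.mem_coe, Submodule.mem_comap]
  induction hz with
  | one => rw [dderFun_one]; exact zero_mem _
  | @bar_mul i q c x hc hx ih =>
    have hred : (G.red c : C) = c := by
      rw [coe_red, G.counit_pos hc, zero_smul, sub_zero]
    have hx' : x ∈ G.cobarDG.deg q := Submodule.subset_span hx
    have hb : G.bar c ∈ G.cobarDG.deg i := G.cobarDeg_bar hc
    rw [dderFun_mul, dderFun_bar, hred]
    refine add_mem ?_ ?_
    · have := G.cobarDG.degT_mul_mem G.cobarDG.one_mem hx' (hf _ c hc)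
        (show 0 + (((i + 1 : ℕ) : ℤ) + p) + q = i + q + 1 + p by push_cast; ring)
      rwa [← Algebra.TensorProduct.one_def, one_mul] at this
    · have := G.cobarDG.degT_mul_mem (G.cobarDG.parityPow_mem (p := p - 1) hb) G.cobarDG.one_mem ih
        (show i + (q + 1 + p) + 0 = i + q + 1 + p by ring)
      rwa [← Algebra.TensorProduct.one_def, mul_one] at this

theorem dderMap_mem (hf : ∀ i, ∀ c ∈ G.gr i, f c ∈ G.cobarDG.degT (i + p)) :
    dderMap p f ∈ G.cobarDG.DDer p := by
  refine ⟨fun q m hm => ?_, fun u m => ?_, fun v m => ?_⟩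
  · rw [dderMap_apply]
    refine add_mem (neg_mem ?_) ?_
    · suffices h' : G.cobarDG.degT (q - 1) ≤ (G.cobarDG.degT (q + p)).comap (dderLeft p f) from
        h' hm.1
      refine iSup_le fun a => Submodule.map₂_le.2 fun x hx y hy => ?_
      rw [Submodule.mem_comap, TensorProduct.mk_apply, dderLeft_tmul]
      have := G.cobarDG.degT_mul_mem (G.cobarDG.parityPow_mem (p := p - 1) hx) G.cobarDG.one_mem
        (dderFun_mem p f hf hy) (show a + (q - 1 - a + 1 + p) + 0 = q + p by ring)
      rwa [← Algebra.TensorProduct.one_def, mul_one] at this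
    · suffices h' : G.cobarDG.degT q ≤ (G.cobarDG.degT (q + p)).comap (dderOne p f) from h' hm.2
      refine iSup_le fun a => Submodule.map₂_le.2 fun x hx y hy => ?_
      rw [Submodule.mem_comap, TensorProduct.mk_apply, dderOne_tmul]
      exact G.cobarDG.degT_mul_mem (G.cobarDG.parityPow_mem hx) hy (hf 0 _ G.one_mem_gr)
        (by push_cast; ring)
  · have e1 : ∀ t, dderLeft p f ((G.cobarDG.parity u ⊗ₜ[k] 1) * t) =
        (G.cobarDG.parityPow p u ⊗ₜ[k] 1) * dderLeft p f t := by
      intro t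
      induction t with
      | zero => simp
      | tmul x y =>
        have : G.cobarDG.parityPow (p - 1) (G.cobarDG.parity u) = G.cobarDG.parityPow p u := by
          rw [parityPow_sub_one]
          unfold DGAlgebra.parityPow; split_ifs <;> simp [DGAlgebra.parity_parity]
        rw [Algebra.TensorProduct.tmul_mul_tmul, one_mul, dderLeft_tmul, dderLeft_tmul, map_mul,
          this, ← mul_assoc, Algebra.TensorProduct.tmul_mul_tmul, one_mul]
      | add x y hx hy => simp only [mul_add, map_add, hx, hy]
    have e2 : ∀ t, dderOne p f ((u ⊗ₜ[k] 1) * t) =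
        (G.cobarDG.parityPow p u ⊗ₜ[k] 1) * dderOne p f t := by
      intro t
      induction t with
      | zero => simp
      | tmul x y =>
        rw [Algebra.TensorProduct.tmul_mul_tmul, one_mul, dderOne_tmul, dderOne_tmul, map_mul,
          ← mul_assoc, ← mul_assoc, Algebra.TensorProduct.tmul_mul_tmul, one_mul]
      | add x y hx hy => simp only [mul_add, map_add, hx, hy]
    rw [dderMap_apply, dderMap_apply, OneForm.left_fst, OneForm.left_snd, Aut.hom_refl, e1, e2,
      mul_add, mul_neg]
  -- The Leibniz rule leaves an extra term with the factor `∑ xy`. Right linearity therefore holds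
  -- only on the kernel of the product, which is where the map is used.
  · have e1 : ∀ t, dderLeft p f (t * (1 ⊗ₜ[k] v)) = dderLeft p f t * (1 ⊗ₜ[k] v) +
        (G.cobarDG.parityPow (p - 1) (LinearMap.mul' k _ t) ⊗ₜ[k] 1) * dderFun p f v := by
      intro t
      induction t with
      | zero => simp
      | tmul x y =>
        rw [Algebra.TensorProduct.tmul_mul_tmul, mul_one, dderLeft_tmul, dderLeft_tmul,
          dderFun_mul, mul_add, LinearMap.mul'_apply, map_mul, ← mul_assoc, ← mul_assoc,
          Algebra.TensorProduct.tmul_mul_tmul, one_mul]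
      | add x y hx hy =>
        simp only [add_mul, map_add, hx, hy, TensorProduct.add_tmul]; abel
    have e2 : ∀ t, dderOne p f (t * (1 ⊗ₜ[k] v)) = dderOne p f t * (1 ⊗ₜ[k] v) := by
      intro t
      induction t with
      | zero => simp
      | tmul x y =>
        rw [Algebra.TensorProduct.tmul_mul_tmul, mul_one, dderOne_tmul, dderOne_tmul,
          mul_assoc (_ * f G.one), Algebra.TensorProduct.tmul_mul_tmul, one_mul]
      | add x y hx hy => simp only [add_mul, map_add, hx, hy]
    rw [dderMap_apply, dderMap_apply, OneForm.right_fst, OneForm.right_snd, e1, e2,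
      Forms.mul'_omega, map_zero, TensorProduct.zero_tmul, zero_mul, add_zero, add_mul, neg_mul]

/-- A homogeneous linear map `C → R ⊗ R` extends uniquely to a double derivation. -/
theorem exists_dder (hf : ∀ i, ∀ c ∈ G.gr i, f c ∈ G.cobarDG.degT (i + p)) :
    ∃ Θ : G.cobarDG.DDer p, ∀ c, Θ.1 (G.dGen c) = f c :=
  ⟨⟨_, dderMap_mem p f hf⟩, dderMap_dGen p f⟩

end Extension

/-! ## One-forms are free over the coalgebra -/

section Free

variable {ι : Type*} [Fintype ι] (b : Module.Basis ι k C) (d : ι → ℕ)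

omit [Fintype ι] in
theorem repr_eq_zero_of_mem (hb : ∀ i, b i ∈ G.gr (d i)) {j : ℕ} {c : C} (hc : c ∈ G.gr j)
    {i : ι} (hi : d i ≠ j) : b.repr c i = 0 := by
  have h : b.coord i ∘ₗ G.proj j = 0 := b.ext fun l => by
    by_cases hl : d l = j
    · have hli : l ≠ i := fun h => hi (h ▸ hl)
      rw [LinearMap.comp_apply, G.proj_same (hl ▸ hb l)]
      simp [hli]
    · rw [LinearMap.comp_apply, G.proj_ne (hb l) hl]
      simp
  have := LinearMap.congr_fun h c
  rw [LinearMap.comp_apply, G.proj_same hc] at this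
  exact this

omit [Fintype ι] in
/-- The double derivations dual to the basis `d(b i)` of the one-forms. -/
theorem exists_dual_dder (hb : ∀ i, b i ∈ G.gr (d i)) (i : ι) :
    ∃ Θ : G.cobarDG.DDer (-(d i : ℤ)), ∀ c, Θ.1 (G.dGen c) = b.repr c i • 1 := by
  refine exists_dder (-(d i : ℤ)) (LinearMap.toSpanSingleton k _ 1 ∘ₗ b.coord i) fun j c hc => ?_
  change b.repr c i • (1 : G.Cobar ⊗[k] G.Cobar) ∈ _
  by_cases hi : d i = j
  · refine Submodule.smul_mem _ _ (G.cobarDG.tmul_mem_degT G.cobarDG.one_mem G.cobarDG.one_mem ?_)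
    omega
  · rw [repr_eq_zero_of_mem b d hb hc hi, zero_smul]; exact zero_mem _

/-- Applying the double derivation dual to `b i` isolates `t i`, up to a sign map which is its own
inverse. -/
theorem sum_sandwich_injective (hb : ∀ i, b i ∈ G.gr (d i)) (t : ι → G.Cobar ⊗[k] G.Cobar)
    (h : ∑ i, OneForm.sandwich (G.dGen (b i)) (t i) = 0) (i : ι) : t i = 0 := by
  classical
  obtain ⟨Θ, hΘ⟩ := exists_dual_dder b d hb i
  have h1 := congrArg Θ.1 h
  rw [map_sum, map_zero, Finset.sum_congr rfl fun j _ =>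
    DDer.apply_sandwich_of_eq_smul_one Θ (hΘ (b j)) (t j)] at h1
  simp only [b.repr_self, Finsupp.single_apply, ite_smul, one_smul, zero_smul,
    Finset.sum_ite_eq', Finset.mem_univ, if_true] at h1
  rw [← map_parityPow_map_parityPow (D := G.cobarDG) (-(d i : ℤ)) (t i), h1, map_zero]

/-- The combinations form a sub-bimodule containing the generators, hence everything. The degrees of
the coefficients follow because the dual double derivation, of degree `-d i`, extracts the `i`-th
one. -/
theorem exists_sum_sandwich (hb : ∀ i, b i ∈ G.gr (d i)) {q : ℤ}
    {m : OneForm (Aut.refl G.cobarDG)} (hm : m ∈ OneForm.deg _ q) :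
    ∃ t : ι → G.Cobar ⊗[k] G.Cobar, (∀ i, t i ∈ G.cobarDG.degT (q - d i)) ∧
      m = ∑ i, OneForm.sandwich (G.dGen (b i)) (t i) := by
  classical
  let T : (ι → G.Cobar ⊗[k] G.Cobar) →ₗ[k] OneForm (Aut.refl G.cobarDG) :=
    ∑ i, OneForm.sandwich (G.dGen (b i)) ∘ₗ LinearMap.proj i
  have hT : ∀ t, T t = ∑ i, OneForm.sandwich (G.dGen (b i)) (t i) := fun t => by simp [T]
  have hmem : m ∈ LinearMap.range T := by
    refine oneForm_span (LinearMap.range T) (fun c => ?_) ?_ ?_ m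
    · refine ⟨fun i => b.repr c i • 1, ?_⟩
      simp only [hT, map_smul, OneForm.sandwich_one]
      simp only [← map_smul]
      rw [← map_sum, b.sum_repr]
    · rintro u _ ⟨t, rfl⟩
      refine ⟨fun i => (u ⊗ₜ[k] 1) * t i, ?_⟩
      rw [hT, hT, map_sum]
      simp [OneForm.left_sandwich]
    · rintro u _ ⟨t, rfl⟩
      refine ⟨fun i => t i * (1 ⊗ₜ[k] u), ?_⟩
      rw [hT, hT, map_sum]
      simp [OneForm.right_sandwich]
  obtain ⟨t, rfl⟩ := hmem
  refine ⟨t, fun i => ?_, hT t⟩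
  obtain ⟨Θ, hΘ⟩ := exists_dual_dder b d hb i
  have h1 := Θ.2.1 q _ hm
  rw [hT, map_sum, Finset.sum_congr rfl fun j _ =>
    DDer.apply_sandwich_of_eq_smul_one Θ (hΘ (b j)) (t j)] at h1
  simp only [b.repr_self, Finsupp.single_apply, ite_smul, one_smul, zero_smul,
    Finset.sum_ite_eq', Finset.mem_univ, if_true] at h1
  rw [← map_parityPow_map_parityPow (D := G.cobarDG) (-(d i : ℤ)) (t i), sub_eq_add_neg]
  exact map_parityPow_mem _ h1

/-- Bases of the components are collected into one of `C`; the index remembers the degree as its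
first entry. -/
theorem exists_homogeneous_basis [Module.Finite k C] {κ : ℕ → Type*}
    (v : ∀ i, Module.Basis (κ i) k (G.gr i)) :
    ∃ (_ : Fintype (Σ i, κ i)) (b : Module.Basis (Σ i, κ i) k C), ∀ i, b i ∈ G.gr i.1 := by
  have : Finite (Σ i, κ i) := Module.Finite.finite_basis (G.isInternal.collectedBasis v)
  exact ⟨Fintype.ofFinite _, G.isInternal.collectedBasis v, G.isInternal.collectedBasis_mem v⟩

end Free

end ConnCoalgebra

/-! ## Signs -/

section Signs

variable (k : Type*) [Field k]

/-- The sign `(-1)^a` as an element of `k`. -/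
def sgn (a : ℤ) : k := ((a.negOnePow : ℤ) : k)

variable {k}

theorem negOnePow_smul {M : Type*} [AddCommGroup M] [Module k M] (a : ℤ) (x : M) :
    a.negOnePow • x = sgn k a • x := by
  rw [Units.smul_def, sgn, Int.cast_smul_eq_zsmul]

theorem sgn_mul_sgn (a b : ℤ) : sgn k a * sgn k b = sgn k (a + b) := by
  simp [sgn, Int.negOnePow_add]

/-- Sign comparisons are reduced to this: both sides are collected into a single exponent, and half
the difference of the exponents is exhibited. -/
theorem sgn_congr {a b : ℤ} (h : Even (a - b)) : sgn k a = sgn k b := by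
  rw [sgn, sgn, (Int.negOnePow_eq_iff a b).2 h]

theorem sgn_even {a : ℤ} (h : Even a) : sgn k a = 1 := by simp [sgn, Int.negOnePow_even _ h]

theorem sgn_odd {a : ℤ} (h : Odd a) : sgn k a = -1 := by simp [sgn, Int.negOnePow_odd _ h]

theorem neg_one_pow_eq_sgn (n : ℕ) : (-1 : k) ^ n = sgn k n := by
  rcases Nat.even_or_odd n with h | h
  · rw [h.neg_one_pow, sgn_even (by exact_mod_cast h)]
  · rw [h.neg_one_pow, sgn_odd (by exact_mod_cast h)]

end Signs

namespace DGAlgebra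

variable {k R : Type*} [Field k] [Ring R] [Algebra k R] {D : DGAlgebra k R}

theorem parity_eq_sgn {p : ℤ} {x : R} (hx : x ∈ D.deg p) : D.parity x = sgn k p • x := by
  rw [D.parity_apply hx, negOnePow_smul (k := k)]

theorem parityPow_eq_sgn (p : ℤ) {a : ℤ} {x : R} (hx : x ∈ D.deg a) :
    D.parityPow p x = sgn k (p * a) • x := by
  rw [D.parityPow_apply hx, negOnePow_smul (k := k)]

theorem degT_hom_ext {M : Type*} [AddCommGroup M] [Module k M] {F F' : R ⊗[k] R →ₗ[k] M} {q : ℤ}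
    (h : ∀ a b, a + b = q → ∀ x ∈ D.deg a, ∀ y ∈ D.deg b, F (x ⊗ₜ y) = F' (x ⊗ₜ y))
    {t : R ⊗[k] R} (ht : t ∈ D.degT q) : F t = F' t := by
  have h1 : D.degT q ≤ LinearMap.ker (F - F') := by
    refine iSup_le fun a => Submodule.map₂_le.2 fun x hx y hy => ?_
    rw [LinearMap.mem_ker, LinearMap.sub_apply, sub_eq_zero]
    exact h a (q - a) (by ring) x hx y hy
  have := h1 ht
  rwa [LinearMap.mem_ker, LinearMap.sub_apply, sub_eq_zero] at this

variable (D) in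
theorem tensor_hom_ext {M : Type*} [AddCommGroup M] [Module k M] {F F' : R ⊗[k] R →ₗ[k] M}
    (h : ∀ a b, ∀ x ∈ D.deg a, ∀ y ∈ D.deg b, F (x ⊗ₜ y) = F' (x ⊗ₜ y)) : F = F' := by
  refine LinearMap.ext fun t => ?_
  have ht : t ∈ ⨆ q, D.degT q := by rw [iSup_degT]; trivial
  exact Submodule.iSup_induction (motive := fun t => F t = F' t) _ ht
    (fun q t ht => degT_hom_ext (fun a b _ => h a b) ht) (by simp)
    (fun x y hx hy => by rw [map_add, map_add, hx, hy])

/-! ## The signed swap -/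

section Swap

variable (D)

/-- The map `x ⊗ y ↦ (-1)^{|x||y|} y ⊗ x`. -/
def braid : R ⊗[k] R →ₗ[k] R ⊗[k] R :=
  (TensorProduct.comm k R R).toLinearMap ∘ₗ
    -- The two summands project `y` to its even and odd parts; only in the second is the sign of `x`
    -- inserted.
    (TensorProduct.map LinearMap.id
        ((2⁻¹ : k) • (LinearMap.id + D.parity.toLinearMap)) +
      TensorProduct.map D.parity.toLinearMap
        ((2⁻¹ : k) • (LinearMap.id - D.parity.toLinearMap)))

variable {D} [CharZero k]

theorem inv_two_smul_add_self {M : Type*} [AddCommGroup M] [Module k M] (x : M) :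
    (2⁻¹ : k) • (x + x) = x := by
  rw [← two_smul k x, smul_smul, inv_mul_cancel₀ two_ne_zero, one_smul]

theorem braid_tmul {a b : ℤ} {x y : R} (hx : x ∈ D.deg a) (hy : y ∈ D.deg b) :
    D.braid (x ⊗ₜ y) = sgn k (a * b) • y ⊗ₜ[k] x := by
  simp only [braid, LinearMap.comp_apply, LinearMap.add_apply, TensorProduct.map_tmul,
    LinearMap.id_apply, LinearMap.smul_apply, LinearMap.sub_apply, AlgHom.toLinearMap_apply,
    parity_eq_sgn hx, parity_eq_sgn hy]
  rcases Int.even_or_odd b with h | h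
  · rw [sgn_even h, sgn_even (h.mul_left a)]
    simp only [one_smul, sub_self, smul_zero, TensorProduct.tmul_zero, add_zero,
      inv_two_smul_add_self]
    simp
  · have e : sgn k (a * b) = sgn k a := by
      obtain ⟨c, rfl⟩ := h
      exact sgn_congr ⟨a * c, by ring⟩
    rw [sgn_odd h, e]
    simp only [neg_smul, one_smul, sub_neg_eq_add, add_neg_cancel, smul_zero,
      TensorProduct.tmul_zero, zero_add, inv_two_smul_add_self]
    simp [TensorProduct.tmul_smul]

theorem braid_braid (t : R ⊗[k] R) : D.braid (D.braid t) = t := by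
  have : D.braid ∘ₗ D.braid = LinearMap.id := D.tensor_hom_ext fun a b x hx y hy => by
    rw [LinearMap.comp_apply, braid_tmul hx hy, map_smul, braid_tmul hy hx, smul_smul,
      sgn_mul_sgn, sgn_even ⟨a * b, by ring⟩, one_smul, LinearMap.id_apply]
  exact LinearMap.congr_fun this t

theorem braid_mem {q : ℤ} {t : R ⊗[k] R} (ht : t ∈ D.degT q) : D.braid t ∈ D.degT q := by
  suffices h' : D.degT q ≤ (D.degT q).comap D.braid from h' ht
  refine iSup_le fun a => Submodule.map₂_le.2 fun x hx y hy => ?_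
  rw [Submodule.mem_comap, TensorProduct.mk_apply, braid_tmul hx hy]
  exact Submodule.smul_mem _ _ (D.tmul_mem_degT hy hx (by ring))

/-- The map `x ⊗ y ↦ (-1)^{|x|(|y| + j)} y ⊗ σ(x)`. -/
def twistedSwap (σ : D.Aut) (j : ℤ) : R ⊗[k] R →ₗ[k] R ⊗[k] R :=
  -- The shift by `j` is the sign of moving `x` past a one-form of degree `j` that will stand
  -- between `y` and `σ(x)`.
  (Algebra.TensorProduct.map (AlgHom.id k R) σ.hom).toLinearMap ∘ₗ D.braid ∘ₗ
    (Algebra.TensorProduct.map (D.parityPow j) (AlgHom.id k R)).toLinearMap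

theorem twistedSwap_tmul (σ : D.Aut) (j : ℤ) {a b : ℤ} {x y : R} (hx : x ∈ D.deg a)
    (hy : y ∈ D.deg b) :
    twistedSwap σ j (x ⊗ₜ y) = sgn k (a * (b + j)) • y ⊗ₜ[k] σ.hom x := by
  simp only [twistedSwap, LinearMap.comp_apply, AlgHom.toLinearMap_apply,
    Algebra.TensorProduct.map_tmul, AlgHom.id_apply, parityPow_eq_sgn j hx,
    ← TensorProduct.smul_tmul', map_smul, braid_tmul hx hy, smul_smul, sgn_mul_sgn]
  congr 2
  ring

/-- The inverse of `twistedSwap σ j`, where `τ` is the inverse of `σ`. -/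
def twistedSwapInv (τ : D.Aut) (j : ℤ) : R ⊗[k] R →ₗ[k] R ⊗[k] R :=
  (Algebra.TensorProduct.map (D.parityPow j) (AlgHom.id k R)).toLinearMap ∘ₗ D.braid ∘ₗ
    (Algebra.TensorProduct.map (AlgHom.id k R) τ.hom).toLinearMap

theorem twistedSwap_inv {σ τ : D.Aut} (h : ∀ x, σ.hom (τ.hom x) = x) (j : ℤ) (t : R ⊗[k] R) :
    twistedSwap σ j (twistedSwapInv τ j t) = t := by
  simp only [twistedSwap, twistedSwapInv, LinearMap.comp_apply, AlgHom.toLinearMap_apply,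
    map_parityPow_map_parityPow, braid_braid]
  induction t with
  | zero => simp
  | tmul x y => simp [h]
  | add x y hx hy => simp only [map_add, hx, hy]

theorem twistedSwapInv_twistedSwap {σ τ : D.Aut} (h : ∀ x, τ.hom (σ.hom x) = x) (j : ℤ)
    (t : R ⊗[k] R) : twistedSwapInv τ j (twistedSwap σ j t) = t := by
  have e : ∀ t, Algebra.TensorProduct.map (AlgHom.id k R) τ.hom
      (Algebra.TensorProduct.map (AlgHom.id k R) σ.hom t) = t := by
    intro t
    induction t with
    | zero => simp
    | tmul x y => simp [h]
    | add x y hx hy => simp only [map_add, hx, hy]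
  simp only [twistedSwap, twistedSwapInv, LinearMap.comp_apply, AlgHom.toLinearMap_apply, e,
    braid_braid, map_parityPow_map_parityPow]

omit [CharZero k] in
theorem map_id_hom_mem (σ : D.Aut) {q : ℤ} {t : R ⊗[k] R} (ht : t ∈ D.degT q) :
    Algebra.TensorProduct.map (AlgHom.id k R) σ.hom t ∈ D.degT q := by
  suffices h' : D.degT q ≤ (D.degT q).comap
    (Algebra.TensorProduct.map (AlgHom.id k R) σ.hom).toLinearMap from h' ht
  refine iSup_le fun a => Submodule.map₂_le.2 fun x hx y hy => ?_
  exact D.tmul_mem_degT hx (σ.hom_mem hy) (by ring)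

theorem twistedSwap_mem (σ : D.Aut) (j : ℤ) {q : ℤ} {t : R ⊗[k] R} (ht : t ∈ D.degT q) :
    twistedSwap σ j t ∈ D.degT q :=
  map_id_hom_mem σ (braid_mem (map_parityPow_mem j ht))

theorem twistedSwapInv_mem (τ : D.Aut) (j : ℤ) {q : ℤ} {t : R ⊗[k] R} (ht : t ∈ D.degT q) :
    twistedSwapInv τ j t ∈ D.degT q :=
  map_parityPow_mem j (braid_mem (map_id_hom_mem τ ht))

end Swap

/-! ## Parity of forms and the twisted cyclic product -/

namespace Forms

/-- `x` is a sum of forms whose degrees are congruent to `e` modulo `2`. -/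
def HasParity (x : Forms D) (e : ℤ) : Prop := parity D x = sgn k e • x

theorem HasParity.mul {x y : Forms D} {e f : ℤ} (hx : HasParity x e) (hy : HasParity y f) :
    HasParity (x * y) (e + f) := by
  rw [HasParity, map_mul, hx, hy, smul_mul_smul_comm, sgn_mul_sgn]

theorem HasParity.smul {x : Forms D} {e : ℤ} (hx : HasParity x e) (c : k) :
    HasParity (c • x) e := by
  rw [HasParity, map_smul, hx, smul_comm]

theorem hasParity_base {x : R} {e : ℤ} (hx : x ∈ D.deg e) : HasParity (base D x) e := by
  rw [HasParity, parity_base, parity_eq_sgn hx, map_smul]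

theorem hasParity_form {m : OneForm (Aut.refl D)} {e : ℤ} (hm : m ∈ OneForm.deg _ e) :
    HasParity (form D m) e := by
  rw [HasParity, parity_form, OneForm.parity_apply D hm, negOnePow_smul (k := k), map_smul]

theorem weightOne_form (m : OneForm (Aut.refl D)) : weightOne D (form D m) = m := by
  have := weightOne_base_form_base D 1 1 m
  rwa [map_one, one_mul, mul_one, OneForm.right_one, OneForm.left_one] at this

/-- The projection to weight one is a left inverse. Identities of one-forms can thus be checked in
the algebra of forms, where they are identities between products. -/
theorem form_injective : Function.Injective (form D) :=
  Function.LeftInverse.injective weightOne_form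

theorem form_sandwich (m : OneForm (Aut.refl D)) (x y : R) :
    form D (OneForm.sandwich m (x ⊗ₜ y)) = base D x * form D m * base D y := by
  rw [OneForm.sandwich_tmul, form_left, form_right, mul_assoc]

theorem signForms_eq {x : Forms D} {e : ℤ} (hx : HasParity x e) (p : ℤ) :
    DDer.signForms D p x = sgn k (p * e) • x := by
  unfold DDer.signForms
  split_ifs with h
  · rw [sgn_even (h.mul_right e), one_smul]; rfl
  · obtain ⟨c, rfl⟩ := Int.not_even_iff_odd.1 h
    rw [hx, sgn_congr (a := (2 * c + 1) * e) (b := e) ⟨c * e, by ring⟩]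

section Cyc

variable [CharZero k]

theorem cyc_of_hasParity (σ : D.Aut) {x y : Forms D} {e f : ℤ} (hx : HasParity x e)
    (hy : HasParity y f) : cyc σ (x ⊗ₜ y) = sgn k (e * f) • (y * map σ x) := by
  rw [HasParity] at hx hy
  rw [cyc_tmul]
  simp only [even, odd, LinearMap.smul_apply, LinearMap.add_apply, LinearMap.sub_apply,
    LinearMap.id_apply, AlgHom.toLinearMap_apply, hx, hy]
  rcases Int.even_or_odd e with h | h
  · rw [sgn_even h, sgn_even (h.mul_right f), one_smul, sub_self, smul_zero, map_zero, mul_zero,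
      add_zero, inv_two_smul_add_self, one_smul]
  · have e1 : sgn k (e * f) = sgn k f := by
      obtain ⟨c, rfl⟩ := h
      exact sgn_congr ⟨c * f, by ring⟩
    rw [sgn_odd h, e1, neg_smul, one_smul, sub_neg_eq_add, add_neg_cancel, smul_zero, map_zero,
      mul_zero, zero_add, inv_two_smul_add_self, smul_mul_assoc]

end Cyc

variable (D) in
/-- The differential of `Ω̂^• R ⊗ Ω̂^• R`. -/
def diffTensor : Forms D ⊗[k] Forms D →ₗ[k] Forms D ⊗[k] Forms D :=
  TensorProduct.map (diff D) LinearMap.id + TensorProduct.map (parity D).toLinearMap (diff D)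

variable (D) in
/-- The sign automorphism of `Ω̂^• R ⊗ Ω̂^• R`. -/
def parityTensor : Forms D ⊗[k] Forms D →ₐ[k] Forms D ⊗[k] Forms D :=
  Algebra.TensorProduct.map (parity D) (parity D)

/-- Rotation with the Koszul sign, followed by a DG automorphism, is a chain map. In the computation
`∂` anticommutes with the parity and so exchanges even and odd parts. -/
theorem diff_cyc (σ : D.Aut) (t : Forms D ⊗[k] Forms D) :
    diff D (cyc σ t) = cyc σ (diffTensor D t) := by
  induction t with
  | zero => simp
  | tmul x y =>
    simp only [diffTensor, LinearMap.add_apply, TensorProduct.map_tmul, LinearMap.id_apply,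
      map_add, cyc_tmul, diff_mul,
      AlgHom.toLinearMap_apply, even, odd, LinearMap.smul_apply, map_smul, map_parity,
      diff_map, diff_parity, parity_parity, mul_add, mul_smul_comm, smul_add, smul_sub,
      mul_neg, neg_mul, smul_neg, LinearMap.sub_apply, map_sub, mul_sub]
    abel
  | add x y hx hy => simp only [map_add, hx, hy]

theorem diffTensor_mul_right (t : Forms D ⊗[k] Forms D) (y : Forms D) :
    diffTensor D (t * (1 ⊗ₜ y)) =
      diffTensor D t * (1 ⊗ₜ y) + parityTensor D t * (1 ⊗ₜ diff D y) := by
  induction t with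
  | zero => simp
  | tmul a b =>
    simp [diffTensor, parityTensor, diff_mul, TensorProduct.tmul_add, add_mul, add_assoc]
  | add x y hx hy => simp only [map_add, add_mul, hx, hy]; abel

theorem diffTensor_baseT (t : R ⊗[k] R) :
    diffTensor D (DDer.baseT D t) = DDer.baseT D (D.diffT t) := by
  induction t with
  | zero => simp
  | tmul x y => simp [diffTensor, DDer.baseT]
  | add x y hx hy => simp only [map_add, hx, hy]

theorem parityTensor_baseT (t : R ⊗[k] R) :
    parityTensor D (DDer.baseT D t) = DDer.baseT D (D.parityT t) := by
  induction t with
  | zero => simp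
  | tmul x y => simp [parityTensor, DDer.baseT]
  | add x y hx hy => simp only [map_add, hx, hy]

end Forms

/-! ### The map `Ψ` between untwisted and twisted one-forms -/

namespace OneForm

variable {σ : D.Aut}

theorem psi_left (u : R) (m : OneForm (Aut.refl D)) : psi σ (left _ u m) = left _ u (psi σ m) := by
  apply ext' <;> simp [Aut.hom_refl, σ.hom_parity]

theorem psi_right (v : R) (m : OneForm (Aut.refl D)) :
    psi σ (right _ v m) = right _ v (psi σ m) := by
  apply ext' <;> simp

theorem homL_diffT (σ : D.Aut) (t : R ⊗[k] R) : σ.homL (D.diffT t) = D.diffT (σ.homL t) := by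
  induction t with
  | zero => simp
  | tmul x y => simp [σ.hom_diff, σ.hom_parity]
  | add x y hx hy => simp [hx, hy]

theorem psi_diff (m : OneForm (Aut.refl D)) : psi σ (diff _ m) = diff _ (psi σ m) := by
  apply ext' <;> simp [homL_diffT]

theorem homL_mem (σ : D.Aut) {q : ℤ} {t : R ⊗[k] R} (ht : t ∈ D.degT q) :
    σ.homL t ∈ D.degT q := by
  suffices h' : D.degT q ≤ (D.degT q).comap σ.homL.toLinearMap from h' ht
  refine iSup_le fun a => Submodule.map₂_le.2 fun x hx y hy => ?_
  exact D.tmul_mem_degT (σ.hom_mem hx) hy (by ring)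

theorem psi_mem {q : ℤ} {m : OneForm (Aut.refl D)} (hm : m ∈ deg _ q) : psi σ m ∈ deg σ q :=
  ⟨homL_mem σ hm.1, homL_mem σ hm.2⟩

theorem homL_homL {σ τ : D.Aut} (h : ∀ x, σ.hom (τ.hom x) = x) (t : R ⊗[k] R) :
    σ.homL (τ.homL t) = t := by
  induction t with
  | zero => simp
  | tmul x y => simp [h]
  | add x y hx hy => simp [hx, hy]

theorem psi_injective {τ : D.Aut} (h : ∀ x, τ.hom (σ.hom x) = x) : Function.Injective (psi σ) := by
  intro m m' hm
  apply ext'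
  · have := congrArg (fun m => τ.homL (m.1 : R ⊗[k] R)) hm
    simpa [homL_homL h] using this
  · have := congrArg (fun m => τ.homL m.2) hm
    simpa [homL_homL h] using this

/-- The inverse of `σ` on left factors undoes `Ψ`. It lands in the untwisted kernel because the
twisted product of the image is `σ` of the untwisted one and `σ` is injective. -/
theorem exists_psi_eq {τ : D.Aut} (h : ∀ x, σ.hom (τ.hom x) = x) (h' : ∀ x, τ.hom (σ.hom x) = x)
    {q : ℤ} {m : OneForm σ} (hm : m ∈ deg σ q) :
    ∃ m' ∈ deg (Aut.refl D) q, psi σ m' = m := by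
  have h0 : τ.homL (m.1 : R ⊗[k] R) ∈ omega (Aut.refl D) := by
    have h1 := twMul_homL σ (τ.homL (m.1 : R ⊗[k] R))
    rw [homL_homL h, mem_omega.1 m.1.2] at h1
    have h2 := congrArg τ.hom h1
    rw [h', map_zero] at h2
    exact h2.symm
  refine ⟨(⟨_, h0⟩, τ.homL m.2), ⟨homL_mem τ hm.1, homL_mem τ hm.2⟩, ?_⟩
  apply ext' <;> simp [homL_homL h]

end OneForm

end DGAlgebra

namespace ConnCoalgebra

open Coalgebra DGAlgebra

variable {k C : Type*} [Field k] [AddCommGroup C] [Module k C] [Coalgebra k C]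
variable {G : ConnCoalgebra k C}

/-! ## Generators of the algebra of forms on the cobar construction -/

variable (G) in
/-- The generators `dc` as forms. -/
def formGen : C →ₗ[k] Forms G.cobarDG := Forms.form G.cobarDG ∘ₗ G.dGen

variable (G) in
/-- The generators `c̄` as forms. -/
def baseGen : C →ₗ[k] Forms G.cobarDG := (Forms.base G.cobarDG).toLinearMap ∘ₗ G.bar

theorem formGen_apply (c : C) : G.formGen c = Forms.form G.cobarDG (G.dGen c) := rfl

theorem baseGen_apply (c : C) : G.baseGen c = Forms.base G.cobarDG (G.bar c) := rfl

theorem hasParity_formGen {i : ℕ} {c : C} (hc : c ∈ G.gr i) : (G.formGen c).HasParity i :=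
  Forms.hasParity_form (dGen_mem hc)

theorem hasParity_baseGen {i : ℕ} {c : C} (hc : c ∈ G.gr i) :
    (G.baseGen c).HasParity ((i : ℤ) - 1) :=
  Forms.hasParity_base (show G.bar c ∈ G.cobarDG.deg _ from G.bar_mem hc)

theorem parity_eq_sgn {i : ℕ} {c : C} (hc : c ∈ G.gr i) : G.parity c = sgn k i • c := by
  rw [G.parity_apply hc, neg_one_pow_eq_sgn]

theorem parity_formGen (c : C) : Forms.parity _ (G.formGen c) = G.formGen (G.parity c) := by
  have : (Forms.parity G.cobarDG).toLinearMap ∘ₗ G.formGen = G.formGen ∘ₗ G.parity :=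
    G.hom_ext_gr fun i c hc => by
      rw [LinearMap.comp_apply, LinearMap.comp_apply, parity_eq_sgn hc, map_smul]
      exact hasParity_formGen hc
  exact LinearMap.congr_fun this c

theorem parity_dGen (c : C) : OneForm.parity _ (G.dGen c) = G.dGen (G.parity c) := by
  apply Forms.form_injective
  rw [← Forms.parity_form]
  exact parity_formGen c

theorem hom_cobar_bar (σ : G.Aut) (c : C) :
    σ.cobar.hom (G.bar c) = G.bar (σ.toCoalgEquiv c) :=
  G.cobarMap_bar _ σ.map_one c

theorem map_formGen (σ : G.Aut) (c : C) :
    Forms.map σ.cobar (G.formGen c) = G.formGen (σ.toCoalgEquiv c) := by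
  rw [formGen_apply, formGen_apply, Forms.map_form, dGen_apply, dGen_apply, map_add, map_smul,
    Forms.map_dOne, ← dFun_hom, hom_cobar_bar, CoalgHomClass.counit_comp_apply]

theorem map_baseGen (σ : G.Aut) (c : C) :
    Forms.map σ.cobar (G.baseGen c) = G.baseGen (σ.toCoalgEquiv c) := by
  rw [baseGen_apply, baseGen_apply, Forms.map_base, hom_cobar_bar]

theorem formGen_eq (c : C) : G.formGen c =
    counit (R := k) c • Forms.form _ (dOne G.cobarDG) + Forms.dBase _ (G.bar c) := by
  rw [formGen_apply, dGen_apply, map_add, map_smul, Forms.dBase_apply]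

theorem counit_parity (c : C) : counit (R := k) (G.parity c) = counit (R := k) c :=
  CoalgHomClass.counit_comp_apply G.parityAut.toCoalgEquiv c

/-- The cone turns `Σ(r ⊗ 1 - 1 ⊗ r)` into `r ⊗ 1 - 1 ⊗ r`, the commutator of `r` with `d𝟏`; the
suspension gives the minus sign of `d(∂r)`. -/
theorem diff_dBase {k R : Type*} [Field k] [Ring R] [Algebra k R] (D : DGAlgebra k R) (r : R) :
    Forms.diff D (Forms.dBase D r) = Forms.base D r * Forms.form D (dOne D) -
      Forms.form D (dOne D) * Forms.base D r - Forms.dBase D (D.diff r) := by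
  rw [Forms.dBase_apply, Forms.dBase_apply, Forms.diff_form, ← Forms.form_left,
    ← Forms.form_right, ← map_sub, ← map_sub]
  congr 1
  apply OneForm.ext'
  · simp [dOne, D.diff_one]
  · simp [dOne, Aut.hom_refl]

/-- `∂(dc) = ∑ c̄₁ dc₂ - ∑ (-1)^{|c₁|} dc₁ c̄₂`. -/
theorem diff_formGen (c : C) : Forms.diff _ (G.formGen c) =
    LinearMap.mul' k _ (TensorProduct.map G.baseGen G.formGen (comul c)) -
      LinearMap.mul' k _ (TensorProduct.map (G.formGen ∘ₗ G.parity) G.baseGen (comul c)) := by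
  -- The parts of the coproduct with a factor `1` produce the commutator with `d𝟏`, and the reduced
  -- parts produce `-d(∂c̄)`. The convention `d1 = d𝟏` thus merges the cone differential and the
  -- cobar differential.
  have key : ∀ t : C ⊗[k] C,
      LinearMap.mul' k _ (TensorProduct.map G.baseGen G.formGen t) -
        LinearMap.mul' k _ (TensorProduct.map (G.formGen ∘ₗ G.parity) G.baseGen t) =
      G.baseGen (TensorProduct.rid k C (LinearMap.lTensor C counit t)) *
          Forms.form _ (dOne G.cobarDG) -
        Forms.form _ (dOne G.cobarDG) *
          G.baseGen (TensorProduct.lid k C (LinearMap.rTensor C counit t)) -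
        Forms.dBase _
          (LinearMap.mul' k G.Cobar (TensorProduct.map (G.bar ∘ₗ G.parity) G.bar t)) := by
    intro t
    induction t with
    | zero => simp
    | tmul a b =>
      have h : G.cobarDG.parity (G.bar (G.parity a)) = - G.bar a := by
        rw [← G.parity_parity a]
        conv_rhs => rw [G.parity_parity]
        have := G.cobarParity_bar (G.parity a)
        rw [G.parity_parity] at this ⊢
        exact this
      simp only [TensorProduct.map_tmul, LinearMap.mul'_apply, LinearMap.comp_apply, formGen_eq,
        counit_parity, LinearMap.lTensor_tmul, LinearMap.rTensor_tmul, TensorProduct.rid_tmul,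
        TensorProduct.lid_tmul, map_smul, Forms.dBase_mul, h, map_neg, baseGen_apply, mul_add,
        add_mul, mul_smul_comm, smul_mul_assoc, neg_mul]
      abel
    | add x y hx hy =>
      simp only [map_add, mul_add, add_mul] at hx hy ⊢
      rw [add_sub_add_comm, hx, hy]; abel
  have h0 : Forms.diff G.cobarDG (Forms.form _ (dOne G.cobarDG)) = 0 := by
    rw [Forms.diff_form]
    convert map_zero (Forms.form G.cobarDG)
    apply OneForm.ext' <;> simp [dOne, Algebra.TensorProduct.one_def, DGAlgebra.diff_one]
  rw [key, Coalgebra.lTensor_counit_comul, Coalgebra.rTensor_counit_comul, formGen_eq, map_add,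
    map_smul, h0, smul_zero, zero_add, diff_dBase]
  simp only [TensorProduct.rid_tmul, TensorProduct.lid_tmul, one_smul]
  congr 2
  exact G.cobarDiff_bar c

/-- Every term of `dForm` on `dr` and on `d𝟏` has as a factor the differential of the unit of `R`,
which is zero (the symbol `d𝟏` is not that differential). -/
theorem d_formGen (c : C) : Forms.d _ (G.formGen c) = 0 := by
  have h1 : dFun G.cobarDG 1 = 0 := by apply OneForm.ext' <;> simp
  have h2 : Forms.dBase G.cobarDG 1 = 0 := by rw [Forms.dBase_apply, h1, map_zero]
  rw [formGen_eq, map_add, map_smul, Forms.dBase_apply, Forms.d_form, Forms.d_form,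
    Forms.dForm_apply, Forms.dForm_apply, dFun_fst, dFun_snd]
  simp [dOne, h2, Algebra.TensorProduct.one_def]

/-! ## Contraction with the two-form -/

/-- The left leg `x`, of degree `e`, is carried past `y` and `z`, of total degree `f + j`. -/
theorem cyc_baseT_mul_right [CharZero k] (σ : G.cobarDG.Aut) {e f j : ℤ} {x y : G.Cobar}
    {z : Forms G.cobarDG} (hx : x ∈ G.cobarDG.deg e) (hy : y ∈ G.cobarDG.deg f)
    (hz : z.HasParity j) : Forms.cyc σ (DDer.baseT _ (x ⊗ₜ y) * (1 ⊗ₜ z)) =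
      sgn k (e * (f + j)) • (Forms.base _ y * z * Forms.base _ (σ.hom x)) := by
  have : DDer.baseT G.cobarDG (x ⊗ₜ y) = Forms.base _ x ⊗ₜ Forms.base _ y := rfl
  rw [this, Algebra.TensorProduct.tmul_mul_tmul, mul_one, Forms.cyc_of_hasParity σ
    (Forms.hasParity_base hx) ((Forms.hasParity_base hy).mul hz), Forms.map_base]

theorem cyc_mul_baseT [CharZero k] (σ : G.cobarDG.Aut) {e f j l : ℤ} {x y : G.Cobar}
    {z w : Forms G.cobarDG} (hx : x ∈ G.cobarDG.deg e) (hy : y ∈ G.cobarDG.deg f)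
    (hz : z.HasParity j) (hw : w.HasParity l) :
    Forms.cyc σ ((z ⊗ₜ 1) * (DDer.baseT _ (x ⊗ₜ y) * (1 ⊗ₜ w))) =
      sgn k ((j + e) * (f + l)) •
        (Forms.base _ y * w * (Forms.map σ z * Forms.base _ (σ.hom x))) := by
  have : DDer.baseT G.cobarDG (x ⊗ₜ y) = Forms.base _ x ⊗ₜ Forms.base _ y := rfl
  rw [this, Algebra.TensorProduct.tmul_mul_tmul, Algebra.TensorProduct.tmul_mul_tmul, mul_one,
    one_mul, Forms.cyc_of_hasParity σ (hz.mul (Forms.hasParity_base hx))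
      ((Forms.hasParity_base hy).mul hw), map_mul, Forms.map_base]

section Contraction

variable (σ : G.Aut) {p : ℤ} (Θ : G.cobarDG.DDer p)

/-- The double derivation `Θ` on the generators `dc`. -/
def extGen : C →ₗ[k] Forms G.cobarDG ⊗[k] Forms G.cobarDG := DDer.ext Θ ∘ₗ G.formGen

theorem extGen_apply (c : C) : extGen Θ c = DDer.baseT _ (Θ.1 (G.dGen c)) := DDer.ext_form Θ _

theorem ext_formGen (c : C) : DDer.ext Θ (G.formGen c) = extGen Θ c := rfl

theorem mem_degT_dGen {i : ℕ} {c : C} (hc : c ∈ G.gr i) :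
    Θ.1 (G.dGen c) ∈ G.cobarDG.degT (i + p) := Θ.2.1 _ _ (dGen_mem hc)

/-- The map `a ⊗ b ↦ ∑ ± Θ(da)'' db σ(Θ(da)')`. -/
def contractLeft : C ⊗[k] C →ₗ[k] Forms G.cobarDG :=
  Forms.cyc σ.cobar ∘ₗ LinearMap.mul' k _ ∘ₗ TensorProduct.map (extGen Θ)
    ((Algebra.TensorProduct.includeRight : _ →ₐ[k] Forms G.cobarDG ⊗[k] _).toLinearMap ∘ₗ
      G.formGen)

theorem contractLeft_tmul (a b : C) : contractLeft σ Θ (a ⊗ₜ b) =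
    Forms.cyc σ.cobar (extGen Θ a * (1 ⊗ₜ G.formGen b)) := rfl

/-- The map `a ⊗ b ↦ ∑ ± Θ(db)'' σ(da) σ(Θ(db)')`. -/
def contractRight : C ⊗[k] C →ₗ[k] Forms G.cobarDG :=
  Forms.cyc σ.cobar ∘ₗ LinearMap.mul' k _ ∘ₗ TensorProduct.map
    ((Algebra.TensorProduct.includeLeft : _ →ₐ[k] Forms G.cobarDG ⊗[k] _).toLinearMap ∘ₗ
      (DDer.signForms _ p).toLinearMap ∘ₗ G.formGen) (extGen Θ)

theorem contractRight_tmul (a b : C) : contractRight σ Θ (a ⊗ₜ b) =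
    Forms.cyc σ.cobar ((DDer.signForms _ p (G.formGen a) ⊗ₜ 1) * extGen Θ b) := rfl

/-- The map `a ⊗ b ⊗ c ↦ ∑ ± Θ(da)'' d(P b) c̄ σ(Θ(da)')`, where `P` is the parity. -/
def contractFormBase : C ⊗[k] (C ⊗[k] C) →ₗ[k] Forms G.cobarDG :=
  Forms.cyc σ.cobar ∘ₗ LinearMap.mul' k _ ∘ₗ TensorProduct.map
    ((Forms.parityTensor _).toLinearMap ∘ₗ extGen Θ)
    ((Algebra.TensorProduct.includeRight : _ →ₐ[k] Forms G.cobarDG ⊗[k] _).toLinearMap ∘ₗ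
      LinearMap.mul' k _ ∘ₗ TensorProduct.map (G.formGen ∘ₗ G.parity) G.baseGen)

/-- The map `a ⊗ b ⊗ c ↦ ∑ ± Θ(da)'' b̄ dc σ(Θ(da)')`. -/
def contractBaseForm : C ⊗[k] (C ⊗[k] C) →ₗ[k] Forms G.cobarDG :=
  Forms.cyc σ.cobar ∘ₗ LinearMap.mul' k _ ∘ₗ TensorProduct.map
    ((Forms.parityTensor _).toLinearMap ∘ₗ extGen Θ)
    ((Algebra.TensorProduct.includeRight : _ →ₐ[k] Forms G.cobarDG ⊗[k] _).toLinearMap ∘ₗ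
      LinearMap.mul' k _ ∘ₗ TensorProduct.map G.baseGen G.formGen)

/-- The map `a ⊗ b ⊗ c ↦ ∑ ± Θ(db)'' dc σ(ā) σ(Θ(db)')`. -/
def contractMiddle : C ⊗[k] (C ⊗[k] C) →ₗ[k] Forms G.cobarDG :=
  sgn k p • (Forms.cyc σ.cobar ∘ₗ LinearMap.mul' k _ ∘ₗ TensorProduct.map
    ((Algebra.TensorProduct.includeLeft : _ →ₐ[k] Forms G.cobarDG ⊗[k] _).toLinearMap ∘ₗ
      (DDer.signForms _ p).toLinearMap ∘ₗ G.baseGen)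
    (LinearMap.mul' k _ ∘ₗ TensorProduct.map (extGen Θ)
      ((Algebra.TensorProduct.includeRight : _ →ₐ[k] Forms G.cobarDG ⊗[k] _).toLinearMap ∘ₗ
        G.formGen)))

theorem contractFormBase_tmul (a b c : C) : contractFormBase σ Θ (a ⊗ₜ (b ⊗ₜ c)) =
    Forms.cyc σ.cobar (Forms.parityTensor _ (extGen Θ a) *
      (1 ⊗ₜ (G.formGen (G.parity b) * G.baseGen c))) := rfl

theorem contractBaseForm_tmul (a b c : C) : contractBaseForm σ Θ (a ⊗ₜ (b ⊗ₜ c)) =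
    Forms.cyc σ.cobar (Forms.parityTensor _ (extGen Θ a) *
      (1 ⊗ₜ (G.baseGen b * G.formGen c))) := rfl

theorem contractMiddle_tmul (a b c : C) : contractMiddle σ Θ (a ⊗ₜ (b ⊗ₜ c)) =
    sgn k p • Forms.cyc σ.cobar ((DDer.signForms _ p (G.baseGen a) ⊗ₜ 1) *
      (extGen Θ b * (1 ⊗ₜ G.formGen c))) := rfl

variable [CharZero k] {σ} {η : C} {n : ℕ}

/-- The two sides contract the first and the second factor of `∑ dη' dη''`. Rotating `Δ(η)` turns
one into the other, since after contraction only the cyclic order matters. -/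
theorem contractLeft_eq_contractRight (h : swapMap (σ.twist n) (comul η) = comul η)
    (hη : η ∈ G.gr n) : contractLeft σ Θ (comul η) = contractRight σ Θ (comul η) := by
  refine comul_swap h hη fun i j hij a ha b hb => ?_
  rw [contractLeft_tmul, contractRight_tmul, extGen_apply]
  refine degT_hom_ext (F := (-1 : k) ^ (i * j) • (Forms.cyc σ.cobar ∘ₗ
      LinearMap.mulRight k (1 ⊗ₜ G.formGen (σ.toCoalgEquiv a)) ∘ₗ (DDer.baseT _).toLinearMap))
    (F' := Forms.cyc σ.cobar ∘ₗ LinearMap.mulLeft k (DDer.signForms _ p (G.formGen a) ⊗ₜ 1) ∘ₗ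
      (DDer.baseT _).toLinearMap) (fun e f hef x hx y hy => ?_) (mem_degT_dGen Θ hb)
  have h1 := cyc_baseT_mul_right σ.cobar hx hy (hasParity_formGen (σ.map_mem ha))
  have h2 := cyc_mul_baseT σ.cobar hx hy
    ((hasParity_formGen ha).smul (sgn k (p * i))) (l := 0) (w := 1) (by simp [Forms.HasParity, sgn])
  rw [← Algebra.TensorProduct.one_def, mul_one] at h2
  simp only [LinearMap.smul_apply, LinearMap.comp_apply, LinearMap.mulRight_apply,
    LinearMap.mulLeft_apply, AlgHom.toLinearMap_apply]
  rw [h1, Forms.signForms_eq (hasParity_formGen ha), h2, map_smul, map_formGen,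
    neg_one_pow_eq_sgn, mul_one, smul_mul_assoc, mul_smul_comm, smul_smul, smul_smul, sgn_mul_sgn,
    sgn_mul_sgn, mul_assoc]
  congr 1
  -- Here `e` and `f` are the degrees of the two legs of `Θ(db)`, so `e + f = j + p`; with this the
  -- exponents `ij + e(f + i)` and `pi + (i + e)f` differ by `2i(e - p)`.
  refine sgn_congr ⟨i * (e - p), ?_⟩
  obtain rfl : p = e + f - j := by omega
  push_cast
  ring

/-- The product rule yields two summands, equal by the preceding lemma; they cancel the factor `½`
in the two-form. -/
theorem contract_twoForm (h : swapMap (σ.twist n) (comul η) = comul η) (hη : η ∈ G.gr n) :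
    DDer.contract σ.cobar Θ (G.twoForm η) = contractLeft σ Θ (comul η) := by
  have key : ∀ t : C ⊗[k] C, Forms.cyc σ.cobar (DDer.ext Θ (LinearMap.mul' k _
      (TensorProduct.map G.formGen G.formGen t))) = contractLeft σ Θ t + contractRight σ Θ t := by
    intro t
    induction t with
    | zero => simp
    | tmul a b =>
      rw [TensorProduct.map_tmul, LinearMap.mul'_apply, DDer.ext_mul, map_add]; rfl
    | add x y hx hy => simp only [map_add, hx, hy]; abel
  rw [twoForm, DDer.contract, map_smul, map_smul]
  change (2⁻¹ : k) • Forms.cyc σ.cobar (DDer.ext Θ (LinearMap.mul' k _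
      (TensorProduct.map G.formGen G.formGen _))) = _
  rw [key, ← contractLeft_eq_contractRight Θ h hη, inv_two_smul_add_self]

omit [CharZero k] in
theorem parityTensor_extGen (c : C) :
    Forms.parityTensor _ (extGen Θ c) = sgn k p • extGen Θ (G.parity c) := by
  rw [extGen_apply, extGen_apply, Forms.parityTensor_baseT, DDer.parityT_apply,
    negOnePow_smul (k := k), map_smul, parity_dGen]

omit [CharZero k] in
theorem extGen_delta (c : C) : extGen (DDer.delta Θ) c =
    Forms.diffTensor _ (extGen Θ c) - sgn k p • DDer.ext Θ (Forms.diff _ (G.formGen c)) := by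
  rw [extGen_apply, extGen_apply, Forms.diffTensor_baseT, formGen_apply, Forms.diff_form,
    DDer.ext_form, ← map_smul, ← map_sub, ← negOnePow_smul]
  rfl

/-- A generator produced at the right end of the second form and one produced at the left end of the
first occupy the same place in the cyclic word; rotating the iterated coproduct exchanges these
descriptions. -/
theorem contractFormBase_comul₃ (h : swapMap (σ.twist n) (comul η) = comul η) (hη : η ∈ G.gr n) :
    contractFormBase σ Θ (comul₃ η) = contractMiddle σ Θ (comul₃ η) := by
  refine comul₃_cyc h hη fun i j l hijl a ha b hb c hc => ?_
  rw [contractFormBase_tmul, contractMiddle_tmul, parityTensor_extGen, parity_eq_sgn hb, map_smul,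
    parity_eq_sgn hc, Forms.signForms_eq (hasParity_baseGen ha), extGen_apply, map_smul]
  refine degT_hom_ext
    (F := (-1 : k) ^ (i * (j + l)) • (Forms.cyc σ.cobar ∘ₗ
      LinearMap.mulRight k (1 ⊗ₜ (sgn k l • G.formGen c * G.baseGen (σ.toCoalgEquiv a))) ∘ₗ
      (sgn k p • sgn k j • (DDer.baseT _).toLinearMap)))
    (F' := sgn k p • (Forms.cyc σ.cobar ∘ₗ
      LinearMap.mulLeft k ((sgn k (p * (i - 1)) • G.baseGen a) ⊗ₜ 1) ∘ₗ
      LinearMap.mulRight k (1 ⊗ₜ G.formGen c) ∘ₗ (DDer.baseT _).toLinearMap))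
    (fun e f hef x hx y hy => ?_) (mem_degT_dGen Θ hb)
  have h1 := cyc_baseT_mul_right σ.cobar hx hy
    (((hasParity_formGen hc).smul (sgn k l)).mul (hasParity_baseGen (σ.map_mem ha)))
  have h2 := cyc_mul_baseT σ.cobar hx hy
    ((hasParity_baseGen ha).smul (sgn k (p * (i - 1)))) (hasParity_formGen hc)
  simp only [LinearMap.smul_apply, LinearMap.comp_apply, LinearMap.mulRight_apply,
    LinearMap.mulLeft_apply, AlgHom.toLinearMap_apply]
  rw [smul_mul_assoc (sgn k p), smul_mul_assoc (sgn k j), map_smul, map_smul, h1, h2, map_smul,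
    map_baseGen, neg_one_pow_eq_sgn]
  simp only [smul_mul_assoc, mul_smul_comm, smul_smul, sgn_mul_sgn, mul_assoc]
  congr 1
  -- Half the difference of the two collected exponents, once `e + f = j + p` is used for the
  -- degrees of the legs of `Θ(db)`.
  refine sgn_congr ⟨i * e - i * p + l + f, ?_⟩
  obtain rfl : p = e + f - j := by omega
  push_cast
  ring

omit [CharZero k] in
-- This evaluates `Θ(∂(dη'))`, the part of `δΘ` where `∂` is applied first. As `Θ` vanishes on
-- functions, each of the two products in `∂(dc)` contributes a single term.
theorem cyc_ext_diff_mul (s : C ⊗[k] C) (b : C) : sgn k p • Forms.cyc σ.cobar (DDer.ext Θ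
      (LinearMap.mul' k _ (TensorProduct.map G.baseGen G.formGen s) -
      LinearMap.mul' k _ (TensorProduct.map (G.formGen ∘ₗ G.parity) G.baseGen s)) *
      (1 ⊗ₜ G.formGen b)) =
    contractMiddle σ Θ (TensorProduct.assoc k C C C (s ⊗ₜ b)) -
      contractBaseForm σ Θ (TensorProduct.assoc k C C C (s ⊗ₜ b)) := by
  induction s with
  | zero => simp
  | tmul c d =>
    have h0 : ∀ c, DDer.ext Θ (G.baseGen c) = 0 := fun c => DDer.ext_base Θ _
    have h1 : DDer.ext Θ (G.baseGen c * G.formGen d) =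
        (DDer.signForms _ p (G.baseGen c) ⊗ₜ 1) * extGen Θ d := by
      rw [DDer.ext_mul, h0, zero_mul, zero_add, ext_formGen]
    have h2 : DDer.ext Θ (G.formGen (G.parity c) * G.baseGen d) =
        extGen Θ (G.parity c) * (1 ⊗ₜ G.baseGen d) := by
      rw [DDer.ext_mul, h0, mul_zero, add_zero, ext_formGen]
    rw [TensorProduct.assoc_tmul, contractMiddle_tmul, contractBaseForm_tmul,
      TensorProduct.map_tmul, TensorProduct.map_tmul,
      LinearMap.mul'_apply, LinearMap.mul'_apply, LinearMap.comp_apply, map_sub, h1, h2,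
      parityTensor_extGen, sub_mul, map_sub, smul_sub, mul_assoc,
      mul_assoc, Algebra.TensorProduct.tmul_mul_tmul, one_mul, smul_mul_assoc, map_smul]
  | add x y hx hy =>
    rw [map_add, map_add, map_add, map_add, TensorProduct.add_tmul, map_add, map_add, map_add,
      add_sub_add_comm, map_add, add_mul, map_add, smul_add]
    exact (congrArg₂ (· + ·) hx hy).trans (add_sub_add_comm _ _ _ _).symm

omit [CharZero k] in
-- By the Leibniz rule `∂` falls on `Θ(da)` or on `db`. The former is `δΘ(da)` plus `±Θ(∂(da))`;
-- both `∂(da)` and `∂(db)` are then expanded in generators.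
theorem diff_contractLeft_tmul (a b : C) : Forms.diff _ (contractLeft σ Θ (a ⊗ₜ b)) =
    contractLeft σ (DDer.delta Θ) (a ⊗ₜ b) +
      (contractBaseForm σ Θ (a ⊗ₜ comul b) - contractFormBase σ Θ (a ⊗ₜ comul b)) +
      (contractMiddle σ Θ (TensorProduct.assoc k C C C (comul a ⊗ₜ b)) -
        contractBaseForm σ Θ (TensorProduct.assoc k C C C (comul a ⊗ₜ b))) := by
  have e2 : contractBaseForm σ Θ (a ⊗ₜ comul b) - contractFormBase σ Θ (a ⊗ₜ comul b) =
      Forms.cyc σ.cobar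
        (Forms.parityTensor _ (extGen Θ a) * (1 ⊗ₜ Forms.diff _ (G.formGen b))) := by
    rw [diff_formGen, TensorProduct.tmul_sub, mul_sub, map_sub]; rfl
  rw [← cyc_ext_diff_mul, ← diff_formGen, e2, contractLeft_tmul, contractLeft_tmul,
    Forms.diff_cyc, Forms.diffTensor_mul_right, extGen_delta, sub_mul, map_add, map_sub,
    smul_mul_assoc, map_smul]
  abel

omit [CharZero k] in
theorem diff_contractLeft (t : C ⊗[k] C) : Forms.diff _ (contractLeft σ Θ t) =
    contractLeft σ (DDer.delta Θ) t +
      (contractBaseForm σ Θ (LinearMap.lTensor C comul t) -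
        contractFormBase σ Θ (LinearMap.lTensor C comul t)) +
      (contractMiddle σ Θ (TensorProduct.assoc k C C C (LinearMap.rTensor C comul t)) -
        contractBaseForm σ Θ (TensorProduct.assoc k C C C (LinearMap.rTensor C comul t))) := by
  induction t with
  | zero => simp
  | tmul a b => exact diff_contractLeft_tmul Θ a b
  | add x y hx hy => 
    simp only [map_add]
    rw [hx, hy]; abel

/-- Of the four extra terms in the differential, the two with a generator between the contracted and
the remaining form cancel by coassociativity, and the other two by rotation. -/
theorem contract_delta (h : swapMap (σ.twist n) (comul η) = comul η) (hη : η ∈ G.gr n) :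
    contractLeft σ (DDer.delta Θ) (comul η) =
      Forms.diff _ (contractLeft σ Θ (comul η)) := by
  rw [diff_contractLeft, ← comul₃_eq,
    show LinearMap.lTensor C comul (comul η) = comul₃ (k := k) η from rfl,
    contractFormBase_comul₃ Θ h hη]
  abel

omit [CharZero k] in
theorem parityPow_dGen (b : ℤ) {i : ℕ} {c : C} (hc : c ∈ G.gr i) :
    OneForm.parityPow _ b (G.dGen c) = sgn k (b * i) • G.dGen c := by
  unfold OneForm.parityPow
  split_ifs with h
  · rw [sgn_even (h.mul_right _), one_smul]; rfl
  · obtain ⟨d, rfl⟩ := Int.not_even_iff_odd.1 h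
    rw [parity_dGen, parity_eq_sgn hc, map_smul,
      sgn_congr (a := (2 * d + 1) * i) (b := i) ⟨d * i, by ring⟩]

/-- The inner structure puts `v` to the right of the first leg and `u` to the left of the second;
after the flip these are the two outer ends, with `v` seen through `σ`. The sign collects
`(-1)^{b|η'|}` from the action and `(-1)^{b|η''|}` from moving `v` past `dη''`, hence `(-1)^{nb}`.
-/
theorem contract_act {a b : ℤ} (u : G.cobarDG.deg a) (v : G.cobarDG.deg b) (hη : η ∈ G.gr n) :
    contractLeft σ (DDer.act u v Θ) (comul η) = sgn k (n * b) • (Forms.base _ u.1 *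
      contractLeft σ Θ (comul η) * Forms.base _ (σ.cobar.hom v.1)) := by
  refine G.comul_hom_ext (F := contractLeft σ (DDer.act u v Θ))
    (F' := sgn k (n * b) • (LinearMap.mulRight k (Forms.base _ (σ.cobar.hom v.1)) ∘ₗ
      LinearMap.mulLeft k (Forms.base _ u.1) ∘ₗ contractLeft σ Θ))
    (fun i j hij c hc c' hc' => ?_) hη
  simp only [LinearMap.smul_apply, LinearMap.comp_apply, LinearMap.mulRight_apply,
      LinearMap.mulLeft_apply, contractLeft_tmul, extGen_apply]
  have e : (DDer.act u v Θ).1 (G.dGen c) =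
      sgn k (b * i) • DDer.inner G.cobarDG a b u.1 v.1 (Θ.1 (G.dGen c)) := by
    change DDer.inner G.cobarDG a b u.1 v.1 (Θ.1 (OneForm.parityPow _ b (G.dGen c))) = _
    rw [parityPow_dGen b hc, map_smul, map_smul]
  rw [e]
  refine degT_hom_ext
    (F := Forms.cyc σ.cobar ∘ₗ LinearMap.mulRight k (1 ⊗ₜ G.formGen c') ∘ₗ
      (DDer.baseT _).toLinearMap ∘ₗ (sgn k (b * i) • DDer.inner G.cobarDG a b u.1 v.1))
    (F' := sgn k (n * b) • (LinearMap.mulRight k (Forms.base _ (σ.cobar.hom v.1)) ∘ₗ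
      LinearMap.mulLeft k (Forms.base _ u.1) ∘ₗ Forms.cyc σ.cobar ∘ₗ
      LinearMap.mulRight k (1 ⊗ₜ G.formGen c') ∘ₗ (DDer.baseT _).toLinearMap))
    (fun e f hef x hx y hy => ?_) (mem_degT_dGen Θ hc)
  have h1 := cyc_baseT_mul_right σ.cobar hx hy (hasParity_formGen hc')
  have h2 := cyc_baseT_mul_right σ.cobar (G.cobarDG.mul_mem hx v.2) (G.cobarDG.mul_mem u.2 hy)
    (hasParity_formGen hc')
  simp only [LinearMap.smul_apply, LinearMap.comp_apply, LinearMap.mulRight_apply,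
      LinearMap.mulLeft_apply, AlgHom.toLinearMap_apply, DDer.inner_tmul, parityPow_eq_sgn _ hx,
      parityPow_eq_sgn _ hy, negOnePow_smul (k := k), smul_mul_assoc, mul_smul_comm,
      ← TensorProduct.smul_tmul', TensorProduct.tmul_smul, map_smul]
  rw [h1, h2]
  simp only [smul_mul_assoc, mul_smul_comm, smul_smul, sgn_mul_sgn, map_mul, mul_assoc]
  congr 1
  refine sgn_congr ⟨b * f + a * e + a * b, ?_⟩
  obtain rfl : p = e + f - i := by omega
  subst hij
  push_cast
  ring

end Contraction

end ConnCoalgebra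

namespace ConnCoalgebra

open Coalgebra DGAlgebra

variable {k C : Type*} [Field k] [AddCommGroup C] [Module k C] [Coalgebra k C]
variable {G : ConnCoalgebra k C}

/-! ## The two-form -/

section TwoForm

variable {η : C} {n : ℕ} {σ : G.Aut}

theorem twoForm_eq (η : C) : G.twoForm η = (2⁻¹ : k) •
    LinearMap.mul' k _ (TensorProduct.map G.formGen G.formGen (comul η)) := rfl

theorem twoForm_mem (hη : η ∈ G.gr n) : G.twoForm η ∈ Forms.bideg G.cobarDG 2 n := by
  rw [twoForm_eq]
  refine Submodule.smul_mem _ _ ?_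
  -- Membership becomes an equation between linear maps, which can be tested on homogeneous tensors.
  rw [← Submodule.Quotient.mk_eq_zero]
  refine G.comul_hom_ext (F := (Forms.bideg G.cobarDG 2 n).mkQ ∘ₗ LinearMap.mul' k _ ∘ₗ
    TensorProduct.map G.formGen G.formGen) (F' := 0) (fun p q hpq a ha b hb => ?_) hη
  refine (Submodule.Quotient.mk_eq_zero _).2 (Submodule.subset_span ?_)
  have := Forms.IsMonomial.form_mul (dGen_mem ha)
    (Forms.IsMonomial.form_mul (dGen_mem hb) (Forms.IsMonomial.one (D := G.cobarDG)))
  rw [mul_one, add_zero] at this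
  subst hpq
  exact_mod_cast this

/-- The automorphism respects the coproduct and fixes `η`, hence fixes `Δ(η)`. -/
theorem map_twoForm (h : swapMap (σ.twist n) (comul η) = comul η) (hη : η ∈ G.gr n) :
    Forms.map σ.cobar (G.twoForm η) = G.twoForm η := by
  have e : ∀ t : C ⊗[k] C, Forms.map σ.cobar
      (LinearMap.mul' k _ (TensorProduct.map G.formGen G.formGen t)) =
      LinearMap.mul' k _ (TensorProduct.map G.formGen G.formGen
        (TensorProduct.map (σ.toCoalgEquiv : C →ₗ[k] C) (σ.toCoalgEquiv : C →ₗ[k] C) t)) := by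
    intro t
    induction t with
    | zero => simp
    | tmul a b => 
      simp only [TensorProduct.map_tmul, LinearMap.mul'_apply, map_mul, map_formGen]; rfl
    | add x y hx hy => simp only [map_add, hx, hy]
  rw [twoForm_eq, map_smul, e]
  congr 3
  conv_rhs => rw [← apply_eq_self h hη]
  exact CoalgHomClass.map_comp_comul_apply σ.toCoalgEquiv η

/-- Both factors are exact, so `d` already vanishes before passing to the cyclic quotient; no
symmetry of `η` is needed. -/
theorem d_twoForm (η : C) : Forms.d _ (G.twoForm η) = 0 := by
  have e : ∀ t : C ⊗[k] C, Forms.d _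
      (LinearMap.mul' k _ (TensorProduct.map G.formGen G.formGen t)) = 0 := by
    intro t
    induction t with
    | zero => simp
    | tmul a b => simp [Forms.d_mul, d_formGen]
    | add x y hx hy => simp only [map_add, hx, hy, add_zero]
  rw [twoForm_eq, map_smul, e, smul_zero]

variable (G) in
/-- The map `a ⊗ b ⊗ c ↦ ā ⊗ db dc`. -/
def baseFormForm : C ⊗[k] (C ⊗[k] C) →ₗ[k] Forms G.cobarDG ⊗[k] Forms G.cobarDG :=
  TensorProduct.map G.baseGen (LinearMap.mul' k _ ∘ₗ TensorProduct.map G.formGen G.formGen)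

variable (G) in
/-- The map `a ⊗ b ⊗ c ↦ d(P a) b̄ dc`, where `P` is the parity. -/
def formBaseForm : C ⊗[k] (C ⊗[k] C) →ₗ[k] Forms G.cobarDG :=
  LinearMap.mul' k _ ∘ₗ TensorProduct.map (G.formGen ∘ₗ G.parity)
    (LinearMap.mul' k _ ∘ₗ TensorProduct.map G.baseGen G.formGen)

variable (G) in
/-- The map `a ⊗ b ⊗ c ↦ d(P a) d(P b) c̄`, where `P` is the parity. -/
def formFormBase : C ⊗[k] (C ⊗[k] C) →ₗ[k] Forms G.cobarDG :=
  LinearMap.mul' k _ ∘ₗ TensorProduct.map (G.formGen ∘ₗ G.parity)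
    (LinearMap.mul' k _ ∘ₗ TensorProduct.map (G.formGen ∘ₗ G.parity) G.baseGen)

theorem baseFormForm_tmul (a b c : C) : G.baseFormForm (a ⊗ₜ (b ⊗ₜ c)) =
    G.baseGen a ⊗ₜ (G.formGen b * G.formGen c) := rfl

theorem formBaseForm_tmul (a b c : C) : G.formBaseForm (a ⊗ₜ (b ⊗ₜ c)) =
    G.formGen (G.parity a) * (G.baseGen b * G.formGen c) := rfl

theorem formFormBase_tmul (a b c : C) : G.formFormBase (a ⊗ₜ (b ⊗ₜ c)) =
    G.formGen (G.parity a) * (G.formGen (G.parity b) * G.baseGen c) := rfl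

/-- One rotation carries the generator at the front of a word to its end, through `σ` and with the
sign of the twisted cyclic product. -/
theorem formFormBase_comul₃ [CharZero k] (h : swapMap (σ.twist n) (comul η) = comul η)
    (hη : η ∈ G.gr n) :
    G.formFormBase (comul₃ η) = Forms.cyc σ.cobar (G.baseFormForm (comul₃ η)) := by
  refine comul₃_cyc h hη (F' := Forms.cyc σ.cobar ∘ₗ G.baseFormForm)
    fun i j l hijl a ha b hb c hc => ?_
  rw [LinearMap.comp_apply, formFormBase_tmul, baseFormForm_tmul,
    Forms.cyc_of_hasParity _ (hasParity_baseGen ha)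
      ((hasParity_formGen hb).mul (hasParity_formGen hc)), map_baseGen, parity_eq_sgn hb,
    parity_eq_sgn hc, neg_one_pow_eq_sgn]
  simp only [map_smul, smul_mul_assoc, mul_smul_comm, smul_smul, sgn_mul_sgn, mul_assoc]
  congr 1
  refine sgn_congr ⟨j + l, ?_⟩
  push_cast
  ring

theorem diff_formGen_mul_formGen (s : C ⊗[k] C) (b : C) :
    (LinearMap.mul' k _ (TensorProduct.map G.baseGen G.formGen s) -
      LinearMap.mul' k _ (TensorProduct.map (G.formGen ∘ₗ G.parity) G.baseGen s)) * G.formGen b =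
    LinearMap.mul' k _ (G.baseFormForm (TensorProduct.assoc k C C C (s ⊗ₜ b))) -
      G.formBaseForm (TensorProduct.assoc k C C C (s ⊗ₜ b)) := by
  induction s with
  | zero => simp
  | tmul c d =>
    rw [TensorProduct.assoc_tmul, baseFormForm_tmul, formBaseForm_tmul]
    simp [sub_mul, mul_assoc]
  | add x y hx hy =>
    rw [map_add, map_add, map_add, map_add, TensorProduct.add_tmul, map_add, map_add, map_add,
      map_add, add_sub_add_comm, add_mul]
    exact (congrArg₂ (· + ·) hx hy).trans (add_sub_add_comm _ _ _ _).symm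

theorem diff_formGen_formGen (t : C ⊗[k] C) : Forms.diff _
      (LinearMap.mul' k _ (TensorProduct.map G.formGen G.formGen t)) =
    (LinearMap.mul' k _ (G.baseFormForm
        (TensorProduct.assoc k C C C (LinearMap.rTensor C comul t))) -
      G.formBaseForm (TensorProduct.assoc k C C C (LinearMap.rTensor C comul t))) +
    (G.formBaseForm (LinearMap.lTensor C comul t) -
      G.formFormBase (LinearMap.lTensor C comul t)) := by
  induction t with
  | zero => simp
  | tmul a b =>
    rw [TensorProduct.map_tmul, LinearMap.mul'_apply, Forms.diff_mul, diff_formGen a,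
      diff_formGen_mul_formGen, parity_formGen, diff_formGen b, mul_sub]
    rfl
  | add x y hx hy =>
    simp only [map_add]
    rw [hx, hy]
    abel

/-- The terms with a generator between the two forms cancel by coassociativity. Those with the
generator in front and at the end differ by a rotation, so the difference is a twisted commutator;
it need not vanish in the algebra of forms. -/
theorem diff_twoForm_mem [CharZero k] (h : swapMap (σ.twist n) (comul η) = comul η)
    (hη : η ∈ G.gr n) : Forms.diff _ (G.twoForm η) ∈ Forms.twComm σ.cobar := by
  rw [twoForm_eq, map_smul, diff_formGen_formGen, ← comul₃_eq,
    show LinearMap.lTensor C comul (comul η) = comul₃ (k := k) η from rfl,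
    formFormBase_comul₃ h hη]
  refine Submodule.smul_mem _ _ ⟨G.baseFormForm (comul₃ η), ?_⟩
  rw [LinearMap.sub_apply]
  abel

end TwoForm

/-! ## The contraction isomorphism -/

section Isomorphism

/-- A degree-preserving map commutes with the projections to the components, and then so does its
inverse. -/
theorem Aut.symm_mem (σ : G.Aut) {i : ℕ} {c : C} (hc : c ∈ G.gr i) :
    σ.toCoalgEquiv.symm c ∈ G.gr i := by
  have e : ∀ c, G.proj i (σ.toCoalgEquiv c) = σ.toCoalgEquiv (G.proj i c) := by
    intro c
    refine G.induction_gr (P := fun c => G.proj i (σ.toCoalgEquiv c) = σ.toCoalgEquiv (G.proj i c))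
      (fun j c hc => ?_) (by simp) (fun x y hx hy => by simp only [map_add, hx, hy]) c
    rw [G.proj_eq hc, G.proj_eq (σ.map_mem hc)]
    split_ifs <;> simp
  have h : σ.toCoalgEquiv (G.proj i (σ.toCoalgEquiv.symm c)) = c := by
    rw [← e, CoalgEquiv.apply_symm_apply, G.proj_same hc]
  rw [← h, CoalgEquiv.symm_apply_apply]
  exact G.proj_mem _ _

/-- The inverse of an automorphism. -/
def Aut.symm (σ : G.Aut) : G.Aut := ⟨σ.toCoalgEquiv.symm, σ.symm_mem⟩

theorem Aut.cobar_cobar {σ τ : G.Aut} (h : ∀ c, σ.toCoalgEquiv (τ.toCoalgEquiv c) = c)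
    (x : G.Cobar) : σ.cobar.hom (τ.cobar.hom x) = x := by
  induction x using G.cobar_induction with
  | h1 => rw [_root_.map_one, _root_.map_one]
  | ha x y hx hy => rw [map_add, map_add, hx, hy]
  | hs c x hx => rw [map_smul, map_smul, hx]
  | hb c x hx => rw [map_mul, map_mul, hx, hom_cobar_bar, hom_cobar_bar, h]

theorem Aut.cobar_symm (σ : G.Aut) (x : G.Cobar) : σ.cobar.hom (σ.symm.cobar.hom x) = x :=
  Aut.cobar_cobar (fun c => σ.toCoalgEquiv.apply_symm_apply c) x

theorem Aut.symm_cobar (σ : G.Aut) (x : G.Cobar) : σ.symm.cobar.hom (σ.cobar.hom x) = x :=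
  Aut.cobar_cobar (fun c => σ.toCoalgEquiv.symm_apply_apply c) x

/-- This presents the contraction in the free bimodule: the surviving generator is `dc` and its
coefficient is the twisted flip of the value of `Θ`. -/
theorem cyc_baseT_formGen [CharZero k] (σ : G.cobarDG.Aut) {j : ℕ} {c : C} (hc : c ∈ G.gr j)
    (t : G.Cobar ⊗[k] G.Cobar) : Forms.cyc σ (DDer.baseT _ t * (1 ⊗ₜ G.formGen c)) =
      Forms.form _ (OneForm.sandwich (G.dGen c) (twistedSwap σ j t)) := by
  have : Forms.cyc σ ∘ₗ LinearMap.mulRight k (1 ⊗ₜ G.formGen c) ∘ₗ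
      (DDer.baseT _).toLinearMap =
      Forms.form _ ∘ₗ OneForm.sandwich (G.dGen c) ∘ₗ twistedSwap σ j :=
    G.cobarDG.tensor_hom_ext fun e f x hx y hy => by
      simp only [LinearMap.comp_apply, twistedSwap_tmul σ j hx hy, map_smul, Forms.form_sandwich]
      exact cyc_baseT_mul_right σ hx hy (hasParity_formGen hc)
  exact LinearMap.congr_fun this t

/-- Homogeneous bases `b`, `g` of `C` with `Δ(η) = ∑ b i ⊗ g i`. -/
theorem exists_dual_bases [Module.Finite k C] {η : C} {n : ℕ} (hη : η ∈ G.gr n)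
    (h : G.IsNondegenerate η) {κ : ℕ → Type*} (v : ∀ i, Module.Basis (κ i) k (G.gr i)) :
    ∃ (_ : Fintype (Σ i, κ i)) (b g : Module.Basis (Σ i, κ i) k C) (e : (Σ i, κ i) → ℕ),
      (∀ i, b i ∈ G.gr i.1) ∧ (∀ i, g i ∈ G.gr (e i)) ∧ (∀ i, i.1 + e i = n) ∧
      comul η = ∑ i, b i ⊗ₜ[k] g i := by
  classical
  obtain ⟨hι, b, hb⟩ := G.exists_homogeneous_basis v
  -- The slices of `η` by the coordinate forms of `b` are the right-hand factors of `Δ(η)` in the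
  -- basis `b`; they form a basis because slicing is bijective.
  let g := b.dualBasis.map (LinearEquiv.ofBijective _ (sliceLeft_bijective h))
  have hg : ∀ i, g i = sliceLeft η (b.coord i) := by
    intro i
    simp [g, Module.Basis.map_apply, Module.Basis.coe_dualBasis]
  have hcoord : ∀ i j, j ≠ i.1 → b.coord i ∘ₗ G.proj j = 0 := by
    intro i j hij
    refine LinearMap.ext fun c => ?_
    exact repr_eq_zero_of_mem b (fun i => i.1) hb (G.proj_mem j c) hij.symm
  have hcoord' : ∀ i, b.coord i ∘ₗ G.proj i.1 = b.coord i := by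
    intro i
    refine G.hom_ext_gr fun j c hc => ?_
    by_cases hij : j = i.1
    · subst hij; rw [LinearMap.comp_apply, G.proj_same hc]
    · rw [LinearMap.comp_apply, G.proj_ne hc hij, map_zero]
      exact (repr_eq_zero_of_mem b (fun i => i.1) hb hc (Ne.symm hij)).symm
  -- A coordinate form of degree greater than `n` would give the slice zero, which is not a basis
  -- vector. This makes the truncated difference `n - i.1` an honest one.
  have hle : ∀ i : (Σ i, κ i), i.1 ≤ n := by
    intro i
    by_contra hi
    refine g.ne_zero i ?_
    rw [hg]
    refine G.comul_hom_ext
      (F := (TensorProduct.lid k C).toLinearMap ∘ₗ LinearMap.rTensor C (b.coord i))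
      (F' := 0) (fun p q hpq x hx y hy => ?_) hη
    have : b.coord i x = 0 := repr_eq_zero_of_mem b (fun i => i.1) hb hx (by omega)
    simp [this]
  refine ⟨hι, b, g, fun i => n - i.1, hb, fun i => ?_, fun i => Nat.add_sub_cancel' (hle i), ?_⟩
  · have := hle i
    rw [hg, ← hcoord' i, sliceLeft_proj hη (show n - i.1 + i.1 = n by omega)]
    exact G.proj_mem _ _
  · rw [← sub_eq_zero]
    refine tensor_sep_left _ fun φ => ?_
    rw [map_sub, map_sub, sub_eq_zero]
    change sliceLeft η φ = _
    have e : φ = ∑ i, φ (b i) • b.coord i := by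
      refine b.ext fun j => ?_
      simp
    conv_lhs => rw [e]
    simp only [map_sum, map_smul, TensorProduct.lid_tmul, LinearMap.rTensor_tmul, hg]

variable [CharZero k] {σ : G.Aut} {η : C} {n : ℕ}

theorem contractLeft_eq_form {ι : Type*} [Fintype ι] {b g : Module.Basis ι k C} {e : ι → ℕ}
    (hg : ∀ i, g i ∈ G.gr (e i)) (hbg : comul η = ∑ i, b i ⊗ₜ[k] g i) {p : ℤ}
    (Θ : G.cobarDG.DDer p) : contractLeft σ Θ (comul η) = Forms.form _
      (∑ i, OneForm.sandwich (G.dGen (g i)) (twistedSwap σ.cobar (e i) (Θ.1 (G.dGen (b i))))) := by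
  rw [hbg, map_sum, map_sum]
  refine Finset.sum_congr rfl fun i _ => ?_
  rw [contractLeft_tmul, extGen_apply, cyc_baseT_formGen σ.cobar (hg i)]

/-- The map `Θ ↦ ∑ ± Ψ(Θ(db i)'' dg i σ(Θ(db i)'))`. -/
def contractSum (σ : G.Aut) {ι : Type*} [Fintype ι] (b g : ι → C) (e : ι → ℕ) (p : ℤ) :
    G.cobarDG.DDer p →ₗ[k] OneForm σ.cobar :=
  OneForm.psi σ.cobar ∘ₗ ∑ i, OneForm.sandwich (G.dGen (g i)) ∘ₗ
    twistedSwap σ.cobar (e i) ∘ₗ LinearMap.applyₗ (G.dGen (b i)) ∘ₗ Submodule.subtype _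

omit [CharZero k] in
theorem contractSum_apply {ι : Type*} [Fintype ι] (b g : ι → C) (e : ι → ℕ) {p : ℤ}
    (Θ : G.cobarDG.DDer p) : contractSum σ b g e p Θ =
      OneForm.psi σ.cobar (∑ i, OneForm.sandwich (G.dGen (g i))
        (twistedSwap σ.cobar (e i) (Θ.1 (G.dGen (b i))))) := by
  rw [contractSum, LinearMap.comp_apply, LinearMap.sum_apply]
  rfl

theorem contractSum_mem {ι : Type*} [Fintype ι] {b g : ι → C} {d e : ι → ℕ}
    (hb : ∀ i, b i ∈ G.gr (d i)) (hg : ∀ i, g i ∈ G.gr (e i)) (hde : ∀ i, d i + e i = n)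
    {p : ℤ} (Θ : G.cobarDG.DDer p) : contractSum σ b g e p Θ ∈ OneForm.deg σ.cobar (p + n) := by
  rw [contractSum_apply]
  refine OneForm.psi_mem (sum_mem fun i _ => ?_)
  have := hde i
  exact OneForm.sandwich_mem (twistedSwap_mem _ _ (mem_degT_dGen Θ (hb i))) (dGen_mem (hg i))
    (by omega)

/-- `Ψ` is injective, the forms `dgᵢ` are free generators and the flip is invertible, so all
`Θ(dbᵢ)` vanish; these values determine `Θ`. -/
theorem contractSum_injective {ι : Type*} [Fintype ι] (b g : Module.Basis ι k C) {e : ι → ℕ}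
    (hg : ∀ i, g i ∈ G.gr (e i)) (p : ℤ) : Function.Injective (contractSum σ b g e p) := by
  refine (injective_iff_map_eq_zero _).2 fun Θ hΘ => ?_
  rw [contractSum_apply, ← map_zero (OneForm.psi σ.cobar)] at hΘ
  have h2 := sum_sandwich_injective g e hg _ (OneForm.psi_injective σ.symm_cobar hΘ)
  have h3 : ∀ i, Θ.1 (G.dGen (b i)) = 0 := by
    intro i
    rw [← twistedSwapInv_twistedSwap σ.symm_cobar (e i) (Θ.1 (G.dGen (b i))), h2, map_zero]
  have h4 : Θ.1 ∘ₗ G.dGen = 0 := b.ext h3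
  exact dder_ext fun c => LinearMap.congr_fun h4 c

/-- The preimage under `Ψ` is expanded in the `dgᵢ`, the flips are undone, and the results are
prescribed as `Θ(dbᵢ)`. The degrees fit because `|bᵢ| + |gᵢ| = n`. -/
theorem exists_contractSum_eq {ι : Type*} [Fintype ι] (b g : Module.Basis ι k C) {d e : ι → ℕ}
    (hb : ∀ i, b i ∈ G.gr (d i)) (hg : ∀ i, g i ∈ G.gr (e i)) (hde : ∀ i, d i + e i = n) {p : ℤ}
    {m : OneForm σ.cobar} (hm : m ∈ OneForm.deg σ.cobar (p + n)) :
    ∃ Θ, contractSum σ b g e p Θ = m := by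
  obtain ⟨m', hm', rfl⟩ := OneForm.exists_psi_eq σ.cobar_symm σ.symm_cobar hm
  obtain ⟨t, ht, rfl⟩ := exists_sum_sandwich g e hg hm'
  obtain ⟨Θ, hΘ⟩ := exists_dder p
    (b.constr k fun i => twistedSwapInv σ.symm.cobar (e i) (t i)) (fun j c hc => by
      rw [Module.Basis.constr_apply_fintype]
      refine sum_mem fun i _ => ?_
      by_cases hi : d i = j
      · refine Submodule.smul_mem _ _ ?_
        have h1 := ht i
        have h2 := hde i
        rw [show p + n - e i = (j : ℤ) + p by omega] at h1
        exact twistedSwapInv_mem _ _ h1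
      · rw [Module.Basis.equivFun_apply, repr_eq_zero_of_mem b d hb hc hi, zero_smul]
        exact zero_mem _)
  refine ⟨Θ, ?_⟩
  rw [contractSum_apply]
  refine congrArg _ (Finset.sum_congr rfl fun i _ => ?_)
  rw [hΘ, b.constr_basis, twistedSwap_inv σ.cobar_symm]

/-- Contraction with the two-form of a volume element is an isomorphism of DG bimodules. -/
theorem isDGBimoduleIso_psiContract [Module.Finite k C] (hη : η ∈ G.gr n)
    (hnd : G.IsNondegenerate η)
    (h : swapMap (σ.twist n) (comul η) = comul η) :
    IsDGBimoduleIso σ.cobar (n : ℤ) (DDer.psiContract σ.cobar (G.twoForm η)) := by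
  obtain ⟨_, b, g, e, hb, hg, hbe, hbg⟩ := exists_dual_bases hη hnd
    (fun i => Module.Free.chooseBasis k (G.gr i))
  -- The contraction of the two-form is already a one-form, so the projection to weight one loses
  -- nothing.
  have hform : ∀ {p : ℤ} (Θ : G.cobarDG.DDer p),
      Forms.form _ (Forms.weightOne _ (DDer.contract σ.cobar Θ (G.twoForm η))) =
        contractLeft σ Θ (comul η) := by
    intro p Θ
    rw [contract_twoForm Θ h hη, contractLeft_eq_form hg hbg, Forms.weightOne_form]
  refine ⟨fun p => ?_, fun {p} Θ => ?_, fun {a b p} u v Θ => ?_⟩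
  · have hL : ∀ Θ, contractSum σ b g e p Θ = DDer.psiContract σ.cobar (G.twoForm η) Θ := by
      intro Θ
      rw [contractSum_apply, DDer.psiContract]
      refine congrArg _ (Forms.form_injective ?_)
      rw [hform, contractLeft_eq_form hg hbg]
    refine ⟨LinearEquiv.ofBijective ((contractSum σ b g e p).codRestrict _
      (contractSum_mem hb hg hbe)) ⟨?_, ?_⟩, hL⟩
    · exact fun Θ Θ' hΘ => contractSum_injective b g hg p (congrArg Subtype.val hΘ)
    · rintro ⟨m, hm⟩
      obtain ⟨Θ, hΘ⟩ := exists_contractSum_eq b g hb hg hbe hm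
      exact ⟨Θ, Subtype.ext hΘ⟩
  · rw [DDer.psiContract, DDer.psiContract, ← OneForm.psi_diff]
    congr 1
    apply Forms.form_injective
    rw [hform, contract_delta Θ h hη, ← Forms.diff_form, hform]
  · rw [DDer.psiContract, DDer.psiContract, ← OneForm.psi_right, ← OneForm.psi_left,
      negOnePow_smul (k := k), ← map_smul]
    congr 1
    apply Forms.form_injective
    rw [hform, contract_act Θ u v hη, map_smul, Forms.form_left, Forms.form_right, hform, mul_assoc]

end Isomorphism

end ConnCoalgebra

/-! ## Extension groups computed by a resolution by projective modules -/

section Ext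

universe u v w

open CategoryTheory

variable {A : Type v} [Ring A]

/-- A coboundary of degree zero factors through the term of the resolution in cochain degree `1`,
which is zero. -/
theorem _root_.CategoryTheory.ProjectiveResolution.extMk_zero_eq_zero_iff {C : Type*} [Category* C]
    [Abelian C] [HasExt C] {X Y : C} (R : ProjectiveResolution X) (f : R.complex.X 0 ⟶ Y)
    (hf : R.complex.d 1 0 ≫ f = 0) : R.extMk f 1 rfl hf = 0 ↔ f = 0 := by
  refine ⟨fun h => ?_, fun h => by subst h; simp⟩
  rw [← R.extEquivCohomologyClass.apply_eq_iff_eq,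
    ProjectiveResolution.extEquivCohomologyClass_extMk,
    ProjectiveResolution.extEquivCohomologyClass_zero,
    CochainComplex.HomComplex.CohomologyClass.mk_eq_zero_iff,
    CochainComplex.HomComplex.Cocycle.toSingleMk_mem_coboundaries_iff _ _ _ _ _ 1 (by lia)] at h
  obtain ⟨g, hg⟩ := h
  rw [(CochainComplex.isZero_of_isStrictlyLE R.cochainComplex 0 1 (by lia)).eq_of_src g 0,
    Limits.comp_zero, eq_comm, Preadditive.IsIso.comp_left_eq_zero] at hg
  exact hg

/-- This will be used with `g` multiplication by a scalar, to turn linear relations between cocycles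
into relations between extension classes. -/
theorem _root_.CategoryTheory.ProjectiveResolution.extMk_sub_comp_mk₀ {C : Type*} [Category* C]
    [Abelian C] [HasExt C] {X Y : C} (R : ProjectiveResolution X) {i : ℕ}
    {f f' f'' : R.complex.X i ⟶ Y} {g : Y ⟶ Y} (h : f'' = f - f' ≫ g)
    (hf : R.complex.d (i + 1) i ≫ f = 0) (hf' : R.complex.d (i + 1) i ≫ f' = 0)
    (hf'' : R.complex.d (i + 1) i ≫ f'' = 0) :
    R.extMk f'' (i + 1) rfl hf'' =
      R.extMk f (i + 1) rfl hf -
        (R.extMk f' (i + 1) rfl hf').comp (Abelian.Ext.mk₀ g) (add_zero i) := by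
  subst h
  rw [ProjectiveResolution.extMk_comp_mk₀, ProjectiveResolution.sub_extMk]

/-- A resolution of `X` by projective modules. -/
structure ModuleResolution (A : Type v) [Ring A] (X : Type v) [AddCommGroup X] [Module A X] where
  obj : ℕ → Type v
  [group : ∀ i, AddCommGroup (obj i)]
  [module : ∀ i, Module A (obj i)]
  [projective : ∀ i, Module.Projective A (obj i)]
  d : ∀ i, obj (i + 1) →ₗ[A] obj i
  π : obj 0 →ₗ[A] X
  exact : ∀ i, Function.Exact (d (i + 1)) (d i)
  exact_zero : Function.Exact (d 0) π
  surjective : Function.Surjective π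

namespace ModuleResolution

attribute [instance] group module projective

variable {X : Type v} [AddCommGroup X] [Module A X] (P : ModuleResolution A X)

/-- The underlying chain complex. -/
def complex : ChainComplex (ModuleCat.{v} A) ℕ :=
  ChainComplex.of (fun i => ModuleCat.of A (P.obj i)) (fun i => ModuleCat.ofHom (P.d i))
    (fun i => by
      ext x
      exact (P.exact i).apply_apply_eq_zero x)

theorem complex_d (i : ℕ) : P.complex.d (i + 1) i = ModuleCat.ofHom (P.d i) :=
  ChainComplex.of_d (fun i => ModuleCat.of A (P.obj i)) (fun i => ModuleCat.ofHom (P.d i)) i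

/-- The projective resolution in the category of modules. -/
def projectiveResolution : ProjectiveResolution (ModuleCat.of A X) where
  complex := P.complex
  projective i := (IsProjective.iff_projective (P := P.obj i)).1 (P.projective i)
  π := (ChainComplex.toSingle₀Equiv _ _).symm ⟨ModuleCat.ofHom P.π, by
    rw [complex_d]
    ext x
    exact P.exact_zero.apply_apply_eq_zero x⟩
  quasiIso := ⟨fun n => by
    cases n
    -- In degree zero a quasi-isomorphism to `X` means exactness at the augmentation together with
    -- its surjectivity; in positive degrees it means exactness of the complex.
    · rw [ChainComplex.quasiIsoAt₀_iff, ShortComplex.quasiIso_iff_of_zeros']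
      · refine (ShortComplex.exact_and_epi_g_iff_of_iso (S₁ := ShortComplex.mk
          (ModuleCat.ofHom (P.d 0)) (ModuleCat.ofHom P.π) (by
            ext x; exact P.exact_zero.apply_apply_eq_zero x)) ?_).1
          ⟨(ShortComplex.moduleCat_exact_iff _).2 fun x hx => (P.exact_zero x).1 hx,
            (ModuleCat.epi_iff_surjective _).2 P.surjective⟩
        exact ShortComplex.isoMk (Iso.refl _) (Iso.refl _) (Iso.refl _)
          ((Category.id_comp _).trans ((P.complex_d 0).trans (Category.comp_id _).symm))
          ((Category.id_comp _).trans
            ((ChainComplex.toSingle₀Equiv_symm_apply_f_zero _ _).trans (Category.comp_id _).symm))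
      all_goals rfl
    · rw [quasiIsoAt_iff_exactAt']
      · rename_i i
        rw [HomologicalComplex.exactAt_iff' _ (i + 1 + 1) (i + 1) i (by simp) (by simp),
          ShortComplex.moduleCat_exact_iff]
        intro x hx
        have h1 : P.d i x = 0 := (congrArg (fun f => f.hom x) (P.complex_d i)).symm.trans hx
        obtain ⟨y, hy⟩ := (P.exact i x).1 h1
        refine ⟨y, ?_⟩
        rw [← hy]
        exact congrArg (fun f => f.hom y) (P.complex_d (i + 1))
      · apply ChainComplex.exactAt_succ_single_obj⟩

/-- The coboundaries of degree `i` with values in `M`. -/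
def IsCoboundary {M : Type v} [AddCommGroup M] [Module A M] (i : ℕ) (f : P.obj i →ₗ[A] M) : Prop :=
  match i, f with
  | 0, f => f = 0
  | j + 1, f => ∃ g : P.obj j →ₗ[A] M, g ∘ₗ P.d j = f

variable {M : Type v} [AddCommGroup M] [Module A M]

/-- The extension class of a cocycle. -/
def extClass {i : ℕ} (f : P.obj i →ₗ[A] M) (hf : f ∘ₗ P.d i = 0) :
    Abelian.Ext (ModuleCat.of A X) (ModuleCat.of A M) i :=
  P.projectiveResolution.extMk (Y := ModuleCat.of A M) (n := i) (ModuleCat.ofHom f) (i + 1) rfl (by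
    refine (congrArg (· ≫ ModuleCat.ofHom f) (P.complex_d i)).trans ?_
    exact congrArg ModuleCat.ofHom hf)

theorem extClass_eq_zero_iff {i : ℕ} (f : P.obj i →ₗ[A] M) (hf : f ∘ₗ P.d i = 0) :
    P.extClass f hf = 0 ↔ P.IsCoboundary i f := by
  cases i with
  | zero =>
    refine (ProjectiveResolution.extMk_zero_eq_zero_iff _ _ _).trans ?_
    exact ⟨fun h => congrArg ModuleCat.Hom.hom h, fun h => congrArg ModuleCat.ofHom h⟩
  | succ j =>
    refine (ProjectiveResolution.extMk_eq_zero_iff _ _ _ _ _ j rfl).trans ?_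
    refine ⟨fun ⟨g, hg⟩ => ⟨g.hom, ?_⟩, fun ⟨g, hg⟩ => ⟨ModuleCat.ofHom g, ?_⟩⟩
    · have := (congrArg (· ≫ g) (P.complex_d j)).symm.trans hg
      exact congrArg ModuleCat.Hom.hom this
    · refine (congrArg (· ≫ ModuleCat.ofHom g) (P.complex_d j)).trans ?_
      rw [← hg]
      rfl

theorem isCoboundary_of_subsingleton {i : ℕ}
    (h : Subsingleton (Abelian.Ext (ModuleCat.of A X) (ModuleCat.of A M) i))
    (f : P.obj i →ₗ[A] M) (hf : f ∘ₗ P.d i = 0) : P.IsCoboundary i f :=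
  (P.extClass_eq_zero_iff f hf).1 (Subsingleton.elim _ _)

variable {k : Type u} [Field k] [Algebra k A] [Module k M] [IsScalarTower k A M]
  [SMulCommClass A k M]

/-- The scalar `r` acts on the extension group through the endomorphism `r • id` of `M`, hence by
composition of classes. -/
theorem extClass_sub_smul {i : ℕ} (f f' : P.obj i →ₗ[A] M) (hf : f ∘ₗ P.d i = 0)
    (hf' : f' ∘ₗ P.d i = 0) (r : k) (hr : (f - r • f') ∘ₗ P.d i = 0) :
    P.extClass (f - r • f') hr = P.extClass f hf - r • P.extClass f' hf' := by
  have h1 : r • P.extClass f' hf' = (P.extClass f' hf').comp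
      (Abelian.Ext.mk₀ (ModuleCat.ofHom (r • (LinearMap.id : M →ₗ[A] M)))) (add_zero i) := by
    have h2 : Abelian.Ext.mk₀ (ModuleCat.ofHom (r • (LinearMap.id : M →ₗ[A] M))) =
        r • Abelian.Ext.mk₀ (𝟙 (ModuleCat.of A M)) := by
      refine Eq.trans ?_ (Abelian.Ext.mk₀_smul (R := k) r (𝟙 (ModuleCat.of A M)))
      congr 1
      ext x
      exact (algebraMap_smul A r (x : M)).symm
    rw [h2, Abelian.Ext.comp_smul, Abelian.Ext.comp_mk₀_id]
  rw [h1]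
  have h2 : ModuleCat.ofHom (f - r • f') = ModuleCat.ofHom f -
      ModuleCat.ofHom f' ≫ ModuleCat.ofHom (r • (LinearMap.id : M →ₗ[A] M)) := rfl
  have h3 : ∀ g : P.obj i →ₗ[A] M, g ∘ₗ P.d i = 0 →
      P.projectiveResolution.complex.d (i + 1) i ≫
        (ModuleCat.ofHom g : P.projectiveResolution.complex.X i ⟶ ModuleCat.of A M) = 0 :=
    fun g hg => (congrArg (· ≫ ModuleCat.ofHom g) (P.complex_d i)).trans
      (congrArg ModuleCat.ofHom hg)
  have h4 := P.projectiveResolution.extMk_sub_comp_mk₀ (Y := ModuleCat.of A M)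
    (f'' := ModuleCat.ofHom (f - r • f')) (f := ModuleCat.ofHom f) (f' := ModuleCat.ofHom f')
    (g := ModuleCat.ofHom (r • LinearMap.id)) (by exact h2) (h3 f hf) (h3 f' hf') (h3 _ hr)
  refine Eq.trans h4 (congrArg (_ - ·) ?_)
  rfl

/-- In a one-dimensional space the nonzero class of `f'` spans; `r` is the quotient of the
coordinates of the two classes. -/
theorem exists_isCoboundary_sub_smul {i : ℕ}
    (e : Abelian.Ext (ModuleCat.of A X) (ModuleCat.of A M) i ≃ₗ[k] k) {f f' : P.obj i →ₗ[A] M}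
    (hf : f ∘ₗ P.d i = 0) (hf' : f' ∘ₗ P.d i = 0) (h : ¬ P.IsCoboundary i f') :
    ∃ r : k, P.IsCoboundary i (f - r • f') := by
  have h0 : e (P.extClass f' hf') ≠ 0 := by
    rwa [Ne, LinearEquiv.map_eq_zero_iff, extClass_eq_zero_iff]
  refine ⟨e (P.extClass f hf) / e (P.extClass f' hf'), ?_⟩
  have hr : (f - (e (P.extClass f hf) / e (P.extClass f' hf')) • f') ∘ₗ P.d i = 0 := by
    rw [LinearMap.sub_comp, LinearMap.smul_comp, hf, hf', smul_zero, sub_zero]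
  rw [← P.extClass_eq_zero_iff _ hr, extClass_sub_smul P f f' hf hf', ← e.map_eq_zero_iff, map_sub,
    map_smul, smul_eq_mul, div_mul_cancel₀ _ h0, sub_self]

end ModuleResolution

end Ext

/-! ## The Koszul resolution -/

section KoszulResolution

universe u v w

open CategoryTheory Coalgebra

/-- A tensor product is a quotient of a set of lists of pairs. Smallness matters because the terms
of the Koszul complex involve the universes of both `k` and `A`, while the extension groups are
formed in the universe of `A`. -/
theorem small_tensorProduct {k : Type*} {M N : Type*} [CommSemiring k] [AddCommMonoid M]
    [AddCommMonoid N] [Module k M] [Module k N] [Small.{w} M] [Small.{w} N] :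
    Small.{w} (M ⊗[k] N) := by
  have h : Function.Surjective (AddCon.mk' (addConGen (TensorProduct.Eqv k M N))) :=
    AddCon.mk'_surjective
  have : Small.{w} (FreeAddMonoid (M × N)) := inferInstanceAs (Small.{w} (List (M × N)))
  exact small_of_surjective h

/-- After a choice of basis its elements are finitely supported functions on words. -/
theorem small_tensorAlgebra {k : Type*} {M : Type*} [Field k] [AddCommGroup M] [Module k M]
    [Small.{w} k] [Small.{w} M] : Small.{w} (TensorAlgebra k M) := by
  have b := Module.Free.chooseBasis k M
  have : Small.{w} (Module.Free.ChooseBasisIndex k M) := small_of_injective b.injective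
  have e := (TensorAlgebra.equivFreeAlgebra b).trans FreeAlgebra.equivMonoidAlgebraFreeMonoid
  have : Small.{w} (FreeMonoid (Module.Free.ChooseBasisIndex k M)) :=
    inferInstanceAs (Small.{w} (List _))
  have : Small.{w} (MonoidAlgebra k (FreeMonoid (Module.Free.ChooseBasisIndex k M))) :=
    small_of_injective MonoidAlgebra.coeff_injective
  exact small_of_injective e.injective

theorem nontrivial_of_isConnected {k : Type u} {A : Type v} [Field k] [Ring A] [Algebra k A]
    {𝒜 : ℕ → Submodule k A} (h : IsConnected 𝒜) : Nontrivial A := by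
  rw [← not_subsingleton_iff_nontrivial]
  intro hA
  have : Module.finrank k (𝒜 0) = 0 := Module.finrank_zero_of_subsingleton
  rw [IsConnected] at h
  omega

variable {k : Type u} {A : Type v} [Field k] [Ring A] [Algebra k A]
variable {𝒜 : ℕ → Submodule k A}

/-- A nonzero algebra contains its field, so `k` is small in the universe of `A`. -/
theorem small_koszulDual [Nontrivial A] : Small.{v} (KoszulDual 𝒜) := by
  have : Small.{v} k := small_of_injective (algebraMap k A).injective
  have := small_tensorAlgebra.{v} (k := k) (M := 𝒜 1)
  infer_instance

theorem koszulTwist_eq_zero {i : ℕ} {c : KoszulDual 𝒜} (hc : c ∈ (koszulDual 𝒜).gr i)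
    (hi : i ≠ 1) : koszulTwist 𝒜 c = 0 := by
  have h := (mem_quadPart.1 (Submodule.mem_comap.1 hc)).1
  rw [koszulTwist, LinearMap.comp_apply, LinearMap.comp_apply, tproj_ne h hi, map_zero]

theorem koszulTwist_mem (c : KoszulDual 𝒜) : koszulTwist 𝒜 c ∈ 𝒜 1 := by
  have h := tproj_mem 1 ((quadCoalg (relations 𝒜)).subtype c)
  rw [tpow, pow_one] at h
  obtain ⟨a, ha⟩ := h
  rw [koszulTwist, LinearMap.comp_apply, LinearMap.comp_apply, ← ha, AlgHom.toLinearMap_apply,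
    TensorAlgebra.lift_ι_apply]
  exact a.2

/-- The extension of a `k`-linear map to an `A`-linear map on the free module. -/
def linExt {N M : Type*} [AddCommMonoid N] [Module k N] [AddCommMonoid M] [Module k M]
    [Module A M] [IsScalarTower k A M] (l : N →ₗ[k] M) : A ⊗[k] N →ₗ[A] M :=
  TensorProduct.AlgebraTensorModule.lift (LinearMap.toSpanSingleton A (N →ₗ[k] M) l)

theorem linExt_tmul {N M : Type*} [AddCommMonoid N] [Module k N] [AddCommMonoid M] [Module k M]
    [Module A M] [IsScalarTower k A M] (l : N →ₗ[k] M) (a : A) (x : N) :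
    linExt l (a ⊗ₜ[k] x) = a • l x := rfl

theorem free_hom_ext {N M : Type*} [AddCommMonoid N] [Module k N] [AddCommMonoid M] [Module A M]
    {f g : A ⊗[k] N →ₗ[A] M} (h : ∀ x, f (1 ⊗ₜ x) = g (1 ⊗ₜ x)) : f = g := by
  refine LinearMap.ext fun t => ?_
  induction t with
  | zero => simp
  | tmul a x =>
    have : a ⊗ₜ[k] x = a • ((1 : A) ⊗ₜ[k] x) := by
      rw [TensorProduct.smul_tmul', smul_eq_mul, mul_one]
    rw [this, map_smul, map_smul, h]
  | add x y hx hy => rw [map_add, map_add, hx, hy]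

/-- The Koszul differential on `1 ⊗ A^¡`. -/
def koszulDiffOne (𝒜 : ℕ → Submodule k A) : KoszulDual 𝒜 →ₗ[k] A ⊗[k] KoszulDual 𝒜 :=
  LinearMap.rTensor _ (koszulTwist 𝒜) ∘ₗ comul

/-- The Koszul differential is `A`-linear, so it is determined on the elements `1 ⊗ c`. -/
theorem koszulDiff_apply (x : A ⊗[k] KoszulDual 𝒜) :
    koszulDiff 𝒜 x = linExt (koszulDiffOne 𝒜) x := by
  induction x with
  | zero => simp
  | add x y hx hy => rw [map_add, map_add, hx, hy]
  | tmul a c =>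
    simp only [koszulDiff, koszulDiffOne, LinearMap.comp_apply, LinearMap.lTensor_tmul,
      linExt_tmul, LinearEquiv.coe_coe]
    generalize (comul c : KoszulDual 𝒜 ⊗[k] KoszulDual 𝒜) = t
    induction t with
    | zero => simp
    | tmul x y => simp [TensorProduct.smul_tmul']
    | add x y hx hy => simp only [map_add, TensorProduct.tmul_add, smul_add, hx, hy]

/-- The projection `κ` kills all degrees but one, so only the summands of `Δ(c)` whose left factor
has degree one survive; their right factor has degree `|c| - 1`. -/
theorem koszulDiffOne_proj (i : ℕ) (c : KoszulDual 𝒜) :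
    LinearMap.lTensor A ((koszulDual 𝒜).proj i) (koszulDiffOne 𝒜 c) =
      koszulDiffOne 𝒜 ((koszulDual 𝒜).proj (i + 1) c) := by
  have : LinearMap.lTensor A ((koszulDual 𝒜).proj i) ∘ₗ koszulDiffOne 𝒜 =
      koszulDiffOne 𝒜 ∘ₗ (koszulDual 𝒜).proj (i + 1) := by
    refine (koszulDual 𝒜).hom_ext_gr fun j c hc => ?_
    rw [LinearMap.comp_apply, LinearMap.comp_apply, (koszulDual 𝒜).proj_eq hc]
    -- The scalar treats both cases at once: `c` lies in degree `i + 1`, or nothing survives the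
    -- projection.
    have h : ∀ r : k, (r = if j = i + 1 then 1 else 0) →
        LinearMap.lTensor A ((koszulDual 𝒜).proj i) (koszulDiffOne 𝒜 c) =
          r • koszulDiffOne 𝒜 c := by
      intro r hr
      refine (koszulDual 𝒜).comul_hom_ext (F := LinearMap.lTensor A ((koszulDual 𝒜).proj i) ∘ₗ
        LinearMap.rTensor _ (koszulTwist 𝒜)) (F' := r • LinearMap.rTensor _ (koszulTwist 𝒜))
        (fun p q hpq a ha b hb => ?_) hc
      by_cases hp : p = 1
      · simp only [LinearMap.comp_apply, LinearMap.rTensor_tmul, LinearMap.lTensor_tmul,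
          LinearMap.smul_apply, (koszulDual 𝒜).proj_eq hb]
        by_cases hq : q = i
        · rw [if_pos hq, hr, if_pos (by omega), one_smul]
        · rw [if_neg hq, hr, if_neg (by omega), zero_smul, TensorProduct.tmul_zero]
      · simp [koszulTwist_eq_zero ha hp]
    rw [h _ rfl]
    split_ifs <;> simp
  exact LinearMap.congr_fun this c

theorem koszulDiffOne_zero {c : KoszulDual 𝒜} (hc : c ∈ (koszulDual 𝒜).gr 0) :
    koszulDiffOne 𝒜 c = 0 := by
  refine (koszulDual 𝒜).comul_hom_ext (F := LinearMap.rTensor _ (koszulTwist 𝒜)) (F' := 0)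
    (fun p q hpq a ha b hb => ?_) hc
  simp [koszulTwist_eq_zero ha (show p ≠ 1 by omega)]

section Components

variable (𝒜)

/-- The component `A ⊗ A^¡ᵢ` of the Koszul complex. -/
abbrev KoszulTerm (i : ℕ) : Type _ := A ⊗[k] (koszulDual 𝒜).gr i

/-- The inclusion of `A ⊗ A^¡ᵢ` in `A ⊗ A^¡`. -/
def koszulIncl (i : ℕ) : KoszulTerm 𝒜 i →ₗ[A] A ⊗[k] KoszulDual 𝒜 :=
  LinearMap.baseChange A ((koszulDual 𝒜).gr i).subtype

variable {𝒜} in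
theorem koszulIncl_tmul {i : ℕ} (a : A) (c : (koszulDual 𝒜).gr i) :
    koszulIncl 𝒜 i (a ⊗ₜ c) = a ⊗ₜ (c : KoszulDual 𝒜) := rfl

/-- The projection of `A ⊗ A^¡` to `A ⊗ A^¡ᵢ`. -/
def koszulProj (i : ℕ) : A ⊗[k] KoszulDual 𝒜 →ₗ[A] KoszulTerm 𝒜 i :=
  LinearMap.baseChange A (((koszulDual 𝒜).proj i).codRestrict _ ((koszulDual 𝒜).proj_mem i))

/-- The Koszul differential `A ⊗ A^¡ᵢ₊₁ → A ⊗ A^¡ᵢ`. -/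
def koszulD (i : ℕ) : KoszulTerm 𝒜 (i + 1) →ₗ[A] KoszulTerm 𝒜 i :=
  koszulProj 𝒜 i ∘ₗ linExt (koszulDiffOne 𝒜) ∘ₗ koszulIncl 𝒜 (i + 1)

variable {𝒜}

theorem koszulProj_incl (i : ℕ) (x : KoszulTerm 𝒜 i) :
    koszulProj 𝒜 i (koszulIncl 𝒜 i x) = x := by
  have : koszulProj 𝒜 i ∘ₗ koszulIncl 𝒜 i = LinearMap.id := free_hom_ext fun c => by
    simp only [koszulProj, koszulIncl, LinearMap.comp_apply, LinearMap.baseChange_tmul,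
      LinearMap.id_apply]
    congr 1
    exact Subtype.ext ((koszulDual 𝒜).proj_same c.2)
  exact LinearMap.congr_fun this x

theorem koszulIncl_proj_diff (i : ℕ) (x : A ⊗[k] KoszulDual 𝒜) :
    koszulIncl 𝒜 i (koszulProj 𝒜 i (linExt (koszulDiffOne 𝒜) x)) =
      linExt (koszulDiffOne 𝒜) (koszulIncl 𝒜 (i + 1) (koszulProj 𝒜 (i + 1) x)) := by
  have h : ∀ (i : ℕ) x, koszulIncl 𝒜 i (koszulProj 𝒜 i x) =
      LinearMap.lTensor A ((koszulDual 𝒜).proj i) x := by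
    intro i x
    induction x with
    | zero => simp
    | tmul a c => rfl
    | add x y hx hy => simp only [map_add, hx, hy]
  have : koszulIncl 𝒜 i ∘ₗ koszulProj 𝒜 i ∘ₗ linExt (koszulDiffOne 𝒜) =
      linExt (koszulDiffOne 𝒜) ∘ₗ koszulIncl 𝒜 (i + 1) ∘ₗ koszulProj 𝒜 (i + 1) :=
    free_hom_ext fun c => by
      simp only [LinearMap.comp_apply, h, linExt_tmul, one_smul, LinearMap.lTensor_tmul,
        koszulDiffOne_proj]
  exact LinearMap.congr_fun this x

theorem koszulIncl_d (i : ℕ) (x : KoszulTerm 𝒜 (i + 1)) :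
    koszulIncl 𝒜 i (koszulD 𝒜 i x) = linExt (koszulDiffOne 𝒜) (koszulIncl 𝒜 (i + 1) x) := by
  rw [koszulD, LinearMap.comp_apply, LinearMap.comp_apply, koszulIncl_proj_diff, koszulProj_incl]

theorem koszulIncl_injective (i : ℕ) : Function.Injective (koszulIncl 𝒜 i) :=
  Function.LeftInverse.injective (koszulProj_incl i)

theorem koszulProj_diff (i : ℕ) (x : A ⊗[k] KoszulDual 𝒜) :
    koszulProj 𝒜 i (linExt (koszulDiffOne 𝒜) x) = koszulD 𝒜 i (koszulProj 𝒜 (i + 1) x) := by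
  apply koszulIncl_injective
  rw [koszulIncl_proj_diff, koszulIncl_d]

theorem diff_koszulIncl_zero (x : KoszulTerm 𝒜 0) :
    linExt (koszulDiffOne 𝒜) (koszulIncl 𝒜 0 x) = 0 := by
  have : linExt (koszulDiffOne 𝒜) ∘ₗ koszulIncl 𝒜 0 = 0 := free_hom_ext fun c => by
    simp [koszulIncl, linExt_tmul, koszulDiffOne_zero c.2]
  exact LinearMap.congr_fun this x

variable [GradedAlgebra 𝒜]

variable (𝒜) in
/-- The augmentation of the Koszul complex with values in the trivial module. -/
def trivialAug : A ⊗[k] KoszulDual 𝒜 →ₗ[A] A ⧸ (HomogeneousIdeal.irrelevant 𝒜).toIdeal :=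
  (HomogeneousIdeal.irrelevant 𝒜).toIdeal.mkQ ∘ₗ
    linExt (LinearMap.toSpanSingleton k A 1 ∘ₗ counit)

theorem trivialAug_tmul (a : A) (c : KoszulDual 𝒜) : trivialAug 𝒜 (a ⊗ₜ c) =
    (HomogeneousIdeal.irrelevant 𝒜).toIdeal.mkQ (a • counit (R := k) c • (1 : A)) := rfl

theorem trivialAug_eq_zero_iff (x : A ⊗[k] KoszulDual 𝒜) :
    trivialAug 𝒜 x = 0 ↔ koszulAug 𝒜 x = 0 := by
  rw [trivialAug, LinearMap.comp_apply, Submodule.mkQ_apply, Submodule.Quotient.mk_eq_zero]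
  refine (HomogeneousIdeal.mem_irrelevant_iff 𝒜 _).trans ?_
  have : linExt (A := A) (LinearMap.toSpanSingleton k A 1 ∘ₗ counit) x =
      TensorProduct.rid k A (LinearMap.lTensor A (counit : KoszulDual 𝒜 →ₗ[k] k) x) := by
    induction x with
    | zero => simp
    | tmul a c => simp [linExt_tmul]
    | add x y hx hy => simp only [map_add, hx, hy]
  rw [this]
  rfl

theorem trivialAug_koszulIncl (i : ℕ) (x : KoszulTerm 𝒜 (i + 1)) :
    trivialAug 𝒜 (koszulIncl 𝒜 (i + 1) x) = 0 := by
  have : trivialAug 𝒜 ∘ₗ koszulIncl 𝒜 (i + 1) = 0 := free_hom_ext fun c => by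
    rw [LinearMap.comp_apply, koszulIncl_tmul, trivialAug_tmul,
      (koszulDual 𝒜).counit_eq_zero (Nat.succ_ne_zero i) c.2, zero_smul, smul_zero, map_zero,
      LinearMap.zero_apply]
  exact LinearMap.congr_fun this x

variable (h : IsKoszul 𝒜)
include h

theorem IsKoszul.exists_diff_eq {x : A ⊗[k] KoszulDual 𝒜}
    (h1 : linExt (A := A) (koszulDiffOne 𝒜) x = 0) (h2 : trivialAug 𝒜 x = 0) :
    ∃ y : A ⊗[k] KoszulDual 𝒜, linExt (koszulDiffOne 𝒜) y = x := by
  have : x ∈ LinearMap.range (koszulDiff 𝒜) := by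
    rw [h.exact]
    exact ⟨(koszulDiff_apply x).trans h1, (trivialAug_eq_zero_iff x).1 h2⟩
  obtain ⟨y, hy⟩ := this
  exact ⟨y, by rw [← koszulDiff_apply, hy]⟩

/-- Contained in the definition of Koszulness, where the range lies in the kernel; no computation
with the coproduct is needed. -/
theorem IsKoszul.diff_diff (x : A ⊗[k] KoszulDual 𝒜) :
    linExt (koszulDiffOne 𝒜) (linExt (koszulDiffOne 𝒜) x) = 0 := by
  have : koszulDiff 𝒜 x ∈ LinearMap.range (koszulDiff 𝒜) := LinearMap.mem_range_self _ _
  rw [h.exact] at this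
  rw [← koszulDiff_apply, ← koszulDiff_apply]
  exact this.1

theorem IsKoszul.trivialAug_diff (x : A ⊗[k] KoszulDual 𝒜) :
    trivialAug 𝒜 (linExt (koszulDiffOne 𝒜) x) = 0 := by
  have : koszulDiff 𝒜 x ∈ LinearMap.range (koszulDiff 𝒜) := LinearMap.mem_range_self _ _
  rw [h.exact] at this
  rw [← koszulDiff_apply, trivialAug_eq_zero_iff]
  exact this.2

/-- The total complex is exact and its differential is homogeneous, so a component of a preimage is
a preimage. The augmentation imposes no condition in positive degrees. -/
theorem IsKoszul.exact_koszulD (i : ℕ) : Function.Exact (koszulD 𝒜 (i + 1)) (koszulD 𝒜 i) := by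
  refine fun x => ⟨fun hx => ?_, ?_⟩
  · obtain ⟨y, hy⟩ := h.exists_diff_eq (x := koszulIncl 𝒜 (i + 1) x)
      (by rw [← koszulIncl_d, hx, map_zero]) (trivialAug_koszulIncl i x)
    exact ⟨koszulProj 𝒜 (i + 2) y, by rw [← koszulProj_diff, hy, koszulProj_incl]⟩
  · rintro ⟨y, rfl⟩
    apply koszulIncl_injective
    rw [koszulIncl_d, koszulIncl_d, h.diff_diff, map_zero]

theorem IsKoszul.exact_trivialAug :
    Function.Exact (koszulD 𝒜 0) (trivialAug 𝒜 ∘ₗ koszulIncl 𝒜 0) := by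
  refine fun x => ⟨fun hx => ?_, ?_⟩
  · obtain ⟨y, hy⟩ := h.exists_diff_eq (diff_koszulIncl_zero x) hx
    exact ⟨koszulProj 𝒜 1 y, by rw [← koszulProj_diff, hy, koszulProj_incl]⟩
  · rintro ⟨y, rfl⟩
    rw [LinearMap.comp_apply, koszulIncl_d, h.trivialAug_diff]

omit h in
theorem trivialAug_surjective : Function.Surjective (trivialAug 𝒜 ∘ₗ koszulIncl 𝒜 0) := by
  intro x
  obtain ⟨a, rfl⟩ := Submodule.mkQ_surjective _ x
  refine ⟨a ⊗ₜ ⟨(koszulDual 𝒜).one, (koszulDual 𝒜).one_mem_gr⟩, ?_⟩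
  rw [LinearMap.comp_apply, koszulIncl_tmul, trivialAug_tmul, (koszulDual 𝒜).counit_one, one_smul,
    smul_eq_mul, mul_one]

end Components

end KoszulResolution

section KoszulCohomology

universe u v w

open CategoryTheory Coalgebra

variable {k : Type u} {A : Type v} [Field k] [Ring A] [Algebra k A]
variable {𝒜 : ℕ → Submodule k A}

/-! ## Extension groups of the trivial module over a Koszul algebra -/

section Small

variable [GradedAlgebra 𝒜] [∀ i, Small.{v} (KoszulTerm 𝒜 i)]

variable (𝒜) in
/-- The Koszul differential on small models of the components. -/
def shrinkKoszulD (i : ℕ) :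
    Shrink.{v} (KoszulTerm 𝒜 (i + 1)) →ₗ[A] Shrink.{v} (KoszulTerm 𝒜 i) :=
  (Shrink.linearEquiv.{v} A (KoszulTerm 𝒜 i)).symm.toLinearMap ∘ₗ koszulD 𝒜 i ∘ₗ
    (Shrink.linearEquiv.{v} A (KoszulTerm 𝒜 (i + 1))).toLinearMap

omit [GradedAlgebra 𝒜] in
theorem linearEquiv_shrinkKoszulD (i : ℕ) (x : Shrink.{v} (KoszulTerm 𝒜 (i + 1))) :
    Shrink.linearEquiv A _ (shrinkKoszulD 𝒜 i x) = koszulD 𝒜 i (Shrink.linearEquiv A _ x) :=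
  LinearEquiv.apply_symm_apply _ _

/-- The Koszul resolution of the trivial module. -/
def IsKoszul.resolution (h : IsKoszul 𝒜) :
    ModuleResolution A (A ⧸ (HomogeneousIdeal.irrelevant 𝒜).toIdeal) where
  obj i := Shrink.{v} (KoszulTerm 𝒜 i)
  projective i := by
    have : Module.Projective A (KoszulTerm 𝒜 i) :=
      Module.Projective.of_basis ((Module.Basis.ofVectorSpace k ((koszulDual 𝒜).gr i)).baseChange A)
    infer_instance
  d i := shrinkKoszulD 𝒜 i
  π := (trivialAug 𝒜 ∘ₗ koszulIncl 𝒜 0) ∘ₗ (Shrink.linearEquiv.{v} A (KoszulTerm 𝒜 0)).toLinearMap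
  exact i x := by
    rw [← (Shrink.linearEquiv A _).map_eq_zero_iff, linearEquiv_shrinkKoszulD, h.exact_koszulD]
    constructor
    · rintro ⟨y, hy⟩
      refine ⟨(Shrink.linearEquiv A _).symm y, (Shrink.linearEquiv A _).injective ?_⟩
      rw [linearEquiv_shrinkKoszulD, LinearEquiv.apply_symm_apply, hy]
    · rintro ⟨y, rfl⟩
      exact ⟨_, (linearEquiv_shrinkKoszulD _ _).symm⟩
  exact_zero x := by
    rw [LinearMap.comp_apply, LinearEquiv.coe_coe, h.exact_trivialAug]
    constructor
    · rintro ⟨y, hy⟩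
      refine ⟨(Shrink.linearEquiv A _).symm y, (Shrink.linearEquiv A _).injective ?_⟩
      rw [linearEquiv_shrinkKoszulD, LinearEquiv.apply_symm_apply, hy]
    · rintro ⟨y, rfl⟩
      exact ⟨_, (linearEquiv_shrinkKoszulD _ _).symm⟩
  surjective := trivialAug_surjective.comp (LinearEquiv.surjective _)

end Small

variable {M : Type w} [AddCommGroup M] [Module k M] [Module A M] [IsScalarTower k A M]

variable (𝒜) in
/-- The differential `φ ↦ (c ↦ ∑ κ(c₁) φ(c₂))` on linear maps from `A^¡` to a module. -/
def koszulCobdry : (KoszulDual 𝒜 →ₗ[k] M) →ₗ[k] KoszulDual 𝒜 →ₗ[k] M where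
  toFun φ := (linExt (A := A) φ).restrictScalars k ∘ₗ koszulDiffOne 𝒜
  map_add' φ ψ := by
    have : linExt (A := A) (φ + ψ) = linExt φ + linExt ψ :=
      free_hom_ext fun x => by simp [linExt_tmul]
    rw [this]
    rfl
  map_smul' r φ := by
    have : ∀ x, linExt (A := A) (r • φ) x = r • linExt (A := A) φ x := by
      intro x
      induction x with
      | zero => simp
      | tmul a x => rw [linExt_tmul, linExt_tmul, LinearMap.smul_apply, smul_comm]
      | add x y hx hy => rw [map_add, map_add, hx, hy, smul_add]
    exact LinearMap.ext fun c => this _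

theorem koszulCobdry_apply (φ : KoszulDual 𝒜 →ₗ[k] M) (c : KoszulDual 𝒜) :
    koszulCobdry 𝒜 φ c = linExt φ (koszulDiffOne 𝒜 c) := rfl

theorem linExt_diff (φ : KoszulDual 𝒜 →ₗ[k] M) (x : A ⊗[k] KoszulDual 𝒜) :
    linExt φ (linExt (koszulDiffOne 𝒜) x) = linExt (koszulCobdry 𝒜 φ) x := by
  have : linExt (A := A) φ ∘ₗ linExt (koszulDiffOne 𝒜) = linExt (koszulCobdry 𝒜 φ) :=
    free_hom_ext fun c => by
      rw [LinearMap.comp_apply, linExt_tmul, linExt_tmul, one_smul, one_smul, koszulCobdry_apply]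
  exact LinearMap.congr_fun this x

/-- To see that a linear map from `A^¡` is given by the Koszul differential in degree `i`, one may
consider the values on each element of the form `κ(a) ⊗ b`. -/
theorem koszulCobdry_mem {N : Submodule k M} (h : ∀ a ∈ 𝒜 1, ∀ m : M, a • m ∈ N)
    (φ : KoszulDual 𝒜 →ₗ[k] M) (c : KoszulDual 𝒜) : koszulCobdry 𝒜 φ c ∈ N := by
  rw [koszulCobdry_apply, koszulDiffOne, LinearMap.comp_apply]
  generalize (comul c : KoszulDual 𝒜 ⊗[k] KoszulDual 𝒜) = t
  induction t with
  | zero => simp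
  | tmul a b => exact h _ (koszulTwist_mem a) _
  | add x y hx hy => rw [map_add, map_add]; exact N.add_mem hx hy

end KoszulCohomology

section

universe u v

open CategoryTheory Coalgebra

variable {k : Type u} {A : Type v} [Field k] [Ring A] [Algebra k A]
variable {𝒜 : ℕ → Submodule k A} [GradedAlgebra 𝒜]
variable {M : Type v} [AddCommGroup M] [Module k M] [Module A M] [IsScalarTower k A M]

section Small

variable [∀ i, Small.{v} (KoszulTerm 𝒜 i)]

/-- The cochain on the Koszul resolution given by a linear map from `A^¡`. -/
def IsKoszul.cochain (h : IsKoszul 𝒜) (i : ℕ) (φ : KoszulDual 𝒜 →ₗ[k] M) :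
    h.resolution.obj i →ₗ[A] M :=
  linExt φ ∘ₗ koszulIncl 𝒜 i ∘ₗ (Shrink.linearEquiv.{v} A (KoszulTerm 𝒜 i)).toLinearMap

theorem IsKoszul.cochain_d (h : IsKoszul 𝒜) {i : ℕ} {φ : KoszulDual 𝒜 →ₗ[k] M}
    (hφ : ∀ c ∈ (koszulDual 𝒜).gr (i + 1), koszulCobdry 𝒜 φ c = 0) :
    h.cochain i φ ∘ₗ h.resolution.d i = 0 := by
  have h1 : linExt (koszulCobdry 𝒜 φ) ∘ₗ koszulIncl 𝒜 (i + 1) = 0 := free_hom_ext fun c => by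
    rw [LinearMap.comp_apply, koszulIncl_tmul, linExt_tmul, hφ _ c.2, smul_zero,
      LinearMap.zero_apply]
  have h2 : ∀ x : Shrink.{v} (KoszulTerm 𝒜 (i + 1)),
      linExt φ (koszulIncl 𝒜 i (Shrink.linearEquiv A _ (shrinkKoszulD 𝒜 i x))) = 0 := fun x => by
    rw [linearEquiv_shrinkKoszulD, koszulIncl_d, linExt_diff]
    exact LinearMap.congr_fun h1 _
  exact LinearMap.ext h2

/-- An `A`-linear map on one component of the complex is extended by zero to the others; its values
on `1 ⊗ c` form `γ`. In degree zero coboundaries are zero and `γ = 0` serves. -/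
theorem IsKoszul.exists_koszulCobdry_eq (h : IsKoszul 𝒜) {i : ℕ} {φ : KoszulDual 𝒜 →ₗ[k] M}
    (hφ : h.resolution.IsCoboundary i (h.cochain i φ)) :
    ∃ γ : KoszulDual 𝒜 →ₗ[k] M, ∀ c ∈ (koszulDual 𝒜).gr i, φ c = koszulCobdry 𝒜 γ c := by
  have h1 : ∀ (c : KoszulDual 𝒜) (hc : c ∈ (koszulDual 𝒜).gr i),
      φ c = h.cochain i φ ((Shrink.linearEquiv A (KoszulTerm 𝒜 i)).symm (1 ⊗ₜ ⟨c, hc⟩)) := by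
    intro c hc
    change _ = linExt φ (koszulIncl 𝒜 i (Shrink.linearEquiv A _ _))
    rw [LinearEquiv.apply_symm_apply, koszulIncl_tmul, linExt_tmul, one_smul]
  cases i with
  | zero =>
    refine ⟨0, fun c hc => ?_⟩
    rw [h1 c hc, show h.cochain 0 φ = 0 from hφ, map_zero]
    rfl
  | succ j =>
    obtain ⟨g, hg⟩ := hφ
    let g' : A ⊗[k] KoszulDual 𝒜 →ₗ[A] M :=
      g ∘ₗ (Shrink.linearEquiv.{v} A (KoszulTerm 𝒜 j)).symm.toLinearMap ∘ₗ koszulProj 𝒜 j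
    refine ⟨g'.restrictScalars k ∘ₗ TensorProduct.mk k A _ 1, fun c hc => ?_⟩
    have h2 : linExt (g'.restrictScalars k ∘ₗ TensorProduct.mk k A (KoszulDual 𝒜) 1) = g' :=
      free_hom_ext fun c => by rw [linExt_tmul, one_smul]; rfl
    rw [h1 c hc, ← hg, koszulCobdry_apply, h2]
    have h3 : koszulProj 𝒜 j (koszulDiffOne 𝒜 c) = koszulD 𝒜 j (1 ⊗ₜ ⟨c, hc⟩) := by
      rw [koszulD, LinearMap.comp_apply, LinearMap.comp_apply, koszulIncl_tmul, linExt_tmul,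
        one_smul]
    change g ((Shrink.linearEquiv A (KoszulTerm 𝒜 j)).symm (koszulD 𝒜 j
      (Shrink.linearEquiv A _ ((Shrink.linearEquiv A _).symm _)))) =
      g ((Shrink.linearEquiv A (KoszulTerm 𝒜 j)).symm (koszulProj 𝒜 j (koszulDiffOne 𝒜 c)))
    rw [LinearEquiv.apply_symm_apply, h3]

end Small

theorem IsKoszul.small (h : IsKoszul 𝒜) (i : ℕ) : Small.{v} (KoszulTerm 𝒜 i) := by
  have := nontrivial_of_isConnected h.connected
  have := small_koszulDual (𝒜 := 𝒜)
  exact small_tensorProduct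

/-- If `Extⁱ(k, M) = 0`, then cocycles of degree `i` are coboundaries. -/
theorem IsKoszul.exists_of_subsingleton_ext (h : IsKoszul 𝒜) {i : ℕ}
    (hi : Subsingleton (Abelian.Ext (trivialModule 𝒜) (ModuleCat.of A M) i))
    {φ : KoszulDual 𝒜 →ₗ[k] M}
    (hφ : ∀ c ∈ (koszulDual 𝒜).gr (i + 1), koszulCobdry 𝒜 φ c = 0) :
    ∃ γ : KoszulDual 𝒜 →ₗ[k] M, ∀ c ∈ (koszulDual 𝒜).gr i, φ c = koszulCobdry 𝒜 γ c := by
  have := h.small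
  exact h.exists_koszulCobdry_eq
    (h.resolution.isCoboundary_of_subsingleton hi _ (h.cochain_d hφ))

/-- If `Extⁱ(k, M)` is one-dimensional, then two cocycles of degree `i` are proportional modulo
coboundaries. -/
theorem IsKoszul.exists_of_ext_equiv (h : IsKoszul 𝒜) {i : ℕ}
    (e : Abelian.Ext (trivialModule 𝒜) (ModuleCat.of A M) i ≃ₗ[k] k)
    {φ ψ : KoszulDual 𝒜 →ₗ[k] M}
    (hφ : ∀ c ∈ (koszulDual 𝒜).gr (i + 1), koszulCobdry 𝒜 φ c = 0)
    (hψ : ∀ c ∈ (koszulDual 𝒜).gr (i + 1), koszulCobdry 𝒜 ψ c = 0)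
    (hψ' : ¬ ∃ γ : KoszulDual 𝒜 →ₗ[k] M, ∀ c ∈ (koszulDual 𝒜).gr i, ψ c = koszulCobdry 𝒜 γ c) :
    ∃ (r : k) (γ : KoszulDual 𝒜 →ₗ[k] M),
      ∀ c ∈ (koszulDual 𝒜).gr i, φ c - r • ψ c = koszulCobdry 𝒜 γ c := by
  have := h.small
  obtain ⟨r, hr⟩ := h.resolution.exists_isCoboundary_sub_smul e (h.cochain_d hφ) (h.cochain_d hψ)
    (fun h' => hψ' (h.exists_koszulCobdry_eq h'))
  refine ⟨r, h.exists_koszulCobdry_eq (φ := φ - r • ψ) ?_⟩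
  convert hr using 1
  have h1 : ∀ x, linExt (A := A) (φ - r • ψ) x = linExt φ x - r • linExt ψ x := by
    intro x
    induction x with
    | zero => simp
    | tmul a x =>
      rw [linExt_tmul, linExt_tmul, linExt_tmul, LinearMap.sub_apply, LinearMap.smul_apply,
        smul_sub, smul_comm]
    | add x y hx hy => rw [map_add, map_add, map_add, hx, hy, smul_add]; abel
  exact LinearMap.ext fun x => h1 _

end

/-! ## Iterated contractions in a coalgebra -/

namespace ConnCoalgebra

open Coalgebra

variable {k C : Type*} [Field k] [AddCommGroup C] [Module k C] [Coalgebra k C]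

/-- The convolution product of linear forms, `c ↦ ∑ u(c₁) v(c₂)`. -/
def convDual (u v : Module.Dual k C) : Module.Dual k C :=
  LinearMap.mul' k k ∘ₗ TensorProduct.map u v ∘ₗ comul

theorem convDual_apply (u v : Module.Dual k C) (c : C) : convDual u v c = u (sliceRight c v) := by
  simp only [convDual, sliceRight, LinearMap.coe_mk, AddHom.coe_mk, LinearMap.comp_apply]
  generalize comul (R := k) c = t
  induction t with
  | zero => simp
  | tmul a b => simp [mul_comm]
  | add x y hx hy => simp only [map_add, hx, hy]

/-- Coassociativity: slicing twice from the right is slicing the iterated coproduct by `u ⊗ v`. This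
makes slicing a module action of the dual algebra. -/
theorem sliceRight_sliceRight (η : C) (u v : Module.Dual k C) :
    sliceRight (sliceRight η v) u = sliceRight η (convDual u v) := by
  have h1 : ∀ t : C ⊗[k] C, TensorProduct.rid k C (LinearMap.lTensor C (convDual u v) t) =
      TensorProduct.rid k C (LinearMap.lTensor C (LinearMap.mul' k k ∘ₗ TensorProduct.map u v)
        (LinearMap.lTensor C comul t)) := by
    intro t
    induction t with
    | zero => simp
    | tmul a b => simp [convDual]
    | add x y hx hy => simp only [map_add, hx, hy]
  have h2 : ∀ t : C ⊗[k] (C ⊗[k] C), TensorProduct.rid k C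
      (LinearMap.lTensor C (LinearMap.mul' k k ∘ₗ TensorProduct.map u v) t) =
      TensorProduct.rid k C (LinearMap.lTensor C u (TensorProduct.rid k _ (LinearMap.lTensor _ v
        ((TensorProduct.assoc k C C C).symm t)))) := by
    intro t
    induction t with
    | zero => simp
    | tmul a s =>
      induction s with
      | zero => simp
      | tmul b c => simp [smul_smul, mul_comm]
      | add x y hx hy => simp only [map_add, TensorProduct.tmul_add, hx, hy]
    | add x y hx hy => simp only [map_add, hx, hy]
  change TensorProduct.rid k C (LinearMap.lTensor C u (comul (sliceRight η v))) =
    TensorProduct.rid k C (LinearMap.lTensor C (convDual u v) (comul η))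
  rw [h1, show LinearMap.lTensor C comul (comul η) = comul₃ (k := k) η from rfl, h2, lTensor_comul₃]

theorem counit_sliceRight (η : C) (u : Module.Dual k C) :
    counit (R := k) (sliceRight η u) = u η := by
  have h : ∀ t : C ⊗[k] C, counit (R := k) (TensorProduct.rid k C (LinearMap.lTensor C u t)) =
      u (TensorProduct.lid k C (LinearMap.rTensor C counit t)) := by
    intro t
    induction t with
    | zero => simp
    | tmul a b => simp [mul_comm]
    | add x y hx hy => simp only [map_add, hx, hy]
  refine (h _).trans ?_
  rw [Coalgebra.rTensor_counit_comul]
  simp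

/-- A tensor is a finite sum, so all its slices lie in the span of the finitely many left factors.
This is the source of the finiteness of `A₁`. -/
theorem finite_range_sliceRight (η : C) :
    Module.Finite k (LinearMap.range (sliceRight (k := k) η)) := by
  have h : ∀ t : C ⊗[k] C, ∃ N : Submodule k C, N.FG ∧ ∀ u : Module.Dual k C,
      TensorProduct.rid k C (LinearMap.lTensor C u t) ∈ N := by
    intro t
    induction t with
    | zero => exact ⟨⊥, Submodule.fg_bot, by simp⟩
    | tmul a b =>
      refine ⟨k ∙ a, Submodule.fg_span_singleton a, fun u => ?_⟩
      simpa using Submodule.smul_mem _ _ (Submodule.mem_span_singleton_self a)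
    | add x y hx hy =>
      obtain ⟨N, hN, h1⟩ := hx
      obtain ⟨N', hN', h2⟩ := hy
      refine ⟨N ⊔ N', hN.sup hN', fun u => ?_⟩
      rw [map_add, map_add]
      exact Submodule.add_mem_sup (h1 u) (h2 u)
  obtain ⟨N, hN, h1⟩ := h (comul η)
  have := Module.Finite.of_fg hN
  refine Submodule.finiteDimensional_of_le (S₂ := N) ?_
  rintro _ ⟨u, rfl⟩
  exact h1 u

end ConnCoalgebra

theorem exists_dual_apply_eq_one {k V : Type*} [Field k] [AddCommGroup V] [Module k V] {v : V}
    (hv : v ≠ 0) : ∃ f : Module.Dual k V, f v = 1 := by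
  obtain ⟨f, hf⟩ := not_forall.1 (mt (Module.forall_dual_apply_eq_zero_iff k v).1 hv)
  exact ⟨(f v)⁻¹ • f, inv_mul_cancel₀ hf⟩

/-! ## The Koszul dual coalgebra of an Artin-Schelter regular algebra -/

section KoszulRegular

universe u v

open CategoryTheory Coalgebra ConnCoalgebra

variable {k : Type u} {A : Type v} [Field k] [Ring A] [Algebra k A]
variable {𝒜 : ℕ → Submodule k A}

/-- For a cochain with values in a line the cocycle condition becomes a condition on slices of `c`.
-/
theorem koszulCobdry_toSpanSingleton {M : Type*} [AddCommGroup M] [Module k M] [Module A M]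
    [IsScalarTower k A M] (f : Module.Dual k (KoszulDual 𝒜)) (m : M) (c : KoszulDual 𝒜) :
    koszulCobdry 𝒜 (LinearMap.toSpanSingleton k M m ∘ₗ f) c =
      koszulTwist 𝒜 (sliceRight c f) • m := by
  simp only [koszulCobdry_apply, koszulDiffOne, sliceRight, LinearMap.coe_mk, AddHom.coe_mk,
    LinearMap.comp_apply]
  generalize (comul c : KoszulDual 𝒜 ⊗[k] KoszulDual 𝒜) = t
  induction t with
  | zero => simp
  | tmul a b =>
    simp [linExt_tmul, smul_comm (f b)]
  | add x y hx hy => simp only [map_add, add_smul, hx, hy]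

variable [GradedAlgebra 𝒜]

/-- Minimality of the Koszul complex: coboundaries take values in `A₁ A`, which has no component of
degree zero. -/
theorem proj_zero_koszulCobdry (γ : KoszulDual 𝒜 →ₗ[k] A) (c : KoszulDual 𝒜) :
    GradedAlgebra.proj 𝒜 0 (koszulCobdry 𝒜 γ c) = 0 :=
  koszulCobdry_mem (N := LinearMap.ker (GradedAlgebra.proj 𝒜 0))
    (fun a ha m => DirectSum.coe_decompose_mul_of_left_mem_of_not_le 𝒜 ha (by omega)) γ c

/-- A scalar cochain that is a coboundary is zero. -/
theorem eq_zero_of_smul_one_eq_koszulCobdry [Nontrivial A] {f : Module.Dual k (KoszulDual 𝒜)}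
    {γ : KoszulDual 𝒜 →ₗ[k] A} {c : KoszulDual 𝒜} (h : f c • (1 : A) = koszulCobdry 𝒜 γ c) :
    f c = 0 := by
  have h1 : GradedAlgebra.proj 𝒜 0 (f c • (1 : A)) = f c • (1 : A) := by
    rw [map_smul]
    congr 1
    exact DirectSum.decompose_of_mem_same 𝒜 SetLike.GradedOne.one_mem
  rw [h, proj_zero_koszulCobdry, ← h] at h1
  exact (smul_eq_zero.1 h1.symm).resolve_right one_ne_zero

variable {n : ℕ} (hreg : IsASRegular 𝒜 n) (hkos : IsKoszul 𝒜)
include hreg hkos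

/-- The hypothesis makes `c ↦ f(c) 1` a cocycle. As `Extⁱ(k, A) = 0` it is a coboundary, and
minimality forces a scalar coboundary to vanish. -/
theorem IsASRegular.eq_zero_of_koszulTwist_sliceRight {i : ℕ} (hi : i ≠ n)
    {f : Module.Dual k (KoszulDual 𝒜)}
    (hf : ∀ c ∈ (koszulDual 𝒜).gr (i + 1), koszulTwist 𝒜 (sliceRight c f) = 0)
    {c : KoszulDual 𝒜} (hc : c ∈ (koszulDual 𝒜).gr i) : f c = 0 := by
  have := nontrivial_of_isConnected hkos.connected
  obtain ⟨γ, hγ⟩ := hkos.exists_of_subsingleton_ext (hreg.ext_ne i hi)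
    (φ := LinearMap.toSpanSingleton k A 1 ∘ₗ f) fun c hc => by
      rw [koszulCobdry_toSpanSingleton, hf c hc, zero_smul]
  exact eq_zero_of_smul_one_eq_koszulCobdry (hγ c hc)

/-- With coefficients in the trivial module all coboundaries vanish, so every linear form on `A^¡ᵢ`
is a cocycle and none but zero is a coboundary. For `i` above the global dimension `Extⁱ(k, k) = 0`,
so there are no nonzero forms. -/
theorem IsASRegular.gr_eq_bot {i : ℕ} (hi : n < i) : (koszulDual 𝒜).gr i = ⊥ := by
  have := nontrivial_of_isConnected hkos.connected
  let I := (HomogeneousIdeal.irrelevant 𝒜).toIdeal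
  have hI : ∀ a ∈ 𝒜 1, ∀ m : A ⧸ I, a • m = 0 := by
    intro a ha m
    obtain ⟨b, rfl⟩ := Submodule.mkQ_surjective _ m
    rw [← map_smul, Submodule.mkQ_apply, Submodule.Quotient.mk_eq_zero]
    refine (HomogeneousIdeal.mem_irrelevant_iff 𝒜 _).2 ?_
    exact DirectSum.coe_decompose_mul_of_left_mem_of_not_le 𝒜 ha (by omega)
  have h1 : I.mkQ 1 ≠ 0 := by
    rw [Ne, Submodule.mkQ_apply, Submodule.Quotient.mk_eq_zero]
    intro h
    have h := (HomogeneousIdeal.mem_irrelevant_iff 𝒜 _).1 h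
    have h2 : GradedRing.proj 𝒜 0 (1 : A) = 1 :=
      DirectSum.decompose_of_mem_same 𝒜 SetLike.GradedOne.one_mem
    exact one_ne_zero (h2.symm.trans h)
  have hdim : HasProjectiveDimensionLT (trivialModule 𝒜) (n + 1) := by
    rw [← projectiveDimension_lt_iff]
    refine lt_of_le_of_lt (b := ((n : ℕ∞) : WithBot ℕ∞)) ?_ (by exact_mod_cast Nat.lt_succ_self n)
    rw [← hreg.globalDimension]
    exact le_iSup (fun M : ModuleCat.{v} A => projectiveDimension M) _
  rw [eq_bot_iff]
  intro c hc
  rw [Submodule.mem_bot, ← Module.forall_dual_apply_eq_zero_iff k c]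
  intro f
  obtain ⟨γ, hγ⟩ := hkos.exists_of_subsingleton_ext (M := A ⧸ I)
    (HasProjectiveDimensionLT.subsingleton (trivialModule 𝒜) (n + 1) i hi _)
    (φ := LinearMap.toSpanSingleton k (A ⧸ I) (I.mkQ 1) ∘ₗ f) fun c hc => by
      rw [koszulCobdry_toSpanSingleton, hI _ (koszulTwist_mem _)]
  have h2 := hγ c hc
  have h3 : koszulCobdry 𝒜 γ c ∈ (⊥ : Submodule k (A ⧸ I)) :=
    koszulCobdry_mem (fun a ha m => (Submodule.mem_bot k).2 (hI a ha m)) γ c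
  rw [Submodule.mem_bot] at h3
  rw [h3] at h2
  exact (smul_eq_zero.1 h2).resolve_right h1

/-- If the component of degree `i + 1` is zero and `i < n`, every form on the component of degree
`i` is a scalar cocycle and hence zero. Vanishing in degree `n` would thus descend to degree zero,
which contains `1`. -/
theorem IsASRegular.gr_ne_bot : (koszulDual 𝒜).gr n ≠ ⊥ := by
  intro h
  have key : ∀ m i, i + m = n → (koszulDual 𝒜).gr i = ⊥ := by
    intro m
    induction m with
    | zero => rintro i rfl; exact h
    | succ m ih =>
      intro i hi
      have h1 := ih (i + 1) (by omega)
      rw [eq_bot_iff]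
      intro c hc
      rw [Submodule.mem_bot, ← Module.forall_dual_apply_eq_zero_iff k c]
      intro f
      refine hreg.eq_zero_of_koszulTwist_sliceRight hkos (i := i) (by omega) (fun c hc => ?_) hc
      rw [h1, Submodule.mem_bot] at hc
      subst hc
      simp [sliceRight]
  have h0 := (koszulDual 𝒜).one_mem_gr
  rw [key n 0 (zero_add n), Submodule.mem_bot] at h0
  have h1 := (koszulDual 𝒜).counit_one
  rw [h0, map_zero] at h1
  exact zero_ne_one h1

/-- Nothing lives in degree `n + 1`, so all cochains of degree `n` are cocycles. The nonzero scalar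
cochain `g · 1` is not a coboundary, hence its class spans the line `Extⁿ(k, A)`. -/
theorem IsASRegular.exists_cochain (f g : Module.Dual k (KoszulDual 𝒜)) (a : A)
    (hg : ∃ c ∈ (koszulDual 𝒜).gr n, g c ≠ 0) : ∃ (r : k) (γ : KoszulDual 𝒜 →ₗ[k] A),
      ∀ c ∈ (koszulDual 𝒜).gr n, f c • a - r • g c • (1 : A) = koszulCobdry 𝒜 γ c := by
  have := nontrivial_of_isConnected hkos.connected
  have h0 : ∀ φ : KoszulDual 𝒜 →ₗ[k] A, ∀ c ∈ (koszulDual 𝒜).gr (n + 1),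
      koszulCobdry 𝒜 φ c = 0 := by
    intro φ c hc
    rw [hreg.gr_eq_bot hkos (Nat.lt_succ_self n), Submodule.mem_bot] at hc
    rw [hc, map_zero]
  obtain ⟨e⟩ := hreg.ext_eq
  refine hkos.exists_of_ext_equiv e (φ := LinearMap.toSpanSingleton k A a ∘ₗ f)
    (ψ := LinearMap.toSpanSingleton k A 1 ∘ₗ g) (h0 _) (h0 _) ?_
  rintro ⟨γ, hγ⟩
  obtain ⟨c, hc, hgc⟩ := hg
  exact hgc (eq_zero_of_smul_one_eq_koszulCobdry (hγ c hc))

/-- For `a = 1` the comparison gives a scalar coboundary `f - r g`, which is zero: every form on the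
top component is a multiple of one `g` with `g(η) = 1`. Forms separate vectors. -/
theorem IsASRegular.exists_smul_eq {η : KoszulDual 𝒜} (hη : η ∈ (koszulDual 𝒜).gr n) (h0 : η ≠ 0)
    {c : KoszulDual 𝒜} (hc : c ∈ (koszulDual 𝒜).gr n) : ∃ r : k, r • η = c := by
  have := nontrivial_of_isConnected hkos.connected
  obtain ⟨g, hg⟩ := exists_dual_apply_eq_one (k := k) h0
  refine ⟨g c, ?_⟩
  rw [← sub_eq_zero, ← Module.forall_dual_apply_eq_zero_iff k]
  intro f
  obtain ⟨r, γ, hγ⟩ := hreg.exists_cochain hkos f g 1 ⟨η, hη, by rw [hg]; exact one_ne_zero⟩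
  have h1 : ∀ x ∈ (koszulDual 𝒜).gr n, f x = r * g x := fun x hx => by
    have h2 := hγ x hx
    rw [smul_smul, ← sub_smul] at h2
    exact sub_eq_zero.1 (eq_zero_of_smul_one_eq_koszulCobdry (f := f - r • g) h2)
  rw [map_sub, map_smul, h1 η hη, h1 c hc, hg, smul_eq_mul]
  ring

theorem IsASRegular.finrank_gr : Module.finrank k ((koszulDual 𝒜).gr n) = 1 := by
  obtain ⟨η, hη, h0⟩ := Submodule.exists_mem_ne_zero_of_ne_bot (hreg.gr_ne_bot hkos)
  exact finrank_eq_one (⟨η, hη⟩ : (koszulDual 𝒜).gr n) (fun h => h0 (congrArg Subtype.val h))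
    fun c => (hreg.exists_smul_eq hkos hη h0 c.2).imp fun r hr => Subtype.ext hr

/-- For `a ∈ A₁` the cochain `f · a` is cohomologous to a multiple of `f · 1`. At `η`, in degree
one, the multiple of `1` drops out and `a` is `κ` of a slice of `η`; the slices of `η` span a
finite-dimensional space. -/
theorem IsASRegular.finite_one : Module.Finite k (𝒜 1) := by
  have := nontrivial_of_isConnected hkos.connected
  obtain ⟨η, hη, h0⟩ := Submodule.exists_mem_ne_zero_of_ne_bot (hreg.gr_ne_bot hkos)
  obtain ⟨f, hf⟩ : ∃ f : Module.Dual k (KoszulDual 𝒜), f η = 1 := exists_dual_apply_eq_one h0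
  -- Any such form identifies the one-dimensional `A₀` with `k`.
  obtain ⟨ε, hε⟩ : ∃ ε : Module.Dual k A, ε 1 = 1 :=
    exists_dual_apply_eq_one one_ne_zero
  have hone : ∀ b ∈ 𝒜 0, b = ε b • (1 : A) := by
    intro b hb
    obtain ⟨r, hr⟩ := (finrank_eq_one_iff_of_nonzero' (⟨1, SetLike.GradedOne.one_mem⟩ : 𝒜 0)
      (fun h => one_ne_zero (congrArg Subtype.val h))).1 hkos.connected ⟨b, hb⟩
    have hr : r • (1 : A) = b := congrArg Subtype.val hr
    rw [← hr, map_smul, hε, smul_eq_mul, mul_one]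
  -- Since `κ` has values in `A₁`, the degree one part of the coboundary depends only on the degree
  -- zero part of `γ`, a linear form.
  have hγ : ∀ γ : KoszulDual 𝒜 →ₗ[k] A, GradedAlgebra.proj 𝒜 1 (koszulCobdry 𝒜 γ η) =
      koszulTwist 𝒜 (sliceRight η (ε ∘ₗ GradedAlgebra.proj 𝒜 0 ∘ₗ γ)) := by
    intro γ
    simp only [koszulCobdry_apply, koszulDiffOne, sliceRight, LinearMap.coe_mk, AddHom.coe_mk,
      LinearMap.comp_apply]
    generalize (comul η : KoszulDual 𝒜 ⊗[k] KoszulDual 𝒜) = t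
    induction t with
    | zero => simp
    | tmul a b =>
      have h1 : GradedAlgebra.proj 𝒜 1 (koszulTwist 𝒜 a * γ b) =
          koszulTwist 𝒜 a * GradedAlgebra.proj 𝒜 0 (γ b) :=
        DirectSum.coe_decompose_mul_add_of_left_mem 𝒜 (j := 0) (koszulTwist_mem a)
      have h2 := hone _ (show GradedAlgebra.proj 𝒜 0 (γ b) ∈ 𝒜 0 from Submodule.coe_mem _)
      rw [LinearMap.rTensor_tmul, linExt_tmul, smul_eq_mul, h1, h2]
      simp
    | add x y hx hy => simp only [map_add, hx, hy]
  have := finite_range_sliceRight (k := k) η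
  have hle : 𝒜 1 ≤ (LinearMap.range (sliceRight (k := k) η)).map (koszulTwist 𝒜) := by
    intro a ha
    obtain ⟨r, γ, h1⟩ := hreg.exists_cochain hkos f f a ⟨η, hη, by rw [hf]; exact one_ne_zero⟩
    have h2 := congrArg (GradedAlgebra.proj 𝒜 1) (h1 η hη)
    have h3 : GradedAlgebra.proj 𝒜 1 a = a := DirectSum.decompose_of_mem_same 𝒜 ha
    have h4 : GradedAlgebra.proj 𝒜 1 (1 : A) = 0 :=
      DirectSum.decompose_of_mem_ne 𝒜 SetLike.GradedOne.one_mem zero_ne_one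
    rw [hγ, hf, one_smul, one_smul, map_sub, map_smul, h3, h4, smul_zero, sub_zero] at h2
    rw [h2]
    exact ⟨_, ⟨_, rfl⟩, rfl⟩
  exact Submodule.finiteDimensional_of_le hle

/-- It is contained in the sum of the tensor powers of the finite-dimensional `A₁` up to degree `n`.
-/
theorem IsASRegular.finite_koszulDual : Module.Finite k (KoszulDual 𝒜) := by
  have := hreg.finite_one hkos
  have h1 : ∀ i, (tpow k (𝒜 1) i).FG := fun i =>
    Submodule.FG.pow (Module.Finite.iff_fg.1 inferInstance) i
  have h2 : (⨆ i ∈ Finset.range (n + 1), tpow k (𝒜 1) i).FG :=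
    Submodule.fg_biSup _ _ fun i _ => h1 i
  have := Module.Finite.of_fg h2
  refine Submodule.finiteDimensional_of_le (S₂ := ⨆ i ∈ Finset.range (n + 1), tpow k (𝒜 1) i) ?_
  refine iSup_le fun i => ?_
  by_cases hi : n < i
  · intro x hx
    have h3 : (⟨x, quadPart_le _ i hx⟩ : KoszulDual 𝒜) ∈ (koszulDual 𝒜).gr i := hx
    rw [hreg.gr_eq_bot hkos hi, Submodule.mem_bot] at h3
    rw [show x = 0 from congrArg Subtype.val h3]
    exact zero_mem _
  · exact inf_le_left.trans (le_iSup₂_of_le i (Finset.mem_range.2 (by omega)) le_rfl)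

/-- Induction on `m = n - i`. In top degree `f(η)` is the counit of the slice. Below it, the forms
whose slice of `η` vanishes are stable under left convolution by forms factoring through `κ`, and
these products vanish by induction; hence `f` is a scalar cocycle of degree `i ≠ n`, and zero. -/
theorem IsASRegular.eq_zero_of_sliceRight {η : KoszulDual 𝒜} (hη : η ∈ (koszulDual 𝒜).gr n)
    (h0 : η ≠ 0) (m : ℕ) : ∀ i, m + i = n → ∀ f : Module.Dual k (KoszulDual 𝒜),
      sliceRight η (f ∘ₗ (koszulDual 𝒜).proj i) = 0 → ∀ c ∈ (koszulDual 𝒜).gr i, f c = 0 := by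
  induction m with
  | zero =>
    intro i hi f hf c hc
    obtain rfl : i = n := by omega
    obtain ⟨r, rfl⟩ := hreg.exists_smul_eq hkos hη h0 hc
    have h1 := counit_sliceRight η (f ∘ₗ (koszulDual 𝒜).proj i)
    rw [hf, map_zero, LinearMap.comp_apply, (koszulDual 𝒜).proj_same hη] at h1
    rw [map_smul, ← h1, smul_zero]
  | succ m ih =>
    intro i hi f hf c hc
    have h1 : (f ∘ₗ (koszulDual 𝒜).proj i) c = 0 := by
      refine hreg.eq_zero_of_koszulTwist_sliceRight hkos (i := i) (by omega) (fun b hb => ?_) hc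
      rw [← Module.forall_dual_apply_eq_zero_iff k]
      intro g
      -- Testing `κ` of the slice of `b` against `g` evaluates at `b` a convolution product, to
      -- which the induction hypothesis in degree `i + 1` applies.
      have h2 := convDual_apply (g ∘ₗ koszulTwist 𝒜) (f ∘ₗ (koszulDual 𝒜).proj i) b
      rw [LinearMap.comp_apply] at h2
      rw [← h2]
      refine ih (i + 1) (by omega) _ ?_ b hb
      rw [sliceRight_proj hη (show m + (i + 1) = n by omega), ← sliceRight_sliceRight, hf]
      simp [sliceRight]
    rwa [LinearMap.comp_apply, (koszulDual 𝒜).proj_same hc] at h1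

/-- The pairing defined by a volume element is non-degenerate. -/
theorem IsASRegular.isNondegenerate {η : KoszulDual 𝒜} (hη : η ∈ (koszulDual 𝒜).gr n)
    (h0 : η ≠ 0) : (koszulDual 𝒜).IsNondegenerate η := by
  have := hreg.finite_koszulDual hkos
  have hinj : Function.Injective (sliceRight (k := k) η) := by
    refine (injective_iff_map_eq_zero _).2 fun f hf => ?_
    refine (koszulDual 𝒜).hom_ext_gr fun i c hc => ?_
    by_cases hi : i ≤ n
    · obtain ⟨m, hm⟩ := Nat.exists_eq_add_of_le hi
      refine hreg.eq_zero_of_sliceRight hkos hη h0 m i (by omega) f ?_ c hc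
      rw [sliceRight_proj hη (show m + i = n by omega), hf, map_zero]
    · rw [hreg.gr_eq_bot hkos (by omega), Submodule.mem_bot] at hc
      rw [hc, map_zero, map_zero]
  -- Only one kernel has been computed; equality of dimensions makes slicing surjective, which is
  -- non-degeneracy on the other side.
  have hsurj : Function.Surjective (sliceRight (k := k) η) :=
    (LinearMap.injective_iff_surjective_of_finrank_eq_finrank Subspace.dual_finrank_eq).1 hinj
  refine ⟨fun u hu => hinj ?_, fun v hv => LinearMap.ext fun c => ?_⟩
  · rw [map_zero, ← Module.forall_dual_apply_eq_zero_iff k]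
    intro v
    rw [← (koszulDual 𝒜).pairing_eq_sliceRight, hu]
  · obtain ⟨u, rfl⟩ := hsurj c
    rw [← (koszulDual 𝒜).pairing_eq_sliceRight, hv, LinearMap.zero_apply]

end KoszulRegular

end

end NCG

/-! ### The theorem -/

set_option maxHeartbeats 400000 in
theorem theorem1p1 {k : Type*} {A : Type*} [Field k] [CharZero k] [Ring A] [Algebra k A]
    (𝒜 : ℕ → Submodule k A) [GradedAlgebra 𝒜] (n : ℕ)
    (hreg : NCG.IsASRegular 𝒜 n) (hkos : NCG.IsKoszul 𝒜) :
    -- `A^¡` is finite dimensional, with a one-dimensional component of degree `n`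
    Module.Finite k (NCG.KoszulDual 𝒜) ∧
    Module.finrank k ((NCG.koszulDual 𝒜).gr n) = 1 ∧
    ∀ η ∈ (NCG.koszulDual 𝒜).gr n, η ≠ 0 →
      (NCG.koszulDual 𝒜).IsNondegenerate η ∧
      ∃ σ : (NCG.koszulDual 𝒜).Aut, σ.IsNakayama η ∧
        (∀ τ : (NCG.koszulDual 𝒜).Aut, τ.IsNakayama η → τ = σ) ∧
        (NCG.koszulDual 𝒜).twoForm η ∈
          NCG.DGAlgebra.Forms.bideg (NCG.koszulDual 𝒜).cobarDG 2 n ∧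
        NCG.DGAlgebra.Forms.map σ.cobar ((NCG.koszulDual 𝒜).twoForm η) =
          (NCG.koszulDual 𝒜).twoForm η ∧
        NCG.DGAlgebra.Forms.DR.diff σ.cobar
          (Submodule.Quotient.mk ((NCG.koszulDual 𝒜).twoForm η)) = 0 ∧
        NCG.DGAlgebra.Forms.DR.d σ.cobar
          (Submodule.Quotient.mk ((NCG.koszulDual 𝒜).twoForm η)) = 0 ∧
        NCG.DGAlgebra.IsDGBimoduleIso σ.cobar (n : ℤ)
          (NCG.DGAlgebra.DDer.psiContract σ.cobar ((NCG.koszulDual 𝒜).twoForm η)) := by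
  refine ⟨hreg.finite_koszulDual hkos, hreg.finrank_gr hkos, fun η hη h0 => ?_⟩
  have := hreg.finite_koszulDual hkos
  have hnd := hreg.isNondegenerate hkos hη h0
  obtain ⟨σ, hσ, huniq⟩ := NCG.ConnCoalgebra.exists_isNakayama hη hnd
  have h := (NCG.ConnCoalgebra.isNakayama_iff hη σ).1 hσ
  refine ⟨hnd, σ, hσ, huniq, NCG.ConnCoalgebra.twoForm_mem hη, NCG.ConnCoalgebra.map_twoForm h hη,
    ?_, ?_, NCG.ConnCoalgebra.isDGBimoduleIso_psiContract hη hnd h⟩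
  · exact (Submodule.mapQ_apply _ _ _ _).trans
      ((Submodule.Quotient.mk_eq_zero _).2 (NCG.ConnCoalgebra.diff_twoForm_mem h hη))
  · exact (Submodule.mapQ_apply _ _ _ _).trans
      ((congrArg _ (NCG.ConnCoalgebra.d_twoForm η)).trans (Submodule.Quotient.mk_zero _))
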